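/- **Setting.** Let $d\in\{1,2,3\}$, $k\ge 0$, $0<\alpha<1$, $T>0$, and let $\Omega\subset\mathbb R^d$ be a convex polyhedral domain (nonempty, open, bounded). Put $\mathcal I^\alpha v(t)=\int_0^t\frac{(t-s)^{\alpha-1}}{\Gamma(\alpha)}v(s)\,ds$ and ${}^{c}\mathrm D^{1-\alpha}v=\mathcal I^\alpha v'$. Let $u$ solve $${}^{c}\mathrm D^{1-\alpha}u-\Delta u=f\ \text{ in }\Omega\times(0,T],\qquad u=g\ \text{ on }\partial\Omega\times(0,T],\qquad u(0)=u_0,$$ and put $\mathbf q=-\nabla u$. Let $\mathcal T_h$ be a conforming triangulation of $\Omega$ into simplices $K$, with $h=\max_K\operatorname{diam}K$, which is shape-regular with parameter $\sigma$: each $K$ contains a ball of radius $\rho_K>0$ with $\operatorname{diam}K\le\sigma\rho_K$. Let $\tau\ge 0$ be constant on each face of each $\partial K$ (possibly with two values on an interior face), set $\tau_K^{\max}=\max\tau|_{\partial K}$, and let $\tau_K^{*}=\max\tau|_{\partial K\setminus F^*}$, where $F^*$ is a face of $K$ at which $\tau|_{\partial K}$ is maximal; assume $\tau_K^{\max}>0$.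 Let $W_h$, $\mathbf V_h$ be the spaces of scalar, respectively $\mathbb R^d$-valued, functions that are polynomials of total degree at most $k$ on each $K$, and $M_h$ the space of functions on the union of the faces that are polynomials of degree at most $k$ on each face. Write $(v,w)=\sum_K\int_Kvw$ and $\langle v,w\rangle=\sum_K\int_{\partial K}vw$, and let $\mathbf n$ be the outward unit normal of $K$. The semi-discrete HDG approximation $(u_h,\mathbf q_h,\widehat u_h)(t)\in W_h\times\mathbf V_h\times M_h$, with $u_h$ absolutely continuous on $[0,T]$ and with the integral defining $\mathcal I^\alpha u_h'(t)$ absolutely convergent for every $t\in(0,T]$, satisfies for every $t\in(0,T]$ $$\begin{aligned} (\mathbf q_h,\mathbf r)-(u_h,\nabla\!\cdot\mathbf r)+\langle\widehat u_h,\mathbf r\cdot\mathbf n\rangle&=0&&\forall\,\mathbf r\in\mathbf V_h,\\ ({}^{c}\mathrm D^{1-\alpha}u_h,w)-(\mathbf q_h,\nabla w)+\langle\widehat{\mathbf q}_h\cdot\mathbf n,w\rangle&=(f,w)&&\forall\,w\in W_h,\\ \langle\widehat u_h,\mu\rangle_{\partial\Omega}&=\langle g,\mu\rangle_{\partial\Omega}&&\forall\,\mu\in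 M_h,\\ \langle\widehat{\mathbf q}_h\cdot\mathbf n,\mu\rangle-\langle\widehat{\mathbf q}_h\cdot\mathbf n,\mu\rangle_{\partial\Omega}&=0&&\forall\,\mu\in M_h, \end{aligned}$$ where $\widehat{\mathbf q}_h=\mathbf q_h+\tau(u_h-\widehat u_h)\mathbf n$, and $u_h(0)=\Pi_Wu_0$. Here $(\Pi_V\mathbf q,\Pi_Wu)\in\mathbf V_h\times W_h$ is defined, on each $K$ and each face $F$ of $K$, by $(\Pi_V\mathbf q,\mathbf v)_K=(\mathbf q,\mathbf v)_K$ for $\mathbf v\in[P_{k-1}(K)]^d$, $(\Pi_Wu,w)_K=(u,w)_K$ for $w\in P_{k-1}(K)$, and $\langle\Pi_V\mathbf q\cdot\mathbf n+\tau\Pi_Wu,\mu\rangle_F=\langle\mathbf q\cdot\mathbf n+\tau u,\mu\rangle_F$ for $\mu\in P_k(F)$ (with $P_{-1}=\{0\}$), applied to $u_0$ and $\mathbf q(0)=-\nabla u_0$. **Theorem 3.3.** Assume $u\in C^1([0,T];H^{k+1}(\Omega))$, $\mathbf q\in C^1([0,T];[H^{k+1}(\Omega)]^d)$, and $\tau_K^{*}\le\mathsf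 C$, $1/\tau_K^{\max}\le\mathsf C$ for all $K\in\mathcal T_h$. Then $$\|(u-u_h)(T)\|_{L^2(\Omega)}+\|(\mathbf q-\mathbf q_h)(T)\|_{L^2(\Omega)}\le C_1\,(1+T)\,h^{k+1},$$ where, besides $d$, $k$ and the shape-regularity parameter $\sigma$, the constant $C_1$ depends only on $\mathsf C$, on $\alpha$, and on upper bounds for $\|u\|_{C^1([0,T];H^{k+1}(\Omega))}$ and $\|\mathbf q\|_{C^1([0,T];[H^{k+1}(\Omega)]^d)}$; it is independent of $\Omega$, $T$, the mesh and $\tau$ otherwise. -/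

import Mathlib

open MeasureTheory Set
open scoped ENNReal ContDiff InnerProductSpace

noncomputable section

namespace HDG

/-- Euclidean space `ℝ^d`. -/
abbrev Space (d : ℕ) := EuclideanSpace ℝ (Fin d)

/-- A convex polyhedral domain: a nonempty open convex set whose closure is the convex hull of
finitely many points (in particular it is bounded). -/
structure IsConvexPolyhedralDomain {d : ℕ} (Ω : Set (Space d)) : Prop where
  isOpen : IsOpen Ω
  nonempty : Ω.Nonempty
  convex : Convex ℝ Ω
  polytope : ∃ s : Finset (Space d), closure Ω = convexHull ℝ (s : Set (Space d))

/-! ### Sobolev spaces `H^m(Ω)` -/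

/-- Multi-indices `β ∈ ℕ^d` with `|β| ≤ m`. -/
abbrev MultiIndex (d m : ℕ) := {β : Fin d → ℕ // ∑ i, β i ≤ m}

instance (d m : ℕ) : Fintype (MultiIndex d m) :=
  Fintype.ofInjective
    (fun (β : MultiIndex d m) (i : Fin d) =>
      (⟨β.1 i, Nat.lt_succ_of_le ((Finset.single_le_sum (f := β.1) (fun _ _ => Nat.zero_le _)
        (Finset.mem_univ i)).trans β.2)⟩ : Fin (m + 1)))
    (fun _ _ h => Subtype.ext (funext fun i => congrArg Fin.val (congrFun h i)))

/-- The multi-index `0`. -/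
def MultiIndex.zero (d m : ℕ) : MultiIndex d m := ⟨0, by simp⟩

/-- The multi-index `e_i`. -/
def MultiIndex.unit {d : ℕ} (m : ℕ) (i : Fin d) : MultiIndex d (m + 1) :=
  ⟨Pi.single i 1, by simp⟩

/-- The classical partial derivative `∂_i φ`. -/
def partialDeriv {d : ℕ} (i : Fin d) (φ : Space d → ℝ) : Space d → ℝ :=
  fun x => fderiv ℝ φ x (EuclideanSpace.single i 1)

/-- The classical derivative `∂^β φ` of a smooth function. -/
def multiDeriv {d : ℕ} (β : Fin d → ℕ) (φ : Space d → ℝ) : Space d → ℝ :=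
  (List.finRange d).foldr (fun i ψ => (partialDeriv i)^[β i] ψ) φ

/-- The Lebesgue space `L²(Ω)`. -/
abbrev L2 {d : ℕ} (Ω : Set (Space d)) : Type := ↥(Lp ℝ 2 (volume.restrict Ω))

/-- `g` is the weak derivative `D^β v` in `Ω`. -/
def IsWeakDeriv {d : ℕ} {Ω : Set (Space d)} (β : Fin d → ℕ) (v g : L2 Ω) : Prop :=
  ∀ φ : Space d → ℝ, ContDiff ℝ ∞ φ → HasCompactSupport φ → tsupport φ ⊆ Ω →
    ∫ x in Ω, v x * multiDeriv β φ x = (-1) ^ (∑ i, β i) * ∫ x in Ω, g x * φ x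

theorem partialDeriv_good {d : ℕ} (i : Fin d) {φ : Space d → ℝ}
    (h : ContDiff ℝ ∞ φ ∧ HasCompactSupport φ) :
    ContDiff ℝ ∞ (partialDeriv i φ) ∧ HasCompactSupport (partialDeriv i φ) := by
  refine ⟨(h.1.fderiv_right (m := ∞) (by simp)).clm_apply contDiff_const, ?_⟩
  exact h.2.fderiv_apply (𝕜 := ℝ) _

theorem multiDeriv_good {d : ℕ} (β : Fin d → ℕ) {φ : Space d → ℝ}
    (h : ContDiff ℝ ∞ φ ∧ HasCompactSupport φ) :
    ContDiff ℝ ∞ (multiDeriv β φ) ∧ HasCompactSupport (multiDeriv β φ) := by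
  unfold multiDeriv
  induction List.finRange d with
  | nil => exact h
  | cons i l ih =>
    simp only [List.foldr_cons]
    generalize β i = n
    induction n with
    | zero => exact ih
    | succ n ihn =>
      rw [Function.iterate_succ_apply']
      exact partialDeriv_good i ihn

theorem integrable_mul_test {d : ℕ} {Ω : Set (Space d)} (v : L2 Ω) {φ : Space d → ℝ}
    (h : ContDiff ℝ ∞ φ ∧ HasCompactSupport φ) :
    Integrable (fun x => v x * φ x) (volume.restrict Ω) :=
  (Lp.memLp v).integrable_mul (p := 2) (q := 2)
    ((h.1.continuous.memLp_of_hasCompactSupport (μ := volume) h.2).restrict Ω)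

/-- The Sobolev space `H^m(Ω)` as a space of families. A function is recorded together with its weak derivatives: an
element is a family `(v_β)`, `|β| ≤ m`, in `L²(Ω)` with `v_β = D^β v_0`. The norm inherited from the
`ℓ²` product is the usual one, `‖v‖² = ∑_{|β| ≤ m} ‖D^β v‖²`. -/
def sobolevSubmodule {d : ℕ} (Ω : Set (Space d)) (m : ℕ) :
    Submodule ℝ (PiLp 2 (fun _ : MultiIndex d m => L2 Ω)) where
  carrier := {v | ∀ β : MultiIndex d m, IsWeakDeriv β.1 (v (MultiIndex.zero d m)) (v β)}
  zero_mem' := by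
    intro β φ _ _ _
    have h0 : ∀ ψ : Space d → ℝ, ∫ x in Ω, (0 : L2 Ω) x * ψ x = 0 := by
      intro ψ
      rw [integral_congr_ae (g := fun _ => (0 : ℝ))]
      · simp
      · filter_upwards [Lp.coeFn_zero ℝ 2 (volume.restrict Ω)] with x hx
        rw [hx, Pi.zero_apply, zero_mul]
    rw [PiLp.zero_apply, PiLp.zero_apply, h0, h0, mul_zero]
  add_mem' := by
    intro v w hv hw β φ h1 h2 h3
    have hadd : ∀ (a b : L2 Ω) (ψ : Space d → ℝ), ContDiff ℝ ∞ ψ ∧ HasCompactSupport ψ →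
        ∫ x in Ω, (a + b) x * ψ x = (∫ x in Ω, a x * ψ x) + ∫ x in Ω, b x * ψ x := by
      intro a b ψ hψ
      rw [← integral_add (integrable_mul_test a hψ) (integrable_mul_test b hψ)]
      refine integral_congr_ae ?_
      filter_upwards [Lp.coeFn_add a b] with x hx
      rw [hx, Pi.add_apply, add_mul]
    have e1 := hv β φ h1 h2 h3
    have e2 := hw β φ h1 h2 h3
    simp only [PiLp.add_apply]
    rw [hadd _ _ _ (multiDeriv_good β.1 ⟨h1, h2⟩), hadd _ _ _ ⟨h1, h2⟩, e1, e2, mul_add]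
  smul_mem' := by
    intro c v hv β φ h1 h2 h3
    have hsm : ∀ (a : L2 Ω) (ψ : Space d → ℝ),
        ∫ x in Ω, (c • a) x * ψ x = c * ∫ x in Ω, a x * ψ x := by
      intro a ψ
      rw [← integral_const_mul]
      refine integral_congr_ae ?_
      filter_upwards [Lp.coeFn_smul c a] with x hx
      rw [hx, Pi.smul_apply, smul_eq_mul, mul_assoc]
    have e1 := hv β φ h1 h2 h3
    simp only [PiLp.smul_apply]
    rw [hsm, hsm, e1]
    ring

/-- The Sobolev space `H^m(Ω)`. -/
abbrev Sobolev {d : ℕ} (Ω : Set (Space d)) (m : ℕ) : Type := ↥(sobolevSubmodule Ω m)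

/-- The weak derivative `D^β v ∈ L²(Ω)` of `v ∈ H^m(Ω)`. -/
def Sobolev.D {d m : ℕ} {Ω : Set (Space d)} (v : Sobolev Ω m) (β : MultiIndex d m) : L2 Ω :=
  v.1 β

/-- `v ∈ H^m(Ω)` as an element of `L²(Ω)`. -/
def Sobolev.toL2 {d m : ℕ} {Ω : Set (Space d)} (v : Sobolev Ω m) : L2 Ω :=
  v.D (MultiIndex.zero d m)

/-- The first order weak derivative `∂_i v` of `v ∈ H^{m+1}(Ω)`. -/
def Sobolev.grad {d m : ℕ} {Ω : Set (Space d)} (v : Sobolev Ω (m + 1)) (i : Fin d) : L2 Ω :=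
  v.D (MultiIndex.unit m i)

/-- The space `[H^m(Ω)]^d` of vector fields. -/
abbrev VSobolev {d : ℕ} (Ω : Set (Space d)) (m : ℕ) := PiLp 2 (fun _ : Fin d => Sobolev Ω m)

/-- The weak divergence of a vector field in `[H^{m+1}(Ω)]^d`. -/
def VSobolev.div {d m : ℕ} {Ω : Set (Space d)} (p : VSobolev Ω (m + 1)) : L2 Ω :=
  ∑ i, (p i).grad i

/-- The surface measure, i.e. the `(d-1)`-dimensional Hausdorff measure normalised so that it agrees
with Lebesgue measure on hyperplanes (the counting measure for `d = 1`). -/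
def surf (d : ℕ) : Measure (Space d) := μHE[d - 1]

/-- `γ ∈ L²(S)` is the trace of `v ∈ H^{m+1}(Ω)` on `S ⊆ closure Ω`, where `S` is (a part of) a
polyhedral surface: `(v, γ)` is a limit of pairs `(φ, φ|_S)` in `H^1(Ω) × L²(S)` with `φ` smooth up
to the boundary. -/
def IsTrace {d m : ℕ} {Ω : Set (Space d)} (v : Sobolev Ω (m + 1)) (S : Set (Space d))
    (γ : Space d → ℝ) : Prop :=
  MemLp γ 2 ((surf d).restrict S) ∧
  ∀ ε : ℝ≥0∞, 0 < ε → ∃ φ : Space d → ℝ, ContDiff ℝ ∞ φ ∧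
    eLpNorm (fun x => φ x - v.toL2 x) 2 (volume.restrict Ω) < ε ∧
    (∀ i, eLpNorm (fun x => partialDeriv i φ x - v.grad i x) 2 (volume.restrict Ω) < ε) ∧
    eLpNorm (fun x => φ x - γ x) 2 ((surf d).restrict S) < ε

/-! ### Time: the spaces `C¹([0,T]; X)` and the Caputo derivative -/

section Time

variable {X : Type*} [NormedAddCommGroup X] [NormedSpace ℝ X]

/-- The norm of `C¹([0,T]; X)`. -/
def c1Norm (T : ℝ) (v : ℝ → X) : ℝ :=
  (⨆ t : Icc (0 : ℝ) T, ‖v t‖) + ⨆ t : Icc (0 : ℝ) T, ‖derivWithin v (Icc 0 T) t‖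

/-- `ω_α(t) = t^{α-1}/Γ(α)`. -/
def omega (α t : ℝ) : ℝ := t ^ (α - 1) / Real.Gamma α

/-- The Riemann–Liouville integral `I^α v(t) = ∫_0^t ω_α(t-s) v(s) ds`. -/
def fracInt (α : ℝ) (v : ℝ → X) (t : ℝ) : X := ∫ s in (0 : ℝ)..t, omega α (t - s) • v s

/-- The Caputo derivative of order `1 - α`: `I^α v'`. -/
def caputo (α : ℝ) (v : ℝ → X) : ℝ → X := fracInt α (deriv v)

end Time

/-! ### The continuous problem -/

/-- `u`, `q` solve `^cD^{1-α} u - Δu = f` in `Ω × (0,T]`, `u = g` on `∂Ω × (0,T]`, `u(0) = u₀`,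
written as the first order system `q + ∇u = 0`, `^cD^{1-α} u + div q = f`. -/
structure IsExactSolution {d k : ℕ} (Ω : Set (Space d)) (α T : ℝ) (f : ℝ → L2 Ω)
    (g : Space d → ℝ) (u₀ : Sobolev Ω (k + 1)) (u : ℝ → Sobolev Ω (k + 1))
    (q : ℝ → VSobolev Ω (k + 1)) : Prop where
  flux : ∀ t ∈ Icc 0 T, ∀ i, (q t i).toL2 = -(u t).grad i
  balance : ∀ t ∈ Ioc 0 T, caputo α (fun s => (u s).toL2) t + (q t).div = f t
  boundary : ∀ t ∈ Ioc 0 T, IsTrace (u t) (frontier Ω) g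
  initial : u 0 = u₀

/-! ### Triangulations -/

/-- A conforming triangulation of `Ω` by simplices. A simplex is given by its set of `d+1` vertices,
the closed simplex itself being their convex hull. -/
structure Triangulation {d : ℕ} (Ω : Set (Space d)) where
  elements : Finset (Finset (Space d))
  card_eq : ∀ K ∈ elements, K.card = d + 1
  indep : ∀ K ∈ elements, AffineIndependent ℝ (fun x : K => (x : Space d))
  conforming : ∀ K ∈ elements, ∀ L ∈ elements,
    convexHull ℝ (K : Set (Space d)) ∩ convexHull ℝ (L : Set (Space d)) ⊆
      convexHull ℝ ((K : Set (Space d)) ∩ (L : Set (Space d)))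
  cover : ⋃ K ∈ elements, convexHull ℝ (K : Set (Space d)) = closure Ω

/-- The closed simplex with a given set of vertices. -/
def hull {d : ℕ} (K : Finset (Space d)) : Set (Space d) := convexHull ℝ (K : Set (Space d))

/-- The faces (of codimension one) of a `d`-simplex. -/
def facets {d : ℕ} (K : Finset (Space d)) : Finset (Finset (Space d)) := K.powersetCard d

/-- `n` is the unit normal of the simplex `K` on its face `F` pointing out of `K`. -/
structure IsOutwardNormal {d : ℕ} (K F : Finset (Space d)) (n : Space d) : Prop where
  unit : ‖n‖ = 1
  orthogonal : ∀ x ∈ F, ∀ y ∈ F, ⟪n, y - x⟫_ℝ = 0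
  outward : ∀ x ∈ F, ∀ y ∈ K, ⟪n, y - x⟫_ℝ ≤ 0

/-- The outward unit normal of the simplex `K` on its face `F`. -/
def normal {d : ℕ} (K F : Finset (Space d)) : Space d := Classical.epsilon (IsOutwardNormal K F)

/-- The outward unit normal of a nondegenerate simplex exists. -/
theorem normal_spec {d : ℕ} (hd : 1 ≤ d) {K F : Finset (Space d)} (hK : K.card = d + 1)
    (hi : AffineIndependent ℝ (fun x : K => (x : Space d))) (hF : F ∈ facets K) :
    IsOutwardNormal K F (normal K F) := by
  classical
  apply Classical.epsilon_spec
  obtain ⟨hFK, hFc⟩ := Finset.mem_powersetCard.1 hF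
  have hFne : F.Nonempty := Finset.card_pos.1 (by omega)
  obtain ⟨v, hvK, hvF⟩ : ∃ v ∈ K, v ∉ F := by
    by_contra! h
    have := Finset.card_le_card (show K ⊆ F from h)
    omega
  have hKins : K = insert v F := by
    symm
    apply Finset.eq_of_subset_of_card_le (Finset.insert_subset hvK hFK)
    rw [Finset.card_insert_of_notMem hvF]; omega
  have : Nonempty (affineSpan ℝ (F : Set (Space d))) :=
    ((affineSpan_nonempty ℝ).2 (by simpa using hFne)).to_subtype
  have hv : v ∉ affineSpan ℝ (F : Set (Space d)) := by
    have := hi.notMem_affineSpan_sdiff ⟨v, hvK⟩ (Set.univ)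
    intro hcon
    apply this
    have e : (fun x : K => (x : Space d)) '' (Set.univ \ {⟨v, hvK⟩}) = (F : Set (Space d)) := by
      ext y
      simp only [Set.mem_image, Set.mem_sdiff, Set.mem_univ, true_and, Set.mem_singleton_iff,
        Subtype.exists, Finset.mem_coe]
      constructor
      · rintro ⟨a, ha, h1, rfl⟩
        have : a ≠ v := fun h => h1 (Subtype.ext h)
        rw [hKins] at ha
        exact (Finset.mem_insert.1 ha).resolve_left this
      · intro hy
        exact ⟨y, hFK hy, fun h => hvF (by rw [Subtype.mk.injEq] at h; rwa [h] at hy), rfl⟩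
    rw [e]; exact hcon
  set p : Space d :=
    (EuclideanGeometry.orthogonalProjection (affineSpan ℝ (F : Set (Space d))) v : Space d)
  have hpm : p ∈ affineSpan ℝ (F : Set (Space d)) := EuclideanGeometry.orthogonalProjection_mem v
  have hne : p - v ≠ 0 := fun h => hv (by rw [sub_eq_zero] at h; rwa [← h])
  have ho : ∀ x ∈ affineSpan ℝ (F : Set (Space d)), ∀ y ∈ affineSpan ℝ (F : Set (Space d)),
      ⟪p - v, y - x⟫_ℝ = 0 := by
    intro x hx y hy
    have h1 := EuclideanGeometry.orthogonalProjection_vsub_mem_direction_orthogonal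
      (affineSpan ℝ (F : Set (Space d))) v
    rw [real_inner_comm]
    exact (Submodule.mem_orthogonal _ _).1 h1 _ (AffineSubspace.vsub_mem_direction hy hx)
  have hs : ∀ x ∈ F, x ∈ affineSpan ℝ (F : Set (Space d)) := fun x hx => subset_affineSpan ℝ _ hx
  refine ⟨‖p - v‖⁻¹ • (p - v), ?_, ?_, ?_⟩
  · rw [norm_smul, norm_inv, norm_norm, inv_mul_cancel₀ (norm_ne_zero_iff.2 hne)]
  · intro x hx y hy
    rw [inner_smul_left, ho x (hs x hx) y (hs y hy), mul_zero]
  · intro x hx y hy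
    rw [inner_smul_left]
    refine mul_nonpos_of_nonneg_of_nonpos (by simp) ?_
    rw [hKins] at hy
    rcases Finset.mem_insert.1 hy with rfl | hy
    · have e : y - x = -(p - y) + (p - x) := by abel
      rw [e, inner_add_right, inner_neg_right, ho x (hs x hx) p hpm, add_zero]
      simp
    · exact (ho x (hs x hx) y (hs y hy)).le

namespace Triangulation

variable {d : ℕ} {Ω : Set (Space d)} (𝒯 : Triangulation Ω)

open Classical in
/-- The set of all faces of the triangulation. -/
def faces : Finset (Finset (Space d)) := 𝒯.elements.biUnion facets

/-- The face `F` lies on the boundary of `Ω`. -/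
def OnBoundary (_ : Triangulation Ω) (F : Finset (Space d)) : Prop := hull F ⊆ frontier Ω

/-- The mesh size `h`: the maximal diameter of the elements. -/
def meshSize : ℝ := ⨆ K : 𝒯.elements, Metric.diam (hull K.1)

/-- Shape regularity: every element `K` contains a ball of radius `ρ` with `diam K ≤ σ ρ`. -/
def ShapeRegular (σ : ℝ) : Prop :=
  ∀ K ∈ 𝒯.elements, ∃ (c : Space d) (ρ : ℝ), 0 < ρ ∧ Metric.closedBall c ρ ⊆ hull K ∧
    Metric.diam (hull K) ≤ σ * ρ

end Triangulation

/-! ### Piecewise polynomials -/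

/-- A piecewise polynomial scalar field: one polynomial for each simplex (elements `K` for `W_h`,
faces `F` for `M_h`). -/
abbrev Piecewise (d : ℕ) := Finset (Space d) → MvPolynomial (Fin d) ℝ

/-- A piecewise polynomial vector field, given by its components. -/
abbrev VPiecewise (d : ℕ) := Fin d → Piecewise d

/-- The value of a polynomial at a point. -/
def ev {d : ℕ} (p : MvPolynomial (Fin d) ℝ) (x : Space d) : ℝ := MvPolynomial.eval (fun i => x i) p

/-- The value on `K` of a piecewise polynomial vector field. -/
def vev {d : ℕ} (r : VPiecewise d) (K : Finset (Space d)) (x : Space d) : Space d :=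
  WithLp.toLp 2 (fun i => ev (r i K) x)

/-- The gradient of a polynomial. -/
def pgrad {d : ℕ} (w : MvPolynomial (Fin d) ℝ) (x : Space d) : Space d :=
  WithLp.toLp 2 (fun i => ev (MvPolynomial.pderiv i w) x)

/-- The divergence on `K` of a piecewise polynomial vector field. -/
def pdiv {d : ℕ} (r : VPiecewise d) (K : Finset (Space d)) (x : Space d) : ℝ :=
  ∑ i, ev (MvPolynomial.pderiv i (r i K)) x

/-- The vector field in `[L²(Ω)]^d` underlying an element of `[H^m(Ω)]^d`. -/
def vval {d m : ℕ} {Ω : Set (Space d)} (p : VSobolev Ω m) (x : Space d) : Space d :=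
  WithLp.toLp 2 (fun i => (p i).toL2 x)

section Spaces

variable {d : ℕ} {Ω : Set (Space d)} (𝒯 : Triangulation Ω) (k : ℕ)

/-- The space `W_h`: polynomials of total degree at most `k` on each element. -/
def Wh : Set (Piecewise d) := {w | ∀ K ∈ 𝒯.elements, (w K).totalDegree ≤ k}

/-- The space `V_h`. -/
def Vh : Set (VPiecewise d) := {r | ∀ i, r i ∈ Wh 𝒯 k}

/-- The space `M_h`: on each face, the restriction to that face of a polynomial of total degree at
most `k`. -/
def Mh : Set (Piecewise d) := {μ | ∀ F ∈ 𝒯.faces, (μ F).totalDegree ≤ k}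

/-- The function on `Ω` defined (off the null set of element boundaries) by a piecewise
polynomial. -/
def toFun (w : Piecewise d) (x : Space d) : ℝ :=
  ∑ K ∈ 𝒯.elements, (interior (hull K)).indicator (ev (w K)) x

/-- The vector field on `Ω` defined by a piecewise polynomial vector field. -/
def vtoFun (r : VPiecewise d) (x : Space d) : Space d := WithLp.toLp 2 (fun i => toFun 𝒯 (r i) x)

/-- `∑_K ∫_K a_K dx` -/
def sumElements (a : Finset (Space d) → Space d → ℝ) : ℝ :=
  ∑ K ∈ 𝒯.elements, ∫ x in hull K, a K x

/-- `∑_K ∑_{F ⊆ ∂K} ∫_F b_{K,F}`, i.e. `⟨·,·⟩` for the integrand `b`. -/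
def sumFaces (b : Finset (Space d) → Finset (Space d) → Space d → ℝ) : ℝ :=
  ∑ K ∈ 𝒯.elements, ∑ F ∈ facets K, ∫ x in hull F, b K F x ∂(surf d)

open Classical in
/-- The part of the sum over the faces that lie on `∂Ω`, i.e. `⟨·,·⟩_{∂Ω}` for the integrand
`b`. -/
def sumBoundary (b : Finset (Space d) → Finset (Space d) → Space d → ℝ) : ℝ :=
  ∑ K ∈ 𝒯.elements, ∑ F ∈ facets K with 𝒯.OnBoundary F, ∫ x in hull F, b K F x ∂(surf d)

end Spaces

/-! ### Stabilization, projection and the HDG method -/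

section Method

variable {d : ℕ} {Ω : Set (Space d)} (𝒯 : Triangulation Ω) (k : ℕ)

/-- The stabilization function: `τ K F` is its constant value on the face `F` of `∂K`; it may take
two different values on the two sides of an interior face. -/
abbrev Stabilization (d : ℕ) := Finset (Space d) → Finset (Space d) → ℝ

/-- `τ ≥ 0` on all element boundaries. -/
def Stabilization.Nonneg (τ : Stabilization d) : Prop :=
  ∀ K ∈ 𝒯.elements, ∀ F ∈ facets K, 0 ≤ τ K F

/-- On each element `K`, with `F⋆` a face at which `τ|_{∂K}` is maximal:
`τ_K^max = τ|_{F⋆}` is positive, `1 / τ_K^max ≤ C`, and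
`τ_K^* = max τ|_{∂K ∖ F⋆} ≤ C`. -/
def Stabilization.BoundedBy (τ : Stabilization d) (C : ℝ) : Prop :=
  ∀ K ∈ 𝒯.elements, ∃ Fs ∈ facets K, (∀ F ∈ facets K, τ K F ≤ τ K Fs) ∧
    0 < τ K Fs ∧ 1 / τ K Fs ≤ C ∧ ∀ F ∈ facets K, F ≠ Fs → τ K F ≤ C

/-- `(p, z) = (Π_V q, Π_W u)`, the HDG projection of `(q, u)`. For `k = 0` there is no polynomial
of degree less than `k`, so only the conditions on the faces are present. -/
def IsHDGProjection (τ : Stabilization d) {m : ℕ} (q : VSobolev Ω (m + 1)) (u : Sobolev Ω (m + 1))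
    (p : VPiecewise d) (z : Piecewise d) : Prop :=
  p ∈ Vh 𝒯 k ∧ z ∈ Wh 𝒯 k ∧
  ∃ (γu : Finset (Space d) → Space d → ℝ) (γq : Fin d → Finset (Space d) → Space d → ℝ),
    (∀ F ∈ 𝒯.faces, IsTrace u (hull F) (γu F) ∧ ∀ i, IsTrace (q i) (hull F) (γq i F)) ∧
    ∀ K ∈ 𝒯.elements,
      (∀ v : VPiecewise d, (∀ i, (v i K).totalDegree < k) →
        ∫ x in hull K, ⟪vev p K x, vev v K x⟫_ℝ = ∫ x in hull K, ⟪vval q x, vev v K x⟫_ℝ) ∧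
      (∀ w : MvPolynomial (Fin d) ℝ, w.totalDegree < k →
        ∫ x in hull K, ev (z K) x * ev w x = ∫ x in hull K, u.toL2 x * ev w x) ∧
      (∀ F ∈ facets K, ∀ μ : MvPolynomial (Fin d) ℝ, μ.totalDegree ≤ k →
        ∫ x in hull F, (⟪vev p K x, normal K F⟫_ℝ + τ K F * ev (z K) x) * ev μ x ∂(surf d) =
        ∫ x in hull F, (⟪WithLp.toLp 2 (fun i => γq i F x), normal K F⟫_ℝ + τ K F * γu F x)
          * ev μ x ∂(surf d))

/-- The numerical flux `q_h + τ (u_h - û_h) n` on the face `F` of `∂K`. -/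
def numFlux (τ : Stabilization d) (qh : VPiecewise d) (uh uhat : Piecewise d)
    (K F : Finset (Space d)) (x : Space d) : Space d :=
  vev qh K x + (τ K F * (ev (uh K) x - ev (uhat F) x)) • normal K F

/-- `(u_h, q_h, û_h)` is the semi-discrete HDG approximation on `[0,T]` for the data `f`, `g` and
the initial condition `u_h(0) = Π_W u₀`; here `q₀ = -∇u₀` is the initial flux entering the joint
definition of `(Π_V, Π_W)`. The unknown `u_h` is absolutely continuous in time, so that `u_h'` and
its fractional integral make sense. -/
structure IsHDGSolution (τ : Stabilization d) (α T : ℝ) (f : ℝ → L2 Ω) (g : Space d → ℝ)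
    {m : ℕ} (u₀ : Sobolev Ω (m + 1)) (q₀ : VSobolev Ω (m + 1))
    (uh : ℝ → Piecewise d) (qh : ℝ → VPiecewise d) (uhat : ℝ → Piecewise d) : Prop where
  mem_Wh : ∀ t ∈ Icc 0 T, uh t ∈ Wh 𝒯 k
  mem_Vh : ∀ t ∈ Ioc 0 T, qh t ∈ Vh 𝒯 k
  mem_Mh : ∀ t ∈ Ioc 0 T, uhat t ∈ Mh 𝒯 k
  absCont : ∀ K ∈ 𝒯.elements, ∀ x : Space d,
    AbsolutelyContinuousOnInterval (fun t => ev (uh t K) x) 0 T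
  fracIntegrable : ∀ t ∈ Ioc 0 T, ∀ K ∈ 𝒯.elements, ∀ x : Space d,
    IntervalIntegrable (fun s => omega α (t - s) * deriv (fun s => ev (uh s K) x) s) volume 0 t
  initial : ∃ p : VPiecewise d, IsHDGProjection 𝒯 k τ q₀ u₀ p (uh 0)
  flux_eq : ∀ t ∈ Ioc 0 T, ∀ r ∈ Vh 𝒯 k,
    sumElements 𝒯 (fun K x => ⟪vev (qh t) K x, vev r K x⟫_ℝ)
      - sumElements 𝒯 (fun K x => ev (uh t K) x * pdiv r K x)
      + sumFaces 𝒯 (fun K F x => ev (uhat t F) x * ⟪vev r K x, normal K F⟫_ℝ) = 0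
  balance_eq : ∀ t ∈ Ioc 0 T, ∀ w ∈ Wh 𝒯 k,
    sumElements 𝒯 (fun K x => caputo α (fun s => ev (uh s K) x) t * ev (w K) x)
      - sumElements 𝒯 (fun K x => ⟪vev (qh t) K x, pgrad (w K) x⟫_ℝ)
      + sumFaces 𝒯 (fun K F x =>
          ⟪numFlux τ (qh t) (uh t) (uhat t) K F x, normal K F⟫_ℝ * ev (w K) x)
      = sumElements 𝒯 (fun K x => f t x * ev (w K) x)
  boundary_eq : ∀ t ∈ Ioc 0 T, ∀ μ ∈ Mh 𝒯 k,
    sumBoundary 𝒯 (fun _ F x => ev (uhat t F) x * ev (μ F) x)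
      = sumBoundary 𝒯 (fun _ F x => g x * ev (μ F) x)
  transmission_eq : ∀ t ∈ Ioc 0 T, ∀ μ ∈ Mh 𝒯 k,
    sumFaces 𝒯 (fun K F x =>
        ⟪numFlux τ (qh t) (uh t) (uhat t) K F x, normal K F⟫_ℝ * ev (μ F) x)
      - sumBoundary 𝒯 (fun K F x =>
        ⟪numFlux τ (qh t) (uh t) (uhat t) K F x, normal K F⟫_ℝ * ev (μ F) x) = 0

end Method

end HDG

end

open MeasureTheory Set
open scoped ENNReal ContDiff InnerProductSpace

noncomputable section

namespace HDG

/-! ### Fractional derivatives of absolutely continuous functions -/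

/-! The error is split through the projection: `u - u_h = E - η` and `q - q_h = Q - δ`, where `E =
Π_W u - u_h` and `Q = Π_V q - q_h` are piecewise polynomial, while `η = Π_W u - u` and `δ = Π_V q -
q` are projection errors. Three ingredients are needed: a bound of order `h^(k+1)` for the
projection errors and their time increments, an energy identity for `E` and `Q`, and a maximum
principle for the Caputo derivative.

Evolution. Let `Y` be the jumps on the faces weighted by `√τ`, and let `G t` represent `w ↦
^cD^{1-α}(E - η, w)(t)` on the discrete space. The discrete equations, taken at two different times,
give `(Q t, Q s) + (Y t, Y s) + (G t, E s) = (δ s, Q t)` (`IsErrorTriple.energy`). If an absolutely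
continuous `ψ` is largest on `[0, t]` at `t`, then `ω_α(t) (ψ t - ψ 0)` is at most the integral `∫
ω_α(t - s) ψ' s` (`omega_mul_le_caputo`). Applied to `ψ s = (E s, E t)` at a time where `‖E‖` is
maximal this bounds `E` (`norm_E_le`); applied to `ψ s = (Q t, Q s) + (Y t, Y s)` at a time where
`‖Q‖² + ‖Y‖²` is maximal it bounds `Q` (`norm_Q_le`). Both bounds are a constant depending on `α`
times `(1 + T) L`, with `L` a common bound and Lipschitz constant of the projection errors. No
Gronwall argument and no time derivative of the projection occur.

Projection. The field `x ↦ φ(x) (x - v)` is tangential to all faces through the vertex `v`, so the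
divergence theorem expresses moments of a trace on the opposite face by integrals over `K`; this is
the functional `fm`, which makes sense for any pair of a function and a gradient. On polynomials of
degree at most `k` orthogonal to lower degrees, Euler's identity turns these moments into `(d + 2k)
/ height` times the `L²(K)` inner product (`fm_top`), and every polynomial of degree at most `k`
agrees on a given face with one of that kind (`exists_top_eqOn`). The face conditions of the
projection thus become equations in `L²(K)`. Their sum over the faces contains no unknown flux, by
Gauss–Green, and determines the scalar part; the `d` faces other than the one with maximal `τ` then
determine the normal components of the flux, hence the flux. This yields both existence
(`exists_projection`) and the estimate (`projection_estimate`) without a reference element. The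
polynomial approximation it relies on comes from iterating the Poincaré inequality on convex sets.
Since the projection is linear, the same estimate for `u s - u t` gives the Lipschitz bound in time.

Link with the problem. On a bounded convex domain, contracting towards an interior point and
mollifying gives smooth functions converging to a Sobolev function together with its gradient. Its
restrictions to the elements therefore have face moments, these agree from both sides of a face, and
they agree with the moments of any trace in the sense of `IsTrace`. Conformity and convexity make
the normals on an interior face cancel, so the exact flux satisfies the transmission condition. -/

theorem omega_nonneg {α t : ℝ} (hα : 0 < α) (ht : 0 ≤ t) : 0 ≤ omega α t :=
  div_nonneg (Real.rpow_nonneg ht _) (Real.Gamma_pos_of_pos hα).le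

theorem omega_antitone {α : ℝ} (hα : 0 < α) (hα1 : α < 1) {a b : ℝ} (ha : 0 < a) (hab : a ≤ b) :
    omega α b ≤ omega α a :=
  div_le_div_of_nonneg_right (Real.rpow_le_rpow_of_nonpos ha hab (by linarith))
    (Real.Gamma_pos_of_pos hα).le

theorem hasDerivAt_omega_sub {α t s : ℝ} (hs : s < t) :
    HasDerivAt (fun s => omega α (t - s)) ((1 - α) * (t - s) ^ (α - 1 - 1) / Real.Gamma α) s := by
  have h1 : HasDerivAt (fun s => t - s) (-1) s := by
    simpa using (hasDerivAt_id s).const_sub t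
  have h2 := (Real.hasDerivAt_rpow_const (x := t - s) (p := α - 1)
    (Or.inl (by linarith : (t - s) ≠ 0))).comp s h1
  have h3 := h2.div_const (Real.Gamma α)
  refine h3.congr_deriv ?_
  ring

theorem intervalIntegrable_omega {α t : ℝ} (hα : 0 < α) :
    IntervalIntegrable (fun s => omega α (t - s)) volume 0 t := by
  have h := (intervalIntegral.intervalIntegrable_rpow' (a := 0) (b := t) (r := α - 1)
    (by linarith)).comp_sub_left t
  simp only [sub_zero, sub_self] at h
  exact (h.symm.div_const _)

theorem integral_omega {α t : ℝ} (hα : 0 < α) :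
    ∫ s in (0 : ℝ)..t, omega α (t - s) = t ^ α / (α * Real.Gamma α) := by
  rw [intervalIntegral.integral_comp_sub_left (fun s => omega α s) t]
  simp only [sub_self, sub_zero, omega]
  rw [intervalIntegral.integral_div, integral_rpow (Or.inl (by linarith))]
  rw [show α - 1 + 1 = α by ring, Real.zero_rpow hα.ne', sub_zero, div_div]

/-- A maximum principle for the Caputo derivative. -/
theorem omega_mul_le_caputo {α t : ℝ} (hα : 0 < α) (hα1 : α < 1) (ht : 0 < t) {ψ : ℝ → ℝ}
    (hac : AbsolutelyContinuousOnInterval ψ 0 t)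
    (hint : IntervalIntegrable (fun s => omega α (t - s) * deriv ψ s) volume 0 t)
    (hmax : ∀ s ∈ Icc 0 t, ψ s ≤ ψ t) :
    omega α t * (ψ t - ψ 0) ≤ ∫ s in (0 : ℝ)..t, omega α (t - s) * deriv ψ s := by
  -- The kernel is singular at `s = t`, so the integration by parts is done on `[0, r]` with `r <
  -- t`. The tail over `[r, t]` is written as a difference of primitives, so that it tends to zero
  -- by continuity as `r → t`.
  have key : ∀ r ∈ Ioo 0 t, omega α t * (ψ t - ψ 0) ≤
      (∫ s in (0 : ℝ)..r, omega α (t - s) * deriv ψ s) +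
        ((∫ s in (0 : ℝ)..t, |omega α (t - s) * deriv ψ s|) -
          ∫ s in (0 : ℝ)..r, |omega α (t - s) * deriv ψ s|) := by
    intro r hr
    have hd : ∀ s ∈ uIcc 0 r, s < t := by
      intro s hs
      rw [uIcc_of_le hr.1.le] at hs
      exact hs.2.trans_lt hr.2
    have hω : AbsolutelyContinuousOnInterval (fun s => omega α (t - s)) 0 r := by
      apply ContDiffOn.absolutelyContinuousOnInterval
      intro s hs
      have h1 : ContDiffAt ℝ 1 (fun s => (t - s) ^ (α - 1)) s :=
        ContDiffAt.rpow_const_of_ne (by fun_prop) (by linarith [hd s hs])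
      exact (h1.div_const _).contDiffWithinAt
    have hψ : AbsolutelyContinuousOnInterval (fun s => ψ s - ψ t) 0 r := by
      have h1 : AbsolutelyContinuousOnInterval (fun _ : ℝ => ψ t) 0 r :=
        (contDiff_const (c := ψ t)).contDiffOn.absolutelyContinuousOnInterval
      exact (hac.mono (by
        rw [uIcc_of_le hr.1.le, uIcc_of_le ht.le]; exact Icc_subset_Icc_right hr.2.le)).sub h1
    have h1 := hω.integral_mul_deriv_eq_deriv_mul hψ
    -- Since `α < 1`, the function `s ↦ ω_α(t - s)` increases, while `ψ s - ψ t ≤ 0`. Maximality at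
    -- `t` enters here only.
    have h2 : ∫ s in (0 : ℝ)..r, deriv (fun s => omega α (t - s)) s * (ψ s - ψ t) ≤ 0 := by
      rw [intervalIntegral.integral_of_le hr.1.le]
      apply setIntegral_nonpos measurableSet_Ioc
      intro s hs
      have hs' : s < t := hs.2.trans_lt hr.2
      rw [(hasDerivAt_omega_sub hs').deriv]
      apply mul_nonpos_of_nonneg_of_nonpos
      · exact div_nonneg (mul_nonneg (by linarith) (Real.rpow_nonneg (by linarith) _))
          (Real.Gamma_pos_of_pos hα).le
      · linarith [hmax s ⟨hs.1.le, hs'.le⟩]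
    have h3 : ∀ s, deriv (fun s => ψ s - ψ t) s = deriv ψ s := fun s => by simp
    simp only [h3, sub_zero] at h1
    have hrt : uIcc r t ⊆ uIcc 0 t := by
      rw [uIcc_of_le hr.2.le, uIcc_of_le ht.le]; exact Icc_subset_Icc_left hr.1.le
    have h0r : uIcc 0 r ⊆ uIcc 0 t := by
      rw [uIcc_of_le hr.1.le, uIcc_of_le ht.le]; exact Icc_subset_Icc_right hr.2.le
    -- The boundary term at `r` has a factor that blows up as `r → t`; it is dominated by `ω_α(t -
    -- s)` for `s` between `r` and `t`, hence by the tail of a convergent integral.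
    have h4 : omega α (t - r) * (ψ t - ψ r) ≤
        ∫ s in r..t, |omega α (t - s) * deriv ψ s| := by
      have hac' := hac.mono hrt
      rw [← hac'.integral_deriv_eq_sub, ← intervalIntegral.integral_const_mul]
      rw [intervalIntegral.integral_of_le hr.2.le, intervalIntegral.integral_of_le hr.2.le,
        integral_Ioc_eq_integral_Ioo, integral_Ioc_eq_integral_Ioo]
      have i1 := (hac'.intervalIntegrable_deriv.const_mul (omega α (t - r)))
      have i2 := (hint.mono_set hrt).abs
      rw [intervalIntegrable_iff_integrableOn_Ioo_of_le hr.2.le] at i1 i2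
      refine setIntegral_mono_on i1 i2 measurableSet_Ioo ?_
      intro s hs
      rw [abs_mul, abs_of_nonneg (omega_nonneg hα (by linarith [hs.2]))]
      refine (mul_le_mul_of_nonneg_left (le_abs_self _)
        (omega_nonneg hα (by linarith [hr.2]))).trans ?_
      exact mul_le_mul_of_nonneg_right
        (omega_antitone hα hα1 (by linarith [hs.2]) (by linarith [hs.1])) (abs_nonneg _)
    have h5 := intervalIntegral.integral_add_adjacent_intervals (hint.mono_set h0r).abs
      (hint.mono_set hrt).abs
    have h6 : omega α (t - r) * (ψ t - ψ r) = -(omega α (t - r) * (ψ r - ψ t)) := by ring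
    have h7 : omega α t * (ψ t - ψ 0) = -(omega α t * (ψ 0 - ψ t)) := by ring
    linarith
  have hcont1 := intervalIntegral.continuousOn_primitive_interval' hint left_mem_uIcc
  have hcont2 := intervalIntegral.continuousOn_primitive_interval' hint.abs left_mem_uIcc
  have ht' : t ∈ uIcc 0 t := right_mem_uIcc
  have hlim := ((hcont1 t ht').add ((continuousWithinAt_const
    (b := ∫ s in (0 : ℝ)..t, |omega α (t - s) * deriv ψ s|)).sub (hcont2 t ht'))).tendsto
  have hsub : Ioo 0 t ⊆ uIcc 0 t := by rw [uIcc_of_le ht.le]; exact Ioo_subset_Icc_self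
  have hlim' := hlim.mono_left (nhdsWithin_mono t hsub)
  simp only [Pi.add_apply, Pi.sub_apply, sub_self, add_zero] at hlim'
  have : (nhdsWithin t (Ioo 0 t)).NeBot := right_nhdsWithin_Ioo_neBot ht
  exact ge_of_tendsto hlim' (eventually_nhdsWithin_of_forall key)

/-- Absolutely continuous functions whose Caputo derivative is an absolutely convergent
integral. -/
structure CaputoRegular (α T : ℝ) (f : ℝ → ℝ) : Prop where
  ac : AbsolutelyContinuousOnInterval f 0 T
  int : ∀ t ∈ Ioc 0 T, IntervalIntegrable (fun s => omega α (t - s) * deriv f s) volume 0 t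

namespace CaputoRegular

variable {α T : ℝ} {f g : ℝ → ℝ}

/-- Derivatives add only where both functions are differentiable, which for absolutely continuous
functions is almost everywhere. Scalar multiples need no such care, as `deriv (c * f) = c * deriv f`
holds unconditionally. -/
theorem ae_deriv_add (hf : CaputoRegular α T f) (hg : CaputoRegular α T g) {t : ℝ}
    (ht : t ∈ Ioc 0 T) :
    ∀ᵐ s, s ∈ uIoc 0 t → deriv (fun s => f s + g s) s = deriv f s + deriv g s := by
  filter_upwards [hf.ac.ae_differentiableAt, hg.ac.ae_differentiableAt] with s h1 h2 hs
  have hs' : s ∈ uIcc 0 T := by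
    rw [uIoc_of_le ht.1.le] at hs
    rw [uIcc_of_le (ht.1.le.trans ht.2)]
    exact ⟨hs.1.le, hs.2.trans ht.2⟩
  exact deriv_fun_add (h1 hs') (h2 hs')

theorem add (hf : CaputoRegular α T f) (hg : CaputoRegular α T g) :
    CaputoRegular α T (fun s => f s + g s) := by
  refine ⟨hf.ac.add hg.ac, fun t ht => ?_⟩
  refine ((hf.int t ht).add (hg.int t ht)).congr_ae ?_
  rw [Filter.EventuallyEq, ae_restrict_iff' measurableSet_uIoc]
  filter_upwards [hf.ae_deriv_add hg ht] with s hs hs'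
  rw [hs hs', mul_add]

theorem caputo_add (hf : CaputoRegular α T f) (hg : CaputoRegular α T g) {t : ℝ}
    (ht : t ∈ Ioc 0 T) :
    caputo α (fun s => f s + g s) t = caputo α f t + caputo α g t := by
  simp only [caputo, fracInt, smul_eq_mul]
  rw [← intervalIntegral.integral_add (hf.int t ht) (hg.int t ht)]
  apply intervalIntegral.integral_congr_ae
  filter_upwards [hf.ae_deriv_add hg ht] with s hs hs'
  rw [hs hs', mul_add]

theorem const_mul (hf : CaputoRegular α T f) (c : ℝ) : CaputoRegular α T (fun s => c * f s) := by
  refine ⟨hf.ac.const_mul c, fun t ht => ?_⟩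
  have h := (hf.int t ht).const_mul c
  refine h.congr (fun s _ => ?_)
  simp only [deriv_const_mul_field]
  ring

theorem _root_.HDG.caputo_const_mul (α : ℝ) (f : ℝ → ℝ) (c t : ℝ) :
    caputo α (fun s => c * f s) t = c * caputo α f t := by
  simp only [caputo, fracInt, smul_eq_mul, deriv_const_mul_field]
  rw [← intervalIntegral.integral_const_mul]
  congr 1; ext s; ring

theorem zero (α T : ℝ) : CaputoRegular α T (fun _ => 0) := by
  refine ⟨(contDiff_const (c := (0 : ℝ))).contDiffOn.absolutelyContinuousOnInterval, ?_⟩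
  intro t _
  simp

theorem _root_.HDG.caputo_zero (α t : ℝ) : caputo α (fun _ => (0 : ℝ)) t = 0 := by
  simp [caputo, fracInt]

theorem sum {ι : Type*} (s : Finset ι) {f : ι → ℝ → ℝ} (hf : ∀ i ∈ s, CaputoRegular α T (f i)) :
    CaputoRegular α T (fun r => ∑ i ∈ s, f i r) := by
  classical
  induction s using Finset.induction_on with
  | empty => simpa using zero α T
  | insert i s hi ih =>
    simp only [Finset.sum_insert hi]
    exact (hf i (Finset.mem_insert_self _ _)).add
      (ih fun j hj => hf j (Finset.mem_insert_of_mem hj))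

theorem caputo_sum {ι : Type*} (s : Finset ι) {f : ι → ℝ → ℝ}
    (hf : ∀ i ∈ s, CaputoRegular α T (f i)) {t : ℝ} (ht : t ∈ Ioc 0 T) :
    caputo α (fun r => ∑ i ∈ s, f i r) t = ∑ i ∈ s, caputo α (f i) t := by
  classical
  induction s using Finset.induction_on with
  | empty => simp [caputo_zero]
  | insert i s hi ih =>
    simp only [Finset.sum_insert hi]
    have h2 : ∀ j ∈ s, CaputoRegular α T (f j) := fun j hj => hf j (Finset.mem_insert_of_mem hj)
    rw [caputo_add (hf i (Finset.mem_insert_self _ _)) (sum s h2) ht, ih h2]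

theorem omega_mul_le (hα : 0 < α) (hα1 : α < 1) (hf : CaputoRegular α T f) {t : ℝ}
    (ht : t ∈ Ioc 0 T) (hmax : ∀ s ∈ Icc 0 t, f s ≤ f t) :
    omega α t * (f t - f 0) ≤ caputo α f t := by
  have h := omega_mul_le_caputo hα hα1 ht.1 (hf.ac.mono (by
    rw [uIcc_of_le ht.1.le, uIcc_of_le (ht.1.le.trans ht.2)]; exact Icc_subset_Icc_right ht.2))
    (hf.int t ht) hmax
  simpa only [caputo, fracInt, smul_eq_mul] using h

theorem congr (hf : CaputoRegular α T f) (hT : 0 < T) (h : ∀ s ∈ Icc 0 T, f s = g s) :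
    CaputoRegular α T g := by
  have hd : ∀ s ∈ Ioo 0 T, deriv f s = deriv g s := by
    intro s hs
    apply Filter.EventuallyEq.deriv_eq
    filter_upwards [Icc_mem_nhds hs.1 hs.2] with r hr using h r hr
  constructor
  · have h0 := hf.ac
    rw [absolutelyContinuousOnInterval_iff] at h0 ⊢
    intro ε hε
    obtain ⟨δ, hδ, hh⟩ := h0 ε hε
    refine ⟨δ, hδ, fun E hE hlt => ?_⟩
    have := hh E hE hlt
    rwa [Finset.sum_congr rfl] at this
    intro i hi
    have h1 := hE.1 i hi
    rw [uIcc_of_le hT.le] at h1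
    rw [h _ h1.1, h _ h1.2]
  · intro t ht
    refine (hf.int t ht).congr_ae ?_
    rw [Filter.EventuallyEq, ae_restrict_iff' measurableSet_uIoc]
    have : ∀ᵐ s : ℝ, s ≠ t := by simp [ae_iff, measure_singleton]
    filter_upwards [this] with s hs hs'
    rw [uIoc_of_le ht.1.le] at hs'
    rw [hd s ⟨hs'.1, (lt_of_le_of_ne hs'.2 hs).trans_le ht.2⟩]

theorem _root_.HDG.caputo_congr {α T : ℝ} {f g : ℝ → ℝ} (h : ∀ s ∈ Icc 0 T, f s = g s) {t : ℝ}
    (ht : t ∈ Ioc 0 T) : caputo α f t = caputo α g t := by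
  have hd : ∀ s ∈ Ioo 0 T, deriv f s = deriv g s := by
    intro s hs
    apply Filter.EventuallyEq.deriv_eq
    filter_upwards [Icc_mem_nhds hs.1 hs.2] with r hr using h r hr
  simp only [caputo, fracInt, smul_eq_mul]
  apply intervalIntegral.integral_congr_ae
  have : ∀ᵐ s : ℝ, s ≠ t := by simp [ae_iff, measure_singleton]
  filter_upwards [this] with s hs hs'
  rw [uIoc_of_le ht.1.le] at hs'
  rw [hd s ⟨hs'.1, (lt_of_le_of_ne hs'.2 hs).trans_le ht.2⟩]

theorem abs_deriv_le_of_lipschitz {L : ℝ} (hL : 0 ≤ L)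
    (hf : ∀ s ∈ Icc 0 T, ∀ r ∈ Icc 0 T, |f s - f r| ≤ L * |s - r|) {s : ℝ} (hs : s ∈ Ioo 0 T) :
    |deriv f s| ≤ L := by
  have h : LipschitzOnWith ⟨L, hL⟩ f (Icc 0 T) :=
    LipschitzOnWith.of_dist_le_mul fun x hx y hy => by
      rw [Real.dist_eq, Real.dist_eq]; exact hf x hx y hy
  exact norm_deriv_le_of_lipschitzOn (Icc_mem_nhds hs.1 hs.2) h

theorem of_lipschitz (hα : 0 < α) {L : ℝ} (hL : 0 ≤ L)
    (hf : ∀ s ∈ Icc 0 T, ∀ r ∈ Icc 0 T, |f s - f r| ≤ L * |s - r|) (hT : 0 < T) :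
    CaputoRegular α T f := by
  constructor
  · have h : LipschitzOnWith ⟨L, hL⟩ f (uIcc 0 T) :=
      LipschitzOnWith.of_dist_le_mul fun x hx y hy => by
        rw [uIcc_of_le hT.le] at hx hy
        rw [Real.dist_eq, Real.dist_eq]; exact hf x hx y hy
    exact h.absolutelyContinuousOnInterval
  · intro t ht
    have h1 := (intervalIntegrable_omega (t := t) hα)
    rw [intervalIntegrable_iff_integrableOn_Ioo_of_le ht.1.le] at h1 ⊢
    refine (h1.norm.const_mul L).mono' (h1.aestronglyMeasurable.mul
      (measurable_deriv f).aestronglyMeasurable) ?_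
    refine (ae_restrict_iff' measurableSet_Ioo).2 (Filter.Eventually.of_forall fun s hs => ?_)
    rw [norm_mul, mul_comm]
    exact mul_le_mul_of_nonneg_right
      (abs_deriv_le_of_lipschitz hL hf ⟨hs.1, hs.2.trans_le ht.2⟩) (norm_nonneg _)

/-- Only a Lipschitz bound in time is available for the projection errors; it suffices, because the
kernel has integral `t^α / (α Γ(α))`. -/
theorem abs_caputo_le_of_lipschitz (hα : 0 < α) {L : ℝ} (hL : 0 ≤ L)
    (hf : ∀ s ∈ Icc 0 T, ∀ r ∈ Icc 0 T, |f s - f r| ≤ L * |s - r|) {t : ℝ} (ht : t ∈ Ioc 0 T) :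
    |caputo α f t| ≤ L * (t ^ α / (α * Real.Gamma α)) := by
  have h1 := (intervalIntegrable_omega (t := t) hα)
  rw [← integral_omega hα, ← intervalIntegral.integral_const_mul]
  simp only [caputo, fracInt, smul_eq_mul]
  refine (intervalIntegral.abs_integral_le_integral_abs ht.1.le).trans ?_
  have h2 := ((of_lipschitz hα hL hf (ht.1.trans_le ht.2)).int t ht).abs
  have h3 := h1.const_mul L
  rw [intervalIntegral.integral_of_le ht.1.le, intervalIntegral.integral_of_le ht.1.le,
    integral_Ioc_eq_integral_Ioo, integral_Ioc_eq_integral_Ioo]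
  rw [intervalIntegrable_iff_integrableOn_Ioo_of_le ht.1.le] at h2 h3
  refine setIntegral_mono_on h2 h3 measurableSet_Ioo ?_
  intro s hs
  rw [abs_mul, abs_of_nonneg (omega_nonneg hα (by linarith [hs.2])), mul_comm]
  exact mul_le_mul_of_nonneg_right
      (abs_deriv_le_of_lipschitz hL hf ⟨hs.1, hs.2.trans_le ht.2⟩)
      (omega_nonneg hα (by linarith [hs.2]))

end CaputoRegular

/-! ### Energy estimates for a semidiscrete fractional evolution -/

section Energy

variable {H V Z : Type*} [NormedAddCommGroup H] [InnerProductSpace ℝ H]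
  [NormedAddCommGroup V] [InnerProductSpace ℝ V] [NormedAddCommGroup Z] [InnerProductSpace ℝ Z]

/-- The error equations of the semidiscrete method, abstractly: `E` and `Q` are the differences
between the projection of the exact solution and the discrete solution, `Y` is the jump term on the
faces, `η` and `δ` are the projection errors, and `G t` represents the functional
`w ↦ ⟪D^{1-α} (E - η) (t), w⟫`. -/
structure ErrorSystem (α T L : ℝ) (W : Submodule ℝ H) (E G η : ℝ → H) (Q δ : ℝ → V) (Y : ℝ → Z) :
    Prop where
  E_zero : E 0 = 0
  E_mem : ∀ t ∈ Icc 0 T, E t ∈ W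
  G_mem : ∀ t ∈ Ioc 0 T, G t ∈ W
  E_cont : ContinuousOn E (Icc 0 T)
  regular : ∀ w ∈ W, CaputoRegular α T (fun s => ⟪E s - η s, w⟫_ℝ)
  repr : ∀ t ∈ Ioc 0 T, ∀ w ∈ W, ⟪G t, w⟫_ℝ = caputo α (fun s => ⟪E s - η s, w⟫_ℝ) t
  η_lip : ∀ s ∈ Icc 0 T, ∀ t ∈ Icc 0 T, ‖η s - η t‖ ≤ L * |s - t|
  δ_lip : ∀ s ∈ Icc 0 T, ∀ t ∈ Icc 0 T, ‖δ s - δ t‖ ≤ L * |s - t|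
  δ_le : ∀ s ∈ Icc 0 T, ‖δ s‖ ≤ L
  energy : ∀ s ∈ Ioc 0 T, ∀ t ∈ Ioc 0 T,
    ⟪Q t, Q s⟫_ℝ + ⟪Y t, Y s⟫_ℝ + ⟪G t, E s⟫_ℝ = ⟪δ s, Q t⟫_ℝ
  G_le : ∃ M : ℝ, 0 ≤ M ∧ (∀ t ∈ Ioc 0 T, ‖G t‖ ≤ M * (‖Q t‖ + ‖Y t‖)) ∧
    ∀ s ∈ Ioc 0 T, ∀ t ∈ Ioc 0 T, ‖G t - G s‖ ≤ M * (‖Q t - Q s‖ + ‖Y t - Y s‖)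

namespace ErrorSystem

variable {α T L : ℝ} {W : Submodule ℝ H} {E G η : ℝ → H} {Q δ : ℝ → V} {Y : ℝ → Z}

theorem lip_inner {X : Type*} [NormedAddCommGroup X] [InnerProductSpace ℝ X] {ξ : ℝ → X}
    (h : ∀ s ∈ Icc 0 T, ∀ t ∈ Icc 0 T, ‖ξ s - ξ t‖ ≤ L * |s - t|) (w : X) :
    ∀ s ∈ Icc 0 T, ∀ t ∈ Icc 0 T, |⟪ξ s, w⟫_ℝ - ⟪ξ t, w⟫_ℝ| ≤ (L * ‖w‖) * |s - t| := by
  intro s hs t ht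
  rw [← inner_sub_left]
  refine (abs_real_inner_le_norm _ _).trans ?_
  nlinarith [h s hs t ht, norm_nonneg w]

/-- If `N` exceeded `(a + b + 1) B` it would in particular exceed `B`, so `b B²` could be replaced
by `b B N` and one factor `N` cancelled. The summand `1` secures `N ≥ B`. -/
theorem le_of_sq_le {N B a b : ℝ} (hB : 0 ≤ B) (ha : 0 ≤ a) (hb : 0 ≤ b)
    (h : N ^ 2 ≤ a * (B * N) + b * B ^ 2) : N ≤ (a + b + 1) * B := by
  by_contra! hcon
  have h1 : B ≤ N := by nlinarith [mul_nonneg ha hB, mul_nonneg hb hB]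
  rcases hB.eq_or_lt with rfl | hB'
  · nlinarith
  have hN : 0 < N := by linarith
  nlinarith [mul_nonneg hb hB, mul_le_mul_of_nonneg_left h1 (mul_nonneg hb hB),
    mul_lt_mul_of_pos_right hcon hN]

theorem rpow_le_one_add {t T p : ℝ} (ht : 0 < t) (htT : t ≤ T) (hp0 : 0 ≤ p) (hp1 : p ≤ 1) :
    t ^ p ≤ 1 + T := by
  have h1 : t ^ p ≤ (1 + T) ^ p := Real.rpow_le_rpow ht.le (by linarith) hp0
  have h2 : (1 + T) ^ p ≤ (1 + T) ^ (1 : ℝ) := Real.rpow_le_rpow_of_exponent_le (by linarith) hp1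
  rw [Real.rpow_one] at h2
  exact h1.trans h2

/-- Let `t` maximise `‖E‖`. By Cauchy–Schwarz `s ↦ (E s, E t)` is largest at `s = t`, so the maximum
principle bounds `ω_α(t) ‖E t‖²` by the Caputo derivative of this function, which is `(G t, E t)`
plus the Caputo derivative of `(η, E t)`. The first is controlled by the energy identity at `s = t`,
the second by the Lipschitz bound for `η`. -/
theorem norm_E_le (h : ErrorSystem α T L W E G η Q δ Y) (hα : 0 < α) (hα1 : α < 1) (hT : 0 < T)
    (hL : 0 ≤ L) : ‖E T‖ ≤ (1 / α + Real.Gamma α / 4 + 1) * ((1 + T) * L) := by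
  have hΓ := Real.Gamma_pos_of_pos hα
  obtain ⟨t, ht, hmax⟩ := isCompact_Icc.exists_isMaxOn (nonempty_Icc.2 hT.le) h.E_cont.norm
  have hET : ‖E T‖ ≤ ‖E t‖ := hmax (right_mem_Icc.2 hT.le)
  refine hET.trans ?_
  have hLT : 0 ≤ (1 + T) * L := by positivity
  rcases ht.1.eq_or_lt with rfl | ht0
  · rw [h.E_zero, norm_zero]; positivity
  have htT : t ∈ Ioc 0 T := ⟨ht0, ht.2⟩
  have r1 := h.regular (E t) (h.E_mem t ht)
  have hLE : 0 ≤ L * ‖E t‖ := by positivity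
  have r2 := CaputoRegular.of_lipschitz hα hLE (lip_inner h.η_lip (E t)) hT
  have r3 := (r1.add r2).congr (g := fun s => ⟪E s, E t⟫_ℝ) hT (fun s _ => by
    simp only [inner_sub_left]; ring)
  have e3 : caputo α (fun s => ⟪E s, E t⟫_ℝ) t = ⟪G t, E t⟫_ℝ + caputo α (fun s => ⟪η s, E t⟫_ℝ) t := by
    rw [h.repr t htT _ (h.E_mem t ht), ← r1.caputo_add r2 htT]
    exact caputo_congr (fun s _ => by simp only [inner_sub_left]; ring) htT
  have m := r3.omega_mul_le hα hα1 htT (fun s hs => by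
    rw [real_inner_self_eq_norm_sq]
    refine (real_inner_le_norm _ _).trans ?_
    have : ‖E s‖ ≤ ‖E t‖ := hmax ⟨hs.1, hs.2.trans ht.2⟩
    nlinarith [norm_nonneg (E t)])
  rw [e3, h.E_zero, inner_zero_left, sub_zero, real_inner_self_eq_norm_sq] at m
  have b1 := (abs_le.1 (CaputoRegular.abs_caputo_le_of_lipschitz hα hLE
    (lip_inner h.η_lip (E t)) htT)).2
  have b2 := h.energy t htT t htT
  rw [real_inner_self_eq_norm_sq, real_inner_self_eq_norm_sq] at b2
  have b3 : ⟪δ t, Q t⟫_ℝ ≤ L * ‖Q t‖ := (real_inner_le_norm _ _).trans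
    (mul_le_mul_of_nonneg_right (h.δ_le t ht) (norm_nonneg _))
  -- By the energy identity this term is at most `L ‖Q‖ - ‖Q‖²`; completing the square gives the
  -- `1/4` in the constant.
  have b4 : ⟪G t, E t⟫_ℝ ≤ L ^ 2 / 4 := by nlinarith [sq_nonneg (‖Q t‖ - L / 2), sq_nonneg ‖Y t‖]
  have m2 : omega α t * ‖E t‖ ^ 2 ≤ L ^ 2 / 4 + L * ‖E t‖ * (t ^ α / (α * Real.Gamma α)) := by
    linarith
  have p1 : t ^ (α - 1) * t ^ (1 - α) = 1 := by
    rw [← Real.rpow_add ht0]; simp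
  have p2 : t ^ α * t ^ (1 - α) = t := by
    rw [← Real.rpow_add ht0]; simp
  -- Multiplication by `Γ(α) t^(1-α) = 1 / ω_α(t)` isolates `‖E t‖²`; the factor `t^α` on the right
  -- becomes `t`, so no negative power of `t` survives.
  have hc : 0 ≤ Real.Gamma α * t ^ (1 - α) := mul_nonneg hΓ.le (Real.rpow_nonneg ht0.le _)
  have m3 := mul_le_mul_of_nonneg_right m2 hc
  have e1 : omega α t * ‖E t‖ ^ 2 * (Real.Gamma α * t ^ (1 - α)) = ‖E t‖ ^ 2 := by
    calc _ = (t ^ (α - 1) * t ^ (1 - α)) * (Real.Gamma α / Real.Gamma α) * ‖E t‖ ^ 2 := by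
          unfold omega; ring
      _ = _ := by rw [p1, div_self hΓ.ne']; ring
  have e2 : (L ^ 2 / 4 + L * ‖E t‖ * (t ^ α / (α * Real.Gamma α))) * (Real.Gamma α * t ^ (1 - α)) =
      L ^ 2 / 4 * Real.Gamma α * t ^ (1 - α) + L * ‖E t‖ / α * t := by
    calc _ = L ^ 2 / 4 * Real.Gamma α * t ^ (1 - α) +
          L * ‖E t‖ / α * (t ^ α * t ^ (1 - α)) * (Real.Gamma α / Real.Gamma α) := by
            field_simp
      _ = _ := by rw [p2, div_self hΓ.ne']; ring
  rw [e1, e2] at m3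
  have q1 := rpow_le_one_add ht0 ht.2 (by linarith : 0 ≤ 1 - α) (by linarith)
  have q2 : t ≤ 1 + T := by linarith [ht.2]
  -- The power `1 + T` is wastefully squared so that the term has the form `b B²` with `B = (1 + T)
  -- L`.
  have q3 : L ^ 2 / 4 * Real.Gamma α * t ^ (1 - α) ≤ L ^ 2 / 4 * Real.Gamma α * (1 + T) ^ 2 := by
    apply mul_le_mul_of_nonneg_left _ (by positivity)
    nlinarith
  have q4 : L * ‖E t‖ / α * t ≤ L * ‖E t‖ / α * (1 + T) :=
    mul_le_mul_of_nonneg_left q2 (by positivity)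
  refine le_of_sq_le hLT (by positivity) (by positivity) ?_
  have : 1 / α * ((1 + T) * L * ‖E t‖) + Real.Gamma α / 4 * ((1 + T) * L) ^ 2 =
    L ^ 2 / 4 * Real.Gamma α * (1 + T) ^ 2 + L * ‖E t‖ / α * (1 + T) := by ring
  linarith

theorem continuousOn_of_le_add {X : Type*} [NormedAddCommGroup X] {ξ : ℝ → X} {a : ℝ → H}
    {b : ℝ → V} {S : Set ℝ} {M : ℝ} (ha : ContinuousOn a S) (hb : ContinuousOn b S)
    (h : ∀ s ∈ S, ∀ t ∈ S, ‖ξ t - ξ s‖ ≤ 2 * (‖b t - b s‖ + M * ‖a t - a s‖)) :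
    ContinuousOn ξ S := by
  intro s hs
  have h1 : Filter.Tendsto (fun t => 2 * (‖b t - b s‖ + M * ‖a t - a s‖)) (nhdsWithin s S)
      (nhds 0) := by
    have h2 : ContinuousWithinAt (fun t => 2 * (‖b t - b s‖ + M * ‖a t - a s‖)) S s :=
      continuousWithinAt_const.mul (((hb s hs).sub continuousWithinAt_const).norm.add
        (continuousWithinAt_const.mul ((ha s hs).sub continuousWithinAt_const).norm))
    simpa using h2.tendsto
  refine tendsto_iff_norm_sub_tendsto_zero.2 ?_
  exact squeeze_zero' (Filter.Eventually.of_forall fun _ => norm_nonneg _)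
    (eventually_nhdsWithin_of_forall fun t ht => h s hs t ht) h1

/-- The function `Ψ s = (δ s, Q t) - (G t, E s)` equals `(Q t, Q s) + (Y t, Y s)` for `s > 0` by the
two-time energy identity, so it is largest at `s = t`. Its Caputo derivative at `t` contains `-‖G
t‖²`, which absorbs the contribution of `η`. -/
theorem norm_Q_le_of_isMaxOn (h : ErrorSystem α T L W E G η Q δ Y) (hα : 0 < α) (hα1 : α < 1)
    (hT : 0 < T) (hL : 0 ≤ L) {t : ℝ} (ht : t ∈ Ioc 0 T)
    (hmax : ∀ s ∈ Ioc 0 T, ‖Q s‖ ^ 2 + ‖Y s‖ ^ 2 ≤ ‖Q t‖ ^ 2 + ‖Y t‖ ^ 2) :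
    √(‖Q t‖ ^ 2 + ‖Y t‖ ^ 2) ≤
      ((1 + 1 / α) + 1 / (4 * α ^ 2 * Real.Gamma α) + 1) * ((1 + T) * L) := by
  have hΓ := Real.Gamma_pos_of_pos hα
  set N := √(‖Q t‖ ^ 2 + ‖Y t‖ ^ 2) with hN
  have hN0 : 0 ≤ N := Real.sqrt_nonneg _
  have hNsq : N ^ 2 = ‖Q t‖ ^ 2 + ‖Y t‖ ^ 2 := Real.sq_sqrt (by positivity)
  have hQN : ‖Q t‖ ≤ N := Real.le_sqrt_of_sq_le (by nlinarith [sq_nonneg ‖Y t‖])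
  have hLT : 0 ≤ (1 + T) * L := by positivity
  have htI : t ∈ Icc 0 T := ⟨ht.1.le, ht.2⟩
  have ht0 := ht.1
  have r1 := h.regular (G t) (h.G_mem t ht)
  have hLG : 0 ≤ L * ‖G t‖ := by positivity
  have hLQ : 0 ≤ L * ‖Q t‖ := by positivity
  have r2 := CaputoRegular.of_lipschitz hα hLG (lip_inner h.η_lip (G t)) hT
  have r3 := CaputoRegular.of_lipschitz hα hLQ (lip_inner h.δ_lip (Q t)) hT
  have r4 := r3.add ((r1.add r2).const_mul (-1))
  -- `Ψ` is expressed through `δ` and `E` because these are regular up to `s = 0`, whereas the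
  -- equations for `Q` and `Y` hold for positive times only. Writing `E = (E - η) + η` exposes the
  -- part whose Caputo derivative is represented by `G`.
  set Ψ : ℝ → ℝ := fun s => ⟪δ s, Q t⟫_ℝ + -1 * (⟪E s - η s, G t⟫_ℝ + ⟪η s, G t⟫_ℝ) with hΨ
  have hΨ' : ∀ s, Ψ s = ⟪δ s, Q t⟫_ℝ - ⟪G t, E s⟫_ℝ := by
    intro s; simp only [hΨ, inner_sub_left, real_inner_comm (G t) (E s)]; ring
  have hΨX : ∀ s ∈ Ioc 0 T, Ψ s = ⟪Q t, Q s⟫_ℝ + ⟪Y t, Y s⟫_ℝ := by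
    intro s hs; rw [hΨ']; linarith [h.energy s hs t ht]
  have hΨt : Ψ t = N ^ 2 := by
    rw [hΨX t ht, real_inner_self_eq_norm_sq, real_inner_self_eq_norm_sq, hNsq]
  have hle : ∀ s ∈ Ioc 0 T, Ψ s ≤ Ψ t := by
    intro s hs
    rw [hΨt, hNsq, hΨX s hs]
    have := hmax s hs
    nlinarith [real_inner_le_norm (Q t) (Q s), real_inner_le_norm (Y t) (Y s),
      sq_nonneg (‖Q t‖ - ‖Q s‖), sq_nonneg (‖Y t‖ - ‖Y s‖)]
  have hcont : ContinuousOn Ψ (Icc 0 T) := by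
    have := r4.ac.continuousOn; rwa [uIcc_of_le hT.le] at this
  have hle0 : Ψ 0 ≤ Ψ t := by
    have h0 : ContinuousWithinAt Ψ (Ioc 0 T) 0 :=
      (hcont 0 (left_mem_Icc.2 hT.le)).mono Ioc_subset_Icc_self
    have : (nhdsWithin (0 : ℝ) (Ioc 0 T)).NeBot := left_nhdsWithin_Ioc_neBot hT
    exact le_of_tendsto h0.tendsto (eventually_nhdsWithin_of_forall hle)
  have m := r4.omega_mul_le hα hα1 ht (fun s hs => by
    rcases hs.1.eq_or_lt with rfl | hs0
    · exact hle0
    · exact hle s ⟨hs0, hs.2.trans ht.2⟩)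
  rw [r3.caputo_add ((r1.add r2).const_mul (-1)) ht, caputo_const_mul, r1.caputo_add r2 ht,
    ← h.repr t ht _ (h.G_mem t ht), real_inner_self_eq_norm_sq] at m
  change omega α t * (Ψ t - Ψ 0) ≤ _ at m
  have b1 := (abs_le.1 (CaputoRegular.abs_caputo_le_of_lipschitz hα hLG
    (lip_inner h.η_lip (G t)) ht)).1
  have b2 := (abs_le.1 (CaputoRegular.abs_caputo_le_of_lipschitz hα hLQ
    (lip_inner h.δ_lip (Q t)) ht)).2
  have b0 : Ψ 0 ≤ L * N := by
    rw [hΨ', h.E_zero, inner_zero_right, sub_zero]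
    refine (real_inner_le_norm _ _).trans ?_
    exact mul_le_mul (h.δ_le 0 (left_mem_Icc.2 hT.le)) hQN (norm_nonneg _) hL
  set A := t ^ α / (α * Real.Gamma α) with hA
  have hA0 : 0 ≤ A := div_nonneg (Real.rpow_nonneg ht0.le _) (by positivity)
  have hω := omega_nonneg (α := α) hα ht0.le
  -- Here `L ‖G‖ A - ‖G‖² ≤ L² A² / 4`, so no bound on `G` is required.
  have m1 : omega α t * (N ^ 2 - L * N) ≤ L * N * A + L ^ 2 * A ^ 2 / 4 := by
    have h1 : omega α t * (N ^ 2 - L * N) ≤ omega α t * (Ψ t - Ψ 0) :=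
      mul_le_mul_of_nonneg_left (by linarith) hω
    have h2 : L * ‖Q t‖ * A ≤ L * N * A :=
      mul_le_mul_of_nonneg_right (mul_le_mul_of_nonneg_left hQN hL) hA0
    nlinarith [sq_nonneg (‖G t‖ - L * A / 2)]
  have p1 : t ^ (α - 1) * t ^ (1 - α) = 1 := by
    rw [← Real.rpow_add ht0]; simp
  have p2 : t ^ α * t ^ (1 - α) = t := by
    rw [← Real.rpow_add ht0]; simp
  have hc : 0 ≤ Real.Gamma α * t ^ (1 - α) := mul_nonneg hΓ.le (Real.rpow_nonneg ht0.le _)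
  have m3 := mul_le_mul_of_nonneg_right m1 hc
  have e1 : omega α t * (N ^ 2 - L * N) * (Real.Gamma α * t ^ (1 - α)) = N ^ 2 - L * N := by
    calc _ = (t ^ (α - 1) * t ^ (1 - α)) * (Real.Gamma α / Real.Gamma α) * (N ^ 2 - L * N) := by
          unfold omega; ring
      _ = _ := by rw [p1, div_self hΓ.ne']; ring
  have e2 : (L * N * A + L ^ 2 * A ^ 2 / 4) * (Real.Gamma α * t ^ (1 - α)) =
      L * N / α * t + L ^ 2 / (4 * α ^ 2 * Real.Gamma α) * (t * t ^ α) := by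
    calc _ = L * N / α * (t ^ α * t ^ (1 - α)) +
          L ^ 2 / (4 * α ^ 2 * Real.Gamma α) * ((t ^ α * t ^ (1 - α)) * t ^ α) := by
            rw [hA]; field_simp
      _ = _ := by rw [p2]
  rw [e1, e2] at m3
  have q1 := rpow_le_one_add ht0 ht.2 hα.le hα1.le
  have q2 : t ≤ 1 + T := by linarith [ht.2]
  have q3 : L ^ 2 / (4 * α ^ 2 * Real.Gamma α) * (t * t ^ α) ≤
      L ^ 2 / (4 * α ^ 2 * Real.Gamma α) * ((1 + T) * (1 + T)) :=
    mul_le_mul_of_nonneg_left (mul_le_mul q2 q1 (Real.rpow_nonneg ht0.le _) (by linarith))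
      (by positivity)
  have q4 : L * N / α * t ≤ L * N / α * (1 + T) := mul_le_mul_of_nonneg_left q2 (by positivity)
  have q5 : L * N ≤ (1 + T) * (L * N) := by nlinarith [mul_nonneg hL hN0]
  refine le_of_sq_le hLT (by positivity) (by positivity) ?_
  have : (1 + 1 / α) * ((1 + T) * L * N) + 1 / (4 * α ^ 2 * Real.Gamma α) * ((1 + T) * L) ^ 2 =
    (1 + T) * (L * N) + L * N / α * (1 + T) +
      L ^ 2 / (4 * α ^ 2 * Real.Gamma α) * ((1 + T) * (1 + T)) := by ring
  linarith

/-- What remains is that the maximum over the half-open interval is attained. Differences of the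
energy identity show that `Q` and `Y` are continuous on `(0, T]`, and near `0` the norm is at most
about `L`, because `E 0 = 0`. If the value at `T` exceeded the claimed bound, which is at least `L`,
the maximum would be attained away from `0`. The constant `M` serves this qualitative argument only.
-/
theorem norm_Q_le (h : ErrorSystem α T L W E G η Q δ Y) (hα : 0 < α) (hα1 : α < 1) (hT : 0 < T)
    (hL : 0 ≤ L) :
    ‖Q T‖ ≤ ((1 + 1 / α) + 1 / (4 * α ^ 2 * Real.Gamma α) + 1) * ((1 + T) * L) := by
  have hΓ := Real.Gamma_pos_of_pos hα
  obtain ⟨M, hM, hM1, hM2⟩ := h.G_le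
  have hδc : ContinuousOn δ (Icc 0 T) := by
    have : LipschitzOnWith ⟨L, hL⟩ δ (Icc 0 T) :=
      LipschitzOnWith.of_dist_le_mul fun x hx y hy => by
        rw [dist_eq_norm, Real.dist_eq]; exact h.δ_lip x hx y hy
    exact this.continuousOn
  have hdiff : ∀ s ∈ Ioc 0 T, ∀ t ∈ Ioc 0 T,
      ‖Q t - Q s‖ + ‖Y t - Y s‖ ≤ 2 * (‖δ t - δ s‖ + M * ‖E t - E s‖) := by
    intro s hs t ht
    -- The alternating sum of the energy identities at `(s, s)`, `(s, t)`, `(t, s)` and `(t, t)`.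
    have e : ‖Q t - Q s‖ ^ 2 + ‖Y t - Y s‖ ^ 2 =
        ⟪δ t - δ s, Q t - Q s⟫_ℝ - ⟪G t - G s, E t - E s⟫_ℝ := by
      rw [← real_inner_self_eq_norm_sq, ← real_inner_self_eq_norm_sq]
      simp only [inner_sub_left, inner_sub_right]
      have h1 := h.energy s hs t ht
      have h2 := h.energy t ht s hs
      have h3 := h.energy s hs s hs
      have h4 := h.energy t ht t ht
      linarith
    have b1 := real_inner_le_norm (δ t - δ s) (Q t - Q s)
    have b2 := (abs_le.1 (abs_real_inner_le_norm (G t - G s) (E t - E s))).1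
    have b3 := mul_le_mul_of_nonneg_right (hM2 s hs t ht) (norm_nonneg (E t - E s))
    set r := ‖Q t - Q s‖
    set y := ‖Y t - Y s‖
    set a := ‖δ t - δ s‖
    set e' := ‖E t - E s‖
    have hr : 0 ≤ r := norm_nonneg _
    have hy : 0 ≤ y := norm_nonneg _
    have ha : 0 ≤ a := norm_nonneg _
    have he : 0 ≤ e' := norm_nonneg _
    by_contra! hcon
    have : (r + y) * (r + y) ≤ 2 * (a + M * e') * (r + y) := by
      nlinarith [sq_nonneg (r - y), mul_nonneg ha hy]
    have hpos : 0 < r + y := by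
      have : 0 ≤ 2 * (a + M * e') := by positivity
      linarith
    have := le_of_mul_le_mul_right this hpos
    linarith
  have hQc : ContinuousOn Q (Ioc 0 T) :=
    continuousOn_of_le_add (h.E_cont.mono Ioc_subset_Icc_self) (hδc.mono Ioc_subset_Icc_self)
      (fun s hs t ht => by linarith [hdiff s hs t ht, norm_nonneg (Y t - Y s)])
  have hYc : ContinuousOn Y (Ioc 0 T) :=
    continuousOn_of_le_add (h.E_cont.mono Ioc_subset_Icc_self) (hδc.mono Ioc_subset_Icc_self)
      (fun s hs t ht => by linarith [hdiff s hs t ht, norm_nonneg (Q t - Q s)])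
  set N : ℝ → ℝ := fun s => √(‖Q s‖ ^ 2 + ‖Y s‖ ^ 2) with hN
  have hNc : ContinuousOn N (Ioc 0 T) := ((hQc.norm.pow 2).add (hYc.norm.pow 2)).sqrt
  have hN0 : ∀ s, 0 ≤ N s := fun s => Real.sqrt_nonneg _
  have hQN : ∀ s, ‖Q s‖ ≤ N s := fun s => Real.le_sqrt_of_sq_le (by nlinarith [sq_nonneg ‖Y s‖])
  have hYN : ∀ s, ‖Y s‖ ≤ N s := fun s => Real.le_sqrt_of_sq_le (by nlinarith [sq_nonneg ‖Q s‖])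
  have hNsq : ∀ s, N s ^ 2 = ‖Q s‖ ^ 2 + ‖Y s‖ ^ 2 := fun s => Real.sq_sqrt (by positivity)
  have hsmall : ∀ s ∈ Ioc 0 T, N s ≤ L + 2 * M * ‖E s‖ := by
    intro s hs
    have e := h.energy s hs s hs
    rw [real_inner_self_eq_norm_sq, real_inner_self_eq_norm_sq] at e
    have b1 : ⟪δ s, Q s⟫_ℝ ≤ L * N s := (real_inner_le_norm _ _).trans
      (mul_le_mul (h.δ_le s ⟨hs.1.le, hs.2⟩) (hQN s) (norm_nonneg _) hL)
    have b2 := (abs_le.1 (abs_real_inner_le_norm (G s) (E s))).1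
    have b3 := mul_le_mul_of_nonneg_right (hM1 s hs) (norm_nonneg (E s))
    have b4 : M * (‖Q s‖ + ‖Y s‖) * ‖E s‖ ≤ M * (N s + N s) * ‖E s‖ := by
      gcongr
      · exact hQN s
      · exact hYN s
    have b5 : N s * N s ≤ (L + 2 * M * ‖E s‖) * N s := by nlinarith [hNsq s]
    rcases (hN0 s).eq_or_lt with h0 | h0
    · rw [← h0]; positivity
    · exact le_of_mul_le_mul_right b5 h0
  set c := ((1 + 1 / α) + 1 / (4 * α ^ 2 * Real.Gamma α) + 1) with hc
  have hc1 : 1 ≤ c := by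
    have h1 : 0 ≤ 1 / α := by positivity
    have h2 : 0 ≤ 1 / (4 * α ^ 2 * Real.Gamma α) := by positivity
    linarith
  refine (hQN T).trans ?_
  by_contra! hcon
  have hLT : L < N T := by
    refine lt_of_le_of_lt ?_ hcon
    have : L ≤ (1 + T) * L := by nlinarith
    nlinarith
  -- By `hsmall` the norm stays below its value at `T` on `(0, s₀]`, so the compact interval `[s₀,
  -- T]` carries the maximum.
  obtain ⟨s₀, hs₀, hs₀'⟩ : ∃ s₀ ∈ Ioo 0 T, ∀ s ∈ Ioc 0 s₀, L + 2 * M * ‖E s‖ < N T := by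
    have h0 : ContinuousWithinAt (fun s => L + 2 * M * ‖E s‖) (Icc 0 T) 0 :=
      continuousWithinAt_const.add
        (continuousWithinAt_const.mul (h.E_cont 0 (left_mem_Icc.2 hT.le)).norm)
    have h1 : ∀ᶠ s in nhdsWithin 0 (Icc 0 T), L + 2 * M * ‖E s‖ < N T := by
      apply h0.tendsto.eventually_lt_const
      simpa [h.E_zero] using hLT
    obtain ⟨ε, hε, hh⟩ := Metric.mem_nhdsWithin_iff.1 h1
    refine ⟨min (ε / 2) (T / 2), ⟨by positivity, ?_⟩, fun s hs => hh ⟨?_, hs.1.le, ?_⟩⟩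
    · exact (min_le_right _ _).trans_lt (by linarith)
    · rw [Metric.mem_ball, Real.dist_eq, sub_zero, abs_of_pos hs.1]
      exact (hs.2.trans (min_le_left _ _)).trans_lt (by linarith)
    · exact (hs.2.trans (min_le_right _ _)).trans (by linarith)
  obtain ⟨t, ht, hmax⟩ := isCompact_Icc.exists_isMaxOn (nonempty_Icc.2 hs₀.2.le)
    (hNc.mono (fun s (hs : s ∈ Icc s₀ T) => ⟨hs₀.1.trans_le hs.1, hs.2⟩))
  have htT : N T ≤ N t := hmax (right_mem_Icc.2 hs₀.2.le)
  have htI : t ∈ Ioc 0 T := ⟨hs₀.1.trans_le ht.1, ht.2⟩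
  have := h.norm_Q_le_of_isMaxOn hα hα1 hT hL htI (fun s hs => by
    rw [← hNsq, ← hNsq]
    have : N s ≤ N t := by
      by_cases hss : s ≤ s₀
      · exact ((hsmall s hs).trans (hs₀' s ⟨hs.1, hss⟩).le).trans htT
      · exact hmax ⟨(not_le.1 hss).le, hs.2⟩
    exact pow_le_pow_left₀ (hN0 s) this 2)
  exact absurd (htT.trans this) (not_le.2 hcon)

end ErrorSystem

end Energy

/-! ### Geometry of simplices -/

/-- `K` is the vertex set of a nondegenerate `d`-simplex. -/
structure IsSimplex {d : ℕ} (K : Finset (Space d)) : Prop where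
  dim_pos : 1 ≤ d
  card_eq : K.card = d + 1
  indep : AffineIndependent ℝ (fun x : K => (x : Space d))

open Classical in
/-- The face of `K` opposite to the vertex `v`. -/
def opp {d : ℕ} (K : Finset (Space d)) (v : Space d) : Finset (Space d) := K.erase v

/-- The outward normal on the face opposite to `v`. -/
abbrev nrm {d : ℕ} (K : Finset (Space d)) (v : Space d) : Space d := normal K (opp K v)

/-- The distance of the vertex `v` from the opposite face. -/
def height {d : ℕ} (K : Finset (Space d)) (v : Space d) : ℝ :=
  (∑ y ∈ opp K v, ⟪nrm K v, y - v⟫_ℝ) / d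

namespace IsSimplex

variable {d : ℕ} {K : Finset (Space d)}

theorem mem_opp {v y : Space d} : y ∈ opp K v ↔ y ≠ v ∧ y ∈ K := by
  classical
  simp [opp]

theorem card_opp (hK : IsSimplex K) {v : Space d} (hv : v ∈ K) : (opp K v).card = d := by
  classical
  rw [opp, Finset.card_erase_of_mem hv, hK.card_eq]; simp

theorem opp_mem_facets (hK : IsSimplex K) {v : Space d} (hv : v ∈ K) : opp K v ∈ facets K := by
  classical
  exact Finset.mem_powersetCard.2 ⟨Finset.erase_subset _ _, hK.card_opp hv⟩

theorem exists_of_mem_facets (hK : IsSimplex K) {F : Finset (Space d)} (hF : F ∈ facets K) :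
    ∃ v ∈ K, F = opp K v := by
  classical
  obtain ⟨hFK, hFc⟩ := Finset.mem_powersetCard.1 hF
  have h1 : (K \ F).card = 1 := by
    rw [Finset.card_sdiff_of_subset hFK, hK.card_eq, hFc]; simp
  obtain ⟨v, hv⟩ := Finset.card_eq_one.1 h1
  have hvm : v ∈ K \ F := by rw [hv]; simp
  refine ⟨v, (Finset.mem_sdiff.1 hvm).1, ?_⟩
  ext y
  rw [mem_opp]
  constructor
  · intro hy
    exact ⟨fun h => (Finset.mem_sdiff.1 hvm).2 (h ▸ hy), hFK hy⟩
  · rintro ⟨h1, h2⟩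
    by_contra hy
    have : y ∈ K \ F := Finset.mem_sdiff.2 ⟨h2, hy⟩
    rw [hv, Finset.mem_singleton] at this
    exact h1 this

theorem opp_injOn : Set.InjOn (opp K) (K : Set (Space d)) := by
  intro v hv w hw h
  by_contra hne
  have : v ∈ opp K w := mem_opp.2 ⟨hne, hv⟩
  rw [← h] at this
  exact (mem_opp.1 this).1 rfl

theorem sum_facets (hK : IsSimplex K) {M : Type*} [AddCommMonoid M] (f : Finset (Space d) → M) :
    ∑ F ∈ facets K, f F = ∑ v ∈ K, f (opp K v) := by
  classical
  symm
  refine Finset.sum_bij (fun v _ => opp K v) (fun v hv => hK.opp_mem_facets hv)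
    (fun v hv w hw h => opp_injOn hv hw h) ?_ (fun _ _ => rfl)
  intro F hF
  obtain ⟨v, hv, rfl⟩ := hK.exists_of_mem_facets hF
  exact ⟨v, hv, rfl⟩

theorem nrm_spec (hK : IsSimplex K) {v : Space d} (hv : v ∈ K) :
    IsOutwardNormal K (opp K v) (nrm K v) :=
  normal_spec hK.dim_pos hK.card_eq hK.indep (hK.opp_mem_facets hv)

theorem opp_nonempty (hK : IsSimplex K) {v : Space d} (hv : v ∈ K) : (opp K v).Nonempty :=
  Finset.card_pos.1 (by rw [hK.card_opp hv]; exact hK.dim_pos)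

/-- The normal is orthogonal to the face, so all terms averaged in `height` are equal; the average
only avoids choosing a vertex. -/
theorem inner_vertex (hK : IsSimplex K) {v y : Space d} (hv : v ∈ K) (hy : y ∈ opp K v) :
    ⟪nrm K v, y - v⟫_ℝ = height K v := by
  have h : ∀ z ∈ opp K v, ⟪nrm K v, z - v⟫_ℝ = ⟪nrm K v, y - v⟫_ℝ := by
    intro z hz
    have := (hK.nrm_spec hv).orthogonal y hy z hz
    rw [← sub_eq_zero, ← inner_sub_right]
    simpa using this
  have hd : (d : ℝ) ≠ 0 := by have := hK.dim_pos; positivity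
  rw [height, Finset.sum_congr rfl h, Finset.sum_const, hK.card_opp hv, nsmul_eq_mul,
    mul_div_cancel_left₀ _ hd]

theorem inner_edge_of_ne (hK : IsSimplex K) {u v w : Space d} (hu : u ∈ K) (hv : v ∈ K)
    (hw : w ∈ K) (huv : u ≠ v) (huw : u ≠ w) : ⟪nrm K u, v - w⟫_ℝ = 0 :=
  (hK.nrm_spec hu).orthogonal w (mem_opp.2 ⟨huw.symm, hw⟩) v (mem_opp.2 ⟨huv.symm, hv⟩)

theorem vectorSpan_eq_top (hK : IsSimplex K) : vectorSpan ℝ (K : Set (Space d)) = ⊤ := by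
  have h := hK.indep.vectorSpan_eq_top_of_card_eq_finrank_add_one (by
    simp [hK.card_eq])
  simpa using h

theorem span_edges (hK : IsSimplex K) {w : Space d} (hw : w ∈ K) :
    Submodule.span ℝ ((fun v => w - v) '' (K : Set (Space d))) = ⊤ := by
  have h := vectorSpan_eq_span_vsub_set_left ℝ (s := (K : Set (Space d))) (p := w) (by simpa using hw)
  rw [hK.vectorSpan_eq_top] at h
  simpa using h.symm

/-- With height zero the unit normal would be orthogonal to every edge at `v`, and these edges span
the space. -/
theorem height_pos (hK : IsSimplex K) {v : Space d} (hv : v ∈ K) : 0 < height K v := by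
  obtain ⟨y, hy⟩ := hK.opp_nonempty hv
  have h0 : 0 ≤ height K v := by
    rw [← hK.inner_vertex hv hy, ← neg_sub, inner_neg_right]
    linarith [(hK.nrm_spec hv).outward y hy v hv]
  refine h0.lt_of_ne fun h => ?_
  have hall : ∀ e ∈ Submodule.span ℝ ((fun w => v - w) '' (K : Set (Space d))),
      ⟪nrm K v, e⟫_ℝ = 0 := by
    intro e he
    induction he using Submodule.span_induction with
    | mem x hx =>
      obtain ⟨w, hw, rfl⟩ := hx
      by_cases hwv : w = v
      · simp [hwv]
      · have := hK.inner_vertex hv (mem_opp.2 ⟨hwv, hw⟩)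
        rw [← h, ← neg_sub, inner_neg_right] at this
        simpa using this
    | zero => simp
    | add x y _ _ hx hy => rw [inner_add_right, hx, hy, add_zero]
    | smul a x _ hx => rw [inner_smul_right, hx, mul_zero]
  rw [hK.span_edges hv] at hall
  have := hall (nrm K v) trivial
  rw [real_inner_self_eq_norm_sq, (hK.nrm_spec hv).unit] at this
  norm_num at this

/-- Expansion of a vector in terms of its normal components on the faces through a vertex. -/
theorem sum_normal_components (hK : IsSimplex K) {w : Space d} (hw : w ∈ K) (p : Space d) :
    ∑ v ∈ opp K w, (⟪nrm K v, p⟫_ℝ / height K v) • (w - v) = p := by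
  -- The edges `w - v` and the vectors `nrm K v / height K v` are dual bases: the normal of the face
  -- opposite to `v` is orthogonal to every edge lying in that face. By linearity the identity need
  -- only be checked on the edges.
  have hall : ∀ p ∈ Submodule.span ℝ ((fun v => w - v) '' (K : Set (Space d))),
      ∑ v ∈ opp K w, (⟪nrm K v, p⟫_ℝ / height K v) • (w - v) = p := by
    intro e he
    induction he using Submodule.span_induction with
    | mem x hx =>
      obtain ⟨u, hu, rfl⟩ := hx
      by_cases huw : u = w
      · simp [huw]
      · have hu' : u ∈ opp K w := mem_opp.2 ⟨huw, hu⟩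
        rw [Finset.sum_eq_single_of_mem u hu']
        · rw [hK.inner_vertex hu (mem_opp.2 ⟨Ne.symm huw, hw⟩),
            div_self (hK.height_pos hu).ne', one_smul]
        · intro v hv hvu
          rw [hK.inner_edge_of_ne (mem_opp.1 hv).2 hw hu (mem_opp.1 hv).1 hvu]
          simp
    | zero => simp
    | add x y _ _ hx hy =>
      simp only [inner_add_right, add_div, add_smul, Finset.sum_add_distrib, hx, hy]
    | smul a x _ hx =>
      conv_rhs => rw [← hx]
      rw [Finset.smul_sum]
      refine Finset.sum_congr rfl fun v _ => ?_
      rw [inner_smul_right, smul_smul, mul_div_assoc]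
  rw [hK.span_edges hw] at hall
  exact hall p trivial

theorem isCompact_hull (F : Finset (Space d)) : IsCompact (hull F) :=
  F.finite_toSet.isCompact_convexHull (𝕜 := ℝ)

theorem convex_hull (F : Finset (Space d)) : Convex ℝ (hull F) := convex_convexHull ℝ _

theorem measurableSet_hull (F : Finset (Space d)) : MeasurableSet (hull F) :=
  (isCompact_hull F).measurableSet

theorem subset_hull (F : Finset (Space d)) : (F : Set (Space d)) ⊆ hull F := subset_convexHull ℝ _

theorem hull_mono {F G : Finset (Space d)} (h : F ⊆ G) : hull F ⊆ hull G :=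
  convexHull_mono (by simpa using h)

theorem convex_inner_eq (n v : Space d) (c : ℝ) : Convex ℝ {y | ⟪n, y - v⟫_ℝ = c} := by
  intro x hx y hy a b _ _ hab
  simp only [mem_ofPred_eq] at *
  have : a • x + b • y - v = a • (x - v) + b • (y - v) := by
    rw [smul_sub, smul_sub]
    have : v = a • v + b • v := by rw [← add_smul, hab, one_smul]
    nth_rewrite 1 [this]
    abel
  rw [this, inner_add_right, inner_smul_right, inner_smul_right, hx, hy, ← add_mul, hab, one_mul]

theorem inner_of_mem_face (hK : IsSimplex K) {v y : Space d} (hv : v ∈ K)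
    (hy : y ∈ hull (opp K v)) : ⟪nrm K v, y - v⟫_ℝ = height K v :=
  convexHull_min (fun _ hz => hK.inner_vertex hv hz) (convex_inner_eq _ _ _) hy

theorem insert_opp {v : Space d} (hv : v ∈ K) : insert v (opp K v : Set (Space d)) = K := by
  classical
  ext y
  simp only [Set.mem_insert_iff, Finset.mem_coe, mem_opp]
  constructor
  · rintro (rfl | h)
    · exact hv
    · exact h.2
  · intro h
    by_cases hy : y = v
    · exact Or.inl hy
    · exact Or.inr ⟨hy, h⟩

theorem mem_hull_iff (hK : IsSimplex K) {v x : Space d} (hv : v ∈ K) :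
    x ∈ hull K ↔ ∃ s ∈ Icc (0 : ℝ) 1, ∃ y ∈ hull (opp K v), x = v + s • (y - v) := by
  have hne : (opp K v : Set (Space d)).Nonempty := by simpa using hK.opp_nonempty hv
  rw [hull, ← insert_opp hv, convexHull_insert hne, convexJoin_singleton_left]
  simp only [mem_iUnion, segment_eq_image', mem_image, exists_prop]
  constructor
  · rintro ⟨y, hy, s, hs, rfl⟩
    exact ⟨s, hs, y, hy, rfl⟩
  · rintro ⟨s, hs, y, hy, rfl⟩
    exact ⟨y, hy, s, hs, rfl⟩

theorem inner_cone (hK : IsSimplex K) {v y : Space d} (hv : v ∈ K) (hy : y ∈ hull (opp K v))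
    (s : ℝ) : ⟪nrm K v, (v + s • (y - v)) - v⟫_ℝ = s * height K v := by
  rw [add_sub_cancel_left, inner_smul_right, hK.inner_of_mem_face hv hy]

theorem inner_mem_Icc (hK : IsSimplex K) {v x : Space d} (hv : v ∈ K) (hx : x ∈ hull K) :
    ⟪nrm K v, x - v⟫_ℝ ∈ Icc 0 (height K v) := by
  obtain ⟨s, hs, y, hy, rfl⟩ := (hK.mem_hull_iff hv).1 hx
  rw [hK.inner_cone hv hy]
  have := hK.height_pos hv
  constructor
  · exact mul_nonneg hs.1 this.le
  · nlinarith [hs.2]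

theorem height_le_diam (hK : IsSimplex K) {v : Space d} (hv : v ∈ K) :
    height K v ≤ Metric.diam (hull K) := by
  obtain ⟨y, hy⟩ := hK.opp_nonempty hv
  rw [← hK.inner_vertex hv hy]
  refine (real_inner_le_norm _ _).trans ?_
  rw [(hK.nrm_spec hv).unit, one_mul, ← dist_eq_norm]
  exact Metric.dist_le_diam_of_mem (isCompact_hull K).isBounded
    (subset_hull K (mem_opp.1 hy).2) (subset_hull K hv)

/-- The centre `c` and the point `c + ρ n` both lie in the slab between `v` and the opposite face.
This is how shape regularity enters the estimates. -/
theorem le_height_of_closedBall_subset (hK : IsSimplex K) {v c : Space d} {ρ : ℝ} (hv : v ∈ K)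
    (hρ : 0 < ρ) (hb : Metric.closedBall c ρ ⊆ hull K) : ρ ≤ height K v := by
  have hn := (hK.nrm_spec hv).unit
  have h0 : c ∈ hull K := hb (Metric.mem_closedBall_self hρ.le)
  have h1 : c + ρ • nrm K v ∈ hull K := hb (by
    rw [mem_closedBall_iff_norm, add_sub_cancel_left, norm_smul, hn, mul_one, Real.norm_eq_abs,
      abs_of_pos hρ])
  have e0 := (hK.inner_mem_Icc hv h0).1
  have e1 := (hK.inner_mem_Icc hv h1).2
  have : c + ρ • nrm K v - v = (c - v) + ρ • nrm K v := by abel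
  rw [this, inner_add_right, inner_smul_right, real_inner_self_eq_norm_sq, hn] at e1
  linarith

/-! ### The cone formula -/

/-- The simplex is the cone over the face with apex `v`, so its slice parallel to the face at
relative distance `s` is the face shrunk by `s` towards `v`. -/
theorem slice_eq (hK : IsSimplex K) {v : Space d} (hv : v ∈ K) (t : Set (Space d)) {s : ℝ}
    (hs : s ∈ Ioc (0 : ℝ) 1) :
    (t ∩ hull K) ∩ (AffineSubspace.mk' ((height K v * s) • nrm K v +ᵥ v) (ℝ ∙ nrm K v)ᗮ) =
      AffineMap.homothety v s '' (hull (opp K v) ∩ {y | v + s • (y - v) ∈ t}) := by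
  have hn := (hK.nrm_spec hv).unit
  have hh := hK.height_pos hv
  ext x
  simp only [mem_inter_iff, SetLike.mem_coe, AffineSubspace.mem_mk', mem_image, mem_ofPred_eq,
    AffineMap.homothety_apply, vsub_eq_sub, vadd_eq_add, Submodule.mem_orthogonal_singleton_iff_inner_right]
  have e0 : x - ((height K v * s) • nrm K v + v) = (x - v) - (height K v * s) • nrm K v := by abel
  rw [e0, inner_sub_right, inner_smul_right, real_inner_self_eq_norm_sq, hn]
  constructor
  · rintro ⟨⟨hxt, hxK⟩, hx⟩
    obtain ⟨r, hr, y, hy, rfl⟩ := (hK.mem_hull_iff hv).1 hxK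
    rw [hK.inner_cone hv hy] at hx
    have : r = s := by
      have : (r - s) * height K v = 0 := by linarith
      rcases mul_eq_zero.1 this with h | h
      · linarith
      · exact absurd h hh.ne'
    subst this
    exact ⟨y, ⟨hy, hxt⟩, by rw [add_comm]⟩
  · rintro ⟨y, ⟨hy, hyt⟩, rfl⟩
    have e : s • (y - v) + v = v + s • (y - v) := add_comm _ _
    rw [e]
    refine ⟨⟨hyt, (hK.mem_hull_iff hv).2 ⟨s, ⟨hs.1.le, hs.2⟩, y, hy, rfl⟩⟩, ?_⟩
    rw [hK.inner_cone hv hy]; ring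

/-- Cavalieri's principle along the normal. The slice at relative distance `s` is a homothetic copy
of part of the face, whence the weight `s^(d-1)`; the substitution `x = height * s` produces the
factor in front. -/
theorem volume_inter_hull (hK : IsSimplex K) {v : Space d} (hv : v ∈ K) {t : Set (Space d)}
    (ht : MeasurableSet t) :
    volume (t ∩ hull K) = ENNReal.ofReal (height K v) * ∫⁻ s in Ioc (0 : ℝ) 1,
      ENNReal.ofReal (s ^ (d - 1)) * surf d (hull (opp K v) ∩ {y | v + s • (y - v) ∈ t}) := by
  have hn := (hK.nrm_spec hv).unit
  have hh := hK.height_pos hv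
  have hn0 : nrm K v ≠ 0 := by
    intro h; rw [h, norm_zero] at hn; exact zero_ne_one hn
  have h1 := EuclideanGeometry.euclideanHausdorffMeasure_eq_lintegral v hn0
    (ht.inter (measurableSet_hull K))
  rw [InnerProductSpace.euclideanHausdorffMeasure_eq_volume] at h1
  simp only [finrank_euclideanSpace, Fintype.card_fin] at h1
  have hne : ‖nrm K v‖ₑ = 1 := by rw [← ofReal_norm, hn, ENNReal.ofReal_one]
  rw [h1, hne, one_mul]
  set f : ℝ → ℝ≥0∞ := fun x => (μHE[d - 1] : Measure (Space d)) ((t ∩ hull K) ∩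
    (AffineSubspace.mk' (x • nrm K v +ᵥ v) (ℝ ∙ nrm K v)ᗮ)) with hf
  have h2 : ∫⁻ x, f x = ENNReal.ofReal (height K v) * ∫⁻ s, f (height K v * s) := by
    have h3 := (Homeomorph.mulLeft₀ _ hh.ne').measurableEmbedding.lintegral_map (μ := volume) f
    conv_lhs => rw [← Real.smul_map_volume_mul_left hh.ne', lintegral_smul_measure, abs_of_pos hh]
    exact congrArg (fun c => ENNReal.ofReal (height K v) * c) h3
  rw [h2]
  congr 1
  rw [← lintegral_indicator measurableSet_Ioc]
  have hae : ∀ᵐ s : ℝ, s ≠ 0 := by simp [ae_iff, measure_singleton]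
  refine lintegral_congr_ae ?_
  filter_upwards [hae] with s hs0
  by_cases hs : s ∈ Ioc (0 : ℝ) 1
  · rw [indicator_of_mem hs, hf]
    simp only
    rw [hK.slice_eq hv t hs, euclideanHausdorffMeasure_homothety_image _ _ hs.1.ne', surf]
    rw [ENNReal.smul_def, smul_eq_mul]
    congr 1
    rw [← ENNReal.ofReal_coe_nnreal]
    congr 1
    push_cast
    rw [Real.norm_eq_abs, abs_of_pos hs.1]
  · rw [indicator_of_notMem hs, hf]
    simp only
    convert measure_empty (μ := (μHE[d - 1] : Measure (Space d)))
    rw [eq_empty_iff_forall_notMem]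
    rintro x ⟨⟨-, hxK⟩, hx⟩
    rw [SetLike.mem_coe, AffineSubspace.mem_mk', Submodule.mem_orthogonal_singleton_iff_inner_right,
      vsub_eq_sub, vadd_eq_add] at hx
    have e0 : x - ((height K v * s) • nrm K v + v) = (x - v) - (height K v * s) • nrm K v := by abel
    rw [e0, inner_sub_right, inner_smul_right, real_inner_self_eq_norm_sq, hn] at hx
    have h3 := hK.inner_mem_Icc hv hxK
    apply hs
    have h4 : ⟪nrm K v, x - v⟫_ℝ = height K v * s := by linarith
    rw [h4] at h3
    constructor
    · have : 0 ≤ s := by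
        by_contra! hcon; nlinarith [h3.1]
      exact lt_of_le_of_ne this (Ne.symm hs0)
    · by_contra! hcon; nlinarith [h3.2]

/-- A face of infinite measure would make the volume of the compact simplex infinite, by the cone
formula. -/
theorem surf_face_lt_top (hK : IsSimplex K) {v : Space d} (hv : v ∈ K) :
    surf d (hull (opp K v)) < ⊤ := by
  have hh := hK.height_pos hv
  have h := hK.volume_inter_hull hv MeasurableSet.univ
  simp only [univ_inter, mem_univ, ofPred_true, inter_univ] at h
  have h1 : volume (hull K) < ⊤ := (isCompact_hull K).measure_lt_top
  by_contra hcon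
  rw [not_lt, top_le_iff] at hcon
  rw [h, hcon] at h1
  have h2 : ∫⁻ s in Ioc (0 : ℝ) 1, ENNReal.ofReal (s ^ (d - 1)) * ⊤ = ⊤ := by
    rw [eq_top_iff]
    calc (⊤ : ℝ≥0∞) = ∫⁻ s in Ioc (0 : ℝ) 1, ⊤ := by simp
      _ ≤ _ := by
        refine setLIntegral_mono_ae' measurableSet_Ioc (Filter.Eventually.of_forall fun s hs => ?_)
        rw [ENNReal.mul_top]
        simpa using pow_pos hs.1 _
  rw [h2, ENNReal.mul_top (by simpa using hh)] at h1
  exact lt_irrefl _ h1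

theorem isFiniteMeasure_surf (hK : IsSimplex K) {v : Space d} (hv : v ∈ K) :
    IsFiniteMeasure ((surf d).restrict (hull (opp K v))) :=
  ⟨by simpa using hK.surf_face_lt_top hv⟩

/-- Polar coordinates in a simplex with respect to a vertex. -/
theorem volume_restrict_hull (hK : IsSimplex K) {v : Space d} (hv : v ∈ K) :
    (volume : Measure (Space d)).restrict (hull K) =
      (((volume.restrict (Ioc (0 : ℝ) 1)).withDensity
        (fun s => ENNReal.ofReal (height K v * s ^ (d - 1)))).prod
        ((surf d).restrict (hull (opp K v)))).map (fun p => v + p.1 • (p.2 - v)) := by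
  have := hK.isFiniteMeasure_surf hv
  have hh := hK.height_pos hv
  have hm : Measurable (fun p : ℝ × Space d => v + p.1 • (p.2 - v)) := by fun_prop
  ext t ht
  rw [Measure.restrict_apply ht, hK.volume_inter_hull hv ht, Measure.map_apply hm ht,
    Measure.prod_apply (hm ht)]
  rw [lintegral_withDensity_eq_lintegral_mul _ (by fun_prop)
    (measurable_measure_prodMk_left (hm ht))]
  rw [← lintegral_const_mul']
  · refine lintegral_congr fun s => ?_
    simp only [Pi.mul_apply]
    rw [ENNReal.ofReal_mul hh.le, mul_assoc]
    congr 2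
    rw [Measure.restrict_apply]
    · rw [inter_comm]; rfl
    · exact measurable_prodMk_left (hm ht)
  · exact ENNReal.ofReal_ne_top

theorem integrable_of_continuous_face (hK : IsSimplex K) {v : Space d} (hv : v ∈ K)
    {g : Space d → ℝ} (hg : Continuous g) : Integrable g ((surf d).restrict (hull (opp K v))) := by
  have := hK.isFiniteMeasure_surf hv
  obtain ⟨C, hC⟩ := (isCompact_hull (opp K v)).exists_bound_of_continuousOn hg.continuousOn
  exact Integrable.of_bound hg.aestronglyMeasurable C
    ((ae_restrict_iff' (measurableSet_hull _)).2 (Filter.Eventually.of_forall hC))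

theorem integrable_of_continuous {g : Space d → ℝ} (hg : Continuous g) :
    Integrable g (volume.restrict (hull K)) :=
  hg.continuousOn.integrableOn_compact (isCompact_hull K)

/-- The divergence theorem for the field `x ↦ φ(x) (x - v)`, which is tangential on all faces but
one. -/
theorem height_mul_integral_face (hK : IsSimplex K) {v : Space d} (hv : v ∈ K) {φ : Space d → ℝ}
    (hφ : ContDiff ℝ 1 φ) :
    height K v * ∫ y in hull (opp K v), φ y ∂(surf d) =
      ∫ x in hull K, (d * φ x + fderiv ℝ φ x (x - v)) := by
  have := hK.isFiniteMeasure_surf hv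
  have hh := hK.height_pos hv
  have hd := hK.dim_pos
  have hm : Measurable (fun p : ℝ × Space d => v + p.1 • (p.2 - v)) := by fun_prop
  have hfd : Continuous (fderiv ℝ φ) := hφ.continuous_fderiv (by norm_num)
  have hg : Continuous (fun x => d * φ x + fderiv ℝ φ x (x - v)) := by
    have := hφ.continuous
    fun_prop
  set g := fun x => d * φ x + fderiv ℝ φ x (x - v) with hgdef
  have hint := integrable_of_continuous (K := K) hg
  rw [hK.volume_restrict_hull hv] at hint ⊢
  rw [integrable_map_measure hg.aestronglyMeasurable hm.aemeasurable] at hint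
  have : SFinite ((volume.restrict (Ioc (0 : ℝ) 1)).withDensity
        (fun s => ENNReal.ofReal (height K v * s ^ (d - 1)))) := inferInstance
  rw [integral_map hm.aemeasurable hg.aestronglyMeasurable, ← integral_const_mul]
  refine Eq.trans ?_ (integral_prod_symm _ hint).symm
  refine integral_congr_ae (Filter.Eventually.of_forall fun y => ?_)
  simp only [Function.comp_apply]
  rw [integral_withDensity_eq_integral_toReal_smul (by fun_prop)
    (Filter.Eventually.of_forall fun _ => ENNReal.ofReal_lt_top)]
  -- Along the ray from `v` to `y` the integrand is an exact derivative. Its primitive vanishes at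
  -- `s = 0` because `d ≥ 1`, so only the value on the face remains.
  have hderiv : ∀ s : ℝ, HasDerivAt (fun s : ℝ => height K v * (s ^ d * φ (v + s • (y - v))))
      (height K v * s ^ (d - 1) * g (v + s • (y - v))) s := by
    intro s
    have h1 : HasDerivAt (fun s : ℝ => v + s • (y - v)) (y - v) s := by
      simpa using ((hasDerivAt_id s).smul_const (y - v)).const_add v
    have h2 := ((hφ.differentiable (by norm_num)) (v + s • (y - v))).hasFDerivAt.comp_hasDerivAt s h1
    have h3 := ((hasDerivAt_pow d s).mul h2).const_mul (height K v)
    refine h3.congr_deriv ?_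
    obtain ⟨m, rfl⟩ : ∃ m, d = m + 1 := ⟨d - 1, by omega⟩
    simp only [hgdef, add_sub_cancel_left, map_smul, smul_eq_mul, add_tsub_cancel_right,
      Function.comp_apply]
    ring
  have hcont : Continuous (fun s : ℝ => height K v * s ^ (d - 1) * g (v + s • (y - v))) := by
    fun_prop
  have h4 := intervalIntegral.integral_eq_sub_of_hasDerivAt (a := 0) (b := 1)
    (fun s _ => hderiv s) (hcont.intervalIntegrable _ _)
  rw [intervalIntegral.integral_of_le zero_le_one] at h4
  have h5 : ∫ s in Ioc (0 : ℝ) 1, (ENNReal.ofReal (height K v * s ^ (d - 1))).toReal •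
      g (v + s • (y - v)) = ∫ s in Ioc (0 : ℝ) 1, height K v * s ^ (d - 1) * g (v + s • (y - v)) := by
    refine setIntegral_congr_fun measurableSet_Ioc fun s hs => ?_
    have h6 : 0 ≤ height K v * s ^ (d - 1) := mul_nonneg hh.le (pow_nonneg hs.1.le _)
    simp only [ENNReal.toReal_ofReal h6, smul_eq_mul]
  rw [h5, h4]
  have : d ≠ 0 := by omega
  simp [this]

/-- The Gauss–Green formula on a simplex. -/
theorem integral_fderiv (hK : IsSimplex K) {φ : Space d → ℝ} (hφ : ContDiff ℝ 1 φ) (e : Space d) :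
    ∫ x in hull K, fderiv ℝ φ x e =
      ∑ v ∈ K, ⟪nrm K v, e⟫_ℝ * ∫ y in hull (opp K v), φ y ∂(surf d) := by
  have hfd : Continuous (fderiv ℝ φ) := hφ.continuous_fderiv (by norm_num)
  have hint : ∀ e : Space d, Integrable (fun x => fderiv ℝ φ x e) (volume.restrict (hull K)) :=
    fun e => integrable_of_continuous (by fun_prop)
  obtain ⟨w, hw⟩ : K.Nonempty := Finset.card_pos.1 (by rw [hK.card_eq]; omega)
  have hall : ∀ e ∈ Submodule.span ℝ ((fun v => w - v) '' (K : Set (Space d))),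
      ∫ x in hull K, fderiv ℝ φ x e =
        ∑ v ∈ K, ⟪nrm K v, e⟫_ℝ * ∫ y in hull (opp K v), φ y ∂(surf d) := by
    intro e he
    induction he using Submodule.span_induction with
    | mem x hx =>
      obtain ⟨u, hu, rfl⟩ := hx
      by_cases huw : u = w
      · simp [huw]
      classical
      have h1 := hK.height_mul_integral_face hu hφ
      have h2 := hK.height_mul_integral_face hw hφ
      have hi : ∀ z : Space d, Integrable (fun x => d * φ x + fderiv ℝ φ x (x - z))
          (volume.restrict (hull K)) := fun z => integrable_of_continuous (by
        have := hφ.continuous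
        fun_prop)
      -- Both sides of the formula are linear in the direction, so edges suffice. For `w - u = (x -
      -- u) - (x - w)` the two cone formulas are subtracted; the normals of the remaining faces are
      -- orthogonal to this edge.
      have h3 : ∫ x in hull K, fderiv ℝ φ x (w - u) =
          height K u * (∫ y in hull (opp K u), φ y ∂(surf d)) -
            height K w * ∫ y in hull (opp K w), φ y ∂(surf d) := by
        rw [h1, h2, ← integral_sub (hi u) (hi w)]
        congr 1; ext x
        have : w - u = (x - u) - (x - w) := by abel
        rw [this, map_sub]; ring
      simp only
      rw [h3, ← Finset.add_sum_erase K _ hu,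
        ← Finset.add_sum_erase (K.erase u) _ (Finset.mem_erase.2 ⟨Ne.symm huw, hw⟩)]
      rw [Finset.sum_eq_zero, hK.inner_vertex hu (mem_opp.2 ⟨Ne.symm huw, hw⟩)]
      · rw [← neg_sub u w, inner_neg_right, hK.inner_vertex hw (mem_opp.2 ⟨huw, hu⟩)]
        ring
      · intro z hz
        simp only [Finset.mem_erase] at hz
        rw [hK.inner_edge_of_ne hz.2.2 hw hu hz.1 hz.2.1, zero_mul]
    | zero => simp
    | add x y _ _ hx hy =>
      simp only [map_add, inner_add_right, add_mul, Finset.sum_add_distrib]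
      rw [integral_add (hint x) (hint y), hx, hy]
    | smul a x _ hx =>
      simp only [map_smul, smul_eq_mul, inner_smul_right, mul_assoc]
      rw [integral_const_mul, hx, Finset.mul_sum]
  rw [hK.span_edges hw] at hall
  exact hall e trivial

end IsSimplex

/-! ### Polynomials as functions -/

section Poly

variable {d : ℕ}

open MvPolynomial

@[simp] theorem ev_add (p q : MvPolynomial (Fin d) ℝ) (x : Space d) : ev (p + q) x = ev p x + ev q x :=
  map_add _ _ _

@[simp] theorem ev_sub (p q : MvPolynomial (Fin d) ℝ) (x : Space d) : ev (p - q) x = ev p x - ev q x :=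
  map_sub _ _ _

@[simp] theorem ev_mul (p q : MvPolynomial (Fin d) ℝ) (x : Space d) : ev (p * q) x = ev p x * ev q x :=
  map_mul _ _ _

@[simp] theorem ev_neg (p : MvPolynomial (Fin d) ℝ) (x : Space d) : ev (-p) x = -ev p x :=
  map_neg _ _

@[simp] theorem ev_zero (x : Space d) : ev (0 : MvPolynomial (Fin d) ℝ) x = 0 := map_zero _

@[simp] theorem ev_smul (c : ℝ) (p : MvPolynomial (Fin d) ℝ) (x : Space d) :
    ev (c • p) x = c * ev p x := by
  rw [ev, smul_eval]; rfl

@[simp] theorem ev_sum {ι : Type*} (s : Finset ι) (p : ι → MvPolynomial (Fin d) ℝ) (x : Space d) :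
    ev (∑ i ∈ s, p i) x = ∑ i ∈ s, ev (p i) x := map_sum _ _ _

@[simp] theorem ev_C (c : ℝ) (x : Space d) : ev (C c : MvPolynomial (Fin d) ℝ) x = c := eval_C _

@[simp] theorem ev_X (i : Fin d) (x : Space d) : ev (X i : MvPolynomial (Fin d) ℝ) x = x i := eval_X _

theorem contDiff_ev (p : MvPolynomial (Fin d) ℝ) {n : WithTop ℕ∞} : ContDiff ℝ n (ev p) := by
  induction p using MvPolynomial.induction_on with
  | C a => simpa [funext (ev_C a)] using contDiff_const
  | add p q hp hq => simpa [funext (ev_add p q)] using hp.add hq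
  | mul_X p i hp =>
    rw [funext (ev_mul p (X i)), funext (ev_X i)]
    exact hp.mul (by fun_prop)

theorem continuous_ev (p : MvPolynomial (Fin d) ℝ) : Continuous (ev p) :=
  (contDiff_ev (n := 0) p).continuous

theorem hasFDerivAt_ev (p : MvPolynomial (Fin d) ℝ) (x : Space d) :
    HasFDerivAt (ev p) (∑ i, ev (pderiv i p) x • (EuclideanSpace.proj i : Space d →L[ℝ] ℝ)) x := by
  induction p using MvPolynomial.induction_on with
  | C a =>
    rw [funext (ev_C a)]
    simpa using hasFDerivAt_const a x
  | add p q hp hq =>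
    rw [funext (ev_add p q)]
    refine (hp.add hq).congr_fderiv ?_
    rw [← Finset.sum_add_distrib]
    refine Finset.sum_congr rfl fun i _ => ?_
    rw [map_add, ev_add, add_smul]
  | mul_X p i hp =>
    rw [funext (ev_mul p (X i)), funext (ev_X i)]
    have h2 : HasFDerivAt (fun y : Space d => y i) (EuclideanSpace.proj i : Space d →L[ℝ] ℝ) x :=
      (EuclideanSpace.proj i : Space d →L[ℝ] ℝ).hasFDerivAt
    refine (hp.mul h2).congr_fderiv ?_
    have h3 : ∀ j, ev (pderiv j (p * X i)) x = x i * ev (pderiv j p) x +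
        (if j = i then ev p x else 0) := by
      intro j
      rw [pderiv_mul, ev_add, ev_mul, ev_mul, ev_X]
      by_cases hj : j = i
      · subst hj; simp [mul_comm]
        rw [← C_1, ev_C, mul_one]
      · rw [pderiv_X_of_ne (Ne.symm hj)]; simp [hj, mul_comm]
    simp only [h3, add_smul, Finset.sum_add_distrib, Finset.smul_sum, smul_smul]
    rw [add_comm]
    congr 1
    simp

theorem fderiv_ev (p : MvPolynomial (Fin d) ℝ) (x e : Space d) :
    fderiv ℝ (ev p) x e = ∑ i, ev (pderiv i p) x * e i := by
  rw [(hasFDerivAt_ev p x).fderiv]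
  simp

theorem partialDeriv_ev (i : Fin d) (p : MvPolynomial (Fin d) ℝ) :
    partialDeriv i (ev p) = ev (pderiv i p) := by
  funext x
  rw [partialDeriv, fderiv_ev, Finset.sum_eq_single i]
  · simp
  · intro j _ hj
    simp [hj]
  · simp

/-- Polynomials all of whose monomials have total degree less than `j`. -/
def Pl (d j : ℕ) : Submodule ℝ (MvPolynomial (Fin d) ℝ) :=
  restrictSupport ℝ {n | n.degree < j}

theorem mem_Pl_succ {k : ℕ} {p : MvPolynomial (Fin d) ℝ} : p ∈ Pl d (k + 1) ↔ p.totalDegree ≤ k := by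
  rw [← mem_restrictTotalDegree, Pl, restrictTotalDegree, mem_restrictSupport_iff,
    mem_restrictSupport_iff]
  simp only [Set.subset_def, mem_ofPred_eq, Nat.lt_succ_iff]
  rfl

/-- The alternative `p = 0` matters for degree bound zero: `Pl d 0` is the zero space, although the
zero polynomial has total degree `0`. -/
theorem mem_Pl_iff {k : ℕ} {p : MvPolynomial (Fin d) ℝ} :
    p ∈ Pl d k ↔ p = 0 ∨ p.totalDegree < k := by
  rcases k with _ | k
  · simp only [Nat.not_lt_zero, or_false]
    constructor
    · intro h
      rw [Pl, mem_restrictSupport_iff] at h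
      ext n; simpa [Set.subset_def] using (by simpa [Set.subset_def] using h : ∀ n, coeff n p = 0) n
    · rintro rfl; exact Submodule.zero_mem _
  · rw [mem_Pl_succ, Nat.lt_succ_iff]
    constructor
    · exact Or.inr
    · rintro (rfl | h)
      · simp
      · exact h

theorem Pl_mono {j k : ℕ} (h : j ≤ k) : Pl d j ≤ Pl d k :=
  restrictSupport_mono ℝ fun _ hn => lt_of_lt_of_le hn h

theorem finite_degree_lt (j : ℕ) : Finite {n : Fin d →₀ ℕ | n.degree < j} := by
  have : ({n : Fin d →₀ ℕ | n.degree < j}).Finite := by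
    refine ((Set.Finite.pi' fun _ : Fin d => Set.finite_le_nat j).preimage
      (f := fun n : Fin d →₀ ℕ => (n : Fin d → ℕ)) DFunLike.coe_injective.injOn).subset ?_
    intro n hn i
    have h1 : n.degree < j := hn
    rw [Finsupp.degree_eq_sum] at h1
    exact (Finset.single_le_sum (f := fun i => n i) (fun _ _ => Nat.zero_le _)
      (Finset.mem_univ i)).trans h1.le
  exact this

instance (j : ℕ) : FiniteDimensional ℝ (Pl d j) := by
  have := finite_degree_lt (d := d) j
  exact Module.Finite.of_basis (basisRestrictSupport ℝ _)

theorem monomial_mem_Pl {j : ℕ} {n : Fin d →₀ ℕ} (h : n.degree < j) (a : ℝ) :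
    monomial n a ∈ Pl d j := (monomial_mem_restrictSupport ℝ).2 (Or.inl h)

theorem Pl_induction {j : ℕ} {S : Submodule ℝ (MvPolynomial (Fin d) ℝ)}
    (f : MvPolynomial (Fin d) ℝ →ₗ[ℝ] MvPolynomial (Fin d) ℝ)
    (h : ∀ n : Fin d →₀ ℕ, n.degree < j → f (monomial n 1) ∈ S) {p : MvPolynomial (Fin d) ℝ}
    (hp : p ∈ Pl d j) : f p ∈ S := by
  have : Pl d j ≤ S.comap f := by
    rw [Pl, restrictSupport_eq_span, Submodule.span_le]
    rintro _ ⟨n, hn, rfl⟩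
    exact h n hn
  exact this hp

theorem pderiv_mem_Pl {j : ℕ} {p : MvPolynomial (Fin d) ℝ} (hp : p ∈ Pl d (j + 1)) (i : Fin d) :
    pderiv i p ∈ Pl d j := by
  refine Pl_induction (S := Pl d j) (pderiv (R := ℝ) i).toLinearMap ?_ hp
  intro n hn
  change pderiv i (monomial n 1) ∈ _
  rw [pderiv_monomial]
  by_cases h0 : n i = 0
  · simp [h0]
  · apply monomial_mem_Pl
    have h1 : (n - Finsupp.single i 1) + Finsupp.single i 1 = n := by
      ext j
      by_cases hj : j = i
      · subst hj; simp; omega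
      · simp [Ne.symm hj]
    have h2 := congrArg Finsupp.degree h1
    rw [map_add, Finsupp.degree_single] at h2
    omega

theorem X_mul_mem_Pl {j : ℕ} {p : MvPolynomial (Fin d) ℝ} (hp : p ∈ Pl d j) (i : Fin d) :
    X i * p ∈ Pl d (j + 1) := by
  refine Pl_induction (S := Pl d (j + 1)) (LinearMap.mulLeft ℝ (X i)) ?_ hp
  intro n hn
  rw [LinearMap.mulLeft_apply, X, monomial_mul]
  apply monomial_mem_Pl
  rw [map_add, Finsupp.degree_single]
  omega

/-- The Euler operator `∑ (x_i - v_i) ∂_i`. -/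
def euler (v : Space d) : MvPolynomial (Fin d) ℝ →ₗ[ℝ] MvPolynomial (Fin d) ℝ :=
  ∑ i, (LinearMap.mulLeft ℝ (X i - C (v i))) ∘ₗ (pderiv (R := ℝ) i).toLinearMap

theorem euler_apply (v : Space d) (p : MvPolynomial (Fin d) ℝ) :
    euler v p = ∑ i, (X i - C (v i)) * pderiv i p := by
  simp [euler, LinearMap.sum_apply]

theorem ev_euler (v : Space d) (p : MvPolynomial (Fin d) ℝ) (x : Space d) :
    ev (euler v p) x = fderiv ℝ (ev p) x (x - v) := by
  rw [euler_apply, fderiv_ev, ev_sum]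
  refine Finset.sum_congr rfl fun i _ => ?_
  simp [mul_comm]

/-- Euler's identity: the homogeneous part of degree `k` is an eigenvector with eigenvalue `k`, and
moving the centre to `v` adds only derivatives, which have lower degree. -/
theorem euler_sub_smul_mem (v : Space d) {k : ℕ} {p : MvPolynomial (Fin d) ℝ}
    (hp : p ∈ Pl d (k + 1)) : euler v p - (k : ℝ) • p ∈ Pl d k := by
  refine Pl_induction (S := Pl d k) (euler v - (k : ℝ) • LinearMap.id) ?_ hp
  intro n hn
  rw [LinearMap.sub_apply, LinearMap.smul_apply, LinearMap.id_apply, euler_apply]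
  simp only [sub_mul, Finset.sum_sub_distrib]
  have h1 : ∑ i, X i * pderiv i (monomial n (1 : ℝ)) = n.degree • monomial n (1 : ℝ) :=
    IsHomogeneous.sum_X_mul_pderiv (isHomogeneous_monomial _ rfl)
  rw [h1]
  have h2 : ∑ i, C (v i) * pderiv i (monomial n (1 : ℝ)) ∈ Pl d k := by
    refine Submodule.sum_mem _ fun i _ => ?_
    rw [← smul_eq_C_mul]
    exact Submodule.smul_mem _ _ (pderiv_mem_Pl (monomial_mem_Pl hn 1) i)
  have h3 : n.degree • monomial n (1 : ℝ) - (k : ℝ) • monomial n (1 : ℝ) ∈ Pl d k := by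
    rcases Nat.lt_succ_iff_lt_or_eq.1 hn with h | h
    · exact Submodule.sub_mem _ (Submodule.smul_of_tower_mem _ _ (monomial_mem_Pl h 1))
        (Submodule.smul_mem _ _ (monomial_mem_Pl h 1))
    · rw [h, ← Nat.cast_smul_eq_nsmul ℝ, sub_self]
      exact Submodule.zero_mem _
  have e : n.degree • monomial n (1 : ℝ) - ∑ i, C (v i) * pderiv i (monomial n (1 : ℝ)) -
      (k : ℝ) • monomial n (1 : ℝ) = (n.degree • monomial n (1 : ℝ) - (k : ℝ) • monomial n (1 : ℝ)) -
        ∑ i, C (v i) * pderiv i (monomial n (1 : ℝ)) := by abel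
  rw [e]
  exact Submodule.sub_mem _ h3 h2

theorem euler_mem_Pl (v : Space d) {k : ℕ} {p : MvPolynomial (Fin d) ℝ}
    (hp : p ∈ Pl d (k + 1)) : euler v p ∈ Pl d (k + 1) := by
  have := Submodule.add_mem _ (Pl_mono (Nat.le_succ k) (euler_sub_smul_mem v hp))
    (Submodule.smul_mem _ (k : ℝ) hp)
  simpa using this

theorem eq_zero_of_ev_eq_zero {U : Set (Space d)} (hU : (interior U).Nonempty)
    {p : MvPolynomial (Fin d) ℝ} (h : ∀ x ∈ U, ev p x = 0) : p = 0 := by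
  obtain ⟨c, hc⟩ := hU
  have hopen : IsOpen ((WithLp.toLp 2 : (Fin d → ℝ) → Space d) ⁻¹' interior U) :=
    isOpen_interior.preimage (PiLp.continuous_toLp 2 _)
  obtain ⟨ε, hε, hb⟩ := Metric.isOpen_iff.1 hopen c.ofLp (by simpa using hc)
  refine MvPolynomial.funext_set (fun i => Ioo (c i - ε) (c i + ε))
    (fun i => Set.Ioo_infinite (by linarith)) fun x hx => ?_
  have hx' : x ∈ Metric.ball c.ofLp ε := by
    rw [Metric.mem_ball, dist_pi_lt_iff hε]
    intro i
    have := hx i (Set.mem_univ i)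
    rw [Real.dist_eq, abs_lt]
    constructor <;> linarith [this.1, this.2]
  have := h _ (interior_subset (hb hx'))
  simpa [ev] using this

/-- The affine polynomial `x ↦ ⟪n, x - a⟫`. -/
def affinePoly (n a : Space d) : MvPolynomial (Fin d) ℝ := ∑ i, C (n i) * (X i - C (a i))

theorem ev_affinePoly (n a x : Space d) : ev (affinePoly n a) x = ⟪n, x - a⟫_ℝ := by
  rw [affinePoly, ev_sum, PiLp.inner_apply]
  refine Finset.sum_congr rfl fun i _ => ?_
  simp [mul_comm]

theorem affinePoly_mul_mem {k : ℕ} (n a : Space d) {p : MvPolynomial (Fin d) ℝ} (hp : p ∈ Pl d k) :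
    affinePoly n a * p ∈ Pl d (k + 1) := by
  rw [affinePoly, Finset.sum_mul]
  refine Submodule.sum_mem _ fun i _ => ?_
  have : C (n i) * (X i - C (a i)) * p = n i • (X i * p - a i • p) := by
    rw [smul_eq_C_mul, smul_eq_C_mul]; ring
  rw [this]
  exact Submodule.smul_mem _ _ (Submodule.sub_mem _ (X_mul_mem_Pl hp i)
    (Submodule.smul_mem _ _ (Pl_mono (Nat.le_succ k) hp)))

/-- Every linear functional on a space of polynomials is a combination of point evaluations. -/
theorem exists_eval_combination (j : ℕ) (ℓ : MvPolynomial (Fin d) ℝ →ₗ[ℝ] ℝ) :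
    ∃ (s : Finset (Space d)) (a : Space d → ℝ), ∀ p ∈ Pl d j, ℓ p = ∑ x ∈ s, a x * ev p x := by
  let evL : Space d → Module.Dual ℝ (Pl d j) := fun x =>
    { toFun := fun p => ev p.1 x
      map_add' := fun p q => ev_add _ _ _
      map_smul' := fun c p => ev_smul _ _ _ }
  have htop : Submodule.span ℝ (Set.range evL) = ⊤ := by
    -- A polynomial killed by all point evaluations is zero; in finite dimension the evaluations
    -- therefore span the dual.
    have h1 : (Submodule.span ℝ (Set.range evL)).dualCoannihilator = ⊥ := by
      rw [eq_bot_iff]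
      intro p hp
      rw [Submodule.mem_dualCoannihilator] at hp
      have : p.1 = 0 := by
        refine eq_zero_of_ev_eq_zero (U := univ) (by simp) fun x _ => ?_
        exact hp (evL x) (Submodule.subset_span ⟨x, rfl⟩)
      exact (Submodule.mem_bot ℝ).2 (Subtype.ext this)
    have h2 := Subspace.dualCoannihilator_dualAnnihilator_eq (W := Submodule.span ℝ (Set.range evL))
    rw [← h2, h1, Submodule.dualAnnihilator_bot]
  have hmem : ℓ ∘ₗ (Pl d j).subtype ∈ Submodule.span ℝ (Set.range evL) := by rw [htop]; trivial
  obtain ⟨c, hc⟩ := Finsupp.mem_span_range_iff_exists_finsupp.1 hmem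
  refine ⟨c.support, c, fun p hp => ?_⟩
  have := LinearMap.congr_fun hc ⟨p, hp⟩
  simp only [LinearMap.comp_apply, Submodule.subtype_apply] at this
  rw [← this, Finsupp.sum, LinearMap.sum_apply]
  rfl

end Poly

/-! ### Square integrable functions -/

section L2

variable {d : ℕ}

open Classical in
/-- The class of a square integrable function. -/
def toL (μ : Measure (Space d)) (f : Space d → ℝ) : Lp ℝ 2 μ :=
  if h : MemLp f 2 μ then h.toLp f else 0

variable {μ : Measure (Space d)} {f g : Space d → ℝ}

theorem toL_eq (h : MemLp f 2 μ) : toL μ f = h.toLp f := by rw [toL, dif_pos h]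

theorem coeFn_toL (h : MemLp f 2 μ) : toL μ f =ᵐ[μ] f := by
  rw [toL_eq h]; exact h.coeFn_toLp

theorem toL_add (hf : MemLp f 2 μ) (hg : MemLp g 2 μ) :
    toL μ (fun x => f x + g x) = toL μ f + toL μ g := by
  rw [toL_eq hf, toL_eq hg, ← MemLp.toLp_add hf hg]; exact toL_eq (hf.add hg)

theorem toL_sub (hf : MemLp f 2 μ) (hg : MemLp g 2 μ) :
    toL μ (fun x => f x - g x) = toL μ f - toL μ g := by
  rw [toL_eq hf, toL_eq hg, ← MemLp.toLp_sub hf hg]; exact toL_eq (hf.sub hg)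

theorem toL_smul (c : ℝ) (hf : MemLp f 2 μ) : toL μ (fun x => c * f x) = c • toL μ f := by
  rw [toL_eq hf, toL_eq (hf.const_mul c)]; rfl

theorem toL_coe (F : Lp ℝ 2 μ) : toL μ F = F := by
  rw [toL_eq (Lp.memLp F), Lp.toLp_coeFn]

theorem toL_congr (hf : MemLp f 2 μ) (h : f =ᵐ[μ] g) : toL μ f = toL μ g := by
  have hg := hf.ae_eq h
  rw [toL_eq hf, toL_eq hg]
  exact (MemLp.toLp_eq_toLp_iff hf hg).2 h

theorem inner_toL (hf : MemLp f 2 μ) (F : Lp ℝ 2 μ) : ⟪toL μ f, F⟫_ℝ = ∫ x, f x * F x ∂μ := by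
  rw [L2.inner_def]
  refine integral_congr_ae ?_
  filter_upwards [coeFn_toL hf] with x hx
  rw [hx]; simp [mul_comm]

theorem inner_toL_toL (hf : MemLp f 2 μ) (hg : MemLp g 2 μ) :
    ⟪toL μ f, toL μ g⟫_ℝ = ∫ x, f x * g x ∂μ := by
  rw [inner_toL hf]
  refine integral_congr_ae ?_
  filter_upwards [coeFn_toL hg] with x hx
  rw [hx]

theorem norm_toL (hf : MemLp f 2 μ) : ‖toL μ f‖ = (eLpNorm f 2 μ).toReal := by
  rw [toL_eq hf, Lp.norm_toLp]

theorem eLpNorm_eq_norm_toL (hf : MemLp f 2 μ) : eLpNorm f 2 μ = ENNReal.ofReal ‖toL μ f‖ := by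
  rw [norm_toL hf, ENNReal.ofReal_toReal hf.2.ne]

theorem norm_toL_mul_le {B : ℝ} (hB : ∀ᵐ x ∂μ, |g x| ≤ B) (F : Lp ℝ 2 μ)
    (h : MemLp (fun x => g x * F x) 2 μ) : ‖toL μ (fun x => g x * F x)‖ ≤ B * ‖F‖ := by
  rcases isEmpty_or_nonempty (Space d) with he | ⟨⟨x0⟩⟩
  · exact (he.false 0).elim
  rw [toL_eq h]
  refine Lp.norm_le_mul_norm_of_ae_le_mul ?_
  filter_upwards [h.coeFn_toLp, hB] with x hx hb
  rw [hx, norm_mul]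
  exact mul_le_mul_of_nonneg_right hb (norm_nonneg _)

end L2

/-! ### Representation of linear functionals by semidefinite forms -/

/-- The range of the transpose of a linear map is the annihilator of its kernel, and the hypothesis
makes `ℓ` vanish on the kernel of `B`. Definiteness is not required, so this also applies to
polynomials on a face, where a nonzero polynomial may vanish. -/
theorem exists_repr_of_vanish {M : Type*} [AddCommGroup M] [Module ℝ M] (S : Submodule ℝ M)
    [FiniteDimensional ℝ S] (B : M →ₗ[ℝ] M →ₗ[ℝ] ℝ) (hsymm : ∀ x ∈ S, ∀ y ∈ S, B x y = B y x)
    (ℓ : M →ₗ[ℝ] ℝ) (hℓ : ∀ x ∈ S, B x x = 0 → ℓ x = 0) : ∃ g ∈ S, ∀ r ∈ S, B g r = ℓ r := by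
  let T : S →ₗ[ℝ] Module.Dual ℝ S :=
    LinearMap.mk₂ ℝ (fun x y : S => B x y) (fun _ _ _ => by simp) (fun _ _ _ => by simp)
      (fun _ _ _ => by simp) (fun _ _ _ => by simp)
  have hmem : ℓ ∘ₗ S.subtype ∈ LinearMap.range T.dualMap := by
    rw [LinearMap.range_dualMap_eq_dualAnnihilator_ker, Submodule.mem_dualAnnihilator]
    intro x hx
    refine hℓ x x.2 ?_
    have := LinearMap.congr_fun (LinearMap.mem_ker.1 hx) x
    simpa [T] using this
  obtain ⟨Φ, hΦ⟩ := hmem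
  obtain ⟨g, rfl⟩ := (Module.evalEquiv ℝ S).surjective Φ
  refine ⟨g, g.2, fun r hr => ?_⟩
  have := LinearMap.congr_fun hΦ ⟨r, hr⟩
  simp only [LinearMap.dualMap_apply, Module.evalEquiv_apply, LinearMap.comp_apply,
    Submodule.subtype_apply] at this
  rw [← this, hsymm _ g.2 _ hr]
  rfl

/-! ### Square integrable functions on a simplex -/

theorem toL_zero {d : ℕ} (μ : Measure (Space d)) :
    toL μ (fun _ => (0 : ℝ)) = 0 := by
  have h : MemLp (fun _ : Space d => (0 : ℝ)) 2 μ := MemLp.zero'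
  have := toL_smul 0 h
  simp only [zero_mul, zero_smul] at this
  exact this

/-- `L²(K)`. -/
abbrev LK {d : ℕ} (K : Finset (Space d)) := Lp ℝ 2 (volume.restrict (hull K))

section Local

variable {d : ℕ} (K : Finset (Space d))

instance : IsFiniteMeasure ((volume : Measure (Space d)).restrict (hull K)) :=
  ⟨by simpa using (IsSimplex.isCompact_hull K).measure_lt_top⟩

variable {K} in
theorem memLp_hull {g : Space d → ℝ} (hg : Continuous g) :
    MemLp g 2 (volume.restrict (hull K)) := by
  obtain ⟨C, hC⟩ := (IsSimplex.isCompact_hull K).exists_bound_of_continuousOn hg.continuousOn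
  exact MemLp.of_bound hg.aestronglyMeasurable C
    ((ae_restrict_iff' (IsSimplex.measurableSet_hull _)).2 (Filter.Eventually.of_forall hC))

variable {K} in
theorem ae_hull {p : Space d → Prop} (h : ∀ x ∈ hull K, p x) :
    ∀ᵐ x ∂(volume.restrict (hull K)), p x :=
  (ae_restrict_iff' (IsSimplex.measurableSet_hull _)).2 (Filter.Eventually.of_forall h)

variable {K} in
theorem memLp_coord_mul (v : Space d) (i : Fin d) (F : LK K) :
    MemLp (fun x => (x i - v i) * F x) 2 (volume.restrict (hull K)) := by
  have hc : Continuous (fun x : Space d => x i - v i) := by fun_prop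
  obtain ⟨C, hC⟩ := (IsSimplex.isCompact_hull K).exists_bound_of_continuousOn hc.continuousOn
  refine (Lp.memLp F).of_le_mul (hc.aestronglyMeasurable.mul (Lp.aestronglyMeasurable F)) (c := C) ?_
  refine ae_hull fun x hx => ?_
  rw [norm_mul]
  exact mul_le_mul_of_nonneg_right (hC x hx) (norm_nonneg _)

/-- Multiplication by the coordinate `x_i - v_i`. -/
def coordMul (v : Space d) (i : Fin d) : LK K →L[ℝ] LK K :=
  LinearMap.mkContinuousOfExistsBound
    { toFun := fun F => toL _ (fun x => (x i - v i) * F x)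
      map_add' := fun F G => by
        rw [← toL_add (memLp_coord_mul v i F) (memLp_coord_mul v i G)]
        refine toL_congr (memLp_coord_mul v i (F + G)) ?_
        filter_upwards [Lp.coeFn_add F G] with x hx
        rw [hx, Pi.add_apply, mul_add]
      map_smul' := fun c F => by
        rw [RingHom.id_apply, ← toL_smul c (memLp_coord_mul v i F)]
        refine toL_congr (memLp_coord_mul v i (c • F)) ?_
        filter_upwards [Lp.coeFn_smul c F] with x hx
        rw [hx, Pi.smul_apply, smul_eq_mul]; ring }
    (by
      have hc : Continuous (fun x : Space d => x i - v i) := by fun_prop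
      obtain ⟨C, hC⟩ := (IsSimplex.isCompact_hull K).exists_bound_of_continuousOn hc.continuousOn
      exact ⟨C, fun F => norm_toL_mul_le (ae_hull hC) F (memLp_coord_mul v i F)⟩)

variable {K} in
theorem coordMul_apply (v : Space d) (i : Fin d) (F : LK K) :
    coordMul K v i F = toL _ (fun x => (x i - v i) * F x) := rfl

variable {K} in
theorem coordMul_toL (v : Space d) (i : Fin d) {g : Space d → ℝ} (hg : Continuous g) :
    coordMul K v i (toL _ g) = toL _ (fun x => (x i - v i) * g x) := by
  rw [coordMul_apply]
  refine toL_congr (memLp_coord_mul v i _) ?_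
  filter_upwards [coeFn_toL (memLp_hull hg)] with x hx
  rw [hx]

variable {K} in
theorem norm_coordMul_le {v : Space d} (hv : v ∈ hull K) (i : Fin d) (F : LK K) :
    ‖coordMul K v i F‖ ≤ Metric.diam (hull K) * ‖F‖ := by
  refine norm_toL_mul_le (ae_hull fun x hx => ?_) F (memLp_coord_mul v i F)
  have h1 : ‖(x - v) i‖ ≤ ‖x - v‖ := PiLp.norm_apply_le (x - v) i
  have h2 := Metric.dist_le_diam_of_mem (IsSimplex.isCompact_hull K).isBounded hx hv
  rw [dist_eq_norm] at h2
  exact h1.trans h2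

/-- The radial derivative `∑ (x_i - v_i) g_i` of a function with gradient `g`. -/
def radial (v : Space d) : (Fin d → LK K) →L[ℝ] LK K :=
  ∑ i, (coordMul K v i).comp (ContinuousLinearMap.proj i)

variable {K} in
theorem radial_apply (v : Space d) (g : Fin d → LK K) : radial K v g = ∑ i, coordMul K v i (g i) := by
  simp [radial]

variable {K} in
theorem norm_radial_le {v : Space d} (hv : v ∈ hull K) (g : Fin d → LK K) :
    ‖radial K v g‖ ≤ Metric.diam (hull K) * ∑ i, ‖g i‖ := by
  rw [radial_apply, Finset.mul_sum]
  exact (norm_sum_le _ _).trans (Finset.sum_le_sum fun i _ => norm_coordMul_le hv i _)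

/-- The class of a polynomial in `L²(K)`. -/
def pol : MvPolynomial (Fin d) ℝ →ₗ[ℝ] LK K where
  toFun p := toL _ (ev p)
  map_add' p q := by
    rw [← toL_add (memLp_hull (continuous_ev p)) (memLp_hull (continuous_ev q))]
    exact congrArg _ (funext (ev_add p q))
  map_smul' c p := by
    rw [RingHom.id_apply, ← toL_smul c (memLp_hull (continuous_ev p))]
    exact congrArg _ (funext (ev_smul c p))

variable {K} in
theorem inner_pol_pol (p q : MvPolynomial (Fin d) ℝ) :
    ⟪pol K p, pol K q⟫_ℝ = ∫ x in hull K, ev p x * ev q x :=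
  inner_toL_toL (memLp_hull (continuous_ev p)) (memLp_hull (continuous_ev q))

/-- Pairs of a function and its gradient. -/
abbrev XK := LK K × (Fin d → LK K)

/-- The pair of a smooth function and its gradient. -/
def smoothPair (φ : Space d → ℝ) : XK K := (toL _ φ, fun i => toL _ (partialDeriv i φ))

theorem continuous_partialDeriv {φ : Space d → ℝ} (hφ : ContDiff ℝ ∞ φ) (i : Fin d) :
    Continuous (partialDeriv i φ) :=
  (hφ.continuous_fderiv (by simp)).clm_apply continuous_const

theorem partialDeriv_add {φ ψ : Space d → ℝ} (hφ : ContDiff ℝ ∞ φ) (hψ : ContDiff ℝ ∞ ψ) (i : Fin d)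
    (x : Space d) : partialDeriv i (fun x => φ x + ψ x) x = partialDeriv i φ x + partialDeriv i ψ x := by
  rw [partialDeriv, fderiv_fun_add (hφ.differentiable (by simp) x) (hψ.differentiable (by simp) x)]
  rfl

theorem partialDeriv_smul {φ : Space d → ℝ} (hφ : ContDiff ℝ ∞ φ) (c : ℝ) (i : Fin d)
    (x : Space d) : partialDeriv i (fun x => c * φ x) x = c * partialDeriv i φ x := by
  rw [partialDeriv, fderiv_const_mul (hφ.differentiable (by simp) x)]
  rfl

/-- Pairs coming from smooth functions. -/
def smoothPairs : Submodule ℝ (XK K) where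
  carrier := {x | ∃ φ, ContDiff ℝ ∞ φ ∧ x = smoothPair K φ}
  zero_mem' := by
    refine ⟨fun _ => 0, contDiff_const, ?_⟩
    have h0 : toL (volume.restrict (hull K)) (fun _ => (0 : ℝ)) = 0 := toL_zero _
    have h1 : ∀ i, partialDeriv i (fun _ : Space d => (0 : ℝ)) = fun _ => 0 := by
      intro i; funext x; simp [partialDeriv]
    simp only [smoothPair, h0, h1]
    rfl
  add_mem' := by
    rintro _ _ ⟨φ, hφ, rfl⟩ ⟨ψ, hψ, rfl⟩
    refine ⟨fun x => φ x + ψ x, hφ.add hψ, ?_⟩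
    simp only [smoothPair, funext (partialDeriv_add hφ hψ _)]
    rw [toL_add (memLp_hull hφ.continuous) (memLp_hull hψ.continuous)]
    refine Prod.ext rfl (funext fun i => ?_)
    exact (toL_add (memLp_hull (continuous_partialDeriv hφ i))
      (memLp_hull (continuous_partialDeriv hψ i))).symm
  smul_mem' := by
    rintro c _ ⟨φ, hφ, rfl⟩
    refine ⟨fun x => c * φ x, contDiff_const.mul hφ, ?_⟩
    simp only [smoothPair, funext (partialDeriv_smul hφ c _)]
    rw [toL_smul c (memLp_hull hφ.continuous)]
    refine Prod.ext rfl (funext fun i => ?_)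
    exact (toL_smul c (memLp_hull (continuous_partialDeriv hφ i))).symm

/-- `H¹(K)`: limits of smooth functions together with their gradients. -/
def H1 : Submodule ℝ (XK K) := (smoothPairs K).topologicalClosure

variable {K}

theorem smoothPair_mem_H1 {φ : Space d → ℝ} (hφ : ContDiff ℝ ∞ φ) : smoothPair K φ ∈ H1 K :=
  Submodule.le_topologicalClosure _ ⟨φ, hφ, rfl⟩

theorem H1_induction {p : XK K → Prop} (hp : IsClosed {x | p x})
    (h : ∀ φ, ContDiff ℝ ∞ φ → p (smoothPair K φ)) {x : XK K} (hx : x ∈ H1 K) : p x := by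
  have : closure (smoothPairs K : Set (XK K)) ⊆ {x | p x} :=
    closure_minimal (by rintro _ ⟨φ, hφ, rfl⟩; exact h φ hφ) hp
  exact this hx

variable (K) in
/-- The pair of a polynomial and its gradient. -/
def polyPair : MvPolynomial (Fin d) ℝ →ₗ[ℝ] XK K where
  toFun p := (pol K p, fun i => pol K (MvPolynomial.pderiv i p))
  map_add' p q := by
    simp only [map_add]; rfl
  map_smul' c p := by
    simp only [map_smul, Derivation.map_smul, RingHom.id_apply]; rfl

theorem polyPair_fst (p : MvPolynomial (Fin d) ℝ) : (polyPair K p).1 = pol K p := rfl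

theorem polyPair_snd (p : MvPolynomial (Fin d) ℝ) (i : Fin d) :
    (polyPair K p).2 i = pol K (MvPolynomial.pderiv i p) := rfl

theorem polyPair_eq (p : MvPolynomial (Fin d) ℝ) : polyPair K p = smoothPair K (ev p) := by
  refine Prod.ext rfl (funext fun i => ?_)
  simp only [polyPair_snd, smoothPair, partialDeriv_ev]
  rfl

theorem polyPair_mem_H1 (p : MvPolynomial (Fin d) ℝ) : polyPair K p ∈ H1 K := by
  rw [polyPair_eq]; exact smoothPair_mem_H1 (contDiff_ev p)

theorem radial_smoothPair (v : Space d) {φ : Space d → ℝ} (hφ : ContDiff ℝ ∞ φ) :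
    radial K v (smoothPair K φ).2 = toL _ (fun x => fderiv ℝ φ x (x - v)) := by
  rw [radial_apply]
  have h1 : ∀ x, fderiv ℝ φ x (x - v) = ∑ i, (x i - v i) * partialDeriv i φ x := by
    intro x
    conv_lhs => rw [← (EuclideanSpace.basisFun (Fin d) ℝ).sum_repr (x - v)]
    rw [map_sum]
    refine Finset.sum_congr rfl fun i _ => ?_
    rw [map_smul]
    simp [partialDeriv]
  have h2 : ∀ i, coordMul K v i ((smoothPair K φ).2 i) =
      toL _ (fun x => (x i - v i) * partialDeriv i φ x) := fun i =>
    coordMul_toL v i (continuous_partialDeriv hφ i)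
  simp only [h1, h2]
  have hc : ∀ i, Continuous (fun x : Space d => (x i - v i) * partialDeriv i φ x) := fun i =>
    (by fun_prop : Continuous fun x : Space d => x i - v i).mul (continuous_partialDeriv hφ i)
  have h3 : ∀ s : Finset (Fin d), ∑ i ∈ s, toL (volume.restrict (hull K))
      (fun x => (x i - v i) * partialDeriv i φ x) =
      toL _ (fun x => ∑ i ∈ s, (x i - v i) * partialDeriv i φ x) := by
    classical
    intro s
    induction s using Finset.induction_on with
    | empty =>
      simp only [Finset.sum_empty]
      exact (toL_zero _).symm
    | insert i s hi ih =>
      simp only [Finset.sum_insert hi, ih]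
      rw [← toL_add (memLp_hull (hc i)) (memLp_hull (continuous_finsetSum _ fun i _ => hc i))]
  exact h3 _

theorem radial_polyPair (v : Space d) (p : MvPolynomial (Fin d) ℝ) :
    radial K v (polyPair K p).2 = pol K (euler v p) := by
  rw [polyPair_eq, radial_smoothPair v (contDiff_ev p)]
  exact congrArg _ (funext fun x => (ev_euler v p x).symm)

variable (K) in
/-- The moment `∫_F f μ` of the trace of `f` on the face opposite to `v`, expressed by the
divergence theorem as an integral over `K`. -/
def fm (v : Space d) (μ : MvPolynomial (Fin d) ℝ) : XK K →L[ℝ] ℝ :=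
  (height K v)⁻¹ • ((innerSL ℝ (pol K ((d : ℝ) • μ + euler v μ))).comp
    (ContinuousLinearMap.fst ℝ _ _) +
    (innerSL ℝ (pol K μ)).comp ((radial K v).comp (ContinuousLinearMap.snd ℝ _ _)))

theorem fm_apply (v : Space d) (μ : MvPolynomial (Fin d) ℝ) (x : XK K) :
    fm K v μ x = (height K v)⁻¹ * (⟪pol K ((d : ℝ) • μ + euler v μ), x.1⟫_ℝ +
      ⟪pol K μ, radial K v x.2⟫_ℝ) := rfl

theorem fm_add (v : Space d) (μ ν : MvPolynomial (Fin d) ℝ) (x : XK K) :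
    fm K v (μ + ν) x = fm K v μ x + fm K v ν x := by
  simp only [fm_apply, map_add, smul_add, inner_add_left]; ring

theorem fm_smul (v : Space d) (c : ℝ) (μ : MvPolynomial (Fin d) ℝ) (x : XK K) :
    fm K v (c • μ) x = c * fm K v μ x := by
  have h : (d : ℝ) • (c • μ) + euler v (c • μ) = c • ((d : ℝ) • μ + euler v μ) := by
    rw [map_smul, smul_comm, smul_add]
  rw [fm_apply, fm_apply, h, map_smul (pol K) c, map_smul (pol K) c, inner_smul_left,
    inner_smul_left]
  simp only [conj_trivial]; ring

theorem fm_sub (v : Space d) (μ ν : MvPolynomial (Fin d) ℝ) (x : XK K) :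
    fm K v (μ - ν) x = fm K v μ x - fm K v ν x := by
  have h := fm_add v (μ - ν) ν x
  rw [sub_add_cancel] at h; linarith

variable (hK : IsSimplex K)
include hK

/-- This justifies the formula defining `fm`: it is the divergence formula for the product `φ μ`,
with the product rule moving the radial derivative onto either factor. -/
theorem fm_smoothPair {v : Space d} (hv : v ∈ K) (μ : MvPolynomial (Fin d) ℝ) {φ : Space d → ℝ}
    (hφ : ContDiff ℝ ∞ φ) :
    fm K v μ (smoothPair K φ) = ∫ y in hull (opp K v), φ y * ev μ y ∂(surf d) := by
  have hh := hK.height_pos hv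
  have hfd : Continuous (fderiv ℝ φ) := hφ.continuous_fderiv (by simp)
  have hφc := hφ.continuous
  have hμc := continuous_ev μ
  have hdc := continuous_ev (d • μ + euler v μ)
  have hprod : ContDiff ℝ 1 (fun x => φ x * ev μ x) :=
    (hφ.of_le (by simp)).mul (contDiff_ev μ)
  rw [fm_apply, radial_smoothPair v hφ, inv_mul_eq_iff_eq_mul₀ hh.ne',
    hK.height_mul_integral_face hv hprod]
  have hc1 : Continuous fun x => fderiv ℝ φ x (x - v) := by fun_prop
  have e1 : ⟪pol K ((d : ℝ) • μ + euler v μ), (smoothPair K φ).1⟫_ℝ =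
      ∫ x in hull K, ev ((d : ℝ) • μ + euler v μ) x * φ x :=
    inner_toL_toL (memLp_hull (continuous_ev _)) (memLp_hull hφc)
  have e2 : ⟪pol K μ, toL _ (fun x => fderiv ℝ φ x (x - v))⟫_ℝ =
      ∫ x in hull K, ev μ x * fderiv ℝ φ x (x - v) :=
    inner_toL_toL (memLp_hull hμc) (memLp_hull hc1)
  rw [e1, e2, ← integral_add]
  · refine integral_congr_ae (Filter.Eventually.of_forall fun x => ?_)
    simp only
    rw [fderiv_fun_mul (hφ.differentiable (by simp) x) ((contDiff_ev (n := 1) μ).differentiable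
      (by simp) x)]
    simp only [ev_add, ev_smul, ev_euler, add_apply,
      smul_apply, smul_eq_mul]
    ring
  · exact IsSimplex.integrable_of_continuous ((continuous_ev _).mul hφc)
  · exact IsSimplex.integrable_of_continuous (hμc.mul hc1)

theorem fm_polyPair {v : Space d} (hv : v ∈ K) (μ p : MvPolynomial (Fin d) ℝ) :
    fm K v μ (polyPair K p) = ∫ y in hull (opp K v), ev p y * ev μ y ∂(surf d) := by
  rw [polyPair_eq]; exact fm_smoothPair hK hv μ (contDiff_ev p)

/-- For an arbitrary pair `fm` depends on `μ` in all of `K`. On limits of smooth pairs it is a limit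
of face integrals and sees only the values of `μ` on the face. -/
theorem fm_eq_of_eqOn {v : Space d} (hv : v ∈ K) {μ ν : MvPolynomial (Fin d) ℝ}
    (h : ∀ x ∈ hull (opp K v), ev μ x = ev ν x) {x : XK K} (hx : x ∈ H1 K) :
    fm K v μ x = fm K v ν x := by
  refine H1_induction (p := fun x => fm K v μ x = fm K v ν x)
    (isClosed_eq (fm K v μ).continuous (fm K v ν).continuous) (fun φ hφ => ?_) hx
  rw [fm_smoothPair hK hv μ hφ, fm_smoothPair hK hv ν hφ]
  refine setIntegral_congr_fun (IsSimplex.measurableSet_hull _) fun y hy => ?_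
  simp only [h y hy]

/-- The Gauss–Green formula for `H¹` functions. -/
theorem sum_fm (i : Fin d) (μ : MvPolynomial (Fin d) ℝ) {x : XK K} (hx : x ∈ H1 K) :
    ∑ v ∈ K, nrm K v i * fm K v μ x =
      ⟪pol K μ, x.2 i⟫_ℝ + ⟪pol K (MvPolynomial.pderiv i μ), x.1⟫_ℝ := by
  refine H1_induction (p := fun x => ∑ v ∈ K, nrm K v i * fm K v μ x =
      ⟪pol K μ, x.2 i⟫_ℝ + ⟪pol K (MvPolynomial.pderiv i μ), x.1⟫_ℝ) ?_ (fun φ hφ => ?_) hx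
  · refine isClosed_eq ?_ ?_
    · exact continuous_finsetSum _ fun v _ => continuous_const.mul (fm K v μ).continuous
    · exact (continuous_const.inner ((continuous_apply i).comp continuous_snd)).add
        (continuous_const.inner continuous_fst)
  · have hprod : ContDiff ℝ 1 (fun x => φ x * ev μ x) :=
      (hφ.of_le (by simp)).mul (contDiff_ev μ)
    have h := hK.integral_fderiv hprod (EuclideanSpace.single i 1)
    have h1 : ∑ v ∈ K, nrm K v i * fm K v μ (smoothPair K φ) =
        ∑ v ∈ K, ⟪nrm K v, EuclideanSpace.single i 1⟫_ℝ *
          ∫ y in hull (opp K v), φ y * ev μ y ∂(surf d) := by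
      refine Finset.sum_congr rfl fun v hv => ?_
      rw [fm_smoothPair hK hv μ hφ]
      simp [EuclideanSpace.inner_single_right]
    rw [h1, ← h]
    have e1 : ⟪pol K μ, (smoothPair K φ).2 i⟫_ℝ = ∫ x in hull K, ev μ x * partialDeriv i φ x :=
      inner_toL_toL (memLp_hull (continuous_ev _)) (memLp_hull (continuous_partialDeriv hφ i))
    have e2 : ⟪pol K (MvPolynomial.pderiv i μ), (smoothPair K φ).1⟫_ℝ =
        ∫ x in hull K, ev (MvPolynomial.pderiv i μ) x * φ x :=
      inner_toL_toL (memLp_hull (continuous_ev _)) (memLp_hull hφ.continuous)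
    rw [e1, e2, ← integral_add]
    · refine integral_congr_ae (Filter.Eventually.of_forall fun x => ?_)
      simp only
      rw [fderiv_fun_mul (hφ.differentiable (by simp) x) ((contDiff_ev (n := 1) μ).differentiable
        (by simp) x), ← partialDeriv_ev]
      simp only [add_apply, smul_apply, smul_eq_mul,
        partialDeriv]
      ring
    · exact IsSimplex.integrable_of_continuous
        ((continuous_ev _).mul (continuous_partialDeriv hφ i))
    · exact IsSimplex.integrable_of_continuous ((continuous_ev _).mul hφ.continuous)

theorem interior_hull_nonempty : (interior (hull K)).Nonempty := by
  have h1 : affineSpan ℝ (K : Set (Space d)) = ⊤ := by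
    have := hK.indep.affineSpan_eq_top_iff_card_eq_finrank_add_one.2 (by simp [hK.card_eq])
    simpa using this
  exact interior_convexHull_nonempty_iff_affineSpan_eq_top.2 h1

theorem eq_zero_of_ae_eq_zero {p : MvPolynomial (Fin d) ℝ}
    (h : ∀ᵐ x ∂(volume.restrict (hull K)), ev p x = 0) : p = 0 := by
  refine eq_zero_of_ev_eq_zero (U := interior (hull K))
    (by rw [interior_interior]; exact interior_hull_nonempty hK) ?_
  have h1 : ∀ᵐ x ∂(volume.restrict (interior (hull K))), ev p x = (0 : ℝ) :=
    ae_restrict_of_ae_restrict_of_subset interior_subset h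
  exact MeasureTheory.Measure.eqOn_open_of_ae_eq h1 isOpen_interior
    (continuous_ev p).continuousOn continuousOn_const

theorem pol_injective : Function.Injective (pol K) := by
  rw [← LinearMap.ker_eq_bot, LinearMap.ker_eq_bot']
  intro p hp
  refine eq_zero_of_ae_eq_zero hK ?_
  have h1 := coeFn_toL (memLp_hull (K := K) (continuous_ev p))
  have h2 : toL (volume.restrict (hull K)) (ev p) = 0 := hp
  rw [h2] at h1
  filter_upwards [h1, Lp.coeFn_zero ℝ 2 (volume.restrict (hull K))] with x hx h0
  rw [← hx, h0]; rfl

/-! ### Polynomials orthogonal to lower degrees -/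

omit hK in
variable (K) in
/-- Polynomials of degree at most `k` which are `L²(K)`-orthogonal to those of degree less
than `k`. -/
def topPl (k : ℕ) : Submodule ℝ (MvPolynomial (Fin d) ℝ) where
  carrier := {w | w ∈ Pl d (k + 1) ∧ ∀ r ∈ Pl d k, ⟪pol K r, pol K w⟫_ℝ = 0}
  zero_mem' := ⟨Submodule.zero_mem _, fun r _ => by simp⟩
  add_mem' := by
    rintro a b ⟨ha, ha'⟩ ⟨hb, hb'⟩
    exact ⟨Submodule.add_mem _ ha hb, fun r hr => by rw [map_add, inner_add_right, ha' r hr, hb' r hr,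
      add_zero]⟩
  smul_mem' := by
    rintro c a ⟨ha, ha'⟩
    exact ⟨Submodule.smul_mem _ c ha, fun r hr => by rw [map_smul, inner_smul_right, ha' r hr,
      mul_zero]⟩

omit hK in
theorem topPl_le {k : ℕ} : topPl K k ≤ Pl d (k + 1) := fun _ h => h.1

omit hK in
instance (k : ℕ) : FiniteDimensional ℝ (topPl K k) :=
  Submodule.finiteDimensional_of_le topPl_le

omit hK in
-- Modulo lower degrees, which are invisible to `w`, the radial derivative is multiplication by `k`.
-- Used once for each factor, this accounts for the `2k` in `fm_top`.
theorem inner_euler_top {k : ℕ} {v : Space d} {p w : MvPolynomial (Fin d) ℝ} (hp : p ∈ Pl d (k + 1))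
    (hw : w ∈ topPl K k) : ⟪pol K (euler v p), pol K w⟫_ℝ = k * ⟪pol K p, pol K w⟫_ℝ := by
  have h := hw.2 _ (euler_sub_smul_mem v hp)
  rw [map_sub, map_smul, inner_sub_left, inner_smul_left] at h
  simp only [conj_trivial] at h
  linarith

omit hK in
/-- On polynomials orthogonal to lower degrees the face moments are multiples of the inner product
of `L²(K)`. -/
theorem fm_top {k : ℕ} (v : Space d) {w μ : MvPolynomial (Fin d) ℝ} (hw : w ∈ topPl K k)
    (hμ : μ ∈ topPl K k) :
    fm K v μ (polyPair K w) = (d + 2 * k) / height K v * ⟪pol K w, pol K μ⟫_ℝ := by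
  rw [fm_apply, radial_polyPair, polyPair_fst, map_add, map_smul, inner_add_left, inner_smul_left,
    inner_euler_top hμ.1 hw, real_inner_comm (pol K (euler v w)) (pol K μ),
    inner_euler_top hw.1 hμ, real_inner_comm (pol K w) (pol K μ)]
  simp only [conj_trivial]
  ring

/-- A polynomial has the same values on a face as one that is orthogonal to lower degrees. -/
theorem exists_top_eqOn {k : ℕ} {v : Space d} (hv : v ∈ K) {μ : MvPolynomial (Fin d) ℝ}
    (hμ : μ ∈ Pl d (k + 1)) :
    ∃ w ∈ topPl K k, ∀ x ∈ hull (opp K v), ev w x = ev μ x := by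
  obtain ⟨y, hy⟩ := hK.opp_nonempty hv
  -- `l` is the affine function vanishing on the face and nonnegative on the simplex; subtracting a
  -- multiple of `l` does not change values on the face.
  set l : MvPolynomial (Fin d) ℝ := -affinePoly (nrm K v) y with hl
  have hlev : ∀ x, ev l x = height K v - ⟪nrm K v, x - v⟫_ℝ := by
    intro x
    rw [hl, ev_neg, ev_affinePoly, ← hK.inner_vertex hv hy, ← inner_sub_right, ← inner_neg_right]
    congr 1; abel
  have hlnn : ∀ x ∈ hull K, 0 ≤ ev l x := fun x hx => by
    rw [hlev]; linarith [(hK.inner_mem_Icc hv hx).2]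
  have hl0 : l ≠ 0 := by
    intro h
    have := hlev v
    rw [h] at this
    simp at this
    exact (hK.height_pos hv).ne this
  -- The `L²` form with weight `l` is positive definite on polynomials, so the correction `l * g`
  -- can be chosen to reproduce all moments of `μ` against degrees less than `k`.
  let B : MvPolynomial (Fin d) ℝ →ₗ[ℝ] MvPolynomial (Fin d) ℝ →ₗ[ℝ] ℝ :=
    LinearMap.mk₂ ℝ (fun g r => ⟪pol K r, pol K (l * g)⟫_ℝ)
      (fun _ _ _ => by rw [mul_add, map_add, inner_add_right])
      (fun c _ _ => by rw [mul_smul_comm, map_smul, inner_smul_right]; rfl)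
      (fun _ _ _ => by rw [map_add, inner_add_left])
      (fun c _ _ => by rw [map_smul, inner_smul_left]; rfl)
  have hB : ∀ g r, B g r = ∫ x in hull K, ev r x * (ev l x * ev g x) := by
    intro g r
    change ⟪pol K r, pol K (l * g)⟫_ℝ = _
    rw [inner_pol_pol]; simp
  let ℓ : MvPolynomial (Fin d) ℝ →ₗ[ℝ] ℝ := (innerₛₗ ℝ (pol K μ)).comp (pol K)
  obtain ⟨g, hg, hgr⟩ := exists_repr_of_vanish (Pl d k) B
    (fun x _ y _ => by
      rw [hB, hB]
      refine integral_congr_ae (Filter.Eventually.of_forall fun z => ?_)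
      simp only; ring) ℓ (fun x _ hx => by
      have : x = 0 := by
        rw [hB] at hx
        have hc : Continuous fun z => ev x z * (ev l z * ev x z) :=
          (continuous_ev _).mul ((continuous_ev _).mul (continuous_ev _))
        rw [setIntegral_eq_zero_iff_of_nonneg_ae] at hx
        · have h2 : l * (x * x) = 0 := by
            refine eq_zero_of_ae_eq_zero hK ?_
            filter_upwards [hx] with z hz
            simp only [Pi.zero_apply] at hz
            rw [ev_mul, ev_mul, ← hz]; ring
          rcases mul_eq_zero.1 h2 with h | h
          · exact absurd h hl0
          · exact mul_self_eq_zero.1 h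
        · refine ae_hull fun z hz => ?_
          simp only [Pi.zero_apply]
          have := hlnn z hz
          nlinarith [mul_nonneg this (mul_self_nonneg (ev x z))]
        · exact IsSimplex.integrable_of_continuous hc
      rw [this, map_zero])
  refine ⟨μ - l * g, ⟨?_, fun r hr => ?_⟩, fun x hx => ?_⟩
  · refine Submodule.sub_mem _ hμ ?_
    rw [hl, neg_mul]
    exact Submodule.neg_mem _ (affinePoly_mul_mem _ _ hg)
  · have := hgr r hr
    have h2 : ⟪pol K r, pol K (l * g)⟫_ℝ = ⟪pol K μ, pol K r⟫_ℝ := this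
    rw [map_sub, inner_sub_right, h2, real_inner_comm, sub_self]
  · rw [ev_sub, ev_mul, hlev, hK.inner_of_mem_face hv hx]; simp

end Local

/-! ### Powers of commuting operators -/

/-- The product `∏ D_i^{β_i}` in a monoid, in the order of the indices. -/
def opow {M : Type*} [Monoid M] {d : ℕ} (D : Fin d → M) (β : Fin d → ℕ) : M :=
  ((List.finRange d).map fun i => D i ^ β i).prod

theorem opow_zero {M : Type*} [Monoid M] {d : ℕ} (D : Fin d → M) : opow D 0 = 1 := by
  simp [opow]

/-- Since the factors commute, an additional one may be pulled out on either side. The statement is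
kept in a monoid because it is used both for derivatives of polynomials and for derivatives of
smooth functions. -/
theorem opow_add_single {M : Type*} [Monoid M] {d : ℕ} {D : Fin d → M}
    (hD : ∀ i j, Commute (D i) (D j)) (β : Fin d → ℕ) (i : Fin d) :
    opow D (β + Pi.single i 1) = D i * opow D β ∧
      opow D (β + Pi.single i 1) = opow D β * D i := by
  have key : ∀ l : List (Fin d), l.Nodup → (i ∈ l →
      (l.map fun j => D j ^ (β + Pi.single i 1 : Fin d → ℕ) j).prod = D i * (l.map fun j => D j ^ β j).prod) ∧
      (i ∉ l → (l.map fun j => D j ^ (β + Pi.single i 1 : Fin d → ℕ) j).prod =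
        (l.map fun j => D j ^ β j).prod) := by
    intro l
    induction l with
    | nil => simp
    | cons a l ih =>
      intro hl
      obtain ⟨h1, h2⟩ := List.nodup_cons.1 hl
      obtain ⟨ih1, ih2⟩ := ih h2
      constructor
      · intro hi
        rcases List.mem_cons.1 hi with rfl | hi
        · rw [List.map_cons, List.prod_cons, ih2 h1, List.map_cons, List.prod_cons]
          simp [pow_succ', mul_assoc]
        · have hne : a ≠ i := fun h => h1 (h ▸ hi)
          rw [List.map_cons, List.prod_cons, ih1 hi, List.map_cons, List.prod_cons]
          simp only [Pi.add_apply, Pi.single_eq_of_ne hne, add_zero]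
          rw [← mul_assoc, ← mul_assoc, ((hD a i).pow_left _).eq]
      · intro hi
        rw [List.mem_cons, not_or] at hi
        rw [List.map_cons, List.prod_cons, ih2 hi.2, List.map_cons, List.prod_cons]
        simp [Pi.single_eq_of_ne (Ne.symm hi.1)]
  have hc : Commute (D i) (opow D β) := by
    unfold opow
    refine Commute.list_prod_right _ _ fun x hx => ?_
    obtain ⟨j, -, rfl⟩ := List.mem_map.1 hx
    exact (hD i j).pow_right _
  have := (key _ (List.nodup_finRange d)).1 (List.mem_finRange i)
  exact ⟨this, this.trans hc.eq⟩

/-- The iterated derivative `∂^β` of polynomials. -/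
def pd {d : ℕ} (β : Fin d → ℕ) : Module.End ℝ (MvPolynomial (Fin d) ℝ) :=
  opow (fun i => (MvPolynomial.pderiv (R := ℝ) i).toLinearMap) β

theorem pd_zero {d : ℕ} (p : MvPolynomial (Fin d) ℝ) : pd 0 p = p := by
  rw [pd, opow_zero]; rfl

theorem pderiv_commute {d : ℕ} (i j : Fin d) (p : MvPolynomial (Fin d) ℝ) :
    MvPolynomial.pderiv i (MvPolynomial.pderiv j p) =
      MvPolynomial.pderiv j (MvPolynomial.pderiv i p) := by
  have : ⁅MvPolynomial.pderiv (R := ℝ) i, MvPolynomial.pderiv (R := ℝ) j⁆ = 0 := by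
    refine MvPolynomial.derivation_ext fun l => ?_
    rw [Derivation.commutator_apply, MvPolynomial.pderiv_X, MvPolynomial.pderiv_X]
    simp only [Pi.single_apply]
    split_ifs <;> simp
  have h := DFunLike.congr_fun this p
  rw [Derivation.commutator_apply] at h
  exact sub_eq_zero.1 h

theorem pd_add_single {d : ℕ} (β : Fin d → ℕ) (i : Fin d) (p : MvPolynomial (Fin d) ℝ) :
    pd (β + Pi.single i 1) p = MvPolynomial.pderiv i (pd β p) ∧
      pd (β + Pi.single i 1) p = pd β (MvPolynomial.pderiv i p) := by
  have h := opow_add_single (D := fun i => (MvPolynomial.pderiv (R := ℝ) (σ := Fin d) i).toLinearMap)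
    (fun i j => LinearMap.ext fun p => pderiv_commute i j p) β i
  exact ⟨LinearMap.congr_fun h.1 p, LinearMap.congr_fun h.2 p⟩

/-- Induction on multi-indices. -/
theorem multiIndex_induction {d : ℕ} {P : (Fin d → ℕ) → Prop} (h0 : P 0)
    (h : ∀ β i, P β → P (β + Pi.single i 1)) (β : Fin d → ℕ) : P β := by
  have : ∀ n, ∀ β : Fin d → ℕ, ∑ i, β i = n → P β := by
    intro n
    induction n with
    | zero =>
      intro β hβ
      have : β = 0 := funext fun i => by
        simpa using (Finset.sum_eq_zero_iff.1 hβ) i (Finset.mem_univ i)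
      rwa [this]
    | succ n ih =>
      intro β hβ
      obtain ⟨i, hi⟩ : ∃ i, β i ≠ 0 := by
        by_contra! hc
        simp [hc] at hβ
      have e : β = (β - Pi.single i 1) + Pi.single i 1 := by
        funext j
        rcases eq_or_ne j i with rfl | hj
        · simp; omega
        · simp [Pi.single_eq_of_ne hj]
      rw [e]
      refine h _ _ (ih _ ?_)
      have h2 := congrArg (fun γ : Fin d → ℕ => ∑ j, γ j) e
      simp only [Pi.add_apply, Finset.sum_add_distrib, Finset.sum_pi_single', Finset.mem_univ,
        if_true] at h2
      have h3 : ∑ j, (Pi.single i 1 : Fin d → ℕ) j = 1 := by simp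
      omega
  exact this _ β rfl

theorem pd_mem_Pl {d m : ℕ} (β : Fin d → ℕ) {p : MvPolynomial (Fin d) ℝ} (hp : p ∈ Pl d m) :
    pd β p ∈ Pl d (m - ∑ i, β i) := by
  induction β using multiIndex_induction with
  | h0 => simpa [pd_zero] using hp
  | h β i ih =>
    rw [(pd_add_single β i p).1]
    have e : m - ∑ j, (β + Pi.single i 1 : Fin d → ℕ) j = (m - ∑ j, β j) - 1 := by
      simp [Finset.sum_add_distrib]; omega
    rw [e]
    -- The subtraction is truncated: once the order of `β` reaches `m` the derivative is already
    -- zero.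
    rcases Nat.eq_zero_or_pos (m - ∑ j, β j) with h | h
    · rw [h] at ih ⊢
      have h0 : pd β p = 0 := by
        rcases mem_Pl_iff.1 ih with h | h
        · exact h
        · omega
      rw [h0, map_zero]; exact Submodule.zero_mem _
    · obtain ⟨n, hn⟩ := Nat.exists_eq_succ_of_ne_zero h.ne'
      rw [hn] at ih ⊢
      exact pderiv_mem_Pl ih i

/-! ### The Poincaré inequality -/

section Poincare

variable {d : ℕ}

/-- Change of variables: the map sends `S` into itself and its Jacobian `s^d` is at least `2^(-d)`.
-/
theorem integral_comp_affine_le {S : Set (Space d)} (hS : IsCompact S) {G : Space d → ℝ}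
    (hG : Continuous G) (hG0 : ∀ x, 0 ≤ G x) {s : ℝ} (hs : 1 / 2 ≤ s) (c : Space d)
    (hc : ∀ x ∈ S, c + s • x ∈ S) :
    ∫ x in S, G (c + s • x) ≤ 2 ^ d * ∫ x in S, G x := by
  have hs0 : 0 < s := by linarith
  have hi : Integrable (S.indicator G) :=
    (integrable_indicator_iff hS.measurableSet).2 (hG.continuousOn.integrableOn_compact hS)
  have hi1 : Integrable (fun x => S.indicator G (c + x)) := hi.comp_add_left c
  have hi2 : Integrable (fun x => S.indicator G (c + s • x)) := hi1.comp_smul hs0.ne'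
  have h1 : ∫ x, S.indicator G (c + s • x) = |(s ^ d)⁻¹| * ∫ x in S, G x := by
    rw [Measure.integral_comp_smul volume (fun x => S.indicator G (c + x)) s,
      integral_add_left_eq_self (S.indicator G) c, integral_indicator hS.measurableSet]
    simp
  have h2 : ∫ x in S, G (c + s • x) ≤ ∫ x, S.indicator G (c + s • x) := by
    calc ∫ x in S, G (c + s • x) = ∫ x in S, S.indicator G (c + s • x) := by
          refine setIntegral_congr_fun hS.measurableSet fun x hx => ?_
          simp only [indicator_of_mem (hc x hx)]
      _ ≤ _ := setIntegral_le_integral hi2 (Filter.Eventually.of_forall fun x =>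
          indicator_nonneg (fun y _ => hG0 y) _)
  refine h2.trans (h1.le.trans ?_)
  refine mul_le_mul_of_nonneg_right ?_ (integral_nonneg fun x => hG0 x)
  rw [abs_of_pos (by positivity), ← inv_pow]
  refine pow_le_pow_left₀ (by positivity) ?_ d
  rw [inv_le_comm₀ hs0 (by norm_num)]; linarith

/-- The fundamental theorem of calculus on the segment from `y` to `x`, followed by Jensen's
inequality for the square. -/
theorem sq_sub_le_integral {φ : Space d → ℝ} (hφ : ContDiff ℝ 1 φ) (x y : Space d) :
    (φ x - φ y) ^ 2 ≤ ‖x - y‖ ^ 2 * ∫ t in Icc (0 : ℝ) 1, ‖fderiv ℝ φ (y + t • (x - y))‖ ^ 2 := by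
  have hfd : Continuous (fderiv ℝ φ) := hφ.continuous_fderiv (by simp)
  set G : ℝ → ℝ := fun t => fderiv ℝ φ (y + t • (x - y)) (x - y) with hG
  have hGc : Continuous G := by fun_prop
  have h1 : φ x - φ y = ∫ t in (0 : ℝ)..1, G t := by
    have hder : ∀ t ∈ uIcc (0 : ℝ) 1, HasDerivAt (fun t : ℝ => φ (y + t • (x - y))) (G t) t := by
      intro t _
      have h2 : HasDerivAt (fun t : ℝ => y + t • (x - y)) (x - y) t := by
        simpa using ((hasDerivAt_id t).smul_const (x - y)).const_add y
      exact ((hφ.differentiable (by simp) _).hasFDerivAt).comp_hasDerivAt t h2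
    rw [intervalIntegral.integral_eq_sub_of_hasDerivAt hder (hGc.intervalIntegrable _ _)]
    simp
  have hint : ∀ {g : ℝ → ℝ}, Continuous g → IntervalIntegrable g volume 0 1 :=
    fun hg => hg.intervalIntegrable _ _
  have h2 : (∫ t in (0 : ℝ)..1, G t) ^ 2 ≤ ∫ t in (0 : ℝ)..1, G t ^ 2 := by
    set m := ∫ t in (0 : ℝ)..1, G t
    have h3 : 0 ≤ ∫ t in (0 : ℝ)..1, (G t - m) ^ 2 :=
      intervalIntegral.integral_nonneg (by norm_num) fun t _ => sq_nonneg _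
    have h4 : ∫ t in (0 : ℝ)..1, (G t - m) ^ 2 =
        (∫ t in (0 : ℝ)..1, G t ^ 2) - 2 * m * m + m ^ 2 := by
      have : ∀ t, (G t - m) ^ 2 = G t ^ 2 - 2 * m * G t + m ^ 2 := fun t => by ring
      simp only [this]
      rw [intervalIntegral.integral_add (hint (by fun_prop)) (hint (by fun_prop)),
        intervalIntegral.integral_sub (hint (by fun_prop)) (hint (by fun_prop)),
        intervalIntegral.integral_const_mul]
      simp [m]
    nlinarith
  rw [h1]
  refine h2.trans ?_
  rw [intervalIntegral.integral_of_le zero_le_one, ← integral_Icc_eq_integral_Ioc,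
    ← integral_const_mul]
  refine setIntegral_mono_on ?_ ?_ measurableSet_Icc fun t _ => ?_
  · exact (by fun_prop : Continuous fun t => G t ^ 2).continuousOn.integrableOn_compact isCompact_Icc
  · exact (by fun_prop : Continuous fun t : ℝ => ‖x - y‖ ^ 2 *
      ‖fderiv ℝ φ (y + t • (x - y))‖ ^ 2).continuousOn.integrableOn_compact isCompact_Icc
  · have := (fderiv ℝ φ (y + t • (x - y))).le_opNorm (x - y)
    rw [Real.norm_eq_abs] at this
    calc G t ^ 2 = |G t| ^ 2 := (sq_abs _).symm
      _ ≤ (‖fderiv ℝ φ (y + t • (x - y))‖ * ‖x - y‖) ^ 2 :=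
        pow_le_pow_left₀ (abs_nonneg _) this 2
      _ = _ := by ring

/-- The Poincaré inequality for smooth functions on a compact convex set. -/
theorem poincare {S : Set (Space d)} (hS : IsCompact S) (hconv : Convex ℝ S) {φ : Space d → ℝ}
    (hφ : ContDiff ℝ 1 φ) :
    volume.real S * (∫ x in S, φ x ^ 2) - (∫ x in S, φ x) ^ 2 ≤
      2 ^ d * Metric.diam S ^ 2 * volume.real S * ∫ x in S, ‖fderiv ℝ φ x‖ ^ 2 := by
  have hfd : Continuous (fderiv ℝ φ) := hφ.continuous_fderiv (by simp)
  have hφc : Continuous φ := hφ.continuous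
  set G : Space d → ℝ := fun x => ‖fderiv ℝ φ x‖ ^ 2 with hGdef
  have hG : Continuous G := by fun_prop
  have hG0 : ∀ x, 0 ≤ G x := fun x => by positivity
  have hfin : IsFiniteMeasure ((volume : Measure (Space d)).restrict S) :=
    ⟨by simpa using hS.measure_lt_top⟩
  set ν := (volume : Measure (Space d)).restrict S with hν
  have hprod : ν.prod ν = (volume : Measure (Space d × Space d)).restrict (S ×ˢ S) :=
    Measure.prod_restrict S S
  have hcont1 : ∀ {g : Space d → ℝ}, Continuous g → Integrable g ν := fun hg =>
    hg.continuousOn.integrableOn_compact hS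
  have hcont2 : ∀ {g : Space d × Space d → ℝ}, Continuous g → Integrable g (ν.prod ν) := by
    intro g hg
    rw [hprod]
    exact hg.continuousOn.integrableOn_compact (hS.prod hS)
  -- The double integral of the squared difference is twice the unnormalised variance, so no mean
  -- value has to be subtracted.
  have hlhs : ∫ z, (φ z.1 - φ z.2) ^ 2 ∂(ν.prod ν) =
      2 * (volume.real S * (∫ x in S, φ x ^ 2) - (∫ x in S, φ x) ^ 2) := by
    rw [integral_prod _ (hcont2 (by fun_prop))]
    have h1 : ∀ x, ∫ y, (φ x - φ y) ^ 2 ∂ν =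
        φ x ^ 2 * volume.real S - 2 * φ x * (∫ y, φ y ∂ν) + ∫ y, φ y ^ 2 ∂ν := by
      intro x
      have : ∀ y, (φ x - φ y) ^ 2 = φ x ^ 2 - 2 * φ x * φ y + φ y ^ 2 := fun y => by ring
      simp only [this]
      rw [integral_add (hcont1 (by fun_prop)) (hcont1 (by fun_prop)),
        integral_sub (hcont1 (by fun_prop)) (hcont1 (by fun_prop)), integral_const_mul,
        integral_const]
      simp [hν, Measure.real, mul_comm]
    simp only [h1]
    rw [integral_add (hcont1 (by fun_prop)) (hcont1 (by fun_prop)),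
      integral_sub (hcont1 (by fun_prop)) (hcont1 (by fun_prop)), integral_mul_const,
      integral_const, integral_mul_const, integral_const_mul]
    simp only [hν, Measure.real, smul_eq_mul, Measure.restrict_apply_univ]
    ring
  have hz : ∀ t : ℝ, Integrable (fun z : Space d × Space d => G (z.2 + t • (z.1 - z.2)))
      (ν.prod ν) := fun t => hcont2 (by fun_prop)
  have hrhs : ∀ t ∈ Icc (0 : ℝ) 1, ∫ z, G (z.2 + t • (z.1 - z.2)) ∂(ν.prod ν) ≤
      2 ^ d * volume.real S * ∫ x in S, G x := by
    intro t ht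
    have hconst : ∫ _ : Space d, 2 ^ d * (∫ x in S, G x) ∂ν =
        2 ^ d * volume.real S * ∫ x in S, G x := by
      rw [integral_const]; simp [hν, Measure.real]; ring
    rw [← hconst]
    -- One of `t` and `1 - t` is at least `1/2`. With the other variable frozen, the point on the
    -- segment is an affine image of the set with contraction factor at least `1/2`.
    rcases le_total (1 / 2) t with h | h
    · rw [integral_prod_symm _ (hcont2 (by fun_prop))]
      refine setIntegral_mono_on (hz t).integral_prod_right
        (integrable_const _) hS.measurableSet fun y hy => ?_
      have := integral_comp_affine_le hS hG hG0 h ((1 - t) • y) fun x hx =>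
        hconv hy hx (by linarith [ht.2]) ht.1 (by ring)
      refine le_trans (le_of_eq ?_) this
      refine integral_congr_ae (Filter.Eventually.of_forall fun x => ?_)
      simp only; congr 1; module
    · rw [integral_prod _ (hcont2 (by fun_prop))]
      refine setIntegral_mono_on (hz t).integral_prod_left
        (integrable_const _) hS.measurableSet fun y hy => ?_
      have := integral_comp_affine_le hS hG hG0 (s := 1 - t) (by linarith) (t • y) fun x hx =>
        hconv hy hx ht.1 (by linarith [ht.2]) (by ring)
      refine le_trans (le_of_eq ?_) this
      refine integral_congr_ae (Filter.Eventually.of_forall fun x => ?_)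
      simp only; congr 1; module
  set lam := (volume : Measure ℝ).restrict (Icc 0 1) with hlam
  have hjoint : Integrable (fun w : (Space d × Space d) × ℝ => G (w.1.2 + w.2 • (w.1.1 - w.1.2)))
      ((ν.prod ν).prod lam) := by
    rw [hprod, hlam, Measure.prod_restrict]
    exact (by fun_prop : Continuous fun w : (Space d × Space d) × ℝ =>
      G (w.1.2 + w.2 • (w.1.1 - w.1.2))).continuousOn.integrableOn_compact
        ((hS.prod hS).prod isCompact_Icc)
  have hmain : ∫ z, (φ z.1 - φ z.2) ^ 2 ∂(ν.prod ν) ≤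
      Metric.diam S ^ 2 * (2 ^ d * volume.real S * ∫ x in S, G x) := by
    calc ∫ z, (φ z.1 - φ z.2) ^ 2 ∂(ν.prod ν)
        ≤ ∫ z, Metric.diam S ^ 2 * (∫ t, G (z.2 + t • (z.1 - z.2)) ∂lam) ∂(ν.prod ν) := by
          rw [hprod]
          refine setIntegral_mono_on ?_ ?_ (hS.measurableSet.prod hS.measurableSet)
            fun z hz => ?_
          · rw [IntegrableOn, ← hprod]; exact hcont2 (by fun_prop)
          · rw [IntegrableOn, ← hprod]; exact hjoint.integral_prod_left.const_mul _
          · refine (sq_sub_le_integral hφ z.1 z.2).trans ?_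
            refine mul_le_mul_of_nonneg_right ?_ (integral_nonneg fun t => hG0 _)
            have := Metric.dist_le_diam_of_mem hS.isBounded hz.1 hz.2
            rw [dist_eq_norm] at this
            exact pow_le_pow_left₀ (norm_nonneg _) this 2
      _ = Metric.diam S ^ 2 * ∫ t, ∫ z, G (z.2 + t • (z.1 - z.2)) ∂(ν.prod ν) ∂lam := by
          rw [integral_const_mul, integral_integral_swap hjoint]
      _ ≤ Metric.diam S ^ 2 * ∫ _ : ℝ, (2 ^ d * volume.real S * ∫ x in S, G x) ∂lam := by
          refine mul_le_mul_of_nonneg_left ?_ (by positivity)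
          refine setIntegral_mono_on hjoint.integral_prod_right
            (integrable_const _) measurableSet_Icc fun t ht => hrhs t ht
      _ = _ := by rw [integral_const]; simp [hlam, Measure.real]
  have h0 : 0 ≤ ∫ x in S, G x := integral_nonneg fun x => hG0 x
  have h1 : 0 ≤ Metric.diam S ^ 2 * (2 ^ d * volume.real S * ∫ x in S, G x) := by positivity
  rw [hlhs] at hmain
  have : 2 ^ d * Metric.diam S ^ 2 * volume.real S * ∫ x in S, G x =
    Metric.diam S ^ 2 * (2 ^ d * volume.real S * ∫ x in S, G x) := by ring
  rw [this]
  linarith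

theorem norm_fderiv_sq {φ : Space d → ℝ} (x : Space d) :
    ‖fderiv ℝ φ x‖ ^ 2 = ∑ i, partialDeriv i φ x ^ 2 := by
  have h1 : ‖fderiv ℝ φ x‖ = ‖(InnerProductSpace.toDual ℝ (Space d)).symm (fderiv ℝ φ x)‖ := by
    simp
  rw [h1, EuclideanSpace.norm_sq_eq]
  refine Finset.sum_congr rfl fun i _ => ?_
  have h2 : ((InnerProductSpace.toDual ℝ (Space d)).symm (fderiv ℝ φ x)) i = partialDeriv i φ x := by
    rw [partialDeriv, ← InnerProductSpace.toDual_symm_apply, EuclideanSpace.inner_single_right]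
    simp
  rw [h2, Real.norm_eq_abs, sq_abs]

theorem poincare_H1 {K : Finset (Space d)} {x : XK K} (hx : x ∈ H1 K) :
    volume.real (hull K) * ‖x.1‖ ^ 2 - ⟪pol K 1, x.1⟫_ℝ ^ 2 ≤
      2 ^ d * Metric.diam (hull K) ^ 2 * volume.real (hull K) * ∑ i, ‖x.2 i‖ ^ 2 := by
  refine H1_induction (p := fun x => volume.real (hull K) * ‖x.1‖ ^ 2 - ⟪pol K 1, x.1⟫_ℝ ^ 2 ≤
      2 ^ d * Metric.diam (hull K) ^ 2 * volume.real (hull K) * ∑ i, ‖x.2 i‖ ^ 2) ?_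
      (fun φ hφ => ?_) hx
  · refine isClosed_le ?_ ?_
    · exact (continuous_const.mul (continuous_fst.norm.pow 2)).sub
        ((continuous_const.inner continuous_fst).pow 2)
    · exact continuous_const.mul (continuous_finsetSum _ fun i _ =>
        (((continuous_apply i).comp continuous_snd).norm.pow 2))
  · have hsq : ∀ {g : Space d → ℝ}, Continuous g →
        ‖toL (volume.restrict (hull K)) g‖ ^ 2 = ∫ x in hull K, g x ^ 2 := by
      intro g hg
      rw [← real_inner_self_eq_norm_sq, inner_toL_toL (memLp_hull hg) (memLp_hull hg)]
      simp only [sq]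
    have h := poincare (IsSimplex.isCompact_hull K) (IsSimplex.convex_hull K)
      (hφ.of_le (by simp) : ContDiff ℝ 1 φ)
    have e1 : ⟪pol K 1, (smoothPair K φ).1⟫_ℝ = ∫ x in hull K, φ x := by
      have : ⟪pol K 1, (smoothPair K φ).1⟫_ℝ = ∫ x in hull K, ev 1 x * φ x :=
        inner_toL_toL (memLp_hull (continuous_ev _)) (memLp_hull hφ.continuous)
      rw [this]; simp [ev]
    have e2 : ∑ i, ‖(smoothPair K φ).2 i‖ ^ 2 = ∫ x in hull K, ‖fderiv ℝ φ x‖ ^ 2 := by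
      simp only [norm_fderiv_sq]
      rw [integral_finsetSum]
      · exact Finset.sum_congr rfl fun i _ => hsq (continuous_partialDeriv hφ i)
      · intro i _
        exact IsSimplex.integrable_of_continuous ((continuous_partialDeriv hφ i).pow 2)
    rw [e1, e2, smoothPair, hsq hφ.continuous]
    exact h

/-- The Poincaré inequality without its mean-value term; dividing by the volume makes the constant
independent of the shape of the simplex. -/
theorem norm_le_of_mean_zero {K : Finset (Space d)} (hK : IsSimplex K) {x : XK K} (hx : x ∈ H1 K)
    (h0 : ⟪pol K 1, x.1⟫_ℝ = 0) {N : ℝ} (hN : ∀ i, ‖x.2 i‖ ≤ N) :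
    ‖x.1‖ ≤ 2 ^ d * d * Metric.diam (hull K) * N := by
  have hpos : 0 < volume.real (hull K) := by
    have h1 : 0 < volume (hull K) :=
      (isOpen_interior.measure_pos volume (interior_hull_nonempty hK)).trans_le
        (measure_mono interior_subset)
    exact ENNReal.toReal_pos h1.ne' (IsSimplex.isCompact_hull K).measure_lt_top.ne
  have h := poincare_H1 hx
  rw [h0] at h
  have hd := hK.dim_pos
  have hN0 : 0 ≤ N := (norm_nonneg _).trans (hN ⟨0, hd⟩)
  have h2 : ∑ i, ‖x.2 i‖ ^ 2 ≤ d * N ^ 2 := by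
    calc ∑ i, ‖x.2 i‖ ^ 2 ≤ ∑ _i : Fin d, N ^ 2 :=
          Finset.sum_le_sum fun i _ => pow_le_pow_left₀ (norm_nonneg _) (hN i) 2
      _ = d * N ^ 2 := by simp
  have hdiam : 0 ≤ Metric.diam (hull K) := Metric.diam_nonneg
  have h3 : ‖x.1‖ ^ 2 ≤ 2 ^ d * Metric.diam (hull K) ^ 2 * (d * N ^ 2) := by
    have h4 : volume.real (hull K) * ‖x.1‖ ^ 2 ≤
        volume.real (hull K) * (2 ^ d * Metric.diam (hull K) ^ 2 * ∑ i, ‖x.2 i‖ ^ 2) := by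
      linarith
    refine (le_of_mul_le_mul_left h4 hpos).trans ?_
    gcongr
  -- The sharp factor would be the square root of `2^d * d`; since this number is at least `1`, it
  -- may replace its own root.
  refine le_of_sq_le_sq ?_ (by positivity)
  refine h3.trans ?_
  have h5 : (1 : ℝ) ≤ 2 ^ d := one_le_pow₀ (by norm_num)
  have h6 : (1 : ℝ) ≤ d := by exact_mod_cast hd
  calc 2 ^ d * Metric.diam (hull K) ^ 2 * (d * N ^ 2)
      = (2 ^ d * d) * (Metric.diam (hull K) ^ 2 * N ^ 2) := by ring
    _ ≤ ((2 ^ d * d) * (2 ^ d * d)) * (Metric.diam (hull K) ^ 2 * N ^ 2) := by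
        refine mul_le_mul_of_nonneg_right ?_ (by positivity)
        have h7 := one_le_mul_of_one_le_of_one_le h5 h6
        exact le_mul_of_one_le_right (by linarith) h7
    _ = _ := by ring

end Poincare

/-! ### Polynomial approximation -/

section Approximation

variable {d : ℕ} {K : Finset (Space d)}

/-- A family of derivatives up to order `m` of a function in `H^m(K)`. -/
def IsSobolevFamily (K : Finset (Space d)) (m : ℕ) (U : (Fin d → ℕ) → LK K) : Prop :=
  ∀ β, ∑ i, β i < m → (U β, fun i => U (β + Pi.single i 1)) ∈ H1 K

theorem IsSobolevFamily.sub {m : ℕ} {U V : (Fin d → ℕ) → LK K} (hU : IsSobolevFamily K m U)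
    (hV : IsSobolevFamily K m V) : IsSobolevFamily K m (fun β => U β - V β) := fun β hβ =>
  Submodule.sub_mem _ (hU β hβ) (hV β hβ)

theorem isSobolevFamily_pd (m : ℕ) (p : MvPolynomial (Fin d) ℝ) :
    IsSobolevFamily K m (fun β => pol K (pd β p)) := by
  intro β _
  have := polyPair_mem_H1 (K := K) (pd β p)
  simp only [(pd_add_single β _ p).1]
  exact this

/-- The Poincaré inequality is applied `j` times, each step passing to derivatives of one order
higher at the cost of one diameter. -/
theorem IsSobolevFamily.norm_le (hK : IsSimplex K) {m : ℕ} {U : (Fin d → ℕ) → LK K}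
    (hU : IsSobolevFamily K m U) (h0 : ∀ β, ∑ i, β i < m → ⟪pol K 1, U β⟫_ℝ = 0) {N : ℝ}
    (hN : ∀ β, ∑ i, β i = m → ‖U β‖ ≤ N) (j : ℕ) (β : Fin d → ℕ) (hβ : ∑ i, β i + j = m) :
    ‖U β‖ ≤ (2 ^ d * d * Metric.diam (hull K)) ^ j * N := by
  induction j generalizing β with
  | zero => simpa using hN β hβ
  | succ j ih =>
    have h := norm_le_of_mean_zero hK (hU β (by omega)) (h0 β (by omega))
      (N := (2 ^ d * d * Metric.diam (hull K)) ^ j * N)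
      (fun i => ih _ (by simp [Finset.sum_add_distrib]; omega))
    calc _ ≤ _ := h
      _ = _ := by ring

/-- A polynomial of degree less than `m` has vanishing derivatives of order `m`, so if all lower
derivatives have mean zero the Poincaré chain forces it to vanish. Injectivity and equality of
dimensions give surjectivity. -/
theorem exists_pd_integral_eq (hK : IsSimplex K) (m : ℕ) (c : (Fin d → ℕ) → ℝ) :
    ∃ Q ∈ Pl d m, ∀ β, ∑ i, β i < m → ⟪pol K 1, pol K (pd β Q)⟫_ℝ = c β := by
  let I := {n : Fin d →₀ ℕ // n.degree < m}
  have hfin : Finite I := finite_degree_lt m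
  have : Fintype I := Fintype.ofFinite I
  let Φ : Pl d m →ₗ[ℝ] (I → ℝ) := LinearMap.pi fun n =>
    (((innerₛₗ ℝ (pol K 1)).comp (pol K)).comp (pd (n : I).1)).comp (Pl d m).subtype
  have hdeg : ∀ n : Fin d →₀ ℕ, n.degree = ∑ i, n i := fun n => Finsupp.degree_eq_sum n
  have hinj : Function.Injective Φ := by
    rw [← LinearMap.ker_eq_bot, LinearMap.ker_eq_bot']
    intro Q hQ
    have h0 : ∀ β : Fin d → ℕ, ∑ i, β i < m → ⟪pol K 1, pol K (pd β Q.1)⟫_ℝ = 0 := by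
      intro β hβ
      have := congrFun hQ ⟨Finsupp.equivFunOnFinite.symm β, by rw [hdeg]; simpa using hβ⟩
      simpa [Φ] using this
    have hN : ∀ β : Fin d → ℕ, ∑ i, β i = m → ‖pol K (pd β Q.1)‖ ≤ 0 := by
      intro β hβ
      have h1 := pd_mem_Pl β Q.2
      rw [hβ, Nat.sub_self] at h1
      have h2 : pd β Q.1 = 0 := by
        rcases mem_Pl_iff.1 h1 with h | h
        · exact h
        · omega
      rw [h2, map_zero, norm_zero]
    have h3 := (isSobolevFamily_pd (K := K) m Q.1).norm_le hK h0 hN m 0 (by simp)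
    rw [mul_zero] at h3
    have h4 := norm_le_zero_iff.1 h3
    simp only [pd_zero] at h4
    exact Subtype.ext (pol_injective hK (h4.trans (map_zero _).symm))
  have hrank : Module.finrank ℝ (Pl d m) = Module.finrank ℝ (I → ℝ) := by
    rw [Module.finrank_fintype_fun_eq_card]
    exact Module.finrank_eq_card_basis
      (MvPolynomial.basisRestrictSupport ℝ {n : Fin d →₀ ℕ | n.degree < m})
  have hsurj := (LinearMap.injective_iff_surjective_of_finrank_eq_finrank hrank).1 hinj
  obtain ⟨Q, hQ⟩ := hsurj (fun n => c n.1)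
  refine ⟨Q.1, Q.2, fun β hβ => ?_⟩
  have := congrFun hQ ⟨Finsupp.equivFunOnFinite.symm β, by rw [hdeg]; simpa using hβ⟩
  simpa [Φ] using this

/-- Polynomial approximation of Sobolev functions on a simplex. -/
theorem IsSobolevFamily.exists_approx (hK : IsSimplex K) {m : ℕ} {U : (Fin d → ℕ) → LK K}
    (hU : IsSobolevFamily K m U) {N : ℝ} (hN : ∀ β, ∑ i, β i = m → ‖U β‖ ≤ N) :
    ∃ Q ∈ Pl d m, ∀ j β, ∑ i, β i + j = m →
      ‖U β - pol K (pd β Q)‖ ≤ (2 ^ d * d * Metric.diam (hull K)) ^ j * N := by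
  obtain ⟨Q, hQ, h⟩ := exists_pd_integral_eq hK m fun β => ⟪pol K 1, U β⟫_ℝ
  refine ⟨Q, hQ, fun j β hβ => ?_⟩
  refine (hU.sub (isSobolevFamily_pd m Q)).norm_le hK (fun β hβ => ?_) (fun β hβ => ?_) j β hβ
  · rw [inner_sub_right, h β hβ, sub_self]
  · have h1 := pd_mem_Pl β hQ
    rw [hβ, Nat.sub_self] at h1
    have h2 : pd β Q = 0 := by
      rcases mem_Pl_iff.1 h1 with h | h
      · exact h
      · omega
    rw [h2, map_zero, sub_zero]
    exact hN β hβ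

end Approximation

/-! ### The projection of the method on one element -/

section Projection

variable {d k : ℕ} {K : Finset (Space d)}

/-- `(e, f)` is the error of the projection of the method on the element `K`, the face opposite to
`v` carrying the stabilization parameter `τ v`. -/
structure IsProjError (K : Finset (Space d)) (k : ℕ) (τ : Space d → ℝ) (e : Fin d → XK K)
    (f : XK K) : Prop where
  vec : ∀ i, ∀ r ∈ Pl d k, ⟪pol K r, (e i).1⟫_ℝ = 0
  scal : ∀ r ∈ Pl d k, ⟪pol K r, f.1⟫_ℝ = 0
  face : ∀ v ∈ K, ∀ μ ∈ Pl d (k + 1),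
    ∑ i, nrm K v i * fm K v μ (e i) + τ v * fm K v μ f = 0

theorem IsProjError.sub {τ : Space d → ℝ} {e e' : Fin d → XK K} {f f' : XK K}
    (h : IsProjError K k τ e f) (h' : IsProjError K k τ e' f') :
    IsProjError K k τ (e - e') (f - f') where
  vec i r hr := by
    rw [Pi.sub_apply, Prod.fst_sub, inner_sub_right, h.vec i r hr, h'.vec i r hr, sub_zero]
  scal r hr := by rw [Prod.fst_sub, inner_sub_right, h.scal r hr, h'.scal r hr, sub_zero]
  face v hv μ hμ := by
    have h1 := h.face v hv μ hμ
    have h2 := h'.face v hv μ hμ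
    simp only [Pi.sub_apply, map_sub, mul_sub, Finset.sum_sub_distrib]
    linarith

/-- Existence of the `L²(K)` projection onto polynomials. -/
theorem exists_L2_projection (m : ℕ) (x : LK K) :
    ∃ r ∈ Pl d m, ∀ s ∈ Pl d m, ⟪pol K s, x - pol K r⟫_ℝ = 0 := by
  obtain ⟨g, hg, h⟩ := exists_repr_of_vanish (Pl d m)
    (((innerₗ (LK K)).compl₁₂ (pol K) (pol K))) (fun a _ b _ => show ⟪pol K a, pol K b⟫_ℝ = ⟪pol K b, pol K a⟫_ℝ from real_inner_comm _ _)
    ((innerₗ (LK K) x).comp (pol K)) (fun a _ ha => by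
      have : pol K a = 0 := inner_self_eq_zero.1 (show ⟪pol K a, pol K a⟫_ℝ = 0 from ha)
      simp [this])
  refine ⟨g, hg, fun s hs => ?_⟩
  have : ⟪pol K g, pol K s⟫_ℝ = ⟪x, pol K s⟫_ℝ := h s hs
  rw [inner_sub_right, real_inner_comm x, ← this, real_inner_comm, sub_self]

theorem L2_projection_le {m : ℕ} {x : LK K} {r Q : MvPolynomial (Fin d) ℝ} (hr : r ∈ Pl d m)
    (h : ∀ s ∈ Pl d m, ⟪pol K s, x - pol K r⟫_ℝ = 0) (hQ : Q ∈ Pl d m) :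
    ‖x - pol K r‖ ≤ ‖x - pol K Q‖ ∧ ‖pol K Q - pol K r‖ ≤ ‖x - pol K Q‖ := by
  have h0 : ⟪x - pol K r, pol K r - pol K Q⟫_ℝ = 0 := by
    rw [real_inner_comm, ← map_sub]; exact h _ (Submodule.sub_mem _ hr hQ)
  have h1 := norm_add_sq_eq_norm_sq_add_norm_sq_of_inner_eq_zero _ _ h0
  rw [sub_add_sub_cancel] at h1
  constructor
  · exact abs_le_of_sq_le_sq' (by nlinarith [sq_nonneg ‖pol K r - pol K Q‖]) (norm_nonneg _) |>.2
  · rw [norm_sub_rev (pol K Q)]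
    exact abs_le_of_sq_le_sq' (by nlinarith [sq_nonneg ‖x - pol K r‖]) (norm_nonneg _) |>.2

/-- The quantity controlling the face moments of the error of the `L²(K)` projection. -/
def defect (k : ℕ) (x : XK K) (Q : MvPolynomial (Fin d) ℝ) : ℝ :=
  Metric.diam (hull K) * ∑ i, ‖x.2 i - pol K (MvPolynomial.pderiv i Q)‖ + k * ‖x.1 - pol K Q‖

theorem defect_nonneg (x : XK K) (Q : MvPolynomial (Fin d) ℝ) : 0 ≤ defect k x Q := by
  have := Metric.diam_nonneg (s := hull K)
  unfold defect
  positivity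

variable (hK : IsSimplex K)
include hK

/-- In the formula for `fm` the zeroth-order term drops out by orthogonality. The radial derivative
of `x - r` is that of `x - Q`, bounded by the gradient error, plus that of the polynomial `Q - r`,
which against `w` is multiplication by `k`. Neither a trace inequality nor an inverse inequality is
needed. -/
theorem abs_fm_sub_L2_projection_le {x : XK K} {r Q w : MvPolynomial (Fin d) ℝ}
    (hr : r ∈ Pl d (k + 1)) (h : ∀ s ∈ Pl d (k + 1), ⟪pol K s, x.1 - pol K r⟫_ℝ = 0)
    (hQ : Q ∈ Pl d (k + 1)) (hw : w ∈ topPl K k) {v : Space d} (hv : v ∈ K) :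
    |fm K v w (x - polyPair K r)| ≤ (height K v)⁻¹ * (‖pol K w‖ * defect k x Q) := by
  have hh := hK.height_pos hv
  have h1 : ⟪pol K ((d : ℝ) • w + euler v w), (x - polyPair K r).1⟫_ℝ = 0 :=
    h _ (Submodule.add_mem _ (Submodule.smul_mem _ _ hw.1) (euler_mem_Pl v hw.1))
  have h2 : radial K v (x - polyPair K r).2 =
      radial K v (x - polyPair K Q).2 + pol K (euler v (Q - r)) := by
    rw [← radial_polyPair, ← map_add, map_sub (polyPair K)]
    congr 1
    simp only [Prod.snd_sub]
    abel
  rw [fm_apply, h1, zero_add, h2, inner_add_right, abs_mul, abs_of_pos (inv_pos.2 hh)]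
  refine mul_le_mul_of_nonneg_left ?_ (inv_nonneg.2 hh.le)
  refine (abs_add_le _ _).trans ?_
  rw [defect, mul_add]
  refine add_le_add ?_ ?_
  · refine (abs_real_inner_le_norm _ _).trans ?_
    exact mul_le_mul_of_nonneg_left (norm_radial_le (IsSimplex.subset_hull K hv) _) (norm_nonneg _)
  · rw [real_inner_comm, inner_euler_top (Submodule.sub_mem _ hQ hr) hw, abs_mul,
      abs_of_nonneg (Nat.cast_nonneg k), mul_left_comm]
    refine mul_le_mul_of_nonneg_left ?_ (Nat.cast_nonneg k)
    rw [map_sub, mul_comm]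
    refine (abs_real_inner_le_norm _ _).trans ?_
    exact mul_le_mul_of_nonneg_right (L2_projection_le hr h hQ).2 (norm_nonneg _)

/-- Gauss–Green componentwise: against `w` the derivatives of the `p i` have too low a degree to be
seen, and against the error so do the derivatives of `w`. The sum over all faces thus contains no
unknown flux, and the scalar part decouples. -/
theorem sum_face_top {xq : Fin d → XK K} (hxq : ∀ i, xq i ∈ H1 K)
    {p : Fin d → MvPolynomial (Fin d) ℝ} (hp : ∀ i, p i ∈ Pl d (k + 1))
    (h : ∀ i, ∀ r ∈ Pl d k, ⟪pol K r, (polyPair K (p i) - xq i).1⟫_ℝ = 0)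
    {w : MvPolynomial (Fin d) ℝ} (hw : w ∈ topPl K k) :
    ∑ v ∈ K, ∑ i, nrm K v i * fm K v w (polyPair K (p i) - xq i) =
      -∑ i, ⟪pol K w, (xq i).2 i⟫_ℝ := by
  rw [Finset.sum_comm, ← Finset.sum_neg_distrib]
  refine Finset.sum_congr rfl fun i _ => ?_
  rw [sum_fm hK i w (Submodule.sub_mem _ (polyPair_mem_H1 _) (hxq i)),
    h i _ (pderiv_mem_Pl hw.1 i), add_zero, Prod.snd_sub, Pi.sub_apply, inner_sub_right,
    polyPair_snd, real_inner_comm, hw.2 _ (pderiv_mem_Pl (hp i) i), zero_sub]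

theorem normal_components_sum {v0 : Space d} (hv0 : v0 ∈ K) (i j : Fin d) :
    ∑ v ∈ opp K v0, (height K v)⁻¹ * ((v0 i - v i) * nrm K v j) = if i = j then 1 else 0 := by
  have h := congrArg (fun x : Space d => x i)
    (hK.sum_normal_components hv0 (EuclideanSpace.single j 1))
  simp only [PiLp.single_apply] at h
  rw [← h, WithLp.ofLp_sum, Finset.sum_apply]
  refine Finset.sum_congr rfl fun v _ => ?_
  simp [EuclideanSpace.inner_single_right]
  ring

omit hK in
theorem abs_coord_sub_le {v w : Space d} (hv : v ∈ K) (hw : w ∈ K) (i : Fin d) :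
    |v i - w i| ≤ Metric.diam (hull K) := by
  have h1 : ‖(v - w) i‖ ≤ ‖v - w‖ := PiLp.norm_apply_le (v - w) i
  have h2 := Metric.dist_le_diam_of_mem (IsSimplex.isCompact_hull K).isBounded
    (IsSimplex.subset_hull K hv) (IsSimplex.subset_hull K hw)
  rw [dist_eq_norm] at h2
  exact h1.trans h2

set_option maxHeartbeats 1000000 in
/-- The error estimate for the projection on one element. -/
theorem projection_estimate {τ : Space d → ℝ} (hτ : ∀ v ∈ K, 0 ≤ τ v) {v0 : Space d} (hv0 : v0 ∈ K)
    (hpos : 0 < τ v0) {C σ : ℝ} (hC : 1 / τ v0 ≤ C)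
    (hle : ∀ v ∈ K, v ≠ v0 → τ v ≤ C)
    (hσ : ∀ v ∈ K, Metric.diam (hull K) ≤ σ * height K v)
    {xq : Fin d → XK K} (hxq : ∀ i, xq i ∈ H1 K) {xu : XK K}
    {p : Fin d → MvPolynomial (Fin d) ℝ} (hp : ∀ i, p i ∈ Pl d (k + 1))
    {z : MvPolynomial (Fin d) ℝ} (hz : z ∈ Pl d (k + 1))
    (h : IsProjError K k τ (fun i => polyPair K (p i) - xq i) (polyPair K z - xu))
    {Q : MvPolynomial (Fin d) ℝ} (hQ : Q ∈ Pl d (k + 1))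
    {R : Fin d → MvPolynomial (Fin d) ℝ} (hR : ∀ i, R i ∈ Pl d (k + 1)) {D : ℝ}
    (hD : D = defect k xu Q + C * Metric.diam (hull K) *
      ∑ i, ‖(xq i).2 i - pol K (MvPolynomial.pderiv i (R i))‖) :
    ‖pol K z - xu.1‖ ≤ ‖xu.1 - pol K Q‖ + D ∧
    ∀ i, ‖pol K (p i) - (xq i).1‖ ≤ ‖(xq i).1 - pol K (R i)‖ +
      d * σ * (∑ j, defect k (xq j) (R j) + C * defect k xu Q + C * (d + 2 * k) * D) := by
  have hd := hK.dim_pos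
  have hd1 : (1 : ℝ) ≤ d := by exact_mod_cast hd
  have hC0 : 0 < C := (one_div_pos.2 hpos).trans_le hC
  set H := Metric.diam (hull K) with hH
  clear_value H
  have hH0 : 0 < H := (hK.height_pos hv0).trans_le (hH ▸ hK.height_le_diam hv0)
  have hn1 : (1 : ℝ) ≤ d + 2 * k := by linarith [(Nat.cast_nonneg k : (0 : ℝ) ≤ k)]
  obtain ⟨r, hr, hrx⟩ := exists_L2_projection (k + 1) xu.1
  have hr2 := L2_projection_le hr hrx hQ
  -- The deviation of `Π_W u` from the `L²` projection is orthogonal to lower degrees, because both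
  -- reproduce the same lower moments.
  obtain ⟨δ, hδ⟩ : ∃ δ, δ = z - r := ⟨_, rfl⟩
  have hδtop : δ ∈ topPl K k := by
    refine ⟨hδ ▸ Submodule.sub_mem _ hz hr, fun s hs => ?_⟩
    have h1 := h.scal s hs
    have h2 := hrx s (Pl_mono (Nat.le_succ k) hs)
    rw [Prod.fst_sub, polyPair_fst, inner_sub_right] at h1
    rw [inner_sub_right] at h2
    rw [hδ, map_sub, inner_sub_right]; linarith
  have hsplit : ∀ v w, fm K v w (polyPair K z - xu) =
      fm K v w (polyPair K δ) - fm K v w (xu - polyPair K r) := by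
    intro v w
    rw [← map_sub]; congr 1
    rw [hδ, map_sub]; abel
  have hεu := defect_nonneg (k := k) xu Q
  set εu := defect k xu Q with hεudef
  have hfmu : ∀ w ∈ topPl K k, ∀ v ∈ K, |fm K v w (xu - polyPair K r)| ≤
      (height K v)⁻¹ * (‖pol K w‖ * εu) := fun w hw v hv =>
    abs_fm_sub_L2_projection_le hK hr hrx hQ hw hv
  clear_value εu
  set G := ∑ i, ‖(xq i).2 i - pol K (MvPolynomial.pderiv i (R i))‖ with hG
  have hG0 : 0 ≤ G := Finset.sum_nonneg fun i _ => norm_nonneg _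
  clear_value G
  have hD0 : 0 ≤ D := by
    rw [hD]; exact add_nonneg hεu (mul_nonneg (mul_nonneg hC0.le hH0.le) hG0)
  have hδle : ‖pol K δ‖ ≤ D := by
    -- `S` is the coefficient of `‖δ‖²` in the summed face equations, up to `d + 2k`. The face with
    -- maximal `τ` alone gives `S ≥ 1 / (C H)`; large values of `τ` do no harm, since `S` also
    -- multiplies the error of the `L²` projection on the right and cancels there.
    set S := ∑ v ∈ K, τ v * (height K v)⁻¹ with hS
    have hSle : 1 / (C * H) ≤ S := by
      calc 1 / (C * H) ≤ τ v0 * (height K v0)⁻¹ := by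
            rw [one_div, mul_inv]
            refine mul_le_mul ?_ (inv_anti₀ (hK.height_pos hv0) (hH ▸ hK.height_le_diam hv0))
              (by positivity) hpos.le
            rw [inv_le_comm₀ hC0 hpos, ← one_div]; exact hC
        _ ≤ S := Finset.single_le_sum (f := fun v => τ v * (height K v)⁻¹)
            (fun v hv => mul_nonneg (hτ v hv) (inv_nonneg.2 (hK.height_pos hv).le)) hv0
    have hS0 : 0 < S := lt_of_lt_of_le (one_div_pos.2 (mul_pos hC0 hH0)) hSle
    -- The face equations tested with `δ` itself and summed; the flux contributes only its exact
    -- divergence.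
    have e1 : ∑ v ∈ K, τ v * fm K v δ (polyPair K z - xu) = ∑ i, ⟪pol K δ, (xq i).2 i⟫_ℝ := by
      have h1 := sum_face_top hK hxq hp h.vec hδtop
      have h2 : ∑ v ∈ K, (∑ i, nrm K v i * fm K v δ (polyPair K (p i) - xq i) +
          τ v * fm K v δ (polyPair K z - xu)) = 0 :=
        Finset.sum_eq_zero fun v hv => h.face v hv δ hδtop.1
      rw [Finset.sum_add_distrib, h1] at h2
      linarith
    have e2 : ∑ v ∈ K, τ v * fm K v δ (polyPair K δ) = (d + 2 * k) * S * ‖pol K δ‖ ^ 2 := by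
      rw [hS, Finset.mul_sum, Finset.sum_mul]
      refine Finset.sum_congr rfl fun v hv => ?_
      rw [fm_top v hδtop hδtop, real_inner_self_eq_norm_sq]
      ring
    have e3 : ∑ v ∈ K, τ v * fm K v δ (xu - polyPair K r) ≤ S * (‖pol K δ‖ * εu) := by
      rw [hS, Finset.sum_mul]
      refine Finset.sum_le_sum fun v hv => ?_
      rw [mul_assoc]
      exact mul_le_mul_of_nonneg_left ((le_abs_self _).trans
        (hfmu δ hδtop v hv)) (hτ v hv)
    have e4 : ∑ i, ⟪pol K δ, (xq i).2 i⟫_ℝ ≤ ‖pol K δ‖ * G := by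
      rw [hG, Finset.mul_sum]
      refine Finset.sum_le_sum fun i _ => ?_
      have h3 : ⟪pol K δ, (xq i).2 i⟫_ℝ =
          ⟪pol K δ, (xq i).2 i - pol K (MvPolynomial.pderiv i (R i))⟫_ℝ := by
        rw [inner_sub_right, real_inner_comm _ (pol K δ), real_inner_comm _ (pol K δ),
          hδtop.2 _ (pderiv_mem_Pl (hR i) i), sub_zero]
      rw [h3]; exact real_inner_le_norm _ _
    simp only [hsplit, mul_sub, Finset.sum_sub_distrib] at e1
    rw [e2] at e1
    have e5 : S * ‖pol K δ‖ ^ 2 ≤ ‖pol K δ‖ * (G + S * εu) := by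
      have h4 : S * ‖pol K δ‖ ^ 2 ≤ (d + 2 * k) * S * ‖pol K δ‖ ^ 2 := by
        have : 0 ≤ S * ‖pol K δ‖ ^ 2 := by positivity
        nlinarith
      nlinarith
    rcases (norm_nonneg (pol K δ)).eq_or_lt with h0 | h0
    · rw [← h0]; exact hD0
    · have e6 : S * ‖pol K δ‖ ≤ G + S * εu := by
        refine le_of_mul_le_mul_left ?_ h0
        calc _ = S * ‖pol K δ‖ ^ 2 := by ring
          _ ≤ _ := e5
      have e7 : G ≤ S * (C * H * G) := by
        calc G = 1 / (C * H) * (C * H * G) := by field_simp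
          _ ≤ _ := mul_le_mul_of_nonneg_right hSle (by positivity)
      refine le_of_mul_le_mul_left ?_ hS0
      rw [hD, mul_add]; linarith
  refine ⟨?_, fun i => ?_⟩
  · have : pol K z - xu.1 = pol K δ - (xu.1 - pol K r) := by rw [hδ, map_sub]; abel
    rw [this]
    refine (norm_sub_le _ _).trans ?_
    linarith [hr2.1]
  · choose s hs hsx using fun j => exists_L2_projection (k + 1) (xq j).1
    set E := ∑ j, defect k (xq j) (R j) with hE
    have hE0 : 0 ≤ E := Finset.sum_nonneg fun j _ => defect_nonneg _ _
    have hB0 : 0 ≤ E + C * εu + C * (d + 2 * k) * D := add_nonneg (add_nonneg hE0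
      (mul_nonneg hC0.le hεu)) (mul_nonneg (mul_nonneg hC0.le (by linarith)) hD0)
    -- `c v` is the normal component, on the face opposite to `v`, of the deviation of `Π_V q` from
    -- the `L²` projection. The face equation tested with `c v` bounds it; this is done only for `v
    -- ≠ v0`, where `τ ≤ C`.
    set c : Space d → MvPolynomial (Fin d) ℝ := fun v => ∑ j, nrm K v j • (p j - s j) with hc
    have htop : ∀ j, p j - s j ∈ topPl K k := by
      intro j
      refine ⟨Submodule.sub_mem _ (hp j) (hs j), fun t ht => ?_⟩
      have h1 := h.vec j t ht
      have h2 := hsx j t (Pl_mono (Nat.le_succ k) ht)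
      simp only [Prod.fst_sub, polyPair_fst] at h1
      rw [inner_sub_right] at h1 h2
      rw [map_sub, inner_sub_right]; linarith
    have hctop : ∀ v, c v ∈ topPl K k := fun v =>
      Submodule.sum_mem _ fun j _ => Submodule.smul_mem _ _ (htop j)
    have hnle : ∀ v ∈ K, ∀ j, |nrm K v j| ≤ 1 := by
      intro v hv j
      have := PiLp.norm_apply_le (nrm K v) j
      rwa [(hK.nrm_spec hv).unit] at this
    have hcle : ∀ v ∈ K, v ≠ v0 → ‖pol K (c v)‖ ≤ E + C * εu + C * (d + 2 * k) * D := by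
      intro v hv hne
      have hh := hK.height_pos hv
      have hτv := hτ v hv
      have hτC := hle v hv hne
      have f1 := h.face v hv (c v) (hctop v).1
      have f2 : ∑ j, nrm K v j * fm K v (c v) (polyPair K (p j) - xq j) =
          fm K v (c v) (polyPair K (c v)) -
            ∑ j, nrm K v j * fm K v (c v) (xq j - polyPair K (s j)) := by
        have : polyPair K (c v) = ∑ j, nrm K v j • polyPair K (p j - s j) := by
          rw [hc]; simp only [map_sum, map_smul]
        rw [this, map_sum, ← Finset.sum_sub_distrib]
        refine Finset.sum_congr rfl fun j _ => ?_
        rw [map_smul, smul_eq_mul, ← mul_sub, ← map_sub]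
        congr 2
        rw [map_sub]; abel
      have f3 : |∑ j, nrm K v j * fm K v (c v) (xq j - polyPair K (s j))| ≤
          (height K v)⁻¹ * (‖pol K (c v)‖ * E) := by
        rw [hE, Finset.mul_sum, Finset.mul_sum]
        refine (Finset.abs_sum_le_sum_abs _ _).trans (Finset.sum_le_sum fun j _ => ?_)
        rw [abs_mul]
        have := abs_fm_sub_L2_projection_le hK (hs j) (hsx j) (hR j) (hctop v) hv
        calc _ ≤ 1 * |fm K v (c v) (xq j - polyPair K (s j))| :=
              mul_le_mul_of_nonneg_right (hnle v hv j) (abs_nonneg _)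
          _ ≤ _ := by rw [one_mul]; exact this
      have f4 : |fm K v (c v) (polyPair K δ)| ≤ (height K v)⁻¹ * (‖pol K (c v)‖ *
          ((d + 2 * k) * D)) := by
        rw [fm_top v hδtop (hctop v), abs_mul, abs_of_pos (by positivity)]
        have : |⟪pol K δ, pol K (c v)⟫_ℝ| ≤ D * ‖pol K (c v)‖ :=
          (abs_real_inner_le_norm _ _).trans
            (mul_le_mul_of_nonneg_right hδle (norm_nonneg _))
        calc _ ≤ (d + 2 * k) / height K v * (D * ‖pol K (c v)‖) :=
              mul_le_mul_of_nonneg_left this (by positivity)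
          _ = _ := by ring
      have f5 := hfmu (c v) (hctop v) v hv
      rw [f2, hsplit, fm_top v (hctop v) (hctop v), real_inner_self_eq_norm_sq] at f1
      have f6 : (height K v)⁻¹ * ‖pol K (c v)‖ ^ 2 ≤
          (d + 2 * k) / height K v * ‖pol K (c v)‖ ^ 2 := by
        rw [← one_div]
        gcongr
      have g1 : τ v * fm K v (c v) (xu - polyPair K r) ≤
          C * ((height K v)⁻¹ * (‖pol K (c v)‖ * εu)) := by
        refine (mul_le_mul_of_nonneg_left ((le_abs_self _).trans f5) hτv).trans ?_
        exact mul_le_mul_of_nonneg_right hτC (by positivity)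
      have g2 : -(τ v * fm K v (c v) (polyPair K δ)) ≤
          C * ((height K v)⁻¹ * (‖pol K (c v)‖ * ((d + 2 * k) * D))) := by
        rw [← mul_neg]
        refine (mul_le_mul_of_nonneg_left ((neg_le_abs _).trans f4) hτv).trans ?_
        exact mul_le_mul_of_nonneg_right hτC (by positivity)
      have f7 : (height K v)⁻¹ * ‖pol K (c v)‖ ^ 2 ≤
          (height K v)⁻¹ * (‖pol K (c v)‖ * (E + C * εu + C * (d + 2 * k) * D)) := by
        have := le_abs_self (∑ j, nrm K v j * fm K v (c v) (xq j - polyPair K (s j)))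
        calc _ ≤ (height K v)⁻¹ * (‖pol K (c v)‖ * E) + C * ((height K v)⁻¹ *
              (‖pol K (c v)‖ * εu)) + C * ((height K v)⁻¹ * (‖pol K (c v)‖ *
              ((d + 2 * k) * D))) := by linarith
          _ = _ := by ring
      have f8 := le_of_mul_le_mul_left f7 (inv_pos.2 hh)
      rcases (norm_nonneg (pol K (c v))).eq_or_lt with h0 | h0
      · rw [← h0]; exact hB0
      · exact le_of_mul_le_mul_left (by rw [← sq]; exact f8) h0
    -- The `d` normals of the faces through `v0` recover the vector; the coefficients are edge
    -- lengths over heights, bounded by `σ`.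
    have hrep : p i - s i = ∑ v ∈ opp K v0, ((height K v)⁻¹ * (v0 i - v i)) • c v := by
      have : ∑ v ∈ opp K v0, ((height K v)⁻¹ * (v0 i - v i)) • c v =
          ∑ j, (∑ v ∈ opp K v0, (height K v)⁻¹ * ((v0 i - v i) * nrm K v j)) • (p j - s j) := by
        simp only [hc, Finset.smul_sum, Finset.sum_smul, smul_smul, mul_assoc]
        exact Finset.sum_comm
      rw [this]
      simp only [normal_components_sum hK hv0]
      simp
    have hfin : ‖pol K (p i - s i)‖ ≤ d * σ * (E + C * εu + C * (d + 2 * k) * D) := by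
      rw [hrep, map_sum]
      refine (norm_sum_le _ _).trans ?_
      calc ∑ v ∈ opp K v0, ‖pol K (((height K v)⁻¹ * (v0 i - v i)) • c v)‖
          ≤ ∑ _v ∈ opp K v0, σ * (E + C * εu + C * (d + 2 * k) * D) := by
            refine Finset.sum_le_sum fun v hv => ?_
            obtain ⟨hne, hvK⟩ := IsSimplex.mem_opp.1 hv
            have hh := hK.height_pos hvK
            rw [map_smul, norm_smul, Real.norm_eq_abs, abs_mul, abs_of_pos (inv_pos.2 hh)]
            refine mul_le_mul ?_ (hcle v hvK hne) (norm_nonneg _) ?_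
            · rw [inv_mul_le_iff₀ hh, mul_comm (height K v)]
              exact (hH ▸ abs_coord_sub_le hv0 hvK i).trans (hσ v hvK)
            · exact le_of_mul_le_mul_right (by rw [zero_mul]; exact (hH0.trans_le (hσ v hvK)).le) hh
        _ = _ := by rw [Finset.sum_const, hK.card_opp hv0, nsmul_eq_mul]; ring
    have : pol K (p i) - (xq i).1 = pol K (p i - s i) - ((xq i).1 - pol K (s i)) := by
      rw [map_sub]; abel
    rw [this]
    refine (norm_sub_le _ _).trans ?_
    linarith [(L2_projection_le (hs i) (hsx i) (hR i)).1]

theorem exists_top_repr (ℓ : MvPolynomial (Fin d) ℝ →ₗ[ℝ] ℝ) :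
    ∃ c ∈ topPl K k, ∀ w ∈ topPl K k, ⟪pol K c, pol K w⟫_ℝ = ℓ w := by
  exact exists_repr_of_vanish (topPl K k) ((innerₗ (LK K)).compl₁₂ (pol K) (pol K))
    (fun a _ b _ => show ⟪pol K a, pol K b⟫_ℝ = ⟪pol K b, pol K a⟫_ℝ from real_inner_comm _ _) ℓ (fun a _ ha => by
      have h1 : pol K a = 0 := inner_self_eq_zero.1 (show ⟪pol K a, pol K a⟫_ℝ = 0 from ha)
      rw [pol_injective hK (h1.trans (map_zero _).symm), map_zero])

omit hK in
variable (K) in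
/-- The face moment as a linear function of the polynomial. -/
def fmLin (v : Space d) (x : XK K) : MvPolynomial (Fin d) ℝ →ₗ[ℝ] ℝ where
  toFun μ := fm K v μ x
  map_add' μ ν := fm_add v μ ν x
  map_smul' c μ := fm_smul v c μ x

set_option maxHeartbeats 1000000 in
/-- Existence of the projection on one element. -/
theorem exists_projection {τ : Space d → ℝ} (hτ : ∀ v ∈ K, 0 ≤ τ v) {v0 : Space d} (hv0 : v0 ∈ K)
    (hpos : 0 < τ v0) {xq : Fin d → XK K} (hxq : ∀ i, xq i ∈ H1 K) {xu : XK K} (hxu : xu ∈ H1 K) :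
    ∃ (p : Fin d → MvPolynomial (Fin d) ℝ) (z : MvPolynomial (Fin d) ℝ),
      (∀ i, p i ∈ Pl d (k + 1)) ∧ z ∈ Pl d (k + 1) ∧
      IsProjError K k τ (fun i => polyPair K (p i) - xq i) (polyPair K z - xu) := by
  have hd := hK.dim_pos
  have hn : (0 : ℝ) < d + 2 * k := by
    have : (1 : ℝ) ≤ d := by exact_mod_cast hd
    linarith [(Nat.cast_nonneg k : (0 : ℝ) ≤ k)]
  set S := ∑ v ∈ K, τ v * (height K v)⁻¹ with hS
  have hS0 : 0 < S := by
    refine Finset.sum_pos' (fun v hv => mul_nonneg (hτ v hv) (inv_nonneg.2 (hK.height_pos hv).le))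
      ⟨v0, hv0, mul_pos hpos (inv_pos.2 (hK.height_pos hv0))⟩
  obtain ⟨r, hr, hrx⟩ := exists_L2_projection (k + 1) xu.1
  choose s hs hsx using fun j => exists_L2_projection (k + 1) (xq j).1
  -- The scalar part is prescribed so that the sum of all face equations holds.
  obtain ⟨δ, hδ, hδw⟩ := exists_top_repr (k := k) hK (((d + 2 * k) * S)⁻¹ •
    ((innerₗ (LK K) (∑ i, (xq i).2 i)).comp (pol K) +
      ∑ v ∈ K, τ v • fmLin K v (xu - polyPair K r)))
  set z := r + δ with hzdef
  -- For each vertex, the normal component that would satisfy the equation on the opposite face. The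
  -- flux is then assembled from those with `v ≠ v0`.
  choose c hc hcw using fun v => exists_top_repr (k := k) hK ((height K v / (d + 2 * k)) •
    (∑ j, nrm K v j • fmLin K v (xq j - polyPair K (s j)) + τ v • fmLin K v (xu - polyPair K z)))
  set p : Fin d → MvPolynomial (Fin d) ℝ := fun i =>
    s i + ∑ v ∈ opp K v0, ((height K v)⁻¹ * (v0 i - v i)) • c v with hpdef
  have hp : ∀ i, p i ∈ Pl d (k + 1) := fun i => Submodule.add_mem _ (hs i)
    (Submodule.sum_mem _ fun v _ => Submodule.smul_mem _ _ (hc v).1)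
  have hz : z ∈ Pl d (k + 1) := Submodule.add_mem _ hr hδ.1
  have hvec : ∀ i, ∀ t ∈ Pl d k, ⟪pol K t, (polyPair K (p i) - xq i).1⟫_ℝ = 0 := by
    intro i t ht
    have h1 := hsx i t (Pl_mono (Nat.le_succ k) ht)
    have h2 : (∑ v ∈ opp K v0, ((height K v)⁻¹ * (v0 i - v i)) • c v) ∈ topPl K k :=
      Submodule.sum_mem _ fun v _ => Submodule.smul_mem _ _ (hc v)
    have h3 := h2.2 t ht
    rw [inner_sub_right] at h1
    rw [Prod.fst_sub, polyPair_fst, hpdef, map_add, inner_sub_right, inner_add_right, h3]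
    linarith
  have hscal : ∀ t ∈ Pl d k, ⟪pol K t, (polyPair K z - xu).1⟫_ℝ = 0 := by
    intro t ht
    have h1 := hrx t (Pl_mono (Nat.le_succ k) ht)
    have h3 := hδ.2 t ht
    rw [inner_sub_right] at h1
    rw [Prod.fst_sub, polyPair_fst, hzdef, map_add, inner_sub_right, inner_add_right, h3]
    linarith
  have hnc : ∀ v ∈ opp K v0, ∑ j, nrm K v j • (p j - s j) = c v := by
    intro v hv
    obtain ⟨hne, hvK⟩ := IsSimplex.mem_opp.1 hv
    have h1 : ∀ w ∈ opp K v0, ∑ j, nrm K v j * ((height K w)⁻¹ * (v0 j - w j)) =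
        if w = v then 1 else 0 := by
      intro w hw
      have hwK := (IsSimplex.mem_opp.1 hw).2
      have h2 : ∑ j, nrm K v j * ((height K w)⁻¹ * (v0 j - w j)) =
          (height K w)⁻¹ * ⟪nrm K v, v0 - w⟫_ℝ := by
        rw [PiLp.inner_apply, Finset.mul_sum]
        refine Finset.sum_congr rfl fun j _ => ?_
        simp; ring
      rw [h2]
      split_ifs with h
      · subst h
        rw [hK.inner_vertex hvK (IsSimplex.mem_opp.2 ⟨hne.symm, hv0⟩),
          inv_mul_cancel₀ (hK.height_pos hvK).ne']
      · rw [hK.inner_edge_of_ne hvK hv0 hwK hne (Ne.symm h), mul_zero]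
    have h3 : ∑ j, nrm K v j • (p j - s j) =
        ∑ w ∈ opp K v0, (∑ j, nrm K v j * ((height K w)⁻¹ * (v0 j - w j))) • c w := by
      simp only [hpdef, add_sub_cancel_left, Finset.smul_sum, Finset.sum_smul, smul_smul]
      exact Finset.sum_comm
    rw [h3, Finset.sum_congr rfl fun w hw => by rw [h1 w hw]]
    simp [hv]
  have hface1 : ∀ v ∈ opp K v0, ∀ w ∈ topPl K k,
      ∑ i, nrm K v i * fm K v w (polyPair K (p i) - xq i) +
        τ v * fm K v w (polyPair K z - xu) = 0 := by
    intro v hv w hw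
    have hh := hK.height_pos (IsSimplex.mem_opp.1 hv).2
    have h1 : ∑ i, nrm K v i * fm K v w (polyPair K (p i) - xq i) =
        fm K v w (polyPair K (c v)) - ∑ i, nrm K v i * fm K v w (xq i - polyPair K (s i)) := by
      rw [← hnc v hv, map_sum, map_sum, ← Finset.sum_sub_distrib]
      refine Finset.sum_congr rfl fun j _ => ?_
      rw [map_smul, map_smul, smul_eq_mul, ← mul_sub, ← map_sub]
      congr 2
      rw [map_sub]; abel
    have h2 : ⟪pol K (c v), pol K w⟫_ℝ = (height K v / (d + 2 * k)) *
        (∑ j, nrm K v j * fm K v w (xq j - polyPair K (s j)) +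
          τ v * fm K v w (xu - polyPair K z)) := by
      rw [hcw v w hw, LinearMap.smul_apply, LinearMap.add_apply, LinearMap.sum_apply]
      rfl
    have h3 : fm K v w (polyPair K z - xu) = -fm K v w (xu - polyPair K z) := by
      rw [← map_neg, neg_sub]
    rw [h1, h3, fm_top v (hc v) hw, h2]
    field_simp
    ring
  have hsum : ∀ w ∈ topPl K k, ∑ v ∈ K, (∑ i, nrm K v i * fm K v w (polyPair K (p i) - xq i) +
        τ v * fm K v w (polyPair K z - xu)) = 0 := by
    intro w hw
    rw [Finset.sum_add_distrib, sum_face_top hK hxq hp hvec hw]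
    have h1 : ∀ v ∈ K, τ v * fm K v w (polyPair K z - xu) =
        (d + 2 * k) * (τ v * (height K v)⁻¹) * ⟪pol K δ, pol K w⟫_ℝ -
          τ v * fm K v w (xu - polyPair K r) := by
      intro v hv
      have : polyPair K z - xu = polyPair K δ - (xu - polyPair K r) := by
        rw [hzdef, map_add]; abel
      rw [this, map_sub, fm_top v hδ hw]
      ring
    rw [Finset.sum_congr rfl h1, Finset.sum_sub_distrib, ← Finset.sum_mul, ← Finset.mul_sum, ← hS,
      hδw w hw]
    have h2 : (((innerₗ (LK K)) (∑ i, (xq i).2 i)).comp (pol K)) w =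
        ∑ i, ⟪pol K w, (xq i).2 i⟫_ℝ := by
      change ⟪∑ i, (xq i).2 i, pol K w⟫_ℝ = _
      rw [real_inner_comm, inner_sum]
    rw [LinearMap.smul_apply, LinearMap.add_apply, h2, LinearMap.sum_apply, smul_eq_mul,
      mul_inv_cancel_left₀ (by positivity)]
    simp only [LinearMap.smul_apply, smul_eq_mul, fmLin, LinearMap.coe_mk, AddHom.coe_mk]
    ring
  refine ⟨p, z, hp, hz, hvec, hscal, fun v hv μ hμ => ?_⟩
  -- Moments on a face depend only on values there, so test polynomials orthogonal to lower degrees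
  -- suffice.
  obtain ⟨w, hw, hwμ⟩ := exists_top_eqOn hK hv hμ
  have hH1u : polyPair K z - xu ∈ H1 K := Submodule.sub_mem _ (polyPair_mem_H1 _) hxu
  have hH1q : ∀ i, polyPair K (p i) - xq i ∈ H1 K := fun i =>
    Submodule.sub_mem _ (polyPair_mem_H1 _) (hxq i)
  have e1 : ∑ i, nrm K v i * fm K v μ (polyPair K (p i) - xq i) +
        τ v * fm K v μ (polyPair K z - xu) =
      ∑ i, nrm K v i * fm K v w (polyPair K (p i) - xq i) +
        τ v * fm K v w (polyPair K z - xu) := by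
    rw [fm_eq_of_eqOn hK hv hwμ hH1u]
    congr 1
    exact Finset.sum_congr rfl fun i _ => by rw [fm_eq_of_eqOn hK hv hwμ (hH1q i)]
  rw [e1]
  -- On the remaining face the equation follows from the summed equation and those on the other `d`
  -- faces.
  rcases eq_or_ne v v0 with rfl | hne
  · have h1 := hsum w hw
    classical
    rw [← Finset.add_sum_erase _ _ hv] at h1
    rwa [Finset.sum_eq_zero (s := K.erase v), add_zero] at h1
    intro u hu
    exact hface1 u (IsSimplex.mem_opp.2 (Finset.mem_erase.1 hu)) w hw
  · exact hface1 v (IsSimplex.mem_opp.2 ⟨hne, hv⟩) w hw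

end Projection

/-! ### Geometry of triangulations -/

namespace IsSimplex

variable {d : ℕ} {K L : Finset (Space d)}

theorem volume_hull_opp (hK : IsSimplex K) {v : Space d} (hv : v ∈ K) :
    volume (hull (opp K v)) = 0 := by
  have hint : interior (hull (opp K v)) = ∅ := by
    rw [eq_empty_iff_forall_notMem]
    intro x hx
    have hcont : Continuous fun ε : ℝ => x + ε • nrm K v := by fun_prop
    have hmem : ∀ᶠ ε : ℝ in nhds 0, x + ε • nrm K v ∈ hull (opp K v) := by
      refine hcont.continuousAt.eventually_mem ?_
      rw [zero_smul, add_zero]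
      exact mem_interior_iff_mem_nhds.1 hx
    obtain ⟨ε, hε, hε0⟩ := (hmem.filter_mono nhdsWithin_le_nhds).and
      (self_mem_nhdsWithin : Ioi (0 : ℝ) ∈ nhdsWithin 0 (Ioi 0)) |>.exists
    have h1 := hK.inner_of_mem_face hv hε
    have h2 := hK.inner_of_mem_face hv (interior_subset hx)
    rw [add_sub_right_comm, inner_add_right, h2, inner_smul_right, real_inner_self_eq_norm_sq,
      (hK.nrm_spec hv).unit] at h1
    have : (0 : ℝ) < ε := hε0
    linarith
  have h := (convex_hull (opp K v)).addHaar_frontier volume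
  rwa [frontier, hint, sdiff_empty, (isCompact_hull _).isClosed.closure_eq] at h

/-- A simplex is the intersection of the half spaces bounded by its faces. -/
theorem mem_hull_of_inner_le (hK : IsSimplex K) {x : Space d}
    (h : ∀ w ∈ K, ⟪nrm K w, x - w⟫_ℝ ≤ height K w) : x ∈ hull K := by
  classical
  obtain ⟨u, hu⟩ : K.Nonempty := Finset.card_pos.1 (by rw [hK.card_eq]; omega)
  -- These are the barycentric coordinates of `x`. The coordinate at `u` is taken as one minus the
  -- sum of the others, and its sign follows from the inequality for `u`.
  set l : Space d → ℝ := fun w => 1 - ⟪nrm K w, x - w⟫_ℝ / height K w with hl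
  have hl0 : ∀ w ∈ K, 0 ≤ l w := fun w hw => by
    rw [hl, sub_nonneg, div_le_one (hK.height_pos hw)]; exact h w hw
  have h1 : x - u = ∑ w ∈ opp K u, l w • (w - u) := by
    conv_lhs => rw [← hK.sum_normal_components hu (x - u)]
    refine Finset.sum_congr rfl fun w hw => ?_
    obtain ⟨hne, hwK⟩ := mem_opp.1 hw
    have h2 : ⟪nrm K w, x - u⟫_ℝ = ⟪nrm K w, x - w⟫_ℝ - height K w := by
      rw [← hK.inner_vertex hwK (mem_opp.2 ⟨hne.symm, hu⟩), ← inner_sub_right]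
      congr 1; abel
    have h3 : ⟪nrm K w, x - u⟫_ℝ / height K w = -l w := by
      rw [h2, hl]
      have := (hK.height_pos hwK).ne'
      field_simp; ring
    rw [h3, neg_smul, ← smul_neg, neg_sub]
  have h4 : ⟪nrm K u, x - u⟫_ℝ = height K u * ∑ w ∈ opp K u, l w := by
    rw [h1, inner_sum, Finset.mul_sum]
    refine Finset.sum_congr rfl fun w hw => ?_
    rw [inner_smul_right, hK.inner_vertex hu hw, mul_comm]
  have h5 : ∑ w ∈ opp K u, l w ≤ 1 := by
    have := h u hu
    rw [h4] at this
    exact le_of_mul_le_mul_left (by linarith) (hK.height_pos hu)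
  have h6 : x = (1 - ∑ w ∈ opp K u, l w) • u + ∑ w ∈ opp K u, l w • w := by
    rw [eq_add_of_sub_eq h1]
    simp only [smul_sub, Finset.sum_sub_distrib, ← Finset.sum_smul, sub_smul, one_smul]
    abel
  have h7 : x = ∑ w ∈ K, (if w = u then 1 - ∑ w ∈ opp K u, l w else l w) • w := by
    rw [← Finset.add_sum_erase _ _ hu, if_pos rfl]
    conv_lhs => rw [h6]
    congr 1
    refine Finset.sum_congr rfl fun w hw => ?_
    rw [if_neg (Finset.ne_of_mem_erase hw)]
  rw [h7]
  refine (convex_hull K).sum_mem (fun w hw => ?_) ?_ (fun w hw => subset_hull K hw)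
  · split_ifs
    · linarith
    · exact hl0 w hw
  · rw [← Finset.add_sum_erase _ _ hu, if_pos rfl]
    have : ∑ w ∈ K.erase u, (if w = u then 1 - ∑ w ∈ opp K u, l w else l w) =
        ∑ w ∈ opp K u, l w :=
      Finset.sum_congr rfl fun w hw => by rw [if_neg (Finset.ne_of_mem_erase hw)]
    rw [this]; ring

/-- The barycentre of a face. -/
def faceCenter (F : Finset (Space d)) : Space d := (F.card : ℝ)⁻¹ • ∑ u ∈ F, u

theorem faceCenter_mem {F : Finset (Space d)} (hF : F.Nonempty) : faceCenter F ∈ hull F := by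
  have hc : (F.card : ℝ) ≠ 0 := by exact_mod_cast hF.card_pos.ne'
  rw [faceCenter, Finset.smul_sum]
  refine (convex_hull F).sum_mem (fun _ _ => by positivity) ?_ (fun w hw => subset_hull F hw)
  rw [Finset.sum_const, nsmul_eq_mul, mul_inv_cancel₀ hc]

theorem inner_faceCenter_lt (hK : IsSimplex K) {v w : Space d} (hw : w ∈ opp K v) :
    ⟪nrm K w, faceCenter (opp K v) - w⟫_ℝ < height K w := by
  have hwK := (mem_opp.1 hw).2
  have hd : (0 : ℝ) < (opp K v).card := by exact_mod_cast Finset.card_pos.2 ⟨w, hw⟩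
  have h1 : faceCenter (opp K v) - w = ((opp K v).card : ℝ)⁻¹ • ∑ u ∈ opp K v, (u - w) := by
    rw [Finset.sum_sub_distrib, Finset.sum_const, smul_sub, ← Nat.cast_smul_eq_nsmul ℝ, smul_smul,
      inv_mul_cancel₀ hd.ne', one_smul]
    rfl
  rw [h1, inner_smul_right, inner_sum, inv_mul_lt_iff₀ hd, ← nsmul_eq_mul, ← Finset.sum_const]
  refine Finset.sum_lt_sum (fun u hu => ?_) ⟨w, hw, ?_⟩
  · exact (hK.inner_mem_Icc hwK (subset_hull K (mem_opp.1 hu).2)).2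
  · rw [sub_self, inner_zero_right]; exact hK.height_pos hwK

/-- Points of the relative interior of the face opposite to `v`. -/
theorem inner_lt_of_face (hK : IsSimplex K) {v w x : Space d} (hw : w ∈ opp K v)
    (hx : x ∈ hull (opp K v)) {ε : ℝ} (hε : ε ∈ Ioo (0 : ℝ) 1) :
    ⟪nrm K w, ((1 - ε) • x + ε • faceCenter (opp K v)) - w⟫_ℝ < height K w := by
  have h1 : ((1 - ε) • x + ε • faceCenter (opp K v)) - w =
      (1 - ε) • (x - w) + ε • (faceCenter (opp K v) - w) := by module
  have h2 := (hK.inner_mem_Icc (mem_opp.1 hw).2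
    (hull_mono (F := opp K v) (fun y hy => (mem_opp.1 hy).2) hx)).2
  have h3 := hK.inner_faceCenter_lt hw
  rw [h1, inner_add_right, inner_smul_right, inner_smul_right]
  nlinarith [hε.1, hε.2]

/-- Small displacements into the simplex from the relative interior of a face. -/
theorem eventually_sub_mem (hK : IsSimplex K) {v y : Space d} (hv : v ∈ K)
    (hy : y ∈ hull (opp K v)) (h : ∀ w ∈ opp K v, ⟪nrm K w, y - w⟫_ℝ < height K w) :
    ∀ᶠ ε : ℝ in nhdsWithin 0 (Ioi 0), y - ε • nrm K v ∈ hull K := by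
  have h1 : ∀ᶠ ε : ℝ in nhdsWithin 0 (Ioi 0), ∀ w ∈ opp K v,
      ⟪nrm K w, y - ε • nrm K v - w⟫_ℝ < height K w := by
    rw [Filter.eventually_all_finset]
    intro w hw
    have hc : Continuous fun ε : ℝ => ⟪nrm K w, y - ε • nrm K v - w⟫_ℝ := by fun_prop
    exact (hc.continuousAt.eventually_lt continuousAt_const (by simpa using h w hw)).filter_mono
      nhdsWithin_le_nhds
  filter_upwards [h1, self_mem_nhdsWithin] with ε hε hε0
  refine hK.mem_hull_of_inner_le fun w hw => ?_
  rcases eq_or_ne w v with rfl | hne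
  · have h2 := hK.inner_of_mem_face hw hy
    rw [sub_right_comm, inner_sub_right, h2, inner_smul_right, real_inner_self_eq_norm_sq]
    have : (0 : ℝ) < ε := hε0
    nlinarith [sq_nonneg ‖nrm K w‖]
  · exact (hε w (mem_opp.2 ⟨hne, hw⟩)).le

/-- Normals of two simplices on a common face agree up to sign. -/
theorem normal_eq_or_eq_neg (hK : IsSimplex K) (hL : IsSimplex L) {v v' : Space d} (hv : v ∈ K)
    (hv' : v' ∈ L) (hF : opp K v = opp L v') : nrm L v' = nrm K v ∨ nrm L v' = -nrm K v := by
  obtain ⟨u, hu⟩ := hK.opp_nonempty hv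
  obtain ⟨huv, huK⟩ := mem_opp.1 hu
  have hn := (hK.nrm_spec hv).unit
  have hn' := (hL.nrm_spec hv').unit
  have horth := (hL.nrm_spec hv').orthogonal
  have key : ∀ p : Space d, ⟪nrm L v', p⟫_ℝ =
      ⟪nrm K v, p⟫_ℝ / height K v * ⟪nrm L v', u - v⟫_ℝ := by
    intro p
    conv_lhs => rw [← hK.sum_normal_components huK p]
    rw [inner_sum, Finset.sum_eq_single v]
    · rw [inner_smul_right]
    · intro x hx hxv
      have hxF : x ∈ opp L v' := hF ▸ mem_opp.2 ⟨hxv, (mem_opp.1 hx).2⟩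
      rw [inner_smul_right, horth x hxF u (hF ▸ hu), mul_zero]
    · intro h
      exact absurd (mem_opp.2 ⟨huv.symm, hv⟩) h
  set a := ⟪nrm L v', u - v⟫_ℝ / height K v with ha
  have hpar : nrm L v' = a • nrm K v := by
    refine ext_inner_right ℝ fun p => ?_
    rw [key p, inner_smul_left, ha]
    simp only [conj_trivial]; ring
  have h1 : |a| = 1 := by
    have := congrArg norm hpar
    rwa [norm_smul, hn, hn', mul_one, Real.norm_eq_abs, eq_comm] at this
  rcases (abs_eq zero_le_one).1 h1 with h | h
  · left; rw [hpar, h, one_smul]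
  · right; rw [hpar, h, neg_smul, one_smul]

end IsSimplex

namespace Triangulation

variable {d : ℕ} {Ω : Set (Space d)} (𝒯 : Triangulation Ω)

theorem isSimplex (hd : 1 ≤ d) {K : Finset (Space d)} (hK : K ∈ 𝒯.elements) : IsSimplex K :=
  ⟨hd, 𝒯.card_eq K hK, 𝒯.indep K hK⟩

theorem exists_vertex_notMem {K L : Finset (Space d)} (hK : K ∈ 𝒯.elements) (hL : L ∈ 𝒯.elements)
    (hne : K ≠ L) : ∃ v ∈ K, v ∉ L := by
  by_contra! h
  exact hne (Finset.eq_of_subset_of_card_le h (by rw [𝒯.card_eq K hK, 𝒯.card_eq L hL]))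

/-- By conformity the intersection is spanned by common vertices, and `v` is not one of them. -/
theorem inter_subset_opp {K L : Finset (Space d)} (hK : K ∈ 𝒯.elements) (hL : L ∈ 𝒯.elements)
    {v : Space d} (hv : v ∉ L) : hull K ∩ hull L ⊆ hull (opp K v) := by
  refine (𝒯.conforming K hK L hL).trans (convexHull_mono ?_)
  rintro x ⟨hxK, hxL⟩
  exact IsSimplex.mem_opp.2 ⟨fun h => hv (h ▸ hxL), hxK⟩

theorem volume_inter (hd : 1 ≤ d) {K L : Finset (Space d)} (hK : K ∈ 𝒯.elements)
    (hL : L ∈ 𝒯.elements) (hne : K ≠ L) : volume (hull K ∩ hull L) = 0 := by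
  obtain ⟨v, hv, hvL⟩ := 𝒯.exists_vertex_notMem hK hL hne
  exact measure_mono_null (𝒯.inter_subset_opp hK hL hvL)
    ((𝒯.isSimplex hd hK).volume_hull_opp hv)

theorem cover_hull : ⋃ K ∈ 𝒯.elements, hull K = closure Ω := 𝒯.cover

theorem hull_subset {K : Finset (Space d)} (hK : K ∈ 𝒯.elements) : hull K ⊆ closure Ω := by
  rw [← 𝒯.cover_hull]; exact subset_biUnion_of_mem (u := fun K => hull K) hK

/-- A convex set has a null frontier, and two different elements meet inside a face; neither the
boundary nor the overlaps carry volume. -/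
theorem restrict_eq_sum (hd : 1 ≤ d) (hΩ : Convex ℝ Ω) :
    (volume : Measure (Space d)).restrict Ω = ∑ K ∈ 𝒯.elements, volume.restrict (hull K) := by
  have h1 : (volume : Measure (Space d)).restrict Ω = volume.restrict (closure Ω) := by
    refine Measure.restrict_congr_set ?_
    exact (closure_ae_eq_of_null_frontier (hΩ.addHaar_frontier volume)).symm
  rw [h1, ← 𝒯.cover_hull]
  ext t ht
  rw [Measure.restrict_apply ht, Measure.finsetSum_apply, inter_iUnion₂,
    measure_biUnion_finset₀]
  · exact Finset.sum_congr rfl fun K _ => (Measure.restrict_apply ht).symm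
  · intro K hK L hL hne
    refine measure_mono_null ?_ (𝒯.volume_inter hd hK hL hne)
    exact inter_subset_inter inter_subset_right inter_subset_right
  · exact fun K _ => (ht.inter (IsSimplex.measurableSet_hull K)).nullMeasurableSet

theorem restrict_hull_le (hd : 1 ≤ d) (hΩ : Convex ℝ Ω) {K : Finset (Space d)}
    (hK : K ∈ 𝒯.elements) :
    (volume : Measure (Space d)).restrict (hull K) ≤ volume.restrict Ω := by
  rw [𝒯.restrict_eq_sum hd hΩ]
  exact Finset.single_le_sum (f := fun K => (volume : Measure (Space d)).restrict (hull K))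
    (fun _ _ => Measure.zero_le _) hK

/-- The interiors of two elements are disjoint, as their intersection is an open null set; on the
interior of `K` a single summand survives. -/
theorem toFun_ae (hd : 1 ≤ d) (w : Piecewise d) {K : Finset (Space d)} (hK : K ∈ 𝒯.elements) :
    toFun 𝒯 w =ᵐ[volume.restrict (hull K)] ev (w K) := by
  classical
  have h1 : ∀ᵐ x ∂(volume.restrict (hull K)), x ∈ interior (hull K) := by
    rw [ae_restrict_iff' (IsSimplex.measurableSet_hull K)]
    have : ∀ᵐ x ∂(volume : Measure (Space d)), x ∉ frontier (hull K) :=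
      measure_eq_zero_iff_ae_notMem.1 ((IsSimplex.convex_hull K).addHaar_frontier volume)
    filter_upwards [this] with x hx hxK
    by_contra hcon
    exact hx ⟨subset_closure hxK, hcon⟩
  filter_upwards [h1] with x hx
  rw [toFun, Finset.sum_eq_single K, indicator_of_mem hx]
  · intro L hL hne
    refine indicator_of_notMem (fun hxL => ?_) _
    have hopen : IsOpen (interior (hull K) ∩ interior (hull L)) :=
      isOpen_interior.inter isOpen_interior
    have := hopen.measure_pos volume ⟨x, hx, hxL⟩
    refine this.ne' (measure_mono_null ?_ (𝒯.volume_inter hd hK hL (Ne.symm hne)))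
    exact inter_subset_inter interior_subset interior_subset
  · exact fun h => absurd hK h

theorem diam_le_meshSize {K : Finset (Space d)} (hK : K ∈ 𝒯.elements) :
    Metric.diam (hull K) ≤ 𝒯.meshSize :=
  le_ciSup (f := fun K : 𝒯.elements => Metric.diam (hull K.1)) (finite_range _).bddAbove ⟨K, hK⟩

/-- Two elements sharing a face lie on different sides of it. -/
theorem normal_eq_neg (hd : 1 ≤ d) {K L F : Finset (Space d)} (hK : K ∈ 𝒯.elements)
    (hL : L ∈ 𝒯.elements) (hne : K ≠ L) (hFK : F ∈ facets K) (hFL : F ∈ facets L) :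
    normal L F = -normal K F := by
  have hK' := 𝒯.isSimplex hd hK
  have hL' := 𝒯.isSimplex hd hL
  obtain ⟨v, hv, rfl⟩ := hK'.exists_of_mem_facets hFK
  obtain ⟨v', hv', hF⟩ := hL'.exists_of_mem_facets hFL
  have hvL : v ∉ L := by
    intro h
    refine hne (Finset.eq_of_subset_of_card_le (fun x hx => ?_)
      (by rw [𝒯.card_eq K hK, 𝒯.card_eq L hL]))
    rcases eq_or_ne x v with rfl | hxv
    · exact h
    · have : x ∈ opp L v' := hF ▸ IsSimplex.mem_opp.2 ⟨hxv, hx⟩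
      exact (IsSimplex.mem_opp.1 this).2
  have h := hK'.normal_eq_or_eq_neg hL' hv hv' hF
  have hL1 : normal L (opp K v) = nrm L v' := by rw [hF]
  rw [hL1]
  refine h.resolve_left fun hsame => ?_
  -- If the normals agreed, a small step inwards from the barycentre of the common face would stay
  -- in both simplices, whereas their intersection is contained in the face.
  have hcm := IsSimplex.faceCenter_mem (hK'.opp_nonempty hv)
  have h1 := hK'.eventually_sub_mem hv hcm fun w hw => hK'.inner_faceCenter_lt hw
  have h2 := hL'.eventually_sub_mem hv' (hF ▸ hcm) fun w hw =>
    hL'.inner_faceCenter_lt hw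
  rw [hsame, ← hF] at h2
  obtain ⟨ε, ⟨hεK, hεL⟩, hε0⟩ := (h1.and h2).and
    (self_mem_nhdsWithin : Ioi (0 : ℝ) ∈ nhdsWithin 0 (Ioi 0)) |>.exists
  have h3 := hK'.inner_of_mem_face hv (𝒯.inter_subset_opp hK hL hvL ⟨hεK, hεL⟩)
  rw [sub_right_comm, inner_sub_right, hK'.inner_of_mem_face hv hcm, inner_smul_right,
    real_inner_self_eq_norm_sq, (hK'.nrm_spec hv).unit] at h3
  have : (0 : ℝ) < ε := hε0
  linarith

/-- A face inside the domain belongs to a second element. -/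
theorem exists_neighbour (hd : 1 ≤ d) (hΩ : IsOpen Ω) {K F : Finset (Space d)}
    (hK : K ∈ 𝒯.elements) (hF : F ∈ facets K) (hb : ¬ 𝒯.OnBoundary F) :
    ∃ L ∈ 𝒯.elements, L ≠ K ∧ F ∈ facets L := by
  have hK' := 𝒯.isSimplex hd hK
  obtain ⟨v, hv, rfl⟩ := hK'.exists_of_mem_facets hF
  obtain ⟨x, hx, hxb⟩ := not_subset.1 hb
  have hsub : opp K v ⊆ K := fun y hy => (IsSimplex.mem_opp.1 hy).2
  have hxΩ : x ∈ Ω := by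
    by_contra h
    exact hxb ⟨𝒯.hull_subset hK (IsSimplex.hull_mono hsub hx), by rwa [hΩ.interior_eq]⟩
  have hcm := IsSimplex.faceCenter_mem (hK'.opp_nonempty hv)
  -- A point of the face inside the domain is moved slightly towards the barycentre: it stays in the
  -- open set and enters the relative interior of the face.
  obtain ⟨ε, hεΩ, hε⟩ : ∃ ε : ℝ, (1 - ε) • x + ε • IsSimplex.faceCenter (opp K v) ∈ Ω ∧
      ε ∈ Ioo (0 : ℝ) 1 := by
    have hc : Continuous fun ε : ℝ => (1 - ε) • x + ε • IsSimplex.faceCenter (opp K v) := by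
      fun_prop
    have h1 : ∀ᶠ ε : ℝ in nhdsWithin 0 (Ioi 0),
        (1 - ε) • x + ε • IsSimplex.faceCenter (opp K v) ∈ Ω :=
      (hc.continuousAt.eventually_mem (by simpa using hΩ.mem_nhds hxΩ)).filter_mono
        nhdsWithin_le_nhds
    exact (h1.and (Ioo_mem_nhdsGT zero_lt_one)).exists
  set y := (1 - ε) • x + ε • IsSimplex.faceCenter (opp K v) with hy
  have hyF : y ∈ hull (opp K v) :=
    IsSimplex.convex_hull _ hx hcm (by linarith [hε.2]) hε.1.le (by ring)
  have hylt : ∀ w ∈ opp K v, ⟪nrm K w, y - w⟫_ℝ < height K w := fun w hw =>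
    hK'.inner_lt_of_face hw hx hε
  have hev : ∀ᶠ t : ℝ in nhdsWithin 0 (Ioi 0), ∃ L ∈ 𝒯.elements, L ≠ K ∧
      y + t • nrm K v ∈ hull L := by
    have hc : Continuous fun t : ℝ => y + t • nrm K v := by fun_prop
    have h1 : ∀ᶠ t : ℝ in nhdsWithin 0 (Ioi 0), y + t • nrm K v ∈ Ω :=
      (hc.continuousAt.eventually_mem (by simpa using hΩ.mem_nhds hεΩ)).filter_mono
        nhdsWithin_le_nhds
    filter_upwards [h1, self_mem_nhdsWithin] with t ht ht0
    have h2 := subset_closure ht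
    rw [← 𝒯.cover_hull] at h2
    obtain ⟨L, hL, hLt⟩ := mem_iUnion₂.1 h2
    refine ⟨L, hL, ?_, hLt⟩
    rintro rfl
    have h3 := (hK'.inner_mem_Icc hv hLt).2
    rw [add_sub_right_comm, inner_add_right, hK'.inner_of_mem_face hv hyF, inner_smul_right,
      real_inner_self_eq_norm_sq, (hK'.nrm_spec hv).unit] at h3
    have : (0 : ℝ) < t := ht0
    linarith
  -- Points just outside `K` across the face are covered by other elements; as there are finitely
  -- many, one of them occurs for arbitrarily small displacements and, being closed, contains `y`.
  have hfreq : ∃ L ∈ 𝒯.elements, L ≠ K ∧ ∃ᶠ t : ℝ in nhdsWithin 0 (Ioi 0),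
      y + t • nrm K v ∈ hull L := by
    by_contra! hcon
    have h1 : ∀ᶠ t : ℝ in nhdsWithin 0 (Ioi 0), ∀ L ∈ 𝒯.elements, L ≠ K →
        y + t • nrm K v ∉ hull L := by
      rw [Filter.eventually_all_finset]
      intro L hL
      by_cases hLK : L = K
      · exact Filter.Eventually.of_forall fun t h => absurd hLK h
      · have := hcon L hL hLK
        filter_upwards [this] with t ht _ using ht
    obtain ⟨t, ⟨L, hL, hLK, hLt⟩, ht⟩ := (hev.and h1).exists
    exact ht L hL hLK hLt
  obtain ⟨L, hL, hLK, hLt⟩ := hfreq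
  have hyL : y ∈ hull L := by
    refine (IsSimplex.isCompact_hull L).isClosed.mem_of_frequently_of_tendsto hLt ?_
    have hc : Continuous fun t : ℝ => y + t • nrm K v := by fun_prop
    have := (hc.tendsto 0).mono_left (nhdsWithin_le_nhds (s := Ioi 0))
    simpa using this
  refine ⟨L, hL, hLK, Finset.mem_powersetCard.2 ⟨fun w hw => ?_, hK'.card_opp hv⟩⟩
  -- If `L` missed a vertex `w` of the face, `y` would lie in the face opposite to `w`, but `y` is
  -- in the relative interior.
  by_contra hwL
  have h1 := 𝒯.inter_subset_opp hK hL hwL ⟨IsSimplex.hull_mono hsub hyF, hyL⟩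
  have h2 := hK'.inner_of_mem_face (hsub hw) h1
  exact (hylt w hw).ne h2

open Classical in
/-- The normals of the elements sharing an interior face cancel. -/
theorem sum_normal_eq_zero (hd : 1 ≤ d) (hΩ : IsOpen Ω)
    {F : Finset (Space d)} (hF : F ∈ 𝒯.faces) (hb : ¬ 𝒯.OnBoundary F) :
    ∑ K ∈ 𝒯.elements with F ∈ facets K, normal K F = 0 := by
  obtain ⟨K, hK, hFK⟩ := Finset.mem_biUnion.1 hF
  obtain ⟨L, hL, hLK, hFL⟩ := 𝒯.exists_neighbour hd hΩ hK hFK hb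
  have h1 : {K ∈ 𝒯.elements | F ∈ facets K} = {K, L} := by
    ext J
    simp only [Finset.mem_filter, Finset.mem_insert, Finset.mem_singleton]
    constructor
    -- A third element would have its normal opposite to both of two opposite unit vectors.
    · rintro ⟨hJ, hFJ⟩
      by_contra! hcon
      have e1 := 𝒯.normal_eq_neg hd hK hJ hcon.1.symm hFK hFJ
      have e2 := 𝒯.normal_eq_neg hd hL hJ hcon.2.symm hFL hFJ
      have e3 := 𝒯.normal_eq_neg hd hK hL hLK.symm hFK hFL
      rw [e1, e3, neg_neg] at e2
      have h0 := (normal_spec hd (𝒯.card_eq K hK) (𝒯.indep K hK) hFK).unit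
      have : normal K F = 0 := by
          rw [neg_eq_iff_add_eq_zero, ← two_smul ℝ] at e2
          exact (smul_eq_zero.1 e2).resolve_left two_ne_zero
      rw [this, norm_zero] at h0
      exact zero_ne_one h0
    · rintro (rfl | rfl)
      · exact ⟨hK, hFK⟩
      · exact ⟨hL, hFL⟩
  rw [h1, Finset.sum_pair hLK.symm, 𝒯.normal_eq_neg hd hK hL hLK.symm hFK hFL, add_neg_cancel]

end Triangulation

/-! ### Smooth approximation in convex domains -/

section Mollification

variable {d : ℕ}

/-- Nonnegative smooth functions of integral one, supported in a small ball. -/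
structure IsMollifier (η : ℝ) (ρ : Space d → ℝ) : Prop where
  smooth : ContDiff ℝ ∞ ρ
  nonneg : ∀ x, 0 ≤ ρ x
  integral_eq_one : ∫ x, ρ x = 1
  tsupport_subset : tsupport ρ ⊆ Metric.closedBall 0 η

theorem exists_mollifier {η : ℝ} (hη : 0 < η) : ∃ ρ : Space d → ℝ, IsMollifier η ρ := by
  let b : ContDiffBump (0 : Space d) := ⟨η / 2, η, by linarith, by linarith⟩
  exact ⟨b.normed volume, b.contDiff_normed, b.nonneg_normed, b.integral_normed,
    b.tsupport_normed_eq.subset⟩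

theorem IsMollifier.hasCompactSupport {η : ℝ} {ρ : Space d → ℝ} (h : IsMollifier η ρ) :
    HasCompactSupport ρ :=
  (isCompact_closedBall (0 : Space d) η).of_isClosed_subset (isClosed_tsupport ρ)
    h.tsupport_subset

/-- The contraction towards `x₀`. -/
def dil (x₀ : Space d) (l : ℝ) (x : Space d) : Space d := x₀ + l • (x - x₀)

theorem continuous_dil (x₀ : Space d) (l : ℝ) : Continuous (dil x₀ l) := by
  unfold dil; fun_prop

/-- Mollification after a contraction. -/
def moll (ρ : Space d → ℝ) (x₀ : Space d) (l : ℝ) (f : Space d → ℝ) (x : Space d) : ℝ :=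
  ∫ z, f z * ρ (dil x₀ l x - z)

theorem moll_eq (ρ : Space d → ℝ) (x₀ : Space d) (l : ℝ) (f : Space d → ℝ) :
    moll ρ x₀ l f = fun x => (convolution f ρ (ContinuousLinearMap.mul ℝ ℝ) volume) (dil x₀ l x) :=
  rfl

theorem contDiff_moll {ρ : Space d → ℝ} (hs : ContDiff ℝ ∞ ρ) (hc : HasCompactSupport ρ)
    (x₀ : Space d) (l : ℝ) {f : Space d → ℝ} (hf : Integrable f) :
    ContDiff ℝ ∞ (moll ρ x₀ l f) := by
  rw [moll_eq]
  refine (hc.contDiff_convolution_right _ hf.locallyIntegrable hs).comp ?_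
  unfold dil; fun_prop

theorem partialDeriv_moll {ρ : Space d → ℝ} (hs : ContDiff ℝ ∞ ρ) (hc : HasCompactSupport ρ)
    (x₀ : Space d) (l : ℝ) {f : Space d → ℝ} (hf : Integrable f) (i : Fin d) (x : Space d) :
    partialDeriv i (moll ρ x₀ l f) x = l * moll (partialDeriv i ρ) x₀ l f x := by
  have h1 := hc.hasFDerivAt_convolution_right (ContinuousLinearMap.mul ℝ ℝ) hf.locallyIntegrable
    (hs.of_le (by simp)) (dil x₀ l x)
  have h2 : HasFDerivAt (dil x₀ l) (l • ContinuousLinearMap.id ℝ (Space d)) x := by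
    unfold dil
    exact (((hasFDerivAt_id x).sub_const x₀).const_smul l).const_add x₀
  have h3 := h1.comp x h2
  rw [partialDeriv, moll_eq]
  have h4 : (fun x => (convolution f ρ (ContinuousLinearMap.mul ℝ ℝ) volume) (dil x₀ l x)) =
    (convolution f ρ (ContinuousLinearMap.mul ℝ ℝ) volume) ∘ dil x₀ l := rfl
  rw [h4, h3.fderiv]
  simp only [ContinuousLinearMap.comp_smul, ContinuousLinearMap.comp_id]
  rw [smul_apply, convolution_precompR_apply _ hf.locallyIntegrable (hc.fderiv ℝ)
    (hs.continuous_fderiv (by simp))]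
  rfl

theorem integrable_mul_comp_sub {ρ : Space d → ℝ} (hs : Continuous ρ) (hc : HasCompactSupport ρ)
    {f : Space d → ℝ} (hf : Integrable f) (a : Space d) :
    Integrable (fun z => f z * ρ (a - z)) := by
  obtain ⟨C, hC⟩ := hs.bounded_above_of_compact_support hc
  exact hf.mul_bdd (c := C) (by fun_prop) (Filter.Eventually.of_forall fun z => hC _)

theorem integral_dil_sub {ρ : Space d → ℝ} (x₀ z : Space d) {l : ℝ} (hl : 1 / 2 ≤ l)
    (h0 : ∀ x, 0 ≤ ρ x) (hi : Integrable ρ) (S : Set (Space d)) :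
    ∫ x in S, ρ (dil x₀ l x - z) ≤ 2 ^ d * ∫ x, ρ x := by
  have hl0 : 0 < l := by linarith
  have e : ∀ x, ρ (dil x₀ l x - z) = (fun y => ρ ((x₀ - l • x₀ - z) + y)) (l • x) := by
    intro x
    simp only [dil]; congr 1; module
  have hi2 : Integrable fun x => ρ (dil x₀ l x - z) := by
    simp only [e]
    exact (hi.comp_add_left (x₀ - l • x₀ - z)).comp_smul hl0.ne'
  calc ∫ x in S, ρ (dil x₀ l x - z) ≤ ∫ x, ρ (dil x₀ l x - z) :=
        setIntegral_le_integral hi2 (Filter.Eventually.of_forall fun x => h0 _)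
    _ = |(l ^ d)⁻¹| * ∫ x, ρ x := by
        simp only [e]
        rw [Measure.integral_comp_smul volume (fun y => ρ ((x₀ - l • x₀ - z) + y)) l,
          integral_add_left_eq_self ρ]
        simp
    _ ≤ 2 ^ d * ∫ x, ρ x := by
        refine mul_le_mul_of_nonneg_right ?_ (integral_nonneg h0)
        rw [abs_of_pos (by positivity), ← inv_pow]
        refine pow_le_pow_left₀ (by positivity) ?_ d
        rw [inv_le_comm₀ hl0 (by norm_num)]; linarith

theorem IsMollifier.integrable {η : ℝ} {ρ : Space d → ℝ} (h : IsMollifier η ρ) : Integrable ρ :=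
  h.smooth.continuous.integrable_of_hasCompactSupport h.hasCompactSupport

/-- Mollification is bounded in `L²`. -/
theorem integral_moll_sq_le {η : ℝ} {ρ : Space d → ℝ} (h : IsMollifier η ρ) (x₀ : Space d) {l : ℝ}
    (hl : 1 / 2 ≤ l) {f : Space d → ℝ} (hf : Integrable f) (hf2 : Integrable fun x => f x ^ 2)
    {S : Set (Space d)} (hfin : volume S < ⊤)
    (hint : IntegrableOn (fun x => moll ρ x₀ l f x ^ 2) S) :
    ∫ x in S, moll ρ x₀ l f x ^ 2 ≤ 2 ^ d * ∫ x, f x ^ 2 := by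
  have hρc := h.smooth.continuous
  have hcs := h.hasCompactSupport
  have : IsFiniteMeasure ((volume : Measure (Space d)).restrict S) := ⟨by simpa using hfin⟩
  -- Jensen's inequality for the probability density `ρ`, obtained by expanding a nonnegative
  -- variance. Fubini and the Jacobian of the contraction then give the factor `2^d`.
  have hpt : ∀ x, moll ρ x₀ l f x ^ 2 ≤ ∫ z, f z ^ 2 * ρ (dil x₀ l x - z) := by
    intro x
    set m := moll ρ x₀ l f x with hm
    have i1 := integrable_mul_comp_sub hρc hcs hf (dil x₀ l x)
    have i2 := integrable_mul_comp_sub hρc hcs hf2 (dil x₀ l x)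
    have i3 : Integrable fun z => ρ (dil x₀ l x - z) := h.integrable.comp_sub_left _
    have h1 : 0 ≤ ∫ z, (f z - m) ^ 2 * ρ (dil x₀ l x - z) :=
      integral_nonneg fun z => mul_nonneg (sq_nonneg _) (h.nonneg _)
    have h2 : ∀ z, (f z - m) ^ 2 * ρ (dil x₀ l x - z) = f z ^ 2 * ρ (dil x₀ l x - z) -
        2 * m * (f z * ρ (dil x₀ l x - z)) + m ^ 2 * ρ (dil x₀ l x - z) := fun z => by ring
    simp only [h2] at h1
    have i4 : Integrable fun z => f z ^ 2 * ρ (dil x₀ l x - z) -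
        2 * m * (f z * ρ (dil x₀ l x - z)) := i2.sub (i1.const_mul _)
    rw [integral_add i4 (i3.const_mul _), integral_sub i2 (i1.const_mul _),
      integral_const_mul, integral_const_mul, integral_sub_left_eq_self ρ volume (dil x₀ l x),
      h.integral_eq_one] at h1
    have h3 : ∫ z, f z * ρ (dil x₀ l x - z) = m := rfl
    rw [h3] at h1
    nlinarith
  obtain ⟨C, hC⟩ := hρc.bounded_above_of_compact_support hcs
  have hjoint : Integrable (fun w : Space d × Space d => f w.2 ^ 2 * ρ (dil x₀ l w.1 - w.2))
      (((volume : Measure (Space d)).restrict S).prod volume) := by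
    have h1 : Integrable (fun w : Space d × Space d => (1 : ℝ) * f w.2 ^ 2)
        (((volume : Measure (Space d)).restrict S).prod volume) :=
      (integrable_const (1 : ℝ)).mul_prod hf2
    simp only [one_mul] at h1
    have hcd := continuous_dil x₀ l
    exact h1.mul_bdd (c := C) (by fun_prop) (Filter.Eventually.of_forall fun z => hC _)
  calc ∫ x in S, moll ρ x₀ l f x ^ 2
      ≤ ∫ x in S, ∫ z, f z ^ 2 * ρ (dil x₀ l x - z) :=
        integral_mono hint hjoint.integral_prod_left hpt
    _ = ∫ z, ∫ x in S, f z ^ 2 * ρ (dil x₀ l x - z) := integral_integral_swap hjoint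
    _ ≤ ∫ z, 2 ^ d * f z ^ 2 := by
        refine integral_mono hjoint.integral_prod_right (hf2.const_mul _) fun z => ?_
        simp only
        rw [integral_const_mul, mul_comm]
        refine mul_le_mul_of_nonneg_right ?_ (sq_nonneg _)
        have := integral_dil_sub x₀ z hl h.nonneg h.integrable S
        rwa [h.integral_eq_one, mul_one] at this
    _ = _ := integral_const_mul _ _

/-- Mollifications of continuous functions converge uniformly. -/
theorem abs_moll_sub_le {η : ℝ} {ρ : Space d → ℝ} (h : IsMollifier η ρ) {x₀ x : Space d} {l : ℝ}
    {g : Space d → ℝ} (hg : Continuous g) (hgc : HasCompactSupport g) {ε : ℝ}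
    (hx : ∀ z, dist z (dil x₀ l x) ≤ η → |g z - g x| ≤ ε) :
    |moll ρ x₀ l g x - g x| ≤ ε := by
  have hρc := h.smooth.continuous
  have i3 : Integrable fun z => ρ (dil x₀ l x - z) := h.integrable.comp_sub_left _
  have i1 := integrable_mul_comp_sub hρc h.hasCompactSupport
    (hg.integrable_of_hasCompactSupport hgc) (dil x₀ l x)
  have e3 : ∫ z, ρ (dil x₀ l x - z) = 1 := by
    rw [integral_sub_left_eq_self ρ volume (dil x₀ l x), h.integral_eq_one]
  have e1 : moll ρ x₀ l g x - g x = ∫ z, (g z - g x) * ρ (dil x₀ l x - z) := by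
    simp only [sub_mul]
    rw [integral_sub i1 (i3.const_mul _), integral_const_mul, e3, mul_one]
    rfl
  have e2 : ε = ∫ z, ε * ρ (dil x₀ l x - z) := by rw [integral_const_mul, e3, mul_one]
  rw [e1, e2]
  rw [← Real.norm_eq_abs]
  refine norm_integral_le_of_norm_le (i3.const_mul ε) (Filter.Eventually.of_forall fun z => ?_)
  rw [norm_mul, Real.norm_of_nonneg (h.nonneg _), Real.norm_eq_abs]
  by_cases hz : dil x₀ l x - z ∈ tsupport ρ
  · refine mul_le_mul_of_nonneg_right (hx z ?_) (h.nonneg _)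
    have := h.tsupport_subset hz
    rwa [mem_closedBall_zero_iff, ← dist_eq_norm, dist_comm] at this
  · rw [image_eq_zero_of_notMem_tsupport hz]; simp

end Mollification

/-! ### Density of smooth functions in a bounded convex domain -/

section Domain

variable {d : ℕ} {Ω : Set (Space d)}

theorem memLp_of_continuous (hb : Bornology.IsBounded Ω) (hm : MeasurableSet Ω) {g : Space d → ℝ}
    (hg : Continuous g) : MemLp g 2 (volume.restrict Ω) := by
  have hc : IsCompact (closure Ω) := hb.isCompact_closure
  have : IsFiniteMeasure ((volume : Measure (Space d)).restrict Ω) :=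
    ⟨by simpa using (measure_mono subset_closure).trans_lt hc.measure_lt_top⟩
  obtain ⟨C, hC⟩ := hc.exists_bound_of_continuousOn hg.continuousOn
  exact MemLp.of_bound hg.aestronglyMeasurable C
    ((ae_restrict_iff' hm).2 (Filter.Eventually.of_forall fun x hx => hC x (subset_closure hx)))

theorem integrable_ext (hb : Bornology.IsBounded Ω) (hm : MeasurableSet Ω) (f : L2 Ω) :
    Integrable (Ω.indicator f) := by
  have : IsFiniteMeasure ((volume : Measure (Space d)).restrict Ω) :=
    ⟨by simpa using hb.measure_lt_top⟩
  rw [integrable_indicator_iff hm]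
  exact (Lp.memLp f).integrable (by norm_num)

theorem norm_toL_sq {μ : Measure (Space d)} {f : Space d → ℝ} (hf : MemLp f 2 μ) :
    ‖toL μ f‖ ^ 2 = ∫ x, f x ^ 2 ∂μ := by
  rw [← real_inner_self_eq_norm_sq, inner_toL_toL hf hf]
  simp only [sq]

theorem dist_dil_le {x₀ x z : Space d} {l R η : ℝ} (hl : l ≤ 1) (hR : ‖x - x₀‖ ≤ R)
    (hz : dist z (dil x₀ l x) ≤ η) : dist z x ≤ η + (1 - l) * R := by
  refine (dist_triangle _ (dil x₀ l x) _).trans (add_le_add hz ?_)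
  have : dil x₀ l x - x = (l - 1) • (x - x₀) := by unfold dil; module
  rw [dist_eq_norm, this, norm_smul, Real.norm_eq_abs, abs_sub_comm, abs_of_nonneg (by linarith)]
  exact mul_le_mul_of_nonneg_left hR (by linarith)

/-- Mollifications converge in `L²`. -/
theorem eventually_moll_lt (hb : Bornology.IsBounded Ω) (hm : MeasurableSet Ω) (x₀ : Space d)
    (f : L2 Ω) {ε : ℝ} (hε : 0 < ε) :
    ∃ δ > 0, ∀ l ∈ Ioo (1 - δ) 1, 1 / 2 ≤ l → ∀ η ∈ Ioo 0 δ, ∀ ρ : Space d → ℝ, IsMollifier η ρ →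
      ‖toL (volume.restrict Ω) (moll ρ x₀ l (Ω.indicator f)) - f‖ < ε := by
  have hf2 : MemLp (Ω.indicator f) 2 volume := (memLp_indicator_iff_restrict hm).2 (Lp.memLp f)
  have hfi := integrable_ext hb hm f
  set V := volume.real Ω with hV
  have hV0 : 0 ≤ V := measureReal_nonneg
  set c : ℝ := 2 ^ d + V + 1 + 1 with hc
  have hcpos : 0 < c := by positivity
  set e := ε / (2 * c) with he
  have he0 : 0 < e := by positivity
  -- Reduction to a continuous compactly supported `g`, for which mollification converges uniformly;
  -- the two replacement errors are controlled by the `L²` bound for `moll`.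
  obtain ⟨g, hgc, hgle, hg, hg2⟩ := hf2.exists_hasCompactSupport_eLpNorm_sub_le (by norm_num)
    (ε := ENNReal.ofReal e) (by simpa using he0)
  obtain ⟨R, hR⟩ : ∃ R, ∀ x ∈ Ω, ‖x - x₀‖ ≤ R := by
    obtain ⟨R, hR⟩ := hb.subset_closedBall x₀
    exact ⟨R, fun x hx => by simpa [dist_eq_norm] using hR hx⟩
  obtain ⟨δ', hδ', huc⟩ := Metric.uniformContinuous_iff.1
    (hgc.uniformContinuous_of_continuous hg) e he0
  set M := |R| + 2 with hM
  have hMpos : 0 < M := by positivity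
  refine ⟨δ' / M, by positivity, fun l hl hl2 η hη ρ hρ => ?_⟩
  set T := moll ρ x₀ l with hT
  have hsm : ∀ {f : Space d → ℝ}, Integrable f → MemLp (T f) 2 (volume.restrict Ω) := fun hf =>
    memLp_of_continuous hb hm (contDiff_moll hρ.smooth hρ.hasCompactSupport x₀ l hf).continuous
  have hgi : Integrable g := hg.integrable_of_hasCompactSupport hgc
  have hgr : MemLp g 2 (volume.restrict Ω) := hg2.restrict Ω
  have hfr : MemLp (Ω.indicator f) 2 (volume.restrict Ω) := hf2.restrict Ω
  have hF : toL (volume.restrict Ω) (Ω.indicator f) = f := by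
    rw [toL_congr hfr (indicator_ae_eq_restrict hm), toL_coe]
  have hsub : MemLp (fun x => Ω.indicator f x - g x) 2 volume := hf2.sub hg2
  have hTsub : T (fun x => Ω.indicator f x - g x) = fun x => T (Ω.indicator f) x - T g x := by
    funext x
    simp only [hT, moll, sub_mul]
    exact integral_sub (integrable_mul_comp_sub hρ.smooth.continuous hρ.hasCompactSupport hfi _)
      (integrable_mul_comp_sub hρ.smooth.continuous hρ.hasCompactSupport hgi _)
  have hglobal : ∫ x, (Ω.indicator f x - g x) ^ 2 ≤ e ^ 2 := by
    rw [← norm_toL_sq hsub, norm_toL hsub]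
    refine pow_le_pow_left₀ ENNReal.toReal_nonneg ?_ 2
    exact ENNReal.toReal_le_of_le_ofReal he0.le hgle
  have b1 : ‖toL (volume.restrict Ω) (T (Ω.indicator f)) - toL (volume.restrict Ω) (T g)‖ ≤
      2 ^ d * e := by
    rw [← toL_sub (hsm hfi) (hsm hgi), ← hTsub]
    have hms : MemLp (T fun x => Ω.indicator f x - g x) 2 (volume.restrict Ω) :=
      hsm (hfi.sub hgi)
    have h1 : ‖toL (volume.restrict Ω) (T fun x => Ω.indicator f x - g x)‖ ^ 2 ≤ 2 ^ d * e ^ 2 := by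
      rw [norm_toL_sq hms]
      refine (integral_moll_sq_le hρ x₀ hl2 (hfi.sub hgi) hsub.integrable_sq
        hb.measure_lt_top hms.integrable_sq).trans ?_
      exact mul_le_mul_of_nonneg_left hglobal (by positivity)
    refine le_of_sq_le_sq (h1.trans ?_) (by positivity)
    rw [mul_pow]
    refine mul_le_mul_of_nonneg_right ?_ (sq_nonneg e)
    exact le_self_pow₀ (one_le_pow₀ (by norm_num)) (by norm_num)
  have b2 : ‖toL (volume.restrict Ω) (T g) - toL (volume.restrict Ω) g‖ ≤ (V + 1) * e := by
    rw [← toL_sub (hsm hgi) hgr]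
    have hms : MemLp (fun x => T g x - g x) 2 (volume.restrict Ω) := (hsm hgi).sub hgr
    refine le_of_sq_le_sq ?_ (by positivity)
    have h1 : ‖toL (volume.restrict Ω) fun x => T g x - g x‖ ^ 2 = ∫ x in Ω, (T g x - g x) ^ 2 :=
      norm_toL_sq hms
    rw [h1]
    have h2 : ∫ x in Ω, (T g x - g x) ^ 2 ≤ ∫ _ in Ω, e ^ 2 := by
      refine setIntegral_mono_on hms.integrable_sq ?_ hm fun x hx => ?_
      · exact integrableOn_const hb.measure_lt_top.ne
      · rw [← sq_abs]
        refine pow_le_pow_left₀ (abs_nonneg _) (abs_moll_sub_le hρ hg hgc fun z hz => ?_) 2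
        have h3 := dist_dil_le hl.2.le (hR x hx) hz
        have h4 : η + (1 - l) * R < δ' := by
          have h5 : (1 - l) * R ≤ δ' / M * |R| :=
            (mul_le_mul_of_nonneg_left (le_abs_self R) (by linarith [hl.2])).trans
              (mul_le_mul_of_nonneg_right (by linarith [hl.1]) (abs_nonneg R))
          have h6 : δ' / M * M = δ' := div_mul_cancel₀ _ hMpos.ne'
          have h7 : 0 < δ' / M := by positivity
          have := hη.2
          nlinarith
        have := huc (h3.trans_lt h4)
        rw [Real.dist_eq] at this
        exact this.le
    refine h2.trans ?_
    rw [setIntegral_const, smul_eq_mul, ← hV]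
    nlinarith [mul_nonneg hV0 (sq_nonneg e), mul_nonneg (mul_nonneg hV0 hV0) (sq_nonneg e),
      sq_nonneg e]
  have b3 : ‖toL (volume.restrict Ω) g - toL (volume.restrict Ω) (Ω.indicator f)‖ ≤ e := by
    rw [norm_sub_rev, ← toL_sub hfr hgr]
    have hms := hfr.sub hgr
    refine le_of_sq_le_sq ?_ he0.le
    have h1 : ‖toL (volume.restrict Ω) fun x => Ω.indicator f x - g x‖ ^ 2 =
        ∫ x in Ω, (Ω.indicator f x - g x) ^ 2 := norm_toL_sq hms
    rw [h1]
    exact (setIntegral_le_integral hsub.integrable_sq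
      (Filter.Eventually.of_forall fun x => sq_nonneg _)).trans hglobal
  rw [hF] at b3
  calc ‖toL (volume.restrict Ω) (T (Ω.indicator f)) - f‖
      = ‖(toL (volume.restrict Ω) (T (Ω.indicator f)) - toL (volume.restrict Ω) (T g)) +
        (toL (volume.restrict Ω) (T g) - toL (volume.restrict Ω) g) +
        (toL (volume.restrict Ω) g - f)‖ := by congr 1; abel
    _ ≤ 2 ^ d * e + (V + 1) * e + e :=
        (norm_add_le _ _).trans (add_le_add ((norm_add_le _ _).trans (add_le_add b1 b2)) b3)
    _ = c * e := by rw [hc]; ring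
    _ = ε / 2 := by rw [he]; field_simp
    _ < ε := by linarith

/-- `g` is the weak gradient of `w`. -/
def IsWeakGrad (w : L2 Ω) (g : Fin d → L2 Ω) : Prop :=
  ∀ i, ∀ ψ : Space d → ℝ, ContDiff ℝ ∞ ψ → HasCompactSupport ψ → tsupport ψ ⊆ Ω →
    ∫ x in Ω, w x * partialDeriv i ψ x = -∫ x in Ω, g i x * ψ x

/-- By convexity the contraction maps the closure into the open set, and a compact subset of an open
set has room around it. This makes mollification possible up to the boundary without an extension
operator. -/
theorem dil_thickening (hΩ : IsOpen Ω) (hconv : Convex ℝ Ω) (hb : Bornology.IsBounded Ω)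
    {x₀ : Space d} (hx₀ : x₀ ∈ Ω) {l : ℝ} (hl : l ∈ Ioo (0 : ℝ) 1) :
    ∃ r > 0, ∀ x ∈ Ω, Metric.closedBall (dil x₀ l x) r ⊆ Ω := by
  have hcomp : IsCompact (dil x₀ l '' closure Ω) :=
    hb.isCompact_closure.image (continuous_dil x₀ l)
  have hsub : dil x₀ l '' closure Ω ⊆ Ω := by
    rintro _ ⟨x, hx, rfl⟩
    have h := hconv.combo_interior_closure_mem_interior (x := x₀) (y := x) (by rwa [hΩ.interior_eq])
      hx (a := 1 - l) (b := l) (by linarith [hl.2]) hl.1.le (by ring)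
    rw [hΩ.interior_eq] at h
    have e : dil x₀ l x = (1 - l) • x₀ + l • x := by unfold dil; module
    rwa [e]
  obtain ⟨r, hr, hr2⟩ := hcomp.exists_cthickening_subset_open hΩ hsub
  exact ⟨r, hr, fun x hx => (Metric.closedBall_subset_cthickening
    (mem_image_of_mem _ (subset_closure hx)) r).trans hr2⟩

/-- The reflected mollifier `z ↦ ρ(a - z)` is supported in the domain and is therefore an admissible
test function for the weak gradient. The factor `l` comes from the chain rule. -/
theorem partialDeriv_moll_of_weak (hm : MeasurableSet Ω) (hb : Bornology.IsBounded Ω)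
    {w : L2 Ω} {g : Fin d → L2 Ω} (h : IsWeakGrad w g) {η : ℝ} {ρ : Space d → ℝ}
    (hρ : IsMollifier η ρ) {x₀ x : Space d} {l : ℝ}
    (hx : Metric.closedBall (dil x₀ l x) η ⊆ Ω) (i : Fin d) :
    partialDeriv i (moll ρ x₀ l (Ω.indicator w)) x = l * moll ρ x₀ l (Ω.indicator (g i)) x := by
  rw [partialDeriv_moll hρ.smooth hρ.hasCompactSupport x₀ l (integrable_ext hb hm w)]
  congr 1
  set a := dil x₀ l x with ha
  set ψ : Space d → ℝ := fun z => ρ (a - z) with hψ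
  have hψs : ContDiff ℝ ∞ ψ := hρ.smooth.comp (contDiff_const.sub contDiff_id)
  have hts : tsupport ψ ⊆ Metric.closedBall a η := by
    refine closure_minimal (fun z hz => ?_) Metric.isClosed_closedBall
    have := hρ.tsupport_subset (subset_tsupport ρ (show a - z ∈ Function.support ρ from hz))
    rwa [mem_closedBall_zero_iff, ← dist_eq_norm, dist_comm] at this
  have hψc : HasCompactSupport ψ :=
    (isCompact_closedBall a η).of_isClosed_subset (isClosed_tsupport ψ) hts
  have hder : ∀ z, partialDeriv i ψ z = -partialDeriv i ρ (a - z) := by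
    intro z
    have h1 : HasFDerivAt (fun z : Space d => a - z) (-ContinuousLinearMap.id ℝ (Space d)) z :=
      (hasFDerivAt_id z).const_sub a
    have h2 := ((hρ.smooth.differentiable (by simp) (a - z)).hasFDerivAt).comp z h1
    have h3 : ψ = ρ ∘ fun z => a - z := rfl
    rw [partialDeriv, h3, h2.fderiv]
    simp [partialDeriv]
  have hw := h i ψ hψs hψc (hts.trans hx)
  have e : ∀ (f : L2 Ω) (ζ : Space d → ℝ), ∫ z, Ω.indicator f z * ζ z = ∫ z in Ω, f z * ζ z := by
    intro f ζ
    rw [← integral_indicator hm]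
    refine integral_congr_ae (Filter.Eventually.of_forall fun z => ?_)
    simp only
    by_cases hz : z ∈ Ω
    · simp [hz]
    · simp [hz]
  rw [moll, moll, e, e, ← ha]
  simp only [hder, mul_neg, integral_neg] at hw
  linarith

/-- A function with a weak gradient in a convex domain is a limit of smooth functions. -/
theorem IsWeakGrad.exists_smooth (hΩ : IsOpen Ω) (hconv : Convex ℝ Ω) (hb : Bornology.IsBounded Ω)
    (hne : Ω.Nonempty) {w : L2 Ω} {g : Fin d → L2 Ω} (h : IsWeakGrad w g) {ε : ℝ} (hε : 0 < ε) :
    ∃ φ : Space d → ℝ, ContDiff ℝ ∞ φ ∧ ‖toL (volume.restrict Ω) φ - w‖ < ε ∧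
      ∀ i, ‖toL (volume.restrict Ω) (partialDeriv i φ) - g i‖ < ε := by
  have hm := hΩ.measurableSet
  obtain ⟨x₀, hx₀⟩ := hne
  obtain ⟨δ₀, hδ₀, h0⟩ := eventually_moll_lt hb hm x₀ w hε
  choose δ hδ hi using fun i => eventually_moll_lt hb hm x₀ (g i) (half_pos hε)
  set G := ∑ i, ‖g i‖ with hG
  have hG0 : 0 ≤ G := Finset.sum_nonneg fun i _ => norm_nonneg _
  obtain ⟨r, hr0, hrδ, hr2, hrG, hri⟩ : ∃ r > 0, r ≤ δ₀ ∧ r ≤ 1 / 2 ∧ r * G ≤ ε / 2 ∧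
      ∀ i, r ≤ δ i := by
    have hall : ∀ᶠ r : ℝ in nhdsWithin 0 (Ioi 0), ∀ i, r ≤ δ i := by
      rw [Filter.eventually_all]
      exact fun i => (eventually_le_nhds (hδ i)).filter_mono nhdsWithin_le_nhds
    have h1 : ∀ᶠ r : ℝ in nhdsWithin 0 (Ioi 0), r ≤ min δ₀ (1 / 2) :=
      (eventually_le_nhds (lt_min hδ₀ (by norm_num))).filter_mono nhdsWithin_le_nhds
    have h2 : ∀ᶠ r : ℝ in nhdsWithin 0 (Ioi 0), r ≤ ε / 2 / (G + 1) :=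
      (eventually_le_nhds (by positivity)).filter_mono nhdsWithin_le_nhds
    obtain ⟨r, ⟨⟨hr1, hr2⟩, hr3⟩, hr4⟩ := ((hall.and h1).and h2).and
      (self_mem_nhdsWithin : Ioi (0 : ℝ) ∈ nhdsWithin 0 (Ioi 0)) |>.exists
    have hr0 : (0 : ℝ) < r := hr4
    refine ⟨r, hr0, hr2.trans (min_le_left _ _), hr2.trans (min_le_right _ _), ?_, hr1⟩
    rw [le_div_iff₀ (by positivity)] at hr3
    nlinarith
  -- The contraction is fixed first and the mollification radius afterwards, small relative to the
  -- room the contraction leaves. The bound on `r * G` pays for the factor `l` in front of the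
  -- gradient.
  set l := 1 - r / 2 with hl
  have hl1 : l ∈ Ioo (0 : ℝ) 1 := ⟨by linarith, by linarith⟩
  obtain ⟨s, hs0, hs⟩ := dil_thickening hΩ hconv hb hx₀ hl1
  set η := min (r / 2) s with hη
  have hη0 : 0 < η := lt_min (by linarith) hs0
  have hηr : η ≤ r / 2 := min_le_left _ _
  obtain ⟨ρ, hρ⟩ := exists_mollifier (d := d) hη0
  have hsmooth : ∀ f : L2 Ω, ContDiff ℝ ∞ (moll ρ x₀ l (Ω.indicator f)) := fun f =>
    contDiff_moll hρ.smooth hρ.hasCompactSupport x₀ l (integrable_ext hb hm f)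
  refine ⟨moll ρ x₀ l (Ω.indicator w), hsmooth w, ?_, fun i => ?_⟩
  · exact h0 l ⟨by linarith, hl1.2⟩ (by linarith) η ⟨hη0, by linarith⟩ ρ hρ
  · have h1 := hi i l ⟨by linarith [hri i], hl1.2⟩ (by linarith) η
      ⟨hη0, by linarith [hri i]⟩ ρ hρ
    have hmem := memLp_of_continuous hb hm (hsmooth (g i)).continuous
    have h2 : toL (volume.restrict Ω) (partialDeriv i (moll ρ x₀ l (Ω.indicator w))) =
        l • toL (volume.restrict Ω) (moll ρ x₀ l (Ω.indicator (g i))) := by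
      rw [← toL_smul l hmem]
      refine toL_congr (memLp_of_continuous hb hm (continuous_partialDeriv (hsmooth w) i)) ?_
      rw [Filter.EventuallyEq, ae_restrict_iff' hm]
      refine Filter.Eventually.of_forall fun x hx => partialDeriv_moll_of_weak hm hb h hρ ?_ i
      exact (Metric.closedBall_subset_closedBall (min_le_right _ _)).trans (hs x hx)
    rw [h2]
    set F := toL (volume.restrict Ω) (moll ρ x₀ l (Ω.indicator (g i)))
    have h3 : l • F - g i = l • (F - g i) - (1 - l) • g i := by module
    have h4 : ‖g i‖ ≤ G := Finset.single_le_sum (f := fun i => ‖g i‖) (fun i _ => norm_nonneg _)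
      (Finset.mem_univ i)
    rw [h3]
    refine (norm_sub_le _ _).trans_lt ?_
    rw [norm_smul, norm_smul, Real.norm_of_nonneg hl1.1.le, Real.norm_of_nonneg (by linarith)]
    have h5 : l * ‖F - g i‖ ≤ ‖F - g i‖ := mul_le_of_le_one_left (norm_nonneg _) hl1.2.le
    have h6 : (1 - l) * ‖g i‖ ≤ r * G :=
      mul_le_mul (by linarith) h4 (norm_nonneg _) hr0.le
    linarith

end Domain

/-! ### Iterated derivatives of smooth functions -/

section Derivatives

variable {d : ℕ}

theorem contDiff_partialDeriv {φ : Space d → ℝ} (hφ : ContDiff ℝ ∞ φ) (i : Fin d) :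
    ContDiff ℝ ∞ (partialDeriv i φ) :=
  (hφ.fderiv_right (m := ∞) (by simp)).clm_apply contDiff_const

theorem partialDeriv_comm {φ : Space d → ℝ} (hφ : ContDiff ℝ ∞ φ) (i j : Fin d) :
    partialDeriv i (partialDeriv j φ) = partialDeriv j (partialDeriv i φ) := by
  have h2 : Differentiable ℝ (fderiv ℝ φ) :=
    (hφ.fderiv_right (m := ∞) (by simp)).differentiable (by simp)
  have h : ∀ i j x, partialDeriv i (partialDeriv j φ) x =
      fderiv ℝ (fderiv ℝ φ) x (EuclideanSpace.single i 1) (EuclideanSpace.single j 1) := by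
    intro i j x
    have : partialDeriv j φ = fun y => fderiv ℝ φ y (EuclideanSpace.single j 1) := rfl
    rw [partialDeriv, this, fderiv_clm_apply (h2 x) (differentiableAt_const _)]
    simp
  funext x
  rw [h, h]
  have h3 : (2 : WithTop ℕ∞) ≤ ((⊤ : ℕ∞) : WithTop ℕ∞) := by
    have : ((2 : ℕ∞) : WithTop ℕ∞) ≤ ((⊤ : ℕ∞) : WithTop ℕ∞) := WithTop.coe_le_coe.2 le_top
    exact this
  exact (hφ.contDiffAt.isSymmSndFDerivAt (by simpa using h3)) _ _

/-- Partial differentiation of smooth functions. -/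
def smoothPartial (i : Fin d) : Function.End {φ : Space d → ℝ // ContDiff ℝ ∞ φ} :=
  fun φ => ⟨partialDeriv i φ.1, contDiff_partialDeriv φ.2 i⟩

/-- On smooth functions partial derivatives commute; passing to operators on this subtype makes the
monoid lemma on commuting powers applicable. -/
theorem multiDeriv_eq (β : Fin d → ℕ) (φ : {φ : Space d → ℝ // ContDiff ℝ ∞ φ}) :
    multiDeriv β φ.1 = (opow smoothPartial β φ).1 := by
  have hpow : ∀ (i : Fin d) (n : ℕ) (φ : {φ : Space d → ℝ // ContDiff ℝ ∞ φ}),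
      (partialDeriv i)^[n] φ.1 = ((smoothPartial i ^ n : Function.End _) φ).1 := by
    intro i n
    induction n with
    | zero => intro φ; rfl
    | succ n ih =>
      intro φ
      rw [Function.iterate_succ_apply', ih, pow_succ']
      rfl
  unfold multiDeriv opow
  induction List.finRange d with
  | nil => rfl
  | cons i l ih =>
    rw [List.foldr_cons, ih, List.map_cons, List.prod_cons, hpow]
    rfl

theorem multiDeriv_add_single (β : Fin d → ℕ) (i : Fin d) {φ : Space d → ℝ}
    (hφ : ContDiff ℝ ∞ φ) :
    multiDeriv (β + Pi.single i 1) φ = multiDeriv β (partialDeriv i φ) := by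
  have hc : ∀ i j : Fin d, Commute (smoothPartial i) (smoothPartial j) := fun i j =>
    funext fun φ => Subtype.ext (partialDeriv_comm φ.2 i j)
  have h1 := multiDeriv_eq (β + Pi.single i 1) ⟨φ, hφ⟩
  have h2 := multiDeriv_eq β ⟨partialDeriv i φ, contDiff_partialDeriv hφ i⟩
  rw [h1, h2, (opow_add_single hc β i).2]
  rfl

end Derivatives

/-! ### Weak gradients of the weak derivatives of a Sobolev function -/

section SobolevDerivatives

variable {d m : ℕ} {Ω : Set (Space d)}

theorem sum_add_single (β : Fin d → ℕ) (i : Fin d) :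
    ∑ j, (β + Pi.single i 1 : Fin d → ℕ) j = ∑ j, β j + 1 := by
  simp [Finset.sum_add_distrib]

/-- The weak derivatives of order less than `m` of a function in `H^m` have weak gradients. -/
theorem isWeakGrad_D (v : Sobolev Ω m) {β : Fin d → ℕ} (hβ : ∑ i, β i < m) :
    IsWeakGrad (v.D ⟨β, hβ.le⟩)
      (fun i => v.D ⟨β + Pi.single i 1, by rw [sum_add_single]; exact hβ⟩) := by
  intro i ψ h1 h2 h3
  have hg := partialDeriv_good i ⟨h1, h2⟩
  have e1 := v.2 ⟨β, hβ.le⟩ (partialDeriv i ψ) hg.1 hg.2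
    ((closure_minimal (support_fderiv_apply_subset ψ i) (isClosed_tsupport ψ)).trans h3)
  have e2 := v.2 ⟨β + Pi.single i 1, by rw [sum_add_single]; exact hβ⟩ ψ h1 h2 h3
  simp only [multiDeriv_add_single β i h1, sum_add_single] at e2
  rw [e2, pow_succ] at e1
  have hs : ((-1 : ℝ) ^ (∑ j, β j)) ≠ 0 := pow_ne_zero _ (by norm_num)
  rw [mul_assoc] at e1
  have := mul_left_cancel₀ hs e1
  rw [neg_one_mul] at this
  exact this.symm
where
  support_fderiv_apply_subset (ψ : Space d → ℝ) (i : Fin d) :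
      Function.support (partialDeriv i ψ) ⊆ tsupport ψ := by
    intro x hx
    refine support_fderiv_subset ℝ (f := ψ) fun h => hx ?_
    rw [partialDeriv, h]; rfl

end SobolevDerivatives

/-! ### Restriction to simplices -/

section Restriction

variable {d m : ℕ} {Ω : Set (Space d)} {K : Finset (Space d)}

/-- `K` is, up to null sets, contained in `Ω`. -/
abbrev Inside (K : Finset (Space d)) (Ω : Set (Space d)) : Prop :=
  (volume : Measure (Space d)).restrict (hull K) ≤ volume.restrict Ω

theorem Inside.ae {K : Finset (Space d)} (h : Inside K Ω) {p : Space d → Prop}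
    (hp : ∀ᵐ x ∂(volume.restrict Ω), p x) : ∀ᵐ x ∂(volume.restrict (hull K)), p x :=
  (Measure.absolutelyContinuous_of_le h).ae_le hp

theorem memLp_res (h : Inside K Ω) (F : L2 Ω) : MemLp F 2 (volume.restrict (hull K)) :=
  (Lp.memLp F).mono_measure h

/-- Restriction of square integrable functions to a simplex. -/
def res (h : Inside K Ω) : L2 Ω →L[ℝ] LK K :=
  LinearMap.mkContinuous
    { toFun := fun F => toL _ F
      map_add' := fun F G => by
        rw [← toL_add (memLp_res h F) (memLp_res h G)]
        exact toL_congr (memLp_res h (F + G)) (h.ae (Lp.coeFn_add F G))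
      map_smul' := fun c F => by
        rw [RingHom.id_apply, ← toL_smul c (memLp_res h F)]
        exact toL_congr (memLp_res h (c • F)) (h.ae (Lp.coeFn_smul c F)) } 1
    (fun F => by
      rw [one_mul, LinearMap.coe_mk, AddHom.coe_mk, norm_toL (memLp_res h F), Lp.norm_def]
      exact ENNReal.toReal_mono (Lp.eLpNorm_ne_top F) (eLpNorm_mono_measure _ h))

theorem inner_pol_res (h : Inside K Ω) (p : MvPolynomial (Fin d) ℝ) (F : L2 Ω) :
    ⟪pol K p, res h F⟫_ℝ = ∫ x in hull K, ev p x * F x :=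
  inner_toL_toL (memLp_hull (continuous_ev p)) (memLp_res h F)

theorem res_toL (h : Inside K Ω) {g : Space d → ℝ} (hg : MemLp g 2 (volume.restrict Ω)) :
    res h (toL _ g) = toL _ g :=
  toL_congr (memLp_res h _) (h.ae (coeFn_toL hg))

/-- The linear map `v ↦ D^β v`. -/
def Dmap (β : MultiIndex d m) : Sobolev Ω m →L[ℝ] L2 Ω :=
  (PiLp.proj 2 (fun _ : MultiIndex d m => L2 Ω) β).comp (sobolevSubmodule Ω m).subtypeL

/-- The restriction of a Sobolev function to a simplex, with its gradient. -/
def pairL (h : Inside K Ω) : Sobolev Ω (m + 1) →L[ℝ] XK K :=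
  ((res h).comp (Dmap (MultiIndex.zero d (m + 1)))).prod
    (ContinuousLinearMap.pi fun i => (res h).comp (Dmap (MultiIndex.unit m i)))

theorem pairL_fst (h : Inside K Ω) (v : Sobolev Ω (m + 1)) : (pairL h v).1 = res h v.toL2 := rfl

/-- Smooth functions converging in `H¹(Ω)` converge in `H¹(K)`. -/
theorem tendsto_smoothPair (hb : Bornology.IsBounded Ω) (hm : MeasurableSet Ω) {w : L2 Ω}
    {g : Fin d → L2 Ω} {φ : ℕ → Space d → ℝ} (hφ : ∀ n, ContDiff ℝ ∞ (φ n))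
    (h1 : Filter.Tendsto (fun n => toL (volume.restrict Ω) (φ n)) Filter.atTop (nhds w))
    (h2 : ∀ i, Filter.Tendsto (fun n => toL (volume.restrict Ω) (partialDeriv i (φ n)))
      Filter.atTop (nhds (g i))) (h : Inside K Ω) :
    Filter.Tendsto (fun n => smoothPair K (φ n)) Filter.atTop
      (nhds (res h w, fun i => res h (g i))) := by
  refine Filter.Tendsto.prodMk_nhds ?_ (tendsto_pi_nhds.2 fun i => ?_)
  · have := ((res h).continuous.tendsto w).comp h1
    refine this.congr fun n => ?_
    exact res_toL h (memLp_of_continuous hb hm (hφ n).continuous)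
  · have := ((res h).continuous.tendsto (g i)).comp (h2 i)
    refine this.congr fun n => ?_
    exact res_toL h (memLp_of_continuous hb hm (continuous_partialDeriv (hφ n) i))

/-- One sequence serves all simplices at once, which is what makes moments from the two sides of a
face comparable. -/
theorem IsWeakGrad.exists_seq (hΩ : IsOpen Ω) (hconv : Convex ℝ Ω) (hb : Bornology.IsBounded Ω)
    (hne : Ω.Nonempty) {w : L2 Ω} {g : Fin d → L2 Ω} (hw : IsWeakGrad w g) :
    ∃ φ : ℕ → Space d → ℝ, (∀ n, ContDiff ℝ ∞ (φ n)) ∧ ∀ (K : Finset (Space d)) (h : Inside K Ω),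
      Filter.Tendsto (fun n => smoothPair K (φ n)) Filter.atTop
        (nhds (res h w, fun i => res h (g i))) := by
  choose φ hφ h1 h2 using fun n : ℕ =>
    hw.exists_smooth hΩ hconv hb hne (Nat.one_div_pos_of_nat (α := ℝ) (n := n))
  refine ⟨φ, hφ, fun K h => tendsto_smoothPair hb hΩ.measurableSet hφ ?_ (fun i => ?_) h⟩
  · rw [tendsto_iff_norm_sub_tendsto_zero]
    exact squeeze_zero (fun _ => norm_nonneg _) (fun n => (h1 n).le)
      tendsto_one_div_add_atTop_nhds_zero_nat
  · rw [tendsto_iff_norm_sub_tendsto_zero]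
    exact squeeze_zero (fun _ => norm_nonneg _) (fun n => (h2 n i).le)
      tendsto_one_div_add_atTop_nhds_zero_nat

theorem unit_eq_zero_add (i : Fin d) (h : ∑ j, (0 + Pi.single i 1 : Fin d → ℕ) j ≤ m + 1) :
    (⟨0 + Pi.single i 1, h⟩ : MultiIndex d (m + 1)) = MultiIndex.unit m i :=
  Subtype.ext (zero_add _)

theorem isWeakGrad_grad (v : Sobolev Ω (m + 1)) : IsWeakGrad v.toL2 v.grad := by
  have h := isWeakGrad_D v (β := 0) (by simp)
  simp only [unit_eq_zero_add] at h
  exact h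

variable (hΩ : IsOpen Ω) (hconv : Convex ℝ Ω) (hb : Bornology.IsBounded Ω) (hne : Ω.Nonempty)
include hΩ hconv hb hne

theorem res_mem_H1 {w : L2 Ω} {g : Fin d → L2 Ω} (hw : IsWeakGrad w g) (h : Inside K Ω) :
    (res h w, fun i => res h (g i)) ∈ H1 K := by
  obtain ⟨φ, hφ, ht⟩ := hw.exists_seq hΩ hconv hb hne
  exact (Submodule.isClosed_topologicalClosure _).mem_of_tendsto (ht K h)
    (Filter.Eventually.of_forall fun n => smoothPair_mem_H1 (hφ n))

theorem pairL_mem_H1 (h : Inside K Ω) (v : Sobolev Ω (m + 1)) : pairL h v ∈ H1 K :=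
  res_mem_H1 hΩ hconv hb hne (isWeakGrad_grad v) h

/-- The face moments of a Sobolev function are the same from both sides of a face. -/
theorem fm_pairL_eq {L : Finset (Space d)} (hK : IsSimplex K) (hL : IsSimplex L) (h : Inside K Ω)
    (h' : Inside L Ω) {a b : Space d} (ha : a ∈ K) (hb' : b ∈ L) (hF : opp K a = opp L b)
    (μ : MvPolynomial (Fin d) ℝ) (v : Sobolev Ω (m + 1)) :
    fm K a μ (pairL h v) = fm L b μ (pairL h' v) := by
  obtain ⟨φ, hφ, ht⟩ := (isWeakGrad_grad v).exists_seq hΩ hconv hb hne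
  have h1 := ((fm K a μ).continuous.tendsto _).comp (ht K h)
  have h2 := ((fm L b μ).continuous.tendsto _).comp (ht L h')
  refine tendsto_nhds_unique h1 (h2.congr fun n => ?_)
  rw [Function.comp_apply, Function.comp_apply, fm_smoothPair hK ha μ (hφ n),
    fm_smoothPair hL hb' μ (hφ n), hF]

omit hconv hne in
/-- Moments of traces are face moments. -/
theorem integral_trace (hK : IsSimplex K) (h : Inside K Ω) {a : Space d} (ha : a ∈ K)
    {S : Set (Space d)} (hS : hull (opp K a) ⊆ S) {v : Sobolev Ω (m + 1)} {γ : Space d → ℝ}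
    (hγ : IsTrace v S γ) (μ : MvPolynomial (Fin d) ℝ) :
    ∫ x in hull (opp K a), γ x * ev μ x ∂(surf d) = fm K a μ (pairL h v) := by
  have hm := hΩ.measurableSet
  -- The smooth functions witnessing the trace converge both in `H¹` of the element and in `L²` of
  -- the face, so their face moments have two limits, which must agree.
  choose φ hφ h1 h2 h3 using fun n : ℕ =>
    hγ.2 (ENNReal.ofReal (1 / ((n : ℝ) + 1))) (ENNReal.ofReal_pos.2 Nat.one_div_pos_of_nat)
  have hle : (surf d).restrict (hull (opp K a)) ≤ (surf d).restrict S :=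
    Measure.restrict_mono hS le_rfl
  have := hK.isFiniteMeasure_surf ha
  have hmem : ∀ {g : Space d → ℝ}, Continuous g →
      MemLp g 2 ((surf d).restrict (hull (opp K a))) := by
    intro g hg
    obtain ⟨C, hC⟩ :=
      (IsSimplex.isCompact_hull (opp K a)).exists_bound_of_continuousOn hg.continuousOn
    exact MemLp.of_bound hg.aestronglyMeasurable C ((ae_restrict_iff'
      (IsSimplex.measurableSet_hull _)).2 (Filter.Eventually.of_forall hC))
  have hγm : MemLp γ 2 ((surf d).restrict (hull (opp K a))) := hγ.1.mono_measure hle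
  have key : ∀ {ν : Measure (Space d)} {f g : Space d → ℝ}, MemLp f 2 ν → MemLp g 2 ν → ∀ n : ℕ,
      eLpNorm (fun x => f x - g x) 2 ν < ENNReal.ofReal (1 / ((n : ℝ) + 1)) →
      ‖toL ν f - toL ν g‖ ≤ 1 / ((n : ℝ) + 1) := by
    intro ν f g hf hg n hlt
    have hfg : MemLp (fun x => f x - g x) 2 ν := hf.sub hg
    rw [← toL_sub hf hg, norm_toL hfg]
    exact ENNReal.toReal_le_of_le_ofReal Nat.one_div_pos_of_nat.le hlt.le
  have hlim : ∀ {ν : Measure (Space d)} {f : ℕ → Space d → ℝ} {g : Space d → ℝ},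
      (∀ n, MemLp (f n) 2 ν) → MemLp g 2 ν → (∀ n : ℕ, eLpNorm (fun x => f n x - g x) 2 ν <
        ENNReal.ofReal (1 / ((n : ℝ) + 1))) →
      Filter.Tendsto (fun n => toL ν (f n)) Filter.atTop (nhds (toL ν g)) := by
    intro ν f g hf hg hlt
    rw [tendsto_iff_norm_sub_tendsto_zero]
    exact squeeze_zero (fun _ => norm_nonneg _) (fun n => key (hf n) hg n (hlt n))
      tendsto_one_div_add_atTop_nhds_zero_nat
  have t1 := hlim (fun n => memLp_of_continuous hb hm (hφ n).continuous) (Lp.memLp v.toL2) h1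
  have t2 := fun i => hlim (fun n => memLp_of_continuous hb hm (continuous_partialDeriv (hφ n) i))
    (Lp.memLp (v.grad i)) (fun n => h2 n i)
  have t3 := hlim (fun n => hmem (hφ n).continuous) hγm
    (fun n => (eLpNorm_mono_measure _ hle).trans_lt (h3 n))
  simp only [toL_coe] at t1 t2
  have t4 := ((fm K a μ).continuous.tendsto _).comp (tendsto_smoothPair hb hm hφ t1 t2 h)
  have t5 := (t3.inner tendsto_const_nhds :
    Filter.Tendsto (fun n => ⟪toL ((surf d).restrict (hull (opp K a))) (φ n),
      toL ((surf d).restrict (hull (opp K a))) (ev μ)⟫_ℝ) Filter.atTop _)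
  have e : ∀ {g : Space d → ℝ}, MemLp g 2 ((surf d).restrict (hull (opp K a))) →
      ⟪toL ((surf d).restrict (hull (opp K a))) g,
        toL ((surf d).restrict (hull (opp K a))) (ev μ)⟫_ℝ =
      ∫ x in hull (opp K a), g x * ev μ x ∂(surf d) := fun hg =>
    inner_toL_toL hg (hmem (continuous_ev μ))
  rw [e hγm] at t5
  refine tendsto_nhds_unique (t5.congr fun n => ?_) t4
  rw [e (hmem (hφ n).continuous), Function.comp_apply, fm_smoothPair hK ha μ (hφ n)]

open Classical in
omit hΩ hconv hb hne in
/-- The derivatives of a Sobolev function on a simplex. -/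
def famK (h : Inside K Ω) (v : Sobolev Ω m) (β : Fin d → ℕ) : LK K :=
  if hβ : ∑ i, β i ≤ m then res h (v.D ⟨β, hβ⟩) else 0

theorem isSobolevFamily_famK (h : Inside K Ω) (v : Sobolev Ω m) :
    IsSobolevFamily K m (famK h v) := by
  intro β hβ
  have h1 := res_mem_H1 hΩ hconv hb hne (isWeakGrad_D v hβ) h
  have h2 : famK h v β = res h (v.D ⟨β, hβ.le⟩) := by rw [famK, dif_pos hβ.le]
  have h3 : ∀ i, famK h v (β + Pi.single i 1) =
      res h (v.D ⟨β + Pi.single i 1, by rw [sum_add_single]; exact hβ⟩) := fun i => by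
    rw [famK, dif_pos (by rw [sum_add_single]; exact hβ)]
  simp only [h2, h3]
  exact h1

omit hΩ hconv hb hne in
/-- The norm of the restriction of a Sobolev function to a simplex. -/
def localNorm (h : Inside K Ω) (v : Sobolev Ω m) : ℝ := √(∑ β, ‖res h (v.D β)‖ ^ 2)

omit hΩ hconv hb hne in
theorem norm_res_D_le (h : Inside K Ω) (v : Sobolev Ω m) (β : MultiIndex d m) :
    ‖res h (v.D β)‖ ≤ localNorm h v :=
  Real.le_sqrt_of_sq_le (Finset.single_le_sum (f := fun β => ‖res h (v.D β)‖ ^ 2)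
    (fun _ _ => sq_nonneg _) (Finset.mem_univ β))

/-- Polynomial approximation of the restriction of a Sobolev function to a simplex. -/
theorem exists_approx_pairL {k : ℕ} (hK : IsSimplex K) (h : Inside K Ω) (v : Sobolev Ω (k + 1)) :
    ∃ Q ∈ Pl d (k + 1),
      ‖(pairL h v).1 - pol K Q‖ ≤
        (2 ^ d * d * Metric.diam (hull K)) ^ (k + 1) * localNorm h v ∧
      (∀ i, ‖(pairL h v).2 i - pol K (MvPolynomial.pderiv i Q)‖ ≤
        (2 ^ d * d * Metric.diam (hull K)) ^ k * localNorm h v) ∧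
      defect k (pairL h v) Q ≤
        (1 + k) * ((2 ^ d * d * Metric.diam (hull K)) ^ (k + 1) * localNorm h v) := by
  obtain ⟨Q, hQ, happ⟩ := (isSobolevFamily_famK hΩ hconv hb hne h v).exists_approx hK
    (N := localNorm h v) fun β hβ => by
      rw [famK, dif_pos hβ.le]; exact norm_res_D_le h v _
  have h1 : ‖(pairL h v).1 - pol K Q‖ ≤
      (2 ^ d * d * Metric.diam (hull K)) ^ (k + 1) * localNorm h v := by
    have := happ (k + 1) 0 (by simp)
    rw [pd_zero, famK, dif_pos (by simp)] at this
    exact this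
  have h2 : ∀ i, ‖(pairL h v).2 i - pol K (MvPolynomial.pderiv i Q)‖ ≤
      (2 ^ d * d * Metric.diam (hull K)) ^ k * localNorm h v := by
    intro i
    have := happ k (0 + Pi.single i 1) (by rw [sum_add_single]; simp [add_comm])
    rw [(pd_add_single 0 i Q).1, pd_zero, famK, dif_pos (by rw [sum_add_single]; simp),
      unit_eq_zero_add] at this
    exact this
  refine ⟨Q, hQ, h1, h2, ?_⟩
  have hN : 0 ≤ localNorm h v := Real.sqrt_nonneg _
  have hH : 0 ≤ Metric.diam (hull K) := Metric.diam_nonneg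
  set H := Metric.diam (hull K)
  have h3 : H * ∑ i, ‖(pairL h v).2 i - pol K (MvPolynomial.pderiv i Q)‖ ≤
      (2 ^ d * d * H) ^ (k + 1) * localNorm h v := by
    calc H * ∑ i, ‖(pairL h v).2 i - pol K (MvPolynomial.pderiv i Q)‖
        ≤ H * ∑ _i : Fin d, (2 ^ d * d * H) ^ k * localNorm h v := by
          gcongr with i _
          exact h2 i
      _ = (1 * d * H) * ((2 ^ d * d * H) ^ k * localNorm h v) := by
          rw [Finset.sum_const, Finset.card_univ, Fintype.card_fin, nsmul_eq_mul]; ring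
      _ ≤ (2 ^ d * d * H) * ((2 ^ d * d * H) ^ k * localNorm h v) := by
          gcongr
          exact one_le_pow₀ (by norm_num)
      _ = _ := by ring
  have h4 : (k : ℝ) * ‖(pairL h v).1 - pol K Q‖ ≤
      k * ((2 ^ d * d * H) ^ (k + 1) * localNorm h v) :=
    mul_le_mul_of_nonneg_left h1 (Nat.cast_nonneg k)
  unfold defect
  linarith

end Restriction

/-! ### Splitting norms on the domain into norms on the elements -/

namespace Triangulation

variable {d m : ℕ} {Ω : Set (Space d)} (𝒯 : Triangulation Ω)

theorem inside (hd : 1 ≤ d) (hΩ : Convex ℝ Ω) {K : Finset (Space d)} (hK : K ∈ 𝒯.elements) :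
    Inside K Ω := 𝒯.restrict_hull_le hd hΩ hK

theorem integral_eq_sum (hd : 1 ≤ d) (hΩ : Convex ℝ Ω) {f : Space d → ℝ}
    (hf : IntegrableOn f Ω) : ∫ x in Ω, f x = ∑ K ∈ 𝒯.elements, ∫ x in hull K, f x := by
  have hf' : Integrable f (∑ K ∈ 𝒯.elements, (volume : Measure (Space d)).restrict (hull K)) := by
    rw [← 𝒯.restrict_eq_sum hd hΩ]; exact hf
  rw [𝒯.restrict_eq_sum hd hΩ, integral_finsetSum_measure]
  exact fun K hK => hf'.mono_measure (Finset.single_le_sum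
    (f := fun K => (volume : Measure (Space d)).restrict (hull K))
    (fun _ _ => Measure.zero_le _) hK)

theorem norm_sq_eq_sum (hd : 1 ≤ d) (hΩ : Convex ℝ Ω) (F : L2 Ω) :
    ‖F‖ ^ 2 = ∑ K : 𝒯.elements, ‖res (𝒯.inside hd hΩ K.2) F‖ ^ 2 := by
  have h1 : ‖F‖ ^ 2 = ∫ x in Ω, F x ^ 2 := by
    conv_lhs => rw [← toL_coe F]
    exact norm_toL_sq (Lp.memLp F)
  rw [h1, 𝒯.integral_eq_sum hd hΩ (Lp.memLp F).integrable_sq, ← Finset.sum_coe_sort]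
  refine Finset.sum_congr rfl fun K _ => ?_
  exact (norm_toL_sq (memLp_res (𝒯.inside hd hΩ K.2) F)).symm

theorem sum_localNorm_sq (hd : 1 ≤ d) (hΩ : Convex ℝ Ω) (v : Sobolev Ω m) :
    ∑ K : 𝒯.elements, localNorm (𝒯.inside hd hΩ K.2) v ^ 2 = ‖v‖ ^ 2 := by
  have h1 : ‖v‖ ^ 2 = ∑ β, ‖v.D β‖ ^ 2 := PiLp.norm_sq_eq_of_L2 _ v.1
  rw [h1]
  simp only [𝒯.norm_sq_eq_sum hd hΩ]
  rw [Finset.sum_comm]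
  refine Finset.sum_congr rfl fun K _ => ?_
  exact Real.sq_sqrt (Finset.sum_nonneg fun _ _ => sq_nonneg _)

end Triangulation

/-! ### Polynomials on faces -/

section Faces

variable {d : ℕ}

theorem memLp_face {F : Finset (Space d)} (hF : IsFiniteMeasure ((surf d).restrict (hull F)))
    {g : Space d → ℝ} (hg : Continuous g) : MemLp g 2 ((surf d).restrict (hull F)) := by
  obtain ⟨C, hC⟩ := (IsSimplex.isCompact_hull F).exists_bound_of_continuousOn hg.continuousOn
  exact MemLp.of_bound hg.aestronglyMeasurable C ((ae_restrict_iff'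
    (IsSimplex.measurableSet_hull _)).2 (Filter.Eventually.of_forall hC))

/-- The class of a polynomial in `L²(F)`. -/
def polF (F : Finset (Space d)) (hF : IsFiniteMeasure ((surf d).restrict (hull F))) :
    MvPolynomial (Fin d) ℝ →ₗ[ℝ] Lp ℝ 2 ((surf d).restrict (hull F)) where
  toFun p := toL _ (ev p)
  map_add' p q := by
    rw [← toL_add (memLp_face hF (continuous_ev p)) (memLp_face hF (continuous_ev q))]
    exact congrArg _ (funext (ev_add p q))
  map_smul' c p := by
    rw [RingHom.id_apply, ← toL_smul c (memLp_face hF (continuous_ev p))]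
    exact congrArg _ (funext (ev_smul c p))

theorem inner_polF {F : Finset (Space d)} (hF : IsFiniteMeasure ((surf d).restrict (hull F)))
    (p q : MvPolynomial (Fin d) ℝ) :
    ⟪polF F hF p, polF F hF q⟫_ℝ = ∫ x in hull F, ev p x * ev q x ∂(surf d) :=
  inner_toL_toL (memLp_face hF (continuous_ev p)) (memLp_face hF (continuous_ev q))

theorem fm_polyPair_eq_inner {K : Finset (Space d)} (hK : IsSimplex K) {v : Space d} (hv : v ∈ K)
    (hF : IsFiniteMeasure ((surf d).restrict (hull (opp K v)))) (p μ : MvPolynomial (Fin d) ℝ) :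
    fm K v μ (polyPair K p) = ⟪polF (opp K v) hF p, polF (opp K v) hF μ⟫_ℝ := by
  rw [fm_polyPair hK hv, inner_polF]

/-- Linear maps on finite dimensional spaces are bounded by injective ones. -/
theorem exists_norm_le_of_injOn {M E₁ E₂ : Type*} [AddCommGroup M] [Module ℝ M]
    [NormedAddCommGroup E₁] [NormedSpace ℝ E₁] [NormedAddCommGroup E₂] [NormedSpace ℝ E₂]
    (S : Submodule ℝ M) [FiniteDimensional ℝ S] (f : M →ₗ[ℝ] E₁) (hf : Function.Injective f)
    (g : M →ₗ[ℝ] E₂) : ∃ C : ℝ, 0 ≤ C ∧ ∀ x ∈ S, ‖g x‖ ≤ C * ‖f x‖ := by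
  let f' : S →ₗ[ℝ] E₁ := f ∘ₗ S.subtype
  have hinj : Function.Injective f' := hf.comp Subtype.val_injective
  let e := LinearEquiv.ofInjective f' hinj
  have hfd : FiniteDimensional ℝ (LinearMap.range f') := inferInstance
  let L : LinearMap.range f' →L[ℝ] E₂ :=
    LinearMap.toContinuousLinearMap ((g ∘ₗ S.subtype) ∘ₗ e.symm.toLinearMap)
  refine ⟨‖L‖, L.opNorm_nonneg, fun x hx => ?_⟩
  have h := L.le_opNorm (e ⟨x, hx⟩)
  have h1 : L (e ⟨x, hx⟩) = g x := by simp [L]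
  rw [h1] at h
  exact h

/-- The solvability condition for the projection on a face: different polynomials may coincide
there, so the `L²` form on the face is only semidefinite, and moments must vanish on its kernel. -/
theorem fm_eq_zero_of_integral {K : Finset (Space d)} (hK : IsSimplex K) {v : Space d} (hv : v ∈ K)
    {μ : MvPolynomial (Fin d) ℝ}
    (h : ∫ x in hull (opp K v), ev μ x * ev μ x ∂(surf d) = 0) {x : XK K} (hx : x ∈ H1 K) :
    fm K v μ x = 0 := by
  have h0 : ∀ᵐ y ∂((surf d).restrict (hull (opp K v))), ev μ y = 0 := by
    rw [integral_eq_zero_iff_of_nonneg (fun y => mul_self_nonneg _)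
      (hK.integrable_of_continuous_face hv ((continuous_ev μ).mul (continuous_ev μ)))] at h
    filter_upwards [h] with y hy
    exact mul_self_eq_zero.1 hy
  refine H1_induction (p := fun x => fm K v μ x = 0)
    (isClosed_eq (fm K v μ).continuous continuous_const) (fun φ hφ => ?_) hx
  rw [fm_smoothPair hK hv μ hφ]
  refine integral_eq_zero_of_ae ?_
  filter_upwards [h0] with y hy
  rw [hy, mul_zero]; rfl

/-- The `L²(F)` projection of the trace of an `H¹` function. -/
theorem exists_face_projection {K : Finset (Space d)} (hK : IsSimplex K) {v : Space d} (hv : v ∈ K)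
    (k : ℕ) {x : XK K} (hx : x ∈ H1 K) :
    ∃ m ∈ Pl d (k + 1), ∀ μ ∈ Pl d (k + 1), fm K v μ (polyPair K m) = fm K v μ x := by
  have hF := hK.isFiniteMeasure_surf hv
  obtain ⟨m, hm, h⟩ := exists_repr_of_vanish (Pl d (k + 1))
    ((innerₗ _).compl₁₂ (polF (opp K v) hF) (polF (opp K v) hF))
    (fun a _ b _ => show ⟪polF (opp K v) hF a, polF (opp K v) hF b⟫_ℝ =
      ⟪polF (opp K v) hF b, polF (opp K v) hF a⟫_ℝ from real_inner_comm _ _) (fmLin K v x)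
    (fun a _ ha => by
      have h1 : ⟪polF (opp K v) hF a, polF (opp K v) hF a⟫_ℝ = 0 := ha
      rw [inner_polF] at h1
      exact fm_eq_zero_of_integral hK hv h1 hx)
  refine ⟨m, hm, fun μ hμ => ?_⟩
  rw [fm_polyPair_eq_inner hK hv hF]
  exact h μ hμ

end Faces

/-! ### The equations of the method on elements and faces -/

section Sums

variable {d : ℕ} {Ω : Set (Space d)} (𝒯 : Triangulation Ω)

theorem sumElements_single {K : Finset (Space d)} (hK : K ∈ 𝒯.elements)
    {a : Finset (Space d) → Space d → ℝ} (h : ∀ L, L ≠ K → ∀ x, a L x = 0) :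
    sumElements 𝒯 a = ∫ x in hull K, a K x := by
  rw [sumElements, Finset.sum_eq_single K]
  · intro L _ hL
    simp [h L hL]
  · exact fun hn => absurd hK hn

theorem sumFaces_single (hd : 1 ≤ d) {K : Finset (Space d)} (hK : K ∈ 𝒯.elements)
    {b : Finset (Space d) → Finset (Space d) → Space d → ℝ} (h : ∀ L, L ≠ K → ∀ F x, b L F x = 0) :
    sumFaces 𝒯 b = ∑ v ∈ K, ∫ x in hull (opp K v), b K (opp K v) x ∂(surf d) := by
  rw [sumFaces, Finset.sum_eq_single K,
    (𝒯.isSimplex hd hK).sum_facets fun F => ∫ x in hull F, b K F x ∂(surf d)]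
  · intro L _ hL
    refine Finset.sum_eq_zero fun F _ => ?_
    simp [h L hL]
  · exact fun hn => absurd hK hn

open Classical in
theorem sumFaces_of_face {F : Finset (Space d)}
    {b : Finset (Space d) → Finset (Space d) → Space d → ℝ} (h : ∀ L G, G ≠ F → ∀ x, b L G x = 0) :
    sumFaces 𝒯 b = ∑ K ∈ 𝒯.elements with F ∈ facets K, ∫ x in hull F, b K F x ∂(surf d) := by
  rw [sumFaces, Finset.sum_filter]
  refine Finset.sum_congr rfl fun K _ => ?_
  have h0 : ∀ G ∈ facets K, G ≠ F → ∫ x in hull G, b K G x ∂(surf d) = 0 := by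
    intro G _ hG
    simp [h K G hG]
  split_ifs with hF
  · exact Finset.sum_eq_single_of_mem F hF h0
  · exact Finset.sum_eq_zero fun G hG => h0 G hG fun e => hF (e ▸ hG)

open Classical in
theorem sumBoundary_of_face {F : Finset (Space d)}
    {b : Finset (Space d) → Finset (Space d) → Space d → ℝ} (h : ∀ L G, G ≠ F → ∀ x, b L G x = 0) :
    sumBoundary 𝒯 b = if 𝒯.OnBoundary F then
      ∑ K ∈ 𝒯.elements with F ∈ facets K, ∫ x in hull F, b K F x ∂(surf d) else 0 := by
  have h0 : ∀ K G, G ≠ F → ∫ x in hull G, b K G x ∂(surf d) = 0 := by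
    intro K G hG
    simp [h K G hG]
  split_ifs with hb
  · rw [sumBoundary, Finset.sum_filter]
    refine Finset.sum_congr rfl fun K _ => ?_
    split_ifs with hF
    · exact Finset.sum_eq_single_of_mem F (Finset.mem_filter.2 ⟨hF, hb⟩) fun G _ hG => h0 K G hG
    · exact Finset.sum_eq_zero fun G hG => h0 K G fun e => hF (e ▸ (Finset.mem_filter.1 hG).1)
  · rw [sumBoundary]
    refine Finset.sum_eq_zero fun K _ => Finset.sum_eq_zero fun G hG => h0 K G fun e => hb ?_
    exact e ▸ (Finset.mem_filter.1 hG).2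

open Classical in
/-- A piecewise polynomial supported on a single simplex. -/
def singlePoly (K : Finset (Space d)) (p : MvPolynomial (Fin d) ℝ) : Piecewise d :=
  fun L => if L = K then p else 0

theorem singlePoly_self (K : Finset (Space d)) (p : MvPolynomial (Fin d) ℝ) :
    singlePoly K p K = p := if_pos rfl

theorem singlePoly_of_ne {K L : Finset (Space d)} (h : L ≠ K) (p : MvPolynomial (Fin d) ℝ) :
    singlePoly K p L = 0 := if_neg h

theorem totalDegree_singlePoly_le {k : ℕ} {p : MvPolynomial (Fin d) ℝ} (hp : p ∈ Pl d (k + 1))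
    (K L : Finset (Space d)) : (singlePoly K p L).totalDegree ≤ k := by
  unfold singlePoly
  split_ifs
  · exact mem_Pl_succ.1 hp
  · simp

theorem inner_vev (r s : VPiecewise d) (K : Finset (Space d)) (x : Space d) :
    ⟪vev r K x, vev s K x⟫_ℝ = ∑ i, ev (r i K) x * ev (s i K) x := by
  rw [PiLp.inner_apply]
  exact Finset.sum_congr rfl fun i _ => by simp [vev, mul_comm]

theorem inner_vev_right (r : VPiecewise d) (K : Finset (Space d)) (x n : Space d) :
    ⟪vev r K x, n⟫_ℝ = ∑ i, n i * ev (r i K) x := by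
  rw [PiLp.inner_apply]
  exact Finset.sum_congr rfl fun i _ => by simp [vev]

end Sums

/-! ### The discrete equations localised to one element or one face -/

section Equations

variable {d k m : ℕ} {Ω : Set (Space d)} {𝒯 : Triangulation Ω} {τ : Stabilization d} {α T : ℝ}
  {f : ℝ → L2 Ω} {g : Space d → ℝ} {u₀ : Sobolev Ω (m + 1)} {q₀ : VSobolev Ω (m + 1)}
  {uh : ℝ → Piecewise d} {qh : ℝ → VPiecewise d} {uhat : ℝ → Piecewise d}

theorem integral_face_combination {K : Finset (Space d)} (hK : IsSimplex K) {v : Space d}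
    (hv : v ∈ K) (c : Fin d → ℝ) (P : Fin d → MvPolynomial (Fin d) ℝ) (b : ℝ)
    (Q μ : MvPolynomial (Fin d) ℝ) :
    ∫ x in hull (opp K v), (∑ i, c i * ev (P i) x + b * ev Q x) * ev μ x ∂(surf d) =
      ∑ i, c i * fm K v μ (polyPair K (P i)) + b * fm K v μ (polyPair K Q) := by
  have h : ∑ i, c i * fm K v μ (polyPair K (P i)) + b * fm K v μ (polyPair K Q) =
      fm K v μ (polyPair K (∑ i, c i • P i + b • Q)) := by
    simp [map_sum, map_smul]
  rw [h, fm_polyPair hK hv]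
  refine integral_congr_ae (Filter.Eventually.of_forall fun x => ?_)
  simp [ev_sum]

theorem IsHDGSolution.flux_local (hd : 1 ≤ d)
    (hs : IsHDGSolution 𝒯 k τ α T f g u₀ q₀ uh qh uhat) {t : ℝ} (ht : t ∈ Ioc 0 T)
    {K : Finset (Space d)} (hK : K ∈ 𝒯.elements) {r : Fin d → MvPolynomial (Fin d) ℝ}
    (hr : ∀ i, r i ∈ Pl d (k + 1)) :
    ∑ i, ⟪pol K (r i), pol K (qh t i K)⟫_ℝ -
      ∑ i, ⟪pol K (MvPolynomial.pderiv i (r i)), pol K (uh t K)⟫_ℝ +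
      ∑ v ∈ K, ∑ i, nrm K v i * fm K v (r i) (polyPair K (uhat t (opp K v))) = 0 := by
  have hK' := 𝒯.isSimplex hd hK
  have h := hs.flux_eq t ht (fun i => singlePoly K (r i))
    (fun i L _ => totalDegree_singlePoly_le (hr i) K L)
  rw [sumElements_single 𝒯 hK, sumElements_single 𝒯 hK, sumFaces_single 𝒯 hd hK] at h
  · convert h using 2
    · congr 1
      · simp only [inner_vev, singlePoly_self]
        rw [integral_finsetSum]
        · refine Finset.sum_congr rfl fun i _ => ?_
          rw [real_inner_comm, inner_pol_pol]
        · exact fun i _ => IsSimplex.integrable_of_continuous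
            ((continuous_ev _).mul (continuous_ev _))
      · simp only [pdiv, singlePoly_self, Finset.mul_sum]
        rw [integral_finsetSum]
        · refine Finset.sum_congr rfl fun i _ => ?_
          rw [real_inner_comm, inner_pol_pol]
        · exact fun i _ => IsSimplex.integrable_of_continuous
            ((continuous_ev _).mul (continuous_ev _))
    · refine Finset.sum_congr rfl fun v hv => ?_
      simp only [inner_vev_right, singlePoly_self, Finset.mul_sum]
      rw [integral_finsetSum]
      · refine Finset.sum_congr rfl fun i _ => ?_
        rw [fm_polyPair hK' hv, ← integral_const_mul]
        refine integral_congr_ae (Filter.Eventually.of_forall fun x => ?_)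
        simp only; ring
      · exact fun i _ => hK'.integrable_of_continuous_face hv
          ((continuous_ev _).mul (continuous_const.mul (continuous_ev _)))
  · intro L hL F x
    simp [inner_vev_right, singlePoly_of_ne hL]
  · intro L hL x
    simp [pdiv, singlePoly_of_ne hL]
  · intro L hL x
    simp [inner_vev, singlePoly_of_ne hL]

theorem inner_numFlux {K F : Finset (Space d)} (hn : ‖normal K F‖ = 1) (q : VPiecewise d)
    (w w' : Piecewise d) (x : Space d) :
    ⟪numFlux τ q w w' K F x, normal K F⟫_ℝ =
      ∑ i, normal K F i * ev (q i K) x + τ K F * ev (w K - w' F) x := by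
  rw [numFlux, inner_add_left, inner_vev_right, inner_smul_left, real_inner_self_eq_norm_sq, hn,
    ev_sub]
  simp

theorem IsHDGSolution.balance_local (hd : 1 ≤ d) (hin : ∀ K ∈ 𝒯.elements, Inside K Ω)
    (hs : IsHDGSolution 𝒯 k τ α T f g u₀ q₀ uh qh uhat) {t : ℝ} (ht : t ∈ Ioc 0 T)
    {K : Finset (Space d)} (hK : K ∈ 𝒯.elements) {P w : MvPolynomial (Fin d) ℝ}
    (hP : ∀ x, caputo α (fun s => ev (uh s K) x) t = ev P x) (hw : w ∈ Pl d (k + 1)) :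
    ⟪pol K w, pol K P⟫_ℝ - ∑ i, ⟪pol K (MvPolynomial.pderiv i w), pol K (qh t i K)⟫_ℝ +
      ∑ v ∈ K, (∑ i, nrm K v i * fm K v w (polyPair K (qh t i K)) +
        τ K (opp K v) * fm K v w (polyPair K (uh t K - uhat t (opp K v)))) =
      ⟪pol K w, res (hin K hK) (f t)⟫_ℝ := by
  have hK' := 𝒯.isSimplex hd hK
  have h := hs.balance_eq t ht (singlePoly K w) (fun L _ => totalDegree_singlePoly_le hw K L)
  rw [sumElements_single 𝒯 hK, sumElements_single 𝒯 hK, sumElements_single 𝒯 hK,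
    sumFaces_single 𝒯 hd hK] at h
  · rw [inner_pol_res]
    convert h using 2
    · congr 1
      · rw [inner_pol_pol]
        refine integral_congr_ae (Filter.Eventually.of_forall fun x => ?_)
        simp only [hP, singlePoly_self]; ring
      · have : ∀ x, ⟪vev (qh t) K x, pgrad (singlePoly K w K) x⟫_ℝ =
            ∑ i, ev (MvPolynomial.pderiv i w) x * ev (qh t i K) x := by
          intro x
          rw [inner_vev_right]
          simp [pgrad, singlePoly_self]
        simp only [this]
        rw [integral_finsetSum]
        · exact Finset.sum_congr rfl fun i _ => inner_pol_pol _ _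
        · exact fun i _ => IsSimplex.integrable_of_continuous
            ((continuous_ev _).mul (continuous_ev _))
    · refine Finset.sum_congr rfl fun v hv => ?_
      simp only [inner_numFlux (hK'.nrm_spec hv).unit, singlePoly_self]
      exact (integral_face_combination hK' hv _ _ _ _ _).symm
    · refine funext fun x => ?_
      rw [singlePoly_self, mul_comm]
  · intro L hL F x
    simp [singlePoly_of_ne hL]
  · intro L hL x
    simp [singlePoly_of_ne hL]
  · intro L hL x
    simp [inner_vev_right, pgrad, singlePoly_of_ne hL]
  · intro L hL x
    simp [singlePoly_of_ne hL]

theorem IsHDGSolution.boundary_face (hs : IsHDGSolution 𝒯 k τ α T f g u₀ q₀ uh qh uhat) {t : ℝ}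
    (ht : t ∈ Ioc 0 T) {F : Finset (Space d)} (hF : F ∈ 𝒯.faces) (hb : 𝒯.OnBoundary F)
    {μ : MvPolynomial (Fin d) ℝ} (hμ : μ ∈ Pl d (k + 1)) :
    ∫ x in hull F, ev (uhat t F) x * ev μ x ∂(surf d) =
      ∫ x in hull F, g x * ev μ x ∂(surf d) := by
  classical
  obtain ⟨K, hK, hFK⟩ := Finset.mem_biUnion.1 hF
  have h := hs.boundary_eq t ht (singlePoly F μ) (fun L _ => totalDegree_singlePoly_le hμ F L)
  rw [sumBoundary_of_face 𝒯 (F := F), sumBoundary_of_face 𝒯 (F := F), if_pos hb, if_pos hb,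
    Finset.sum_const, Finset.sum_const, nsmul_eq_mul, nsmul_eq_mul] at h
  · simp only [singlePoly_self] at h
    refine mul_left_cancel₀ ?_ h
    have : 0 < ({K ∈ 𝒯.elements | F ∈ facets K}).card :=
      Finset.card_pos.2 ⟨K, Finset.mem_filter.2 ⟨hK, hFK⟩⟩
    exact_mod_cast this.ne'
  · intro L G hG x
    simp [singlePoly_of_ne hG]
  · intro L G hG x
    simp [singlePoly_of_ne hG]

open Classical in
theorem IsHDGSolution.transmission_face
    (hs : IsHDGSolution 𝒯 k τ α T f g u₀ q₀ uh qh uhat) {t : ℝ} (ht : t ∈ Ioc 0 T)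
    {F : Finset (Space d)} (hb : ¬ 𝒯.OnBoundary F)
    {μ : MvPolynomial (Fin d) ℝ} (hμ : μ ∈ Pl d (k + 1)) :
    ∑ K ∈ 𝒯.elements with F ∈ facets K, ∫ x in hull F,
      ⟪numFlux τ (qh t) (uh t) (uhat t) K F x, normal K F⟫_ℝ * ev μ x ∂(surf d) = 0 := by
  have h := hs.transmission_eq t ht (singlePoly F μ)
    (fun L _ => totalDegree_singlePoly_le hμ F L)
  rw [sumFaces_of_face 𝒯 (F := F), sumBoundary_of_face 𝒯 (F := F), if_neg hb, sub_zero] at h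
  · simp only [singlePoly_self] at h
    exact h
  · intro L G hG x
    simp [singlePoly_of_ne hG]
  · intro L G hG x
    simp [singlePoly_of_ne hG]

theorem exists_monomial_expansion (d j : ℕ) : ∃ N : Finset (Fin d →₀ ℕ), ∀ p ∈ Pl d j,
    p = ∑ n ∈ N, p.coeff n • MvPolynomial.monomial n (1 : ℝ) := by
  have hfin : Finite {n : Fin d →₀ ℕ | n.degree < j} := finite_degree_lt j
  refine ⟨(Set.toFinite {n : Fin d →₀ ℕ | n.degree < j}).toFinset, fun p hp => ?_⟩
  conv_lhs => rw [p.as_sum]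
  have hsub : p.support ⊆ (Set.toFinite {n : Fin d →₀ ℕ | n.degree < j}).toFinset := by
    intro n hn
    rw [Set.Finite.mem_toFinset]
    exact hp hn
  rw [Finset.sum_subset hsub]
  · exact Finset.sum_congr rfl fun n _ => by rw [MvPolynomial.smul_monomial]; simp
  · intro n _ hn
    rw [MvPolynomial.notMem_support_iff.1 hn, map_zero]

/-- Caputo derivatives of polynomials with time dependent coefficients. -/
theorem exists_caputo_poly {j : ℕ} {P : ℝ → MvPolynomial (Fin d) ℝ} (hT : 0 < T)
    (hP : ∀ s ∈ Icc 0 T, P s ∈ Pl d j) (hreg : ∀ x, CaputoRegular α T (fun s => ev (P s) x)) :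
    (∀ ℓ : MvPolynomial (Fin d) ℝ →ₗ[ℝ] ℝ, CaputoRegular α T (fun s => ℓ (P s))) ∧
    ∀ t ∈ Ioc 0 T, ∃ R, ∀ ℓ : MvPolynomial (Fin d) ℝ →ₗ[ℝ] ℝ,
      caputo α (fun s => ℓ (P s)) t = ℓ R := by
  have hall : ∀ ℓ : MvPolynomial (Fin d) ℝ →ₗ[ℝ] ℝ, CaputoRegular α T (fun s => ℓ (P s)) := by
    intro ℓ
    obtain ⟨s, a, hsa⟩ := exists_eval_combination j ℓ
    refine CaputoRegular.congr (f := fun t => ∑ x ∈ s, a x * ev (P t) x) ?_ hT ?_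
    · exact CaputoRegular.sum s fun x _ => (hreg x).const_mul (a x)
    · exact fun t ht => (hsa _ (hP t ht)).symm
  refine ⟨hall, fun t ht => ?_⟩
  -- Regularity is assumed for point values, but the Caputo derivative must again be a polynomial.
  -- Coefficients are finite combinations of point values, hence regular, and are differentiated one
  -- by one.
  obtain ⟨N, hexp⟩ := exists_monomial_expansion d j
  refine ⟨∑ n ∈ N, caputo α (fun s => (P s).coeff n) t • MvPolynomial.monomial n (1 : ℝ),
    fun ℓ => ?_⟩
  have h1 : caputo α (fun s => ℓ (P s)) t =
      caputo α (fun s => ∑ n ∈ N, ℓ (MvPolynomial.monomial n 1) * (P s).coeff n) t := by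
    refine caputo_congr (T := T) (fun s hs => ?_) ht
    conv_lhs => rw [hexp _ (hP s hs)]
    rw [map_sum]
    exact Finset.sum_congr rfl fun n _ => by rw [map_smul, smul_eq_mul, mul_comm]
  rw [h1, CaputoRegular.caputo_sum N (f := fun n s => ℓ (MvPolynomial.monomial n 1) * (P s).coeff n)
    (fun n _ => (hall (MvPolynomial.lcoeff ℝ n)).const_mul _) ht, map_sum]
  refine Finset.sum_congr rfl fun n _ => ?_
  rw [caputo_const_mul, map_smul, smul_eq_mul, mul_comm]

end Equations

/-! ### The approximation error of the projection -/

section ProjectionError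

variable {d k : ℕ} {Ω : Set (Space d)}

/-- The constant in the local error estimate of the projection. -/
def projConst (d k : ℕ) (C σ : ℝ) : ℝ :=
  (2 ^ d * d) ^ (k + 1) * ((2 + k + C) +
    d * σ * ((1 + k) + C * (1 + k) + C * (d + 2 * k) * (1 + k + C)))

theorem projConst_nonneg {C σ : ℝ} (hC : 0 ≤ C) (hσ : 0 ≤ σ) : 0 ≤ projConst d k C σ := by
  unfold projConst; positivity

/-- The same constant is used for both components; the surplus over what the scalar estimate needs
is an explicit nonnegative expression. -/
theorem le_scalar_constant {E Nu Nq C k d σ a b D : ℝ} (hE : 0 ≤ E) (hNu : 0 ≤ Nu) (hNq : 0 ≤ Nq)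
    (hC : 0 ≤ C) (hk : 0 ≤ k) (hd : 0 ≤ d) (hσ : 0 ≤ σ) (ha : a ≤ E * Nu)
    (hD : D ≤ (1 + k) * (E * Nu) + C * (E * Nq)) (hb : b ≤ a + D) :
    b ≤ ((2 + k + C) + d * σ * ((1 + k) + C * (1 + k) + C * (d + 2 * k) * (1 + k + C))) *
      (E * (Nu + Nq)) := by
  have h1 : b ≤ E * Nu + ((1 + k) * (E * Nu) + C * (E * Nq)) := by linarith
  refine h1.trans ((le_add_of_nonneg_right (b := C * (E * Nu) + (2 + k) * (E * Nq) +
    d * σ * ((1 + k) + C * (1 + k) + C * (d + 2 * k) * (1 + k + C)) * (E * (Nu + Nq)))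
    (by positivity)).trans_eq ?_)
  ring

theorem le_vector_constant {E Nu Nq C k d σ a b D S e : ℝ} (hE : 0 ≤ E) (hNu : 0 ≤ Nu)
    (hNq : 0 ≤ Nq) (hC : 0 ≤ C) (hk : 0 ≤ k) (hd : 0 ≤ d) (hσ : 0 ≤ σ) (ha : a ≤ E * Nq)
    (hS : S ≤ (1 + k) * (E * Nq)) (he : e ≤ (1 + k) * (E * Nu))
    (hD : D ≤ (1 + k) * (E * Nu) + C * (E * Nq))
    (hb : b ≤ a + d * σ * (S + C * e + C * (d + 2 * k) * D)) :
    b ≤ ((2 + k + C) + d * σ * ((1 + k) + C * (1 + k) + C * (d + 2 * k) * (1 + k + C))) *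
      (E * (Nu + Nq)) := by
  have h1 : b ≤ E * Nq + d * σ * ((1 + k) * (E * Nq) + C * ((1 + k) * (E * Nu)) +
      C * (d + 2 * k) * ((1 + k) * (E * Nu) + C * (E * Nq))) := by
    refine hb.trans (add_le_add ha ?_)
    gcongr
  refine h1.trans ((le_add_of_nonneg_right (b := E * Nu + (1 + k + C) * (E * (Nu + Nq)) +
    d * σ * ((1 + k) * (E * Nu) + C * (1 + k) * (E * Nq) +
      C * (d + 2 * k) * (C * (E * Nu) + (1 + k) * (E * Nq)))) (by positivity)).trans_eq ?_)
  ring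

theorem localNorm_nonneg {m : ℕ} {K : Finset (Space d)} (h : Inside K Ω) (v : Sobolev Ω m) :
    0 ≤ localNorm h v := Real.sqrt_nonneg _

/-- The abstract estimate with the approximating polynomials inserted. Every gradient error appears
with a factor of the diameter, so all terms have order `k + 1`. -/
theorem local_projection_error (hΩ : IsOpen Ω) (hconv : Convex ℝ Ω) (hb : Bornology.IsBounded Ω)
    (hne : Ω.Nonempty) {K : Finset (Space d)} (hK : IsSimplex K) (hin : Inside K Ω)
    {τ : Space d → ℝ} (hτ : ∀ v ∈ K, 0 ≤ τ v) {v0 : Space d} (hv0 : v0 ∈ K)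
    (hpos : 0 < τ v0) {C σ : ℝ} (hC : 1 / τ v0 ≤ C) (hle : ∀ v ∈ K, v ≠ v0 → τ v ≤ C)
    (hσ0 : 0 ≤ σ) (hσ : ∀ v ∈ K, Metric.diam (hull K) ≤ σ * height K v)
    (q : Fin d → Sobolev Ω (k + 1)) (u : Sobolev Ω (k + 1))
    {p : Fin d → MvPolynomial (Fin d) ℝ} (hp : ∀ i, p i ∈ Pl d (k + 1))
    {z : MvPolynomial (Fin d) ℝ} (hz : z ∈ Pl d (k + 1))
    (h : IsProjError K k τ (fun i => polyPair K (p i) - pairL hin (q i))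
      (polyPair K z - pairL hin u)) :
    ‖pol K z - (pairL hin u).1‖ ≤ projConst d k C σ * Metric.diam (hull K) ^ (k + 1) *
      (localNorm hin u + ∑ j, localNorm hin (q j)) ∧
    ∀ i, ‖pol K (p i) - (pairL hin (q i)).1‖ ≤
      projConst d k C σ * Metric.diam (hull K) ^ (k + 1) *
        (localNorm hin u + ∑ j, localNorm hin (q j)) := by
  obtain ⟨Q, hQ, hQ1, hQ2, hQ3⟩ := exists_approx_pairL hΩ hconv hb hne hK hin u
  choose R hR hR1 hR2 hR3 using fun i => exists_approx_pairL hΩ hconv hb hne hK hin (q i)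
  obtain ⟨e1, e2⟩ := projection_estimate hK hτ hv0 hpos hC hle hσ
    (fun i => pairL_mem_H1 hΩ hconv hb hne hin (q i)) hp hz h hQ hR rfl
  have hC0 : 0 ≤ C := (one_div_pos.2 hpos).le.trans hC
  have hH0 : 0 ≤ Metric.diam (hull K) := Metric.diam_nonneg
  have hNu := localNorm_nonneg hin u
  have hNq := fun j => localNorm_nonneg hin (q j)
  have hd : (1 : ℝ) ≤ 2 ^ d * d := by
    have h1 : (1 : ℝ) ≤ d := by exact_mod_cast hK.dim_pos
    have h2 : (1 : ℝ) ≤ 2 ^ d := one_le_pow₀ (by norm_num)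
    nlinarith
  have hprod : (2 ^ d * d * Metric.diam (hull K)) ^ (k + 1) =
      (2 ^ d * d) ^ (k + 1) * Metric.diam (hull K) ^ (k + 1) := mul_pow _ _ _
  have hstep : ∀ j, Metric.diam (hull K) *
      ‖(pairL hin (q j)).2 j - pol K (MvPolynomial.pderiv j (R j))‖ ≤
      (2 ^ d * d * Metric.diam (hull K)) ^ (k + 1) * localNorm hin (q j) := by
    intro j
    calc _ ≤ Metric.diam (hull K) *
          ((2 ^ d * d * Metric.diam (hull K)) ^ k * localNorm hin (q j)) :=
          mul_le_mul_of_nonneg_left (hR2 j j) hH0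
      _ ≤ (2 ^ d * d * Metric.diam (hull K)) *
          ((2 ^ d * d * Metric.diam (hull K)) ^ k * localNorm hin (q j)) := by
          refine mul_le_mul_of_nonneg_right ?_ (by have := hNq j; positivity)
          nlinarith
      _ = _ := by ring
  set E := (2 ^ d * d * Metric.diam (hull K)) ^ (k + 1) with hE
  have hE0 : 0 ≤ E := by positivity
  have hsumstep : C * Metric.diam (hull K) * ∑ i,
      ‖(pairL hin (q i)).2 i - pol K (MvPolynomial.pderiv i (R i))‖ ≤
      C * (E * ∑ j, localNorm hin (q j)) := by
    rw [mul_assoc, Finset.mul_sum, Finset.mul_sum _ _ E]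
    exact mul_le_mul_of_nonneg_left (Finset.sum_le_sum fun j _ => hstep j) hC0
  have hdef : ∑ j, defect k (pairL hin (q j)) (R j) ≤
      (1 + k) * (E * ∑ j, localNorm hin (q j)) := by
    rw [Finset.mul_sum, Finset.mul_sum]
    exact Finset.sum_le_sum fun j _ => hR3 j
  have hqi : ∀ i, localNorm hin (q i) ≤ ∑ j, localNorm hin (q j) := fun i =>
    Finset.single_le_sum (fun j _ => hNq j) (Finset.mem_univ i)
  have hS0 : 0 ≤ ∑ j, localNorm hin (q j) := Finset.sum_nonneg fun j _ => hNq j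
  have hD := add_le_add hQ3 hsumstep
  have hc : projConst d k C σ * Metric.diam (hull K) ^ (k + 1) *
      (localNorm hin u + ∑ j, localNorm hin (q j)) =
      ((2 + k + C) + d * σ * ((1 + k) + C * (1 + k) + C * (d + 2 * k) * (1 + k + C))) *
        (E * (localNorm hin u + ∑ j, localNorm hin (q j))) := by
    rw [hprod, projConst]; ring
  rw [hc]
  exact ⟨le_scalar_constant hE0 hNu hS0 hC0 (Nat.cast_nonneg k) (Nat.cast_nonneg d) hσ0
      hQ1 hD e1,
    fun i => le_vector_constant hE0 hNu hS0 hC0 (Nat.cast_nonneg k) (Nat.cast_nonneg d) hσ0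
      ((hR1 i).trans (mul_le_mul_of_nonneg_left (hqi i) hE0)) hdef hQ3 hD (e2 i)⟩

theorem Triangulation.meshSize_nonneg (𝒯 : Triangulation Ω) : 0 ≤ 𝒯.meshSize :=
  Real.iSup_nonneg fun _ => Metric.diam_nonneg

theorem sq_add_sum_le (a : ℝ) (b : Fin d → ℝ) :
    (a + ∑ j, b j) ^ 2 ≤ (d + 1) * (a ^ 2 + ∑ j, b j ^ 2) := by
  have h := sq_sum_le_card_mul_sum_sq (s := Finset.univ) (f := (Fin.cons a b : Fin (d + 1) → ℝ))
  simpa [Fin.sum_univ_succ] using h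

/-- Summation of local error estimates over the elements. -/
theorem Triangulation.norm_le_of_local (𝒯 : Triangulation Ω) (hd : 1 ≤ d) (hconv : Convex ℝ Ω)
    {c : ℝ} (hc : 0 ≤ c) (u : Sobolev Ω (k + 1)) (q : VSobolev Ω (k + 1))
    (x : PiLp 2 fun K : 𝒯.elements => LK K.1)
    (y : PiLp 2 fun j : 𝒯.elements × Fin d => LK j.1.1)
    (hx : ∀ K : 𝒯.elements, ‖x K‖ ≤ c * (localNorm (𝒯.inside hd hconv K.2) u +
      ∑ j, localNorm (𝒯.inside hd hconv K.2) (q j)))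
    (hy : ∀ (K : 𝒯.elements) i, ‖y (K, i)‖ ≤ c * (localNorm (𝒯.inside hd hconv K.2) u +
      ∑ j, localNorm (𝒯.inside hd hconv K.2) (q j))) :
    ‖x‖ ≤ c * (d + 1) * (‖u‖ + ‖q‖) ∧ ‖y‖ ≤ c * (d + 1) * (‖u‖ + ‖q‖) := by
  have hS : ∑ K : 𝒯.elements, (localNorm (𝒯.inside hd hconv K.2) u +
      ∑ j, localNorm (𝒯.inside hd hconv K.2) (q j)) ^ 2 ≤ (d + 1) * (‖u‖ + ‖q‖) ^ 2 := by
    have h1 : ‖q‖ ^ 2 = ∑ j, ‖q j‖ ^ 2 := PiLp.norm_sq_eq_of_L2 _ q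
    calc _ ≤ ∑ K : 𝒯.elements, (d + 1 : ℝ) * (localNorm (𝒯.inside hd hconv K.2) u ^ 2 +
          ∑ j, localNorm (𝒯.inside hd hconv K.2) (q j) ^ 2) :=
          Finset.sum_le_sum fun K _ => sq_add_sum_le _ _
      _ = (d + 1) * (‖u‖ ^ 2 + ‖q‖ ^ 2) := by
          rw [← Finset.mul_sum, Finset.sum_add_distrib, Finset.sum_comm,
            𝒯.sum_localNorm_sq hd hconv, h1]
          simp only [𝒯.sum_localNorm_sq hd hconv]
      _ ≤ _ := by
          refine mul_le_mul_of_nonneg_left ?_ (by positivity)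
          nlinarith [norm_nonneg u, norm_nonneg q]
  have hd0 : (0 : ℝ) ≤ d := Nat.cast_nonneg d
  have hR : 0 ≤ c * (d + 1) * (‖u‖ + ‖q‖) := by positivity
  have key : ∀ K : 𝒯.elements, ∀ a : ℝ, 0 ≤ a → a ≤ c * (localNorm (𝒯.inside hd hconv K.2) u +
      ∑ j, localNorm (𝒯.inside hd hconv K.2) (q j)) → a ^ 2 ≤
      c ^ 2 * (localNorm (𝒯.inside hd hconv K.2) u +
      ∑ j, localNorm (𝒯.inside hd hconv K.2) (q j)) ^ 2 := by
    intro K a ha h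
    rw [← mul_pow]
    exact pow_le_pow_left₀ ha h 2
  constructor
  · refine abs_le_of_sq_le_sq' ?_ hR |>.2
    rw [PiLp.norm_sq_eq_of_L2]
    calc _ ≤ ∑ K : 𝒯.elements, c ^ 2 * (localNorm (𝒯.inside hd hconv K.2) u +
          ∑ j, localNorm (𝒯.inside hd hconv K.2) (q j)) ^ 2 :=
          Finset.sum_le_sum fun K _ => key K _ (norm_nonneg _) (hx K)
      _ ≤ c ^ 2 * ((d + 1) * (‖u‖ + ‖q‖) ^ 2) := by
          rw [← Finset.mul_sum]
          exact mul_le_mul_of_nonneg_left hS (sq_nonneg c)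
      _ ≤ _ := by
          have : 0 ≤ c ^ 2 * (‖u‖ + ‖q‖) ^ 2 := by positivity
          nlinarith
  · refine abs_le_of_sq_le_sq' ?_ hR |>.2
    rw [PiLp.norm_sq_eq_of_L2, Fintype.sum_prod_type]
    calc _ ≤ ∑ K : 𝒯.elements, ∑ _i : Fin d, c ^ 2 * (localNorm (𝒯.inside hd hconv K.2) u +
          ∑ j, localNorm (𝒯.inside hd hconv K.2) (q j)) ^ 2 :=
          Finset.sum_le_sum fun K _ => Finset.sum_le_sum fun i _ =>
            key K _ (norm_nonneg _) (hy K i)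
      _ ≤ d * (c ^ 2 * ((d + 1) * (‖u‖ + ‖q‖) ^ 2)) := by
          simp only [Finset.sum_const, Finset.card_univ, Fintype.card_fin, nsmul_eq_mul]
          rw [← Finset.mul_sum, ← Finset.mul_sum]
          exact mul_le_mul_of_nonneg_left (mul_le_mul_of_nonneg_left hS (sq_nonneg c)) hd0
      _ ≤ _ := by
          have : 0 ≤ c ^ 2 * (‖u‖ + ‖q‖) ^ 2 := by positivity
          nlinarith

end ProjectionError

/-! ### Functions of class `C¹` in time -/

section C1

variable {X : Type*} [NormedAddCommGroup X] [NormedSpace ℝ X] {T A : ℝ} {v : ℝ → X}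

theorem norm_le_c1Norm (hT : 0 < T) (hv : ContDiffOn ℝ 1 v (Icc 0 T)) {t : ℝ} (ht : t ∈ Icc 0 T) :
    ‖v t‖ ≤ c1Norm T v ∧ ‖derivWithin v (Icc 0 T) t‖ ≤ c1Norm T v := by
  have hc := hv.continuousOn
  have hc' := hv.continuousOn_derivWithin (uniqueDiffOn_Icc hT) le_rfl
  have key : ∀ w : ℝ → X, ContinuousOn w (Icc 0 T) →
      BddAbove (range fun t : Icc (0 : ℝ) T => ‖w t‖) := by
    intro w hw
    obtain ⟨M, hM⟩ := isCompact_Icc.exists_bound_of_continuousOn hw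
    exact ⟨M, by rintro _ ⟨s, rfl⟩; exact hM s s.2⟩
  have h1 := le_ciSup (key v hc) ⟨t, ht⟩
  have h2 := le_ciSup (key _ hc') ⟨t, ht⟩
  have h3 : 0 ≤ ⨆ t : Icc (0 : ℝ) T, ‖v t‖ := Real.iSup_nonneg fun _ => norm_nonneg _
  have h4 : 0 ≤ ⨆ t : Icc (0 : ℝ) T, ‖derivWithin v (Icc 0 T) t‖ :=
    Real.iSup_nonneg fun _ => norm_nonneg _
  dsimp only at h1 h2
  exact ⟨h1.trans (le_add_of_nonneg_right h4), h2.trans (le_add_of_nonneg_left h3)⟩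

theorem norm_sub_le_c1Norm (hT : 0 < T) (hv : ContDiffOn ℝ 1 v (Icc 0 T)) {s t : ℝ}
    (hs : s ∈ Icc 0 T) (ht : t ∈ Icc 0 T) : ‖v s - v t‖ ≤ c1Norm T v * |s - t| := by
  exact (convex_Icc 0 T).norm_image_sub_le_of_norm_derivWithin_le
    (hv.differentiableOn one_ne_zero) (fun x hx => (norm_le_c1Norm hT hv hx).2) ht hs

end C1

/-! ### The error equations at a fixed time -/

section Local

variable {d k : ℕ} {K : Finset (Space d)}

variable (K) in
/-- The linear form on the right hand side of the balance equation on an element: `q` is the flux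
and `w v` the jump on the face opposite to `v`. -/
def fluxForm (τ : Space d → ℝ) (q : Fin d → MvPolynomial (Fin d) ℝ)
    (w : Space d → MvPolynomial (Fin d) ℝ) : MvPolynomial (Fin d) ℝ →ₗ[ℝ] ℝ :=
  ∑ i, (innerₗ (LK K) (pol K (q i))).comp ((pol K).comp (MvPolynomial.pderiv i).toLinearMap) -
    ∑ v ∈ K, (∑ i, nrm K v i • fmLin K v (polyPair K (q i)) +
      τ v • fmLin K v (polyPair K (w v)))

theorem fluxForm_apply (τ : Space d → ℝ) (q : Fin d → MvPolynomial (Fin d) ℝ)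
    (w : Space d → MvPolynomial (Fin d) ℝ) (r : MvPolynomial (Fin d) ℝ) :
    fluxForm K τ q w r = ∑ i, ⟪pol K (q i), pol K (MvPolynomial.pderiv i r)⟫_ℝ -
      ∑ v ∈ K, (∑ i, nrm K v i * fm K v r (polyPair K (q i)) +
        τ v * fm K v r (polyPair K (w v))) := by
  simp only [fluxForm, LinearMap.sub_apply, LinearMap.sum_apply, LinearMap.add_apply,
    LinearMap.smul_apply, smul_eq_mul]
  rfl

theorem fluxForm_sub (τ : Space d → ℝ) (q q' : Fin d → MvPolynomial (Fin d) ℝ)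
    (w w' : Space d → MvPolynomial (Fin d) ℝ) (r : MvPolynomial (Fin d) ℝ) :
    fluxForm K τ (q - q') (w - w') r = fluxForm K τ q w r - fluxForm K τ q' w' r := by
  simp only [fluxForm_apply, Pi.sub_apply, map_sub, inner_sub_left, mul_sub,
    Finset.sum_sub_distrib, Finset.sum_add_distrib]
  ring

variable (hK : IsSimplex K)
include hK

theorem fm_polyPair_comm {v : Space d} (hv : v ∈ K) (p μ : MvPolynomial (Fin d) ℝ) :
    fm K v μ (polyPair K p) = fm K v p (polyPair K μ) := by
  rw [fm_polyPair hK hv, fm_polyPair hK hv]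
  exact integral_congr_ae (Filter.Eventually.of_forall fun x => mul_comm _ _)

/-- Gauss–Green turns the volume part of the flux form into the divergence term of the flux
equation, and face moments of polynomials are symmetric. What is left over is the numerical flux
tested with the trace variable, which cancels after summation over the elements. -/
theorem local_energy (τ : Space d → ℝ) (q q' : Fin d → MvPolynomial (Fin d) ℝ)
    (u u' : MvPolynomial (Fin d) ℝ) (w w' : Space d → MvPolynomial (Fin d) ℝ) :
    ∑ i, ⟪pol K (q i), pol K (q' i)⟫_ℝ +
        ∑ v ∈ K, τ v * fm K v (u - w v) (polyPair K (u' - w' v)) +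
        fluxForm K τ q (fun v => u - w v) u' =
      (∑ i, ⟪pol K (q i), pol K (q' i)⟫_ℝ -
        ∑ i, ⟪pol K (MvPolynomial.pderiv i (q i)), pol K u'⟫_ℝ +
        ∑ v ∈ K, ∑ i, nrm K v i * fm K v (q i) (polyPair K (w' v))) -
      ∑ v ∈ K, (∑ i, nrm K v i * fm K v (w' v) (polyPair K (q i)) +
        τ v * fm K v (w' v) (polyPair K (u - w v))) := by
  have h1 : ∑ v ∈ K, ∑ i, nrm K v i * fm K v u' (polyPair K (q i)) =
      ∑ i, ⟪pol K (MvPolynomial.pderiv i (q i)), pol K u'⟫_ℝ +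
      ∑ i, ⟪pol K (q i), pol K (MvPolynomial.pderiv i u')⟫_ℝ := by
    rw [Finset.sum_comm, ← Finset.sum_add_distrib]
    refine Finset.sum_congr rfl fun i _ => ?_
    rw [sum_fm hK i u' (polyPair_mem_H1 _), polyPair_fst, polyPair_snd, real_inner_comm,
      real_inner_comm (pol K (q i))]
  have h2 : ∑ v ∈ K, ∑ i, nrm K v i * fm K v (q i) (polyPair K (w' v)) =
      ∑ v ∈ K, ∑ i, nrm K v i * fm K v (w' v) (polyPair K (q i)) :=
    Finset.sum_congr rfl fun v hv => Finset.sum_congr rfl fun i _ => by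
      rw [fm_polyPair_comm hK hv]
  have h3 : ∑ v ∈ K, τ v * fm K v (u - w v) (polyPair K (u' - w' v)) =
      ∑ v ∈ K, τ v * fm K v u' (polyPair K (u - w v)) -
      ∑ v ∈ K, τ v * fm K v (w' v) (polyPair K (u - w v)) := by
    rw [← Finset.sum_sub_distrib]
    refine Finset.sum_congr rfl fun v hv => ?_
    rw [fm_polyPair_comm hK hv, fm_sub, mul_sub]
  rw [fluxForm_apply, h2, h3]
  simp only [Finset.sum_add_distrib]
  rw [h1]
  ring

/-- The weighted jump on the face opposite to a vertex. -/
def jumpF (τ : Space d → ℝ) (w : Space d → MvPolynomial (Fin d) ℝ) (v : K) :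
    Lp ℝ 2 ((surf d).restrict (hull (opp K v.1))) :=
  √(τ v) • polF (opp K v.1) (hK.isFiniteMeasure_surf v.2) (w v)

theorem inner_jumpF {τ : Space d → ℝ} (hτ : ∀ v ∈ K, 0 ≤ τ v)
    (w w' : Space d → MvPolynomial (Fin d) ℝ) (v : K) :
    ⟪jumpF hK τ w v, jumpF hK τ w' v⟫_ℝ = τ v * fm K v (w v) (polyPair K (w' v)) := by
  rw [jumpF, jumpF, inner_smul_left, inner_smul_right, ← mul_assoc,
    fm_polyPair_eq_inner hK v.2 (hK.isFiniteMeasure_surf v.2),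
    real_inner_comm (polF (opp K v.1) _ (w' v))]
  congr 1
  simp [Real.mul_self_sqrt (hτ v v.2)]

/-- The representative of the flux form is bounded by the flux and the jumps. -/
theorem exists_norm_repr_le {τ : Space d → ℝ} (hτ : ∀ v ∈ K, 0 ≤ τ v) :
    ∃ M : ℝ, 0 ≤ M ∧ ∀ (q : Fin d → MvPolynomial (Fin d) ℝ) (w : Space d → MvPolynomial (Fin d) ℝ)
      (g : MvPolynomial (Fin d) ℝ), (∀ i, q i ∈ Pl d (k + 1)) → g ∈ Pl d (k + 1) →
      (∀ r ∈ Pl d (k + 1), ⟪pol K g, pol K r⟫_ℝ = fluxForm K τ q w r) →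
      ‖pol K g‖ ≤ M * (∑ i, ‖pol K (q i)‖ + ∑ v : K, ‖jumpF hK τ w v‖) := by
  have hinj := pol_injective hK
  choose a ha0 ha using fun i => exists_norm_le_of_injOn (Pl d (k + 1)) (pol K) hinj
    ((pol K).comp (MvPolynomial.pderiv (R := ℝ) i).toLinearMap)
  choose b hb0 hb using fun v : K => exists_norm_le_of_injOn (Pl d (k + 1)) (pol K) hinj
    (polF (opp K v.1) (hK.isFiniteMeasure_surf v.2))
  refine ⟨∑ i, a i + ∑ v, (b v * b v + √(τ v) * b v), add_nonneg
    (Finset.sum_nonneg fun i _ => ha0 i) (Finset.sum_nonneg fun v _ => add_nonneg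
      (mul_nonneg (hb0 v) (hb0 v)) (mul_nonneg (Real.sqrt_nonneg _) (hb0 v))),
    fun q w g hq hg h => ?_⟩
  set X := ∑ i, ‖pol K (q i)‖ with hX
  set Y := ∑ v : K, ‖jumpF hK τ w v‖ with hY
  have hX0 : 0 ≤ X := Finset.sum_nonneg fun _ _ => norm_nonneg _
  have hY0 : 0 ≤ Y := Finset.sum_nonneg fun _ _ => norm_nonneg _
  have hXi : ∀ i, ‖pol K (q i)‖ ≤ X := fun i =>
    Finset.single_le_sum (f := fun i => ‖pol K (q i)‖) (fun _ _ => norm_nonneg _)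
      (Finset.mem_univ i)
  have hYi : ∀ v : K, ‖jumpF hK τ w v‖ ≤ Y := fun v =>
    Finset.single_le_sum (f := fun v => ‖jumpF hK τ w v‖) (fun _ _ => norm_nonneg _)
      (Finset.mem_univ v)
  have e := h g hg
  have hself : ⟪pol K g, pol K g⟫_ℝ = ‖pol K g‖ ^ 2 := real_inner_self_eq_norm_sq _
  have h1 : ∑ i, ⟪pol K (q i), pol K (MvPolynomial.pderiv i g)⟫_ℝ ≤
      (∑ i, a i) * X * ‖pol K g‖ := by
    rw [Finset.sum_mul, Finset.sum_mul]
    refine Finset.sum_le_sum fun i _ => (real_inner_le_norm _ _).trans ?_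
    calc _ ≤ X * (a i * ‖pol K g‖) :=
          mul_le_mul (hXi i) (ha i g hg) (norm_nonneg _) hX0
      _ = _ := by ring
  have h2 : ∀ v : K, -(∑ i, nrm K v i * fm K v g (polyPair K (q i)) +
      τ v * fm K v g (polyPair K (w v))) ≤
      b v * b v * X * ‖pol K g‖ + √(τ v) * b v * Y * ‖pol K g‖ := by
    intro v
    have hF := hK.isFiniteMeasure_surf v.2
    rw [neg_add]
    refine add_le_add ?_ ?_
    · rw [← Finset.sum_neg_distrib, hX, Finset.mul_sum, Finset.sum_mul]
      refine Finset.sum_le_sum fun i _ => ?_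
      rw [fm_polyPair_eq_inner hK v.2 hF]
      refine (neg_le_abs _).trans ?_
      rw [abs_mul]
      have hn : |nrm K v i| ≤ 1 := by
        rw [← (hK.nrm_spec v.2).unit]; exact PiLp.norm_apply_le (nrm K v.1) i
      calc _ ≤ 1 * (‖polF (opp K v.1) hF (q i)‖ * ‖polF (opp K v.1) hF g‖) :=
            mul_le_mul hn (abs_real_inner_le_norm _ _) (abs_nonneg _) zero_le_one
        _ ≤ 1 * ((b v * ‖pol K (q i)‖) * (b v * ‖pol K g‖)) := by
            refine mul_le_mul_of_nonneg_left ?_ zero_le_one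
            exact mul_le_mul (hb v _ (hq i)) (hb v g hg) (norm_nonneg _)
              (mul_nonneg (hb0 v) (norm_nonneg _))
        _ = _ := by ring
    · rw [fm_polyPair_eq_inner hK v.2 hF]
      -- Writing `τ = √τ √τ` brings in the weighted jump only, so a face with `τ = 0` needs no
      -- control of its jump.
      have e1 : τ v * ⟪polF (opp K v.1) hF (w v), polF (opp K v.1) hF g⟫_ℝ =
          √(τ v) * ⟪jumpF hK τ w v, polF (opp K v.1) hF g⟫_ℝ := by
        rw [jumpF, inner_smul_left, ← mul_assoc]
        simp [Real.mul_self_sqrt (hτ v v.2)]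
      rw [e1]
      refine (neg_le_abs _).trans ?_
      rw [abs_mul, abs_of_nonneg (Real.sqrt_nonneg _)]
      calc _ ≤ √(τ v) * (‖jumpF hK τ w v‖ * ‖polF (opp K v.1) hF g‖) :=
            mul_le_mul_of_nonneg_left (abs_real_inner_le_norm _ _) (Real.sqrt_nonneg _)
        _ ≤ √(τ v) * (Y * (b v * ‖pol K g‖)) := by
            refine mul_le_mul_of_nonneg_left ?_ (Real.sqrt_nonneg _)
            exact mul_le_mul (hYi v) (hb v g hg) (norm_nonneg _) hY0
        _ = _ := by ring
  have h3 : ‖pol K g‖ * ‖pol K g‖ ≤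
      ((∑ i, a i + ∑ v, (b v * b v + √(τ v) * b v)) * (X + Y)) * ‖pol K g‖ := by
    have h4 : ‖pol K g‖ * ‖pol K g‖ ≤ (∑ i, a i) * X * ‖pol K g‖ +
        ∑ v : K, (b v * b v * X * ‖pol K g‖ + √(τ v) * b v * Y * ‖pol K g‖) := by
      rw [← pow_two, ← hself, e, fluxForm_apply, sub_eq_add_neg, ← Finset.sum_neg_distrib,
        ← Finset.sum_coe_sort K]
      exact add_le_add h1 (Finset.sum_le_sum fun v _ => h2 v)
    refine h4.trans ?_
    have h5 : (∑ v : K, (b v * b v + √(τ v) * b v)) * (X + Y) * ‖pol K g‖ =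
        ∑ v : K, (b v * b v + √(τ v) * b v) * (X + Y) * ‖pol K g‖ := by
      rw [Finset.sum_mul, Finset.sum_mul]
    rw [add_mul, add_mul, h5]
    refine add_le_add ?_ (Finset.sum_le_sum fun v _ => ?_)
    · refine mul_le_mul_of_nonneg_right (mul_le_mul_of_nonneg_left (by linarith)
        (Finset.sum_nonneg fun i _ => ha0 i)) (norm_nonneg _)
    · have := hb0 v
      rw [← add_mul]
      refine mul_le_mul_of_nonneg_right ?_ (norm_nonneg _)
      have p1 : 0 ≤ b v * b v * Y := by positivity
      have p2 : 0 ≤ √(τ v) * b v * X := by positivity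
      linarith
  rcases (norm_nonneg (pol K g)).eq_or_lt with h0 | h0
  · rw [← h0]
    refine mul_nonneg (add_nonneg (Finset.sum_nonneg fun i _ => ha0 i)
      (Finset.sum_nonneg fun v _ => ?_)) (add_nonneg hX0 hY0)
    have := hb0 v
    positivity
  · exact le_of_mul_le_mul_right h3 h0

end Local

/-! ### Summation over the elements and the global energy identity -/

section Global

variable {d k : ℕ} {Ω : Set (Space d)} (𝒯 : Triangulation Ω)

/-- `L²` on the elements, as a Hilbert space. -/
abbrev ScalarSpace := PiLp 2 fun K : 𝒯.elements => LK K.1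

/-- `[L²]^d` on the elements, as a Hilbert space. -/
abbrev FluxSpace := PiLp 2 fun j : 𝒯.elements × Fin d => LK j.1.1

/-- `L²` on the faces of the elements, as a Hilbert space. -/
abbrev JumpSpace := PiLp 2 fun j : (Σ K : 𝒯.elements, K.1) =>
  Lp ℝ 2 ((surf d).restrict (hull (opp j.1.1 j.2.1)))

def scalarClass (w : Piecewise d) : ScalarSpace 𝒯 := WithLp.toLp 2 fun K => pol K.1 (w K.1)

def fluxClass (r : VPiecewise d) : FluxSpace 𝒯 := WithLp.toLp 2 fun j => pol j.1.1 (r j.2 j.1.1)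

def jumpClass (hd : 1 ≤ d) (τ : Stabilization d) (u w : Piecewise d) : JumpSpace 𝒯 :=
  WithLp.toLp 2 fun j => jumpF (𝒯.isSimplex hd j.1.2) (fun v => τ j.1.1 (opp j.1.1 v))
    (fun v => u j.1.1 - w (opp j.1.1 v)) j.2

theorem scalarClass_sub (w w' : Piecewise d) :
    scalarClass 𝒯 (w - w') = scalarClass 𝒯 w - scalarClass 𝒯 w' := by
  ext1 K
  exact map_sub (pol K.1) (w K.1) (w' K.1)

theorem fluxClass_sub (r r' : VPiecewise d) :
    fluxClass 𝒯 (r - r') = fluxClass 𝒯 r - fluxClass 𝒯 r' := by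
  ext1 j
  exact map_sub (pol j.1.1) (r j.2 j.1.1) (r' j.2 j.1.1)

theorem jumpClass_sub (hd : 1 ≤ d) (τ : Stabilization d) (u u' w w' : Piecewise d) :
    jumpClass 𝒯 hd τ (u - u') (w - w') = jumpClass 𝒯 hd τ u w - jumpClass 𝒯 hd τ u' w' := by
  ext1 j
  simp only [jumpClass, jumpF, PiLp.sub_apply, Pi.sub_apply]
  rw [← smul_sub, ← map_sub]
  congr 2
  abel

/-- `g` represents the right hand side of the balance equation. -/
def IsBalance (k : ℕ) (τ : Stabilization d) (q : VPiecewise d) (u w g : Piecewise d) : Prop :=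
  ∀ K ∈ 𝒯.elements, g K ∈ Pl d (k + 1) ∧ ∀ r ∈ Pl d (k + 1), ⟪pol K (g K), pol K r⟫_ℝ =
    fluxForm K (fun v => τ K (opp K v)) (fun i => q i K) (fun v => u K - w (opp K v)) r

variable {𝒯} in
theorem IsBalance.sub {τ : Stabilization d} {q q' : VPiecewise d} {u u' w w' g g' : Piecewise d}
    (h : IsBalance 𝒯 k τ q u w g) (h' : IsBalance 𝒯 k τ q' u' w' g') :
    IsBalance 𝒯 k τ (q - q') (u - u') (w - w') (g - g') := by
  intro K hK
  refine ⟨Submodule.sub_mem _ (h K hK).1 (h' K hK).1, fun r hr => ?_⟩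
  rw [Pi.sub_apply, map_sub, inner_sub_left, (h K hK).2 r hr, (h' K hK).2 r hr, ← fluxForm_sub]
  congr 1
  congr 1
  funext v
  simp only [Pi.sub_apply]
  abel

theorem exists_isBalance (hd : 1 ≤ d) (τ : Stabilization d) (q : VPiecewise d) (u w : Piecewise d) :
    ∃ g, IsBalance 𝒯 k τ q u w g := by
  have : ∀ K ∈ 𝒯.elements, ∃ g ∈ Pl d (k + 1), ∀ r ∈ Pl d (k + 1), ⟪pol K g, pol K r⟫_ℝ =
      fluxForm K (fun v => τ K (opp K v)) (fun i => q i K) (fun v => u K - w (opp K v)) r := by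
    intro K hK
    exact exists_repr_of_vanish (Pl d (k + 1)) ((innerₗ (LK K)).compl₁₂ (pol K) (pol K))
      (fun a _ b _ => real_inner_comm (pol K b) (pol K a)) _ (fun a _ ha => by
        have h0 : pol K a = 0 := inner_self_eq_zero.1 (show ⟪pol K a, pol K a⟫_ℝ = 0 from ha)
        have : a = 0 := pol_injective (𝒯.isSimplex hd hK) (by rw [h0, map_zero])
        rw [this, map_zero])
  choose! g hg using this
  exact ⟨g, fun K hK => hg K hK⟩

/-- A uniform bound for the representative of the balance equation. -/
theorem exists_norm_balance_le (hd : 1 ≤ d) {τ : Stabilization d} (hτ : τ.Nonneg 𝒯) :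
    ∃ M : ℝ, 0 ≤ M ∧ ∀ (q : VPiecewise d) (u w g : Piecewise d), q ∈ Vh 𝒯 k →
      IsBalance 𝒯 k τ q u w g →
      ‖scalarClass 𝒯 g‖ ≤ M * (‖fluxClass 𝒯 q‖ + ‖jumpClass 𝒯 hd τ u w‖) := by
  choose M hM0 hM using fun K : 𝒯.elements => exists_norm_repr_le (k := k) (𝒯.isSimplex hd K.2)
    (τ := fun v => τ K.1 (opp K.1 v))
    (fun v hv => hτ K.1 K.2 _ ((𝒯.isSimplex hd K.2).opp_mem_facets hv))
  refine ⟨∑ K, M K * (d + (d + 1)), Finset.sum_nonneg fun K _ =>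
    mul_nonneg (hM0 K) (by positivity), fun q u w g hq hg => ?_⟩
  have h1 : ‖scalarClass 𝒯 g‖ ≤ ∑ K : 𝒯.elements, ‖pol K.1 (g K.1)‖ := by
    have hs : 0 ≤ ∑ K : 𝒯.elements, ‖pol K.1 (g K.1)‖ :=
      Finset.sum_nonneg fun _ _ => norm_nonneg _
    refine (abs_le_of_sq_le_sq' ?_ hs).2
    rw [PiLp.norm_sq_eq_of_L2]
    exact Finset.sum_sq_le_sq_sum_of_nonneg fun _ _ => norm_nonneg _
  refine h1.trans ?_
  rw [Finset.sum_mul]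
  refine Finset.sum_le_sum fun K _ => ?_
  refine (hM K (fun i => q i K.1) (fun v => u K.1 - w (opp K.1 v)) (g K.1)
    (fun i => mem_Pl_succ.2 (hq i K.1 K.2)) (hg K.1 K.2).1 (hg K.1 K.2).2).trans ?_
  rw [mul_assoc]
  refine mul_le_mul_of_nonneg_left ?_ (hM0 K)
  have h2 : ∑ i, ‖pol K.1 (q i K.1)‖ ≤ d * ‖fluxClass 𝒯 q‖ := by
    calc _ ≤ ∑ _i : Fin d, ‖fluxClass 𝒯 q‖ :=
          Finset.sum_le_sum fun i _ => PiLp.norm_apply_le (fluxClass 𝒯 q) (K, i)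
      _ = _ := by simp
  have h3 : ∑ v : K.1, ‖jumpF (𝒯.isSimplex hd K.2) (fun v => τ K.1 (opp K.1 v))
      (fun v => u K.1 - w (opp K.1 v)) v‖ ≤ (d + 1) * ‖jumpClass 𝒯 hd τ u w‖ := by
    calc _ ≤ ∑ _v : K.1, ‖jumpClass 𝒯 hd τ u w‖ :=
          Finset.sum_le_sum fun v _ => PiLp.norm_apply_le (jumpClass 𝒯 hd τ u w) ⟨K, v⟩
      _ = _ := by
        rw [Finset.sum_const, Finset.card_univ, Fintype.card_coe, (𝒯.isSimplex hd K.2).card_eq]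
        simp
  have hd0 : (0 : ℝ) ≤ d := Nat.cast_nonneg d
  have n1 := norm_nonneg (fluxClass 𝒯 q)
  have n2 := norm_nonneg (jumpClass 𝒯 hd τ u w)
  nlinarith

/-- The equations satisfied by the projected errors at a fixed time. -/
structure IsErrorTriple (k : ℕ) (τ : Stabilization d) (q : VPiecewise d) (u w : Piecewise d)
    (δ : FluxSpace 𝒯) : Prop where
  mem_q : q ∈ Vh 𝒯 k
  mem_u : u ∈ Wh 𝒯 k
  mem_w : w ∈ Mh 𝒯 k
  flux : ∀ K : 𝒯.elements, ∀ r : Fin d → MvPolynomial (Fin d) ℝ, (∀ i, r i ∈ Pl d (k + 1)) →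
    ∑ i, ⟪pol K.1 (r i), pol K.1 (q i K.1)⟫_ℝ -
      ∑ i, ⟪pol K.1 (MvPolynomial.pderiv i (r i)), pol K.1 (u K.1)⟫_ℝ +
      ∑ v ∈ K.1, ∑ i, nrm K.1 v i * fm K.1 v (r i) (polyPair K.1 (w (opp K.1 v))) =
      ∑ i, ⟪pol K.1 (r i), δ (K, i)⟫_ℝ
  boundary : ∀ K ∈ 𝒯.elements, ∀ v ∈ K, 𝒯.OnBoundary (opp K v) → ∀ μ ∈ Pl d (k + 1),
    fm K v μ (polyPair K (w (opp K v))) = 0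
  -- The moments are indexed by the vertex opposite to `F`, which varies with the element; the
  -- function `c` allows summing over elements without choosing that vertex.
  transmission : ∀ F ∈ 𝒯.faces, ¬ 𝒯.OnBoundary F → ∀ μ ∈ Pl d (k + 1),
    ∀ c : Finset (Space d) → ℝ, (∀ K ∈ 𝒯.elements, ∀ v ∈ K, F = opp K v →
      c K = ∑ i, nrm K v i * fm K v μ (polyPair K (q i K)) +
        τ K F * fm K v μ (polyPair K (u K - w F))) →
      (∀ K ∈ 𝒯.elements, F ∉ facets K → c K = 0) → ∑ K ∈ 𝒯.elements, c K = 0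

/-- Regrouped by faces, the interior contributions vanish by the transmission condition of the first
triple and the boundary ones because the trace of the second has zero moments there. This holds for
triples at two different times. -/
theorem sum_flux_trace_eq_zero (hd : 1 ≤ d) {τ : Stabilization d} {q q' : VPiecewise d}
    {u u' w w' : Piecewise d} {δ δ' : FluxSpace 𝒯} (h : IsErrorTriple 𝒯 k τ q u w δ)
    (h' : IsErrorTriple 𝒯 k τ q' u' w' δ') :
    ∑ K ∈ 𝒯.elements, ∑ v ∈ K, (∑ i, nrm K v i * fm K v (w' (opp K v)) (polyPair K (q i K)) +
      τ K (opp K v) * fm K v (w' (opp K v)) (polyPair K (u K - w (opp K v)))) = 0 := by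
  classical
  set b : Finset (Space d) → Finset (Space d) → ℝ := fun K F =>
    ∫ x in hull F, (∑ i, normal K F i * ev (q i K) x + τ K F * ev (u K - w F) x) *
      ev (w' F) x ∂(surf d) with hbdef
  have hb : ∀ K ∈ 𝒯.elements, ∀ v ∈ K, b K (opp K v) =
      ∑ i, nrm K v i * fm K v (w' (opp K v)) (polyPair K (q i K)) +
      τ K (opp K v) * fm K v (w' (opp K v)) (polyPair K (u K - w (opp K v))) :=
    fun K hK v hv => integral_face_combination (𝒯.isSimplex hd hK) hv _ _ _ _ _
  have h1 : ∑ K ∈ 𝒯.elements, ∑ v ∈ K,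
      (∑ i, nrm K v i * fm K v (w' (opp K v)) (polyPair K (q i K)) +
      τ K (opp K v) * fm K v (w' (opp K v)) (polyPair K (u K - w (opp K v)))) =
      ∑ K ∈ 𝒯.elements, ∑ F ∈ facets K, b K F := by
    refine Finset.sum_congr rfl fun K hK => ?_
    rw [(𝒯.isSimplex hd hK).sum_facets]
    exact Finset.sum_congr rfl fun v hv => (hb K hK v hv).symm
  have h2 : ∑ K ∈ 𝒯.elements, ∑ F ∈ facets K, b K F =
      ∑ F ∈ 𝒯.faces, ∑ K ∈ 𝒯.elements, if F ∈ facets K then b K F else 0 := by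
    rw [Finset.sum_comm]
    refine Finset.sum_congr rfl fun K hK => ?_
    rw [← Finset.sum_filter]
    refine Finset.sum_congr ?_ fun _ _ => rfl
    ext F
    simp only [Finset.mem_filter, Triangulation.faces, Finset.mem_biUnion]
    exact ⟨fun hF => ⟨⟨K, hK, hF⟩, hF⟩, fun hF => hF.2⟩
  rw [h1, h2]
  refine Finset.sum_eq_zero fun F hF => ?_
  by_cases hbF : 𝒯.OnBoundary F
  · refine Finset.sum_eq_zero fun K hK => ?_
    split_ifs with hFK
    · obtain ⟨v, hv, rfl⟩ := (𝒯.isSimplex hd hK).exists_of_mem_facets hFK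
      have hs := 𝒯.isSimplex hd hK
      have hz : ∀ μ ∈ Pl d (k + 1), fm K v (w' (opp K v)) (polyPair K μ) = 0 := fun μ hμ => by
        rw [fm_polyPair_comm hs hv]
        exact h'.boundary K hK v hv hbF μ hμ
      rw [hb K hK v hv, hz _ (Submodule.sub_mem _ (mem_Pl_succ.2 (h.mem_u K hK))
        (mem_Pl_succ.2 (h.mem_w _ hF)))]
      simp only [hz _ (mem_Pl_succ.2 (h.mem_q _ K hK)), mul_zero, Finset.sum_const_zero, add_zero]
    · rfl
  · refine h.transmission F hF hbF (w' F) (mem_Pl_succ.2 (h'.mem_w F hF)) _ ?_ ?_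
    · rintro K hK v hv rfl
      rw [if_pos ((𝒯.isSimplex hd hK).opp_mem_facets hv), hb K hK v hv]
    · intro K hK hFK
      rw [if_neg hFK]

variable {𝒯} in
theorem inner_fluxClass (q q' : VPiecewise d) : ⟪fluxClass 𝒯 q, fluxClass 𝒯 q'⟫_ℝ =
    ∑ K : 𝒯.elements, ∑ i, ⟪pol K.1 (q i K.1), pol K.1 (q' i K.1)⟫_ℝ := by
  rw [PiLp.inner_apply, Fintype.sum_prod_type]
  rfl

variable {𝒯} in
theorem inner_fluxClass_right (δ : FluxSpace 𝒯) (q : VPiecewise d) : ⟪δ, fluxClass 𝒯 q⟫_ℝ =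
    ∑ K : 𝒯.elements, ∑ i, ⟪pol K.1 (q i K.1), δ (K, i)⟫_ℝ := by
  rw [real_inner_comm, PiLp.inner_apply, Fintype.sum_prod_type]
  rfl

variable {𝒯} in
theorem inner_jumpClass (hd : 1 ≤ d) {τ : Stabilization d} (hτ : τ.Nonneg 𝒯)
    (u u' w w' : Piecewise d) : ⟪jumpClass 𝒯 hd τ u w, jumpClass 𝒯 hd τ u' w'⟫_ℝ =
    ∑ K : 𝒯.elements, ∑ v ∈ K.1, τ K.1 (opp K.1 v) *
      fm K.1 v (u K.1 - w (opp K.1 v)) (polyPair K.1 (u' K.1 - w' (opp K.1 v))) := by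
  rw [PiLp.inner_apply, Fintype.sum_sigma]
  refine Finset.sum_congr rfl fun K _ => ?_
  rw [← Finset.sum_coe_sort K.1]
  refine Finset.sum_congr rfl fun v _ => ?_
  exact inner_jumpF (𝒯.isSimplex hd K.2) (τ := fun v => τ K.1 (opp K.1 v))
    (fun v hv => hτ K.1 K.2 _ ((𝒯.isSimplex hd K.2).opp_mem_facets hv))
    (fun v => u K.1 - w (opp K.1 v)) (fun v => u' K.1 - w' (opp K.1 v)) v

variable {𝒯} in
theorem IsBalance.inner {τ : Stabilization d} {q : VPiecewise d} {u w g : Piecewise d}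
    (hg : IsBalance 𝒯 k τ q u w g) {r : Piecewise d} (hr : r ∈ Wh 𝒯 k) :
    ⟪scalarClass 𝒯 g, scalarClass 𝒯 r⟫_ℝ = ∑ K : 𝒯.elements,
      fluxForm K.1 (fun v => τ K.1 (opp K.1 v)) (fun i => q i K.1)
        (fun v => u K.1 - w (opp K.1 v)) (r K.1) := by
  rw [PiLp.inner_apply]
  exact Finset.sum_congr rfl fun K _ => (hg K.1 K.2).2 _ (mem_Pl_succ.2 (hr K.1 K.2))

variable {𝒯} in
/-- The energy identity for the projected errors at two times. -/
theorem IsErrorTriple.energy (hd : 1 ≤ d) {τ : Stabilization d} (hτ : τ.Nonneg 𝒯)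
    {q q' : VPiecewise d} {u u' w w' g : Piecewise d} {δ δ' : FluxSpace 𝒯}
    (h : IsErrorTriple 𝒯 k τ q u w δ) (h' : IsErrorTriple 𝒯 k τ q' u' w' δ')
    (hg : IsBalance 𝒯 k τ q u w g) :
    ⟪fluxClass 𝒯 q, fluxClass 𝒯 q'⟫_ℝ +
      ⟪jumpClass 𝒯 hd τ u w, jumpClass 𝒯 hd τ u' w'⟫_ℝ +
      ⟪scalarClass 𝒯 g, scalarClass 𝒯 u'⟫_ℝ = ⟪δ', fluxClass 𝒯 q⟫_ℝ := by
  have e5 := sum_flux_trace_eq_zero 𝒯 hd h h'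
  rw [← Finset.sum_coe_sort 𝒯.elements] at e5
  rw [inner_fluxClass, inner_jumpClass hd hτ, hg.inner h'.mem_u, inner_fluxClass_right,
    ← Finset.sum_add_distrib, ← Finset.sum_add_distrib, ← sub_eq_zero,
    ← Finset.sum_sub_distrib, ← neg_eq_zero.2 e5, ← Finset.sum_neg_distrib]
  refine Finset.sum_congr rfl fun K _ => ?_
  rw [local_energy (𝒯.isSimplex hd K.2), h'.flux K (fun i => q i K.1)
    fun i => mem_Pl_succ.2 (h.mem_q i K.1 K.2)]
  exact sub_sub_cancel_left _ _

end Global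

theorem IsConvexPolyhedralDomain.isBounded {d : ℕ} {Ω : Set (Space d)}
    (hΩ : IsConvexPolyhedralDomain Ω) : Bornology.IsBounded Ω := by
  obtain ⟨s, hs⟩ := hΩ.polytope
  refine Bornology.IsBounded.subset ?_ (subset_closure (s := Ω))
  rw [hs]
  exact (isBounded_convexHull).2 s.finite_toSet.isBounded

/-! ### Projections on the triangulation -/

section Projection

variable {d k m : ℕ} {Ω : Set (Space d)} {𝒯 : Triangulation Ω} (hd : 1 ≤ d)
  (hΩ : IsConvexPolyhedralDomain Ω) {τ : Stabilization d}

/-- `(p, z)` is the projection of `(q, u)` on each element. -/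
def IsElementProjection (𝒯 : Triangulation Ω) (k : ℕ) (τ : Stabilization d)
    (q : VSobolev Ω (m + 1)) (u : Sobolev Ω (m + 1)) (p : VPiecewise d) (z : Piecewise d) : Prop :=
  p ∈ Vh 𝒯 k ∧ z ∈ Wh 𝒯 k ∧ ∀ K : 𝒯.elements,
    IsProjError K.1 k (fun v => τ K.1 (opp K.1 v))
      (fun i => polyPair K.1 (p i K.1) - pairL (𝒯.inside hd hΩ.convex K.2) (q i))
      (polyPair K.1 (z K.1) - pairL (𝒯.inside hd hΩ.convex K.2) u)

variable {hd hΩ}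

theorem IsElementProjection.sub {q q' : VSobolev Ω (m + 1)} {u u' : Sobolev Ω (m + 1)}
    {p p' : VPiecewise d} {z z' : Piecewise d} (h : IsElementProjection hd hΩ 𝒯 k τ q u p z)
    (h' : IsElementProjection hd hΩ 𝒯 k τ q' u' p' z') :
    IsElementProjection hd hΩ 𝒯 k τ (q - q') (u - u') (p - p') (z - z') := by
  refine ⟨fun i K hK => ?_, fun K hK => ?_, fun K => ?_⟩
  · exact mem_Pl_succ.1 (Submodule.sub_mem _ (mem_Pl_succ.2 (h.1 i K hK))
      (mem_Pl_succ.2 (h'.1 i K hK)))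
  · exact mem_Pl_succ.1 (Submodule.sub_mem _ (mem_Pl_succ.2 (h.2.1 K hK))
      (mem_Pl_succ.2 (h'.2.1 K hK)))
  · convert (h.2.2 K).sub (h'.2.2 K) using 1
    · funext i
      simp only [Pi.sub_apply, PiLp.sub_apply, map_sub]
      abel
    · simp only [Pi.sub_apply, map_sub]
      abel

theorem exists_face_max (hd : 1 ≤ d) {C : ℝ} (hτC : τ.BoundedBy 𝒯 C) (K : 𝒯.elements) :
    ∃ v0 ∈ K.1, 0 < τ K.1 (opp K.1 v0) ∧ 1 / τ K.1 (opp K.1 v0) ≤ C ∧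
      ∀ v ∈ K.1, v ≠ v0 → τ K.1 (opp K.1 v) ≤ C := by
  have hs := 𝒯.isSimplex hd K.2
  obtain ⟨F, hF, -, hpos, hC, hle⟩ := hτC K.1 K.2
  obtain ⟨v0, hv0, rfl⟩ := hs.exists_of_mem_facets hF
  refine ⟨v0, hv0, hpos, hC, fun v hv hne => hle _ (hs.opp_mem_facets hv) fun e => hne ?_⟩
  exact IsSimplex.opp_injOn hv hv0 e

theorem exists_isElementProjection (hτ : τ.Nonneg 𝒯) {C : ℝ} (hτC : τ.BoundedBy 𝒯 C)
    (q : VSobolev Ω (m + 1)) (u : Sobolev Ω (m + 1)) :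
    ∃ p z, IsElementProjection hd hΩ 𝒯 k τ q u p z := by
  classical
  have key : ∀ K : 𝒯.elements, ∃ (p : Fin d → MvPolynomial (Fin d) ℝ) (z : MvPolynomial (Fin d) ℝ),
      (∀ i, p i ∈ Pl d (k + 1)) ∧ z ∈ Pl d (k + 1) ∧
      IsProjError K.1 k (fun v => τ K.1 (opp K.1 v))
        (fun i => polyPair K.1 (p i) - pairL (𝒯.inside hd hΩ.convex K.2) (q i))
        (polyPair K.1 z - pairL (𝒯.inside hd hΩ.convex K.2) u) := by
    intro K
    have hs := 𝒯.isSimplex hd K.2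
    obtain ⟨v0, hv0, hpos, -⟩ := exists_face_max hd hτC K
    exact exists_projection hs (τ := fun v => τ K.1 (opp K.1 v))
      (fun v hv => hτ K.1 K.2 _ (hs.opp_mem_facets hv)) hv0 hpos
      (fun i => pairL_mem_H1 hΩ.isOpen hΩ.convex hΩ.isBounded hΩ.nonempty _ (q i))
      (pairL_mem_H1 hΩ.isOpen hΩ.convex hΩ.isBounded hΩ.nonempty _ u)
  choose p z hp hz h using key
  refine ⟨fun i K => if hK : K ∈ 𝒯.elements then p ⟨K, hK⟩ i else 0,
    fun K => if hK : K ∈ 𝒯.elements then z ⟨K, hK⟩ else 0, fun i K hK => ?_, fun K hK => ?_,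
    fun K => ?_⟩
  · simp only [dif_pos hK]
    exact mem_Pl_succ.1 (hp _ i)
  · simp only [dif_pos hK]
    exact mem_Pl_succ.1 (hz _)
  · simp only [dif_pos K.2]
    exact h K

theorem integral_inner_vev {K : Finset (Space d)} (h : Inside K Ω) (q : VSobolev Ω m)
    (r : VPiecewise d) : ∫ x in hull K, ⟪vval q x, vev r K x⟫_ℝ =
      ∑ i, ⟪pol K (r i K), res h (q i).toL2⟫_ℝ := by
  have e : ∀ x, ⟪vval q x, vev r K x⟫_ℝ = ∑ i, ev (r i K) x * (q i).toL2 x := by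
    intro x
    rw [PiLp.inner_apply]
    exact Finset.sum_congr rfl fun i _ => by simp [vval, vev]
  simp only [e]
  rw [integral_finsetSum]
  · exact Finset.sum_congr rfl fun i _ => (inner_pol_res h _ _).symm
  · exact fun i _ => (memLp_hull (continuous_ev _)).integrable_mul (p := 2) (q := 2)
      (memLp_res h _)

theorem integral_inner_vev_poly {K : Finset (Space d)} (p r : VPiecewise d) :
    ∫ x in hull K, ⟪vev p K x, vev r K x⟫_ℝ = ∑ i, ⟪pol K (r i K), pol K (p i K)⟫_ℝ := by
  simp only [inner_vev]
  rw [integral_finsetSum]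
  · exact Finset.sum_congr rfl fun i _ => by rw [real_inner_comm, inner_pol_pol]
  · exact fun i _ => IsSimplex.integrable_of_continuous ((continuous_ev _).mul (continuous_ev _))

/-- The projection of the method is the elementwise one. -/
theorem IsHDGProjection.isElementProjection {q : VSobolev Ω (m + 1)} {u : Sobolev Ω (m + 1)}
    {p : VPiecewise d} {z : Piecewise d} (h : IsHDGProjection 𝒯 k τ q u p z) :
    IsElementProjection hd hΩ 𝒯 k τ q u p z := by
  classical
  obtain ⟨hp, hz, γu, γq, hγ, h⟩ := h
  refine ⟨hp, hz, fun K => ?_⟩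
  have hs := 𝒯.isSimplex hd K.2
  obtain ⟨h1, h2, h3⟩ := h K.1 K.2
  have hin := 𝒯.inside hd hΩ.convex K.2
  refine ⟨fun i r hr => ?_, fun r hr => ?_, fun v hv μ hμ => ?_⟩
  · rcases mem_Pl_iff.1 hr with rfl | hr'
    · simp
    · have h0 : 0 < k := by omega
      have := h1 (Pi.single i (fun _ => r)) (fun j => by
        by_cases hj : j = i
        · subst hj; simpa using hr'
        · simpa [Pi.single_eq_of_ne hj] using h0)
      rw [integral_inner_vev hin, integral_inner_vev_poly, Finset.sum_eq_single i,
        Finset.sum_eq_single i, Pi.single_eq_same] at this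
      · rw [Prod.fst_sub, inner_sub_right, polyPair_fst, pairL_fst, this, sub_self]
      · intro j _ hj
        simp [Pi.single_eq_of_ne hj]
      · simp
      · intro j _ hj
        simp [Pi.single_eq_of_ne hj]
      · simp
  · rcases mem_Pl_iff.1 hr with rfl | hr'
    · simp
    · have := h2 r hr'
      rw [← inner_pol_pol, real_inner_comm] at this
      rw [Prod.fst_sub, inner_sub_right, polyPair_fst, pairL_fst, this, inner_pol_res, sub_eq_zero]
      exact integral_congr_ae (Filter.Eventually.of_forall fun x => mul_comm _ _)
  · have hF : opp K.1 v ∈ 𝒯.faces := Finset.mem_biUnion.2 ⟨K.1, K.2, hs.opp_mem_facets hv⟩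
    obtain ⟨hγu, hγq⟩ := hγ _ hF
    have e := h3 _ (hs.opp_mem_facets hv) μ (mem_Pl_succ.1 hμ)
    simp only [inner_vev_right] at e
    rw [integral_face_combination hs hv] at e
    have hint : ∀ {w : Sobolev Ω (m + 1)} {γ : Space d → ℝ}, IsTrace w (hull (opp K.1 v)) γ →
        Integrable (fun x => γ x * ev μ x) ((surf d).restrict (hull (opp K.1 v))) := fun hγ =>
      hγ.1.integrable_mul (p := 2) (q := 2)
        (memLp_face (hs.isFiniteMeasure_surf hv) (continuous_ev μ))
    have e2 : ∫ x in hull (opp K.1 v), (⟪WithLp.toLp 2 (fun i => γq i (opp K.1 v) x),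
        normal K.1 (opp K.1 v)⟫_ℝ + τ K.1 (opp K.1 v) * γu (opp K.1 v) x) * ev μ x ∂(surf d) =
        ∑ i, nrm K.1 v i * fm K.1 v μ (pairL hin (q i)) +
          τ K.1 (opp K.1 v) * fm K.1 v μ (pairL hin u) := by
      have e3 : ∀ x, (⟪WithLp.toLp 2 (fun i => γq i (opp K.1 v) x),
          normal K.1 (opp K.1 v)⟫_ℝ + τ K.1 (opp K.1 v) * γu (opp K.1 v) x) * ev μ x =
          ∑ i, nrm K.1 v i * (γq i (opp K.1 v) x * ev μ x) +
            τ K.1 (opp K.1 v) * (γu (opp K.1 v) x * ev μ x) := by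
        intro x
        rw [PiLp.inner_apply, add_mul, Finset.sum_mul]
        congr 1
        · exact Finset.sum_congr rfl fun i _ => by simp [mul_assoc]
        · ring
      simp only [e3]
      rw [integral_add (integrable_finsetSum _ fun i _ => (hint (hγq i)).const_mul _)
        ((hint hγu).const_mul _), integral_finsetSum _ fun i _ => (hint (hγq i)).const_mul _]
      simp only [integral_const_mul]
      rw [integral_trace hΩ.isOpen hΩ.isBounded hs hin hv subset_rfl hγu]
      simp only [fun i => integral_trace hΩ.isOpen hΩ.isBounded hs hin hv subset_rfl (hγq i) μ]
    rw [e2] at e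
    simp only [map_sub, mul_sub, Finset.sum_sub_distrib]
    linarith

/-- The projection of the trace of a Sobolev function on the faces. -/
theorem exists_traceProjection (𝒯 : Triangulation Ω) (hd : 1 ≤ d)
    (hΩ : IsConvexPolyhedralDomain Ω) (k : ℕ) (u : Sobolev Ω (m + 1)) :
    ∃ w ∈ Mh 𝒯 k, ∀ K : 𝒯.elements, ∀ v ∈ K.1, ∀ μ ∈ Pl d (k + 1),
      fm K.1 v μ (polyPair K.1 (w (opp K.1 v))) =
        fm K.1 v μ (pairL (𝒯.inside hd hΩ.convex K.2) u) := by
  have key : ∀ F ∈ 𝒯.faces, ∃ w ∈ Pl d (k + 1), ∀ K : 𝒯.elements, ∀ v ∈ K.1, F = opp K.1 v →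
      ∀ μ ∈ Pl d (k + 1), fm K.1 v μ (polyPair K.1 w) =
        fm K.1 v μ (pairL (𝒯.inside hd hΩ.convex K.2) u) := by
    intro F hF
    -- The trace is projected from one element containing the face; by `fm_pairL_eq` the result is
    -- the same from every other one.
    obtain ⟨K, hK, hFK⟩ := Finset.mem_biUnion.1 hF
    have hs := 𝒯.isSimplex hd hK
    obtain ⟨v, hv, rfl⟩ := hs.exists_of_mem_facets hFK
    have hin := 𝒯.inside hd hΩ.convex hK
    obtain ⟨w, hw, h⟩ := exists_face_projection hs hv k
      (pairL_mem_H1 hΩ.isOpen hΩ.convex hΩ.isBounded hΩ.nonempty hin u)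
    refine ⟨w, hw, fun L v' hv' e μ hμ => ?_⟩
    have hL := 𝒯.isSimplex hd L.2
    rw [fm_polyPair hL hv', ← e, ← fm_polyPair hs hv, h μ hμ]
    exact fm_pairL_eq hΩ.isOpen hΩ.convex hΩ.isBounded hΩ.nonempty hs hL _ _ hv hv' e μ u
  choose! w hw h using key
  refine ⟨w, fun F hF => mem_Pl_succ.1 (hw F hF), fun K v hv μ hμ => ?_⟩
  have hF : opp K.1 v ∈ 𝒯.faces :=
    Finset.mem_biUnion.2 ⟨K.1, K.2, (𝒯.isSimplex hd K.2).opp_mem_facets hv⟩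
  exact h _ hF K v hv rfl μ hμ

end Projection

/-! ### Projection errors measured on the whole domain -/

section Classes

variable {d m : ℕ} {Ω : Set (Space d)} (𝒯 : Triangulation Ω) (hd : 1 ≤ d)
  (hΩ : IsConvexPolyhedralDomain Ω)

/-- The restrictions to the elements of a function in `L²(Ω)`. -/
def scalarRes : L2 Ω →ₗ[ℝ] ScalarSpace 𝒯 where
  toFun F := WithLp.toLp 2 fun K => res (𝒯.inside hd hΩ.convex K.2) F
  map_add' F G := by ext1 K; exact map_add (res _) F G
  map_smul' c F := by ext1 K; exact map_smul (res _) c F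

/-- The restrictions to the elements of a vector field. -/
def fluxRes : VSobolev Ω m →ₗ[ℝ] FluxSpace 𝒯 where
  toFun q := WithLp.toLp 2 fun j => res (𝒯.inside hd hΩ.convex j.1.2) (q j.2).toL2
  map_add' q r := by ext1 j; exact map_add (res _) (q j.2).toL2 (r j.2).toL2
  map_smul' c q := by ext1 j; exact map_smul (res _) c (q j.2).toL2

variable {𝒯}

theorem Triangulation.ShapeRegular.sigma_nonneg {σ : ℝ} (hσ : 𝒯.ShapeRegular σ) (K : 𝒯.elements) : 0 ≤ σ := by
  obtain ⟨c, ρ, hρ, -, h⟩ := hσ K.1 K.2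
  by_contra! hcon
  have : (0 : ℝ) ≤ Metric.diam (hull K.1) := Metric.diam_nonneg
  nlinarith

include hd in
theorem Triangulation.ShapeRegular.diam_le {σ : ℝ} (hσ : 𝒯.ShapeRegular σ) (K : 𝒯.elements) {v : Space d}
    (hv : v ∈ K.1) : Metric.diam (hull K.1) ≤ σ * height K.1 v := by
  have h0 := hσ.sigma_nonneg K
  obtain ⟨c, ρ, hρ, hb, h⟩ := hσ K.1 K.2
  exact h.trans (mul_le_mul_of_nonneg_left
    ((𝒯.isSimplex hd K.2).le_height_of_closedBall_subset hv hρ hb) h0)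

theorem exists_element (hΩ : IsConvexPolyhedralDomain Ω) : Nonempty 𝒯.elements := by
  obtain ⟨x, hx⟩ := hΩ.nonempty
  have := 𝒯.cover_hull ▸ subset_closure hx
  obtain ⟨K, hK, -⟩ := mem_iUnion₂.1 this
  exact ⟨⟨K, hK⟩⟩

variable {hd hΩ}

/-- The error of the projection on the whole domain. -/
theorem IsElementProjection.norm_le {k : ℕ} {τ : Stabilization d} (hτ : τ.Nonneg 𝒯) {C σ : ℝ}
    (hτC : τ.BoundedBy 𝒯 C) (hσ : 𝒯.ShapeRegular σ) {q : VSobolev Ω (k + 1)}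
    {u : Sobolev Ω (k + 1)} {p : VPiecewise d} {z : Piecewise d}
    (h : IsElementProjection hd hΩ 𝒯 k τ q u p z) :
    ‖scalarClass 𝒯 z - scalarRes 𝒯 hd hΩ u.toL2‖ ≤
      projConst d k C σ * 𝒯.meshSize ^ (k + 1) * (d + 1) * (‖u‖ + ‖q‖) ∧
    ‖fluxClass 𝒯 p - fluxRes 𝒯 hd hΩ q‖ ≤
      projConst d k C σ * 𝒯.meshSize ^ (k + 1) * (d + 1) * (‖u‖ + ‖q‖) := by
  obtain ⟨K₀⟩ := exists_element (𝒯 := 𝒯) hΩ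
  have hσ0 := hσ.sigma_nonneg K₀
  have hC0 : 0 ≤ C := by
    obtain ⟨v0, -, hpos, hC, -⟩ := exists_face_max hd hτC K₀
    exact (one_div_pos.2 hpos).le.trans hC
  have hc := projConst_nonneg (d := d) (k := k) hC0 hσ0
  choose v0 hv0 hpos hC hle using fun K : 𝒯.elements => exists_face_max hd hτC K
  have key := fun K : 𝒯.elements => local_projection_error hΩ.isOpen hΩ.convex hΩ.isBounded
    hΩ.nonempty (𝒯.isSimplex hd K.2) (𝒯.inside hd hΩ.convex K.2)
    (τ := fun v => τ K.1 (opp K.1 v))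
    (fun v hv => hτ K.1 K.2 _ ((𝒯.isSimplex hd K.2).opp_mem_facets hv)) (hv0 K) (hpos K) (hC K)
    (hle K) hσ0 (fun v hv => hσ.diam_le hd K hv) q u
    (fun i => mem_Pl_succ.2 (h.1 i K.1 K.2)) (mem_Pl_succ.2 (h.2.1 K.1 K.2)) (h.2.2 K)
  have hmono : ∀ K : 𝒯.elements, ∀ N : ℝ, 0 ≤ N →
      projConst d k C σ * Metric.diam (hull K.1) ^ (k + 1) * N ≤
      projConst d k C σ * 𝒯.meshSize ^ (k + 1) * N := fun K N hN =>
    mul_le_mul_of_nonneg_right (mul_le_mul_of_nonneg_left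
      (pow_le_pow_left₀ Metric.diam_nonneg (𝒯.diam_le_meshSize K.2) _) hc) hN
  have hN : ∀ K : 𝒯.elements, 0 ≤ localNorm (𝒯.inside hd hΩ.convex K.2) u +
      ∑ j, localNorm (𝒯.inside hd hΩ.convex K.2) (q j) := fun K =>
    add_nonneg (localNorm_nonneg _ _) (Finset.sum_nonneg fun j _ => localNorm_nonneg _ _)
  exact 𝒯.norm_le_of_local hd hΩ.convex (mul_nonneg hc (pow_nonneg 𝒯.meshSize_nonneg _)) u q
    (scalarClass 𝒯 z - scalarRes 𝒯 hd hΩ u.toL2) (fluxClass 𝒯 p - fluxRes 𝒯 hd hΩ q)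
    (fun K => (key K).1.trans (hmono K _ (hN K)))
    (fun K i => ((key K).2 i).trans (hmono K _ (hN K)))

end Classes

/-! ### Equations for the projected errors -/

section ErrorEquations

variable {d k : ℕ} {Ω : Set (Space d)} {𝒯 : Triangulation Ω} {hd : 1 ≤ d}
  {hΩ : IsConvexPolyhedralDomain Ω} {τ : Stabilization d} {α T : ℝ}
  {f : ℝ → L2 Ω} {g : Space d → ℝ} {u₀ : Sobolev Ω (k + 1)} {u : ℝ → Sobolev Ω (k + 1)}
  {q : ℝ → VSobolev Ω (k + 1)} {uh : ℝ → Piecewise d} {qh : ℝ → VPiecewise d}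
  {uhat : ℝ → Piecewise d} {p : VPiecewise d} {z w : Piecewise d}

theorem sum_fm_pairL {K : Finset (Space d)} (hΩ : IsConvexPolyhedralDomain Ω) (hK : IsSimplex K)
    (h : Inside K Ω) (i : Fin d) (μ : MvPolynomial (Fin d) ℝ) (v : Sobolev Ω (k + 1)) :
    ∑ a ∈ K, nrm K a i * fm K a μ (pairL h v) = ⟪pol K μ, res h (v.grad i)⟫_ℝ +
      ⟪pol K (MvPolynomial.pderiv i μ), res h v.toL2⟫_ℝ :=
  sum_fm hK i μ (pairL_mem_H1 hΩ.isOpen hΩ.convex hΩ.isBounded hΩ.nonempty h v)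

theorem IsExactSolution.flux_local (hu : IsExactSolution Ω α T f g u₀ u q) {t : ℝ}
    (ht : t ∈ Icc 0 T) (hΩ : IsConvexPolyhedralDomain Ω) {K : Finset (Space d)} (hK : IsSimplex K)
    (h : Inside K Ω) (r : Fin d → MvPolynomial (Fin d) ℝ) :
    ∑ i, ⟪pol K (r i), res h (q t i).toL2⟫_ℝ -
      ∑ i, ⟪pol K (MvPolynomial.pderiv i (r i)), res h (u t).toL2⟫_ℝ +
      ∑ v ∈ K, ∑ i, nrm K v i * fm K v (r i) (pairL h (u t)) = 0 := by
  rw [Finset.sum_comm, ← Finset.sum_sub_distrib, ← Finset.sum_add_distrib]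
  refine Finset.sum_eq_zero fun i _ => ?_
  rw [sum_fm_pairL hΩ hK, hu.flux t ht i, map_neg, inner_neg_right]
  ring

/-- Exact and discrete solution satisfy the same flux equation on each element. The projection may
replace the exact solution wherever it is tested with derivatives or on faces, and only the term `δ`
remains. -/
theorem isErrorTriple_of_solution (hu : IsExactSolution Ω α T f g u₀ u q)
    (hs : IsHDGSolution 𝒯 k τ α T f g u₀ (q 0) uh qh uhat) {t : ℝ} (ht : t ∈ Ioc 0 T)
    (hp : IsElementProjection hd hΩ 𝒯 k τ (q t) (u t) p z) (hw : w ∈ Mh 𝒯 k)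
    (hwu : ∀ K : 𝒯.elements, ∀ v ∈ K.1, ∀ μ ∈ Pl d (k + 1),
      fm K.1 v μ (polyPair K.1 (w (opp K.1 v))) =
        fm K.1 v μ (pairL (𝒯.inside hd hΩ.convex K.2) (u t))) :
    IsErrorTriple 𝒯 k τ (p - qh t) (z - uh t) (w - uhat t)
      (fluxClass 𝒯 p - fluxRes 𝒯 hd hΩ (q t)) := by
  have ht' : t ∈ Icc 0 T := Ioc_subset_Icc_self ht
  refine ⟨fun i K hK => ?_, fun K hK => ?_, fun F hF => ?_, fun K r hr => ?_,
    fun K hK v hv hb μ hμ => ?_, fun F hF hb μ hμ c hc hc0 => ?_⟩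
  · exact mem_Pl_succ.1 (Submodule.sub_mem _ (mem_Pl_succ.2 (hp.1 i K hK))
      (mem_Pl_succ.2 (hs.mem_Vh t ht i K hK)))
  · exact mem_Pl_succ.1 (Submodule.sub_mem _ (mem_Pl_succ.2 (hp.2.1 K hK))
      (mem_Pl_succ.2 (hs.mem_Wh t ht' K hK)))
  · exact mem_Pl_succ.1 (Submodule.sub_mem _ (mem_Pl_succ.2 (hw F hF))
      (mem_Pl_succ.2 (hs.mem_Mh t ht F hF)))
  · have hK := 𝒯.isSimplex hd K.2
    have hin := 𝒯.inside hd hΩ.convex K.2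
    have e1 := hs.flux_local hd ht K.2 hr
    have e2 := hu.flux_local ht' hΩ hK hin r
    -- The divergence of a test field has degree less than `k`, where `Π_W u` and `u` have the same
    -- moments.
    have e3 : ∑ i, ⟪pol K.1 (MvPolynomial.pderiv i (r i)), pol K.1 (z K.1)⟫_ℝ =
        ∑ i, ⟪pol K.1 (MvPolynomial.pderiv i (r i)), res hin (u t).toL2⟫_ℝ := by
      refine Finset.sum_congr rfl fun i _ => ?_
      have := (hp.2.2 K).scal _ (pderiv_mem_Pl (hr i) i)
      rw [Prod.fst_sub, inner_sub_right] at this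
      exact sub_eq_zero.1 this
    have e4 : ∑ v ∈ K.1, ∑ i, nrm K.1 v i * fm K.1 v (r i) (polyPair K.1 (w (opp K.1 v))) =
        ∑ v ∈ K.1, ∑ i, nrm K.1 v i * fm K.1 v (r i) (pairL hin (u t)) :=
      Finset.sum_congr rfl fun v hv => Finset.sum_congr rfl fun i _ => by
        rw [hwu K v hv (r i) (hr i)]
    have e5 : ∑ i, ⟪pol K.1 (r i), (fluxClass 𝒯 p - fluxRes 𝒯 hd hΩ (q t)) (K, i)⟫_ℝ =
        ∑ i, ⟪pol K.1 (r i), pol K.1 (p i K.1)⟫_ℝ -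
        ∑ i, ⟪pol K.1 (r i), res hin (q t i).toL2⟫_ℝ := by
      rw [← Finset.sum_sub_distrib]
      exact Finset.sum_congr rfl fun i _ => inner_sub_right _ _ _
    rw [e5]
    simp only [Pi.sub_apply, map_sub, inner_sub_right, mul_sub, Finset.sum_sub_distrib]
    linarith
  · have hK' := 𝒯.isSimplex hd hK
    have hF : opp K v ∈ 𝒯.faces := Finset.mem_biUnion.2 ⟨K, hK, hK'.opp_mem_facets hv⟩
    have e := hs.boundary_face ht hF hb hμ
    rw [integral_trace hΩ.isOpen hΩ.isBounded hK' (𝒯.inside hd hΩ.convex hK) hv hb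
      (hu.boundary t ht) μ, ← fm_polyPair hK' hv] at e
    rw [Pi.sub_apply, map_sub, map_sub, e, hwu ⟨K, hK⟩ v hv μ hμ, sub_self]
  · classical
    have hfilter : ∑ K ∈ 𝒯.elements, c K = ∑ K ∈ 𝒯.elements with F ∈ facets K, c K := by
      rw [Finset.sum_filter]
      refine Finset.sum_congr rfl fun K hK => ?_
      split_ifs with h
      · rfl
      · exact hc0 K hK h
    obtain ⟨K₀, hK₀, hFK₀⟩ := Finset.mem_biUnion.1 hF
    have hs₀ := 𝒯.isSimplex hd hK₀
    obtain ⟨v₀, hv₀, hFv₀⟩ := hs₀.exists_of_mem_facets hFK₀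
    -- The face condition of the projection converts the projected flux into the exact one, whose
    -- moments do not depend on the side; its sum vanishes because the normals cancel, and the
    -- discrete flux is conservative.
    have hlocal : ∀ K ∈ 𝒯.elements, F ∈ facets K →
        c K = ∑ i, normal K F i *
          fm K₀ v₀ μ (pairL (𝒯.inside hd hΩ.convex hK₀) (q t i)) - ∫ x in hull F,
          ⟪numFlux τ (qh t) (uh t) (uhat t) K F x, normal K F⟫_ℝ * ev μ x ∂(surf d) := by
      intro K hK hFK
      have hK' := 𝒯.isSimplex hd hK
      obtain ⟨v, hv, hFv⟩ := hK'.exists_of_mem_facets hFK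
      have hin := 𝒯.inside hd hΩ.convex hK
      rw [hc K hK v hv hFv]
      subst hFv
      simp only [inner_numFlux (hK'.nrm_spec hv).unit]
      rw [integral_face_combination hK' hv]
      have e1 := (hp.2.2 ⟨K, hK⟩).face v hv μ hμ
      have e2 := hwu ⟨K, hK⟩ v hv μ hμ
      have e3 : ∀ i, fm K₀ v₀ μ (pairL (𝒯.inside hd hΩ.convex hK₀) (q t i)) =
          fm K v μ (pairL hin (q t i)) := fun i =>
        (fm_pairL_eq hΩ.isOpen hΩ.convex hΩ.isBounded hΩ.nonempty hK' hs₀ hin _ hv hv₀ hFv₀ μ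
          (q t i)).symm
      simp only [e3]
      simp only [Pi.sub_apply, map_sub, mul_sub, Finset.sum_sub_distrib] at e1 e2 ⊢
      rw [e2]
      linarith
    rw [hfilter, Finset.sum_congr rfl fun K hK =>
      hlocal K (Finset.mem_filter.1 hK).1 (Finset.mem_filter.1 hK).2, Finset.sum_sub_distrib,
      hs.transmission_face ht hb hμ, sub_zero, Finset.sum_comm]
    refine Finset.sum_eq_zero fun i _ => ?_
    rw [← Finset.sum_mul]
    have e := congrArg (fun x : Space d => x i) (𝒯.sum_normal_eq_zero hd hΩ.isOpen hF hb)
    simp only [WithLp.ofLp_sum, Finset.sum_apply, PiLp.zero_apply] at e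
    rw [e, zero_mul]

/-- Bochner integration commutes with functionals. -/
theorem caputo_clm {X : Type*} [NormedAddCommGroup X] [NormedSpace ℝ X] [CompleteSpace X]
    (hα : 0 < α) {v : ℝ → X} (hv : ContDiffOn ℝ 1 v (Icc 0 T)) (ℓ : X →L[ℝ] ℝ) {t : ℝ}
    (ht : t ∈ Ioc 0 T) : caputo α (fun s => ℓ (v s)) t = ℓ (caputo α v t) := by
  have hT : 0 < T := ht.1.trans_le ht.2
  have hd : ∀ s ∈ Ioo 0 t, DifferentiableAt ℝ v s ∧ deriv v s = derivWithin v (Icc 0 T) s := by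
    intro s hs
    have hn : Icc 0 T ∈ nhds s := Icc_mem_nhds hs.1 (hs.2.trans_le ht.2)
    exact ⟨(hv.differentiableOn one_ne_zero).differentiableAt hn, (derivWithin_of_mem_nhds hn).symm⟩
  have hc := hv.continuousOn_derivWithin (uniqueDiffOn_Icc hT) le_rfl
  have hne : ∀ᵐ s : ℝ, s ≠ t := by simp [ae_iff, measure_singleton]
  have hint : IntervalIntegrable (fun s => omega α (t - s) • derivWithin v (Icc 0 T) s) volume 0 t :=
    (intervalIntegrable_omega hα).smul_continuousOn (hc.mono (by
      rw [uIcc_of_le ht.1.le]; exact Icc_subset_Icc_right ht.2))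
  have e1 : caputo α v t = ∫ s in (0 : ℝ)..t, omega α (t - s) • derivWithin v (Icc 0 T) s := by
    refine intervalIntegral.integral_congr_ae ?_
    filter_upwards [hne] with s hs hs'
    rw [uIoc_of_le ht.1.le] at hs'
    rw [(hd s ⟨hs'.1, lt_of_le_of_ne hs'.2 hs⟩).2]
  rw [e1, ← ContinuousLinearMap.intervalIntegral_comp_comm ℓ hint]
  refine intervalIntegral.integral_congr_ae ?_
  filter_upwards [hne] with s hs hs'
  rw [uIoc_of_le ht.1.le] at hs'
  obtain ⟨h1, h2⟩ := hd s ⟨hs'.1, lt_of_le_of_ne hs'.2 hs⟩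
  rw [map_smul, ← h2]
  congr 1
  exact (ℓ.hasFDerivAt.comp_hasDerivAt s h1.hasDerivAt).deriv

end ErrorEquations

/-! ### The projected errors as an abstract error system -/

section Evolution

variable {d k : ℕ} {Ω : Set (Space d)} {𝒯 : Triangulation Ω} {hd : 1 ≤ d}
  {hΩ : IsConvexPolyhedralDomain Ω} {τ : Stabilization d} {α T : ℝ}
  {f : ℝ → L2 Ω} {g : Space d → ℝ} {u₀ : Sobolev Ω (k + 1)} {u : ℝ → Sobolev Ω (k + 1)}
  {q : ℝ → VSobolev Ω (k + 1)} {uh : ℝ → Piecewise d} {qh : ℝ → VPiecewise d}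
  {uhat : ℝ → Piecewise d} {p : VPiecewise d} {z w : Piecewise d}

/-- Functionals of a `C¹` function have a Caputo derivative. -/
theorem caputoRegular_clm {X : Type*} [NormedAddCommGroup X] [NormedSpace ℝ X]
    (hα : 0 < α) (hT : 0 < T) {v : ℝ → X} (hv : ContDiffOn ℝ 1 v (Icc 0 T)) (ℓ : X →L[ℝ] ℝ) :
    CaputoRegular α T (fun s => ℓ (v s)) := by
  have h0 : 0 ≤ c1Norm T v :=
    (norm_nonneg _).trans (norm_le_c1Norm hT hv (left_mem_Icc.2 hT.le)).1
  refine CaputoRegular.of_lipschitz hα (mul_nonneg (norm_nonneg ℓ) h0) (fun s hs r hr => ?_) hT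
  rw [← map_sub, mul_assoc]
  exact (ℓ.le_opNorm _).trans
    (mul_le_mul_of_nonneg_left (norm_sub_le_c1Norm hT hv hs hr) (norm_nonneg ℓ))

theorem IsHDGSolution.caputoRegular (hs : IsHDGSolution 𝒯 k τ α T f g u₀ (q 0) uh qh uhat)
    {K : Finset (Space d)} (hK : K ∈ 𝒯.elements) (x : Space d) :
    CaputoRegular α T (fun s => ev (uh s K) x) :=
  ⟨hs.absCont K hK x, fun t ht => hs.fracIntegrable t ht K hK x⟩

theorem IsHDGSolution.mem_Pl (hs : IsHDGSolution 𝒯 k τ α T f g u₀ (q 0) uh qh uhat)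
    {K : Finset (Space d)} (hK : K ∈ 𝒯.elements) {s : ℝ} (h : s ∈ Icc 0 T) :
    uh s K ∈ Pl d (k + 1) := mem_Pl_succ.2 (hs.mem_Wh s h K hK)

/-- The scalar error on an element is regular in time. -/
theorem caputoRegular_local (hα : 0 < α) (hT : 0 < T)
    (hs : IsHDGSolution 𝒯 k τ α T f g u₀ (q 0) uh qh uhat)
    (hu1 : ContDiffOn ℝ 1 u (Icc 0 T)) {K : Finset (Space d)} (hK : K ∈ 𝒯.elements)
    (hin : Inside K Ω) (r : MvPolynomial (Fin d) ℝ) :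
    CaputoRegular α T (fun s => ⟪res hin (u s).toL2 - pol K (uh s K), pol K r⟫_ℝ) := by
  have r1 := caputoRegular_clm hα hT hu1
    ((innerSL ℝ (pol K r)).comp ((res hin).comp (Dmap (MultiIndex.zero d (k + 1)))))
  have r2 := (exists_caputo_poly hT (fun s h => hs.mem_Pl hK h)
    (fun x => hs.caputoRegular hK x)).1 ((innerₗ (LK K) (pol K r)).comp (pol K))
  refine (r1.add (r2.const_mul (-1))).congr hT fun s _ => ?_
  rw [real_inner_comm, inner_sub_right, neg_one_mul, ← sub_eq_add_neg]
  rfl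

set_option maxHeartbeats 2000000 in
/-- The balance equation for the projected errors on an element. -/
theorem fluxForm_eq_caputo (hα : 0 < α) (hu : IsExactSolution Ω α T f g u₀ u q)
    (hu1 : ContDiffOn ℝ 1 u (Icc 0 T))
    (hs : IsHDGSolution 𝒯 k τ α T f g u₀ (q 0) uh qh uhat) {t : ℝ} (ht : t ∈ Ioc 0 T)
    (hp : IsElementProjection hd hΩ 𝒯 k τ (q t) (u t) p z)
    (hwu : ∀ K : 𝒯.elements, ∀ v ∈ K.1, ∀ μ ∈ Pl d (k + 1),
      fm K.1 v μ (polyPair K.1 (w (opp K.1 v))) =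
        fm K.1 v μ (pairL (𝒯.inside hd hΩ.convex K.2) (u t)))
    (K : 𝒯.elements) {r : MvPolynomial (Fin d) ℝ} (hr : r ∈ Pl d (k + 1)) :
    fluxForm K.1 (fun v => τ K.1 (opp K.1 v)) (fun i => (p - qh t) i K.1)
        (fun v => (z - uh t) K.1 - (w - uhat t) (opp K.1 v)) r =
      caputo α (fun s => ⟪res (𝒯.inside hd hΩ.convex K.2) (u s).toL2 - pol K.1 (uh s K.1),
        pol K.1 r⟫_ℝ) t := by
  have hT : 0 < T := ht.1.trans_le ht.2
  have hK := 𝒯.isSimplex hd K.2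
  have hin := 𝒯.inside hd hΩ.convex K.2
  have hv1 : ContDiffOn ℝ 1 (fun s => (u s).toL2) (Icc 0 T) :=
    (Dmap (MultiIndex.zero d (k + 1))).contDiff.comp_contDiffOn hu1
  obtain ⟨hreg, hcap⟩ := exists_caputo_poly hT (fun s h => hs.mem_Pl K.2 h)
    (fun x => hs.caputoRegular K.2 x)
  obtain ⟨P, hP⟩ := hcap t ht
  have r1 := caputoRegular_clm hα hT hv1 ((innerSL ℝ (pol K.1 r)).comp (res hin))
  have r2 := hreg ((innerₗ (LK K.1) (pol K.1 r)).comp (pol K.1))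
  have e1 : caputo α (fun s => ⟪res hin (u s).toL2 - pol K.1 (uh s K.1), pol K.1 r⟫_ℝ) t =
      ⟪pol K.1 r, res hin (caputo α (fun s => (u s).toL2) t)⟫_ℝ - ⟪pol K.1 r, pol K.1 P⟫_ℝ := by
    have e : ∀ s ∈ Icc 0 T, ⟪res hin (u s).toL2 - pol K.1 (uh s K.1), pol K.1 r⟫_ℝ =
        ((innerSL ℝ (pol K.1 r)).comp (res hin)) (u s).toL2 +
        (-1) * ((innerₗ (LK K.1) (pol K.1 r)).comp (pol K.1)) (uh s K.1) := by
      intro s _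
      rw [real_inner_comm, inner_sub_right, neg_one_mul, ← sub_eq_add_neg]
      rfl
    rw [caputo_congr e ht, CaputoRegular.caputo_add r1 (r2.const_mul (-1)) ht, caputo_const_mul,
      caputo_clm hα hv1 _ ht, hP, neg_one_mul, ← sub_eq_add_neg]
    rfl
  -- Evaluation at a point is a linear functional, so the polynomial `P` takes the values of the
  -- pointwise Caputo derivative.
  have e2 := hs.balance_local hd (fun L hL => 𝒯.inside hd hΩ.convex hL) ht K.2 (P := P)
    (fun x => hP (MvPolynomial.aeval (R := ℝ) (fun i => x i)).toLinearMap) hr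
  have e3 : res hin (f t) = res hin (caputo α (fun s => (u s).toL2) t) +
      ∑ i, res hin ((q t i).grad i) := by
    rw [← hu.balance t ht, map_add, VSobolev.div, map_sum]
  -- The face condition replaces the projected numerical flux by the exact flux, and Gauss–Green
  -- rewrites the latter as volume terms.
  have e4 : ∑ v ∈ K.1, (∑ i, nrm K.1 v i * fm K.1 v r (polyPair K.1 (p i K.1)) +
      τ K.1 (opp K.1 v) * fm K.1 v r (polyPair K.1 (z K.1 - w (opp K.1 v)))) =
      ∑ i, (⟪pol K.1 r, res hin ((q t i).grad i)⟫_ℝ +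
        ⟪pol K.1 (MvPolynomial.pderiv i r), res hin (q t i).toL2⟫_ℝ) := by
    rw [← Finset.sum_congr rfl fun i _ => sum_fm_pairL hΩ hK hin i r (q t i), Finset.sum_comm]
    refine Finset.sum_congr rfl fun v hv => ?_
    have e5 := (hp.2.2 K).face v hv r hr
    have e6 := hwu K v hv r hr
    simp only [map_sub, mul_sub, Finset.sum_sub_distrib] at e5 e6 ⊢
    rw [e6]
    linarith
  have e7 : ∑ i, ⟪pol K.1 (p i K.1), pol K.1 (MvPolynomial.pderiv i r)⟫_ℝ =
      ∑ i, ⟪pol K.1 (MvPolynomial.pderiv i r), res hin (q t i).toL2⟫_ℝ := by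
    refine Finset.sum_congr rfl fun i _ => ?_
    have := (hp.2.2 K).vec i _ (pderiv_mem_Pl hr i)
    rw [Prod.fst_sub, inner_sub_right] at this
    rw [real_inner_comm]
    exact sub_eq_zero.1 this
  have e8 : fluxForm K.1 (fun v => τ K.1 (opp K.1 v)) (fun i => (p - qh t) i K.1)
        (fun v => (z - uh t) K.1 - (w - uhat t) (opp K.1 v)) r =
      fluxForm K.1 (fun v => τ K.1 (opp K.1 v)) (fun i => p i K.1)
        (fun v => z K.1 - w (opp K.1 v)) r -
      fluxForm K.1 (fun v => τ K.1 (opp K.1 v)) (fun i => qh t i K.1)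
        (fun v => uh t K.1 - uhat t (opp K.1 v)) r := by
    rw [← fluxForm_sub]
    congr 1
    congr 1
    funext v
    simp only [Pi.sub_apply]
    abel
  rw [e3, inner_add_right, inner_sum] at e2
  rw [e1, e8, fluxForm_apply, fluxForm_apply, e4, e7, Finset.sum_add_distrib]
  simp only [real_inner_comm (pol K.1 (MvPolynomial.pderiv _ r))] at e2 ⊢
  linarith

variable (𝒯 k) in
/-- The piecewise polynomials as a subspace of `L²`. -/
def polySpace : Submodule ℝ (ScalarSpace 𝒯) where
  carrier := {x | ∃ r ∈ Wh 𝒯 k, x = scalarClass 𝒯 r}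
  zero_mem' := ⟨0, fun K _ => by simp, by ext1 K; exact (map_zero (pol K.1)).symm⟩
  add_mem' := by
    rintro _ _ ⟨r, hr, rfl⟩ ⟨s, hs, rfl⟩
    refine ⟨r + s, fun K hK => mem_Pl_succ.1 (Submodule.add_mem _ (mem_Pl_succ.2 (hr K hK))
      (mem_Pl_succ.2 (hs K hK))), ?_⟩
    ext1 K
    exact (map_add (pol K.1) (r K.1) (s K.1)).symm
  smul_mem' := by
    rintro c _ ⟨r, hr, rfl⟩
    refine ⟨c • r, fun K hK => mem_Pl_succ.1 (Submodule.smul_mem _ c (mem_Pl_succ.2 (hr K hK))),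
      ?_⟩
    ext1 K
    exact (map_smul (pol K.1) c (r K.1)).symm

variable (hd hΩ) in
theorem inner_error (s : ℝ) (r : Piecewise d) :
    ⟪scalarRes 𝒯 hd hΩ (u s).toL2 - scalarClass 𝒯 (uh s), scalarClass 𝒯 r⟫_ℝ =
      ∑ K : 𝒯.elements, ⟪res (𝒯.inside hd hΩ.convex K.2) (u s).toL2 - pol K.1 (uh s K.1),
        pol K.1 (r K.1)⟫_ℝ := by
  rw [PiLp.inner_apply]
  rfl

theorem continuousOn_scalarClass (hT : 0 < T)
    (hs : IsHDGSolution 𝒯 k τ α T f g u₀ (q 0) uh qh uhat) :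
    ContinuousOn (fun s => scalarClass 𝒯 (uh s)) (Icc 0 T) := by
  refine (PiLp.continuous_toLp 2 _).comp_continuousOn (continuousOn_pi.2 fun K => ?_)
  obtain ⟨hreg, -⟩ := exists_caputo_poly hT (fun s h => hs.mem_Pl K.2 h)
    (fun x => hs.caputoRegular K.2 x)
  obtain ⟨N, hN⟩ := exists_monomial_expansion d (k + 1)
  have e : ∀ s ∈ Icc 0 T, pol K.1 (uh s K.1) =
      ∑ n ∈ N, (uh s K.1).coeff n • pol K.1 (MvPolynomial.monomial n 1) := by
    intro s h
    conv_lhs => rw [hN _ (hs.mem_Pl K.2 h)]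
    simp only [map_sum, map_smul]
  refine ContinuousOn.congr (continuousOn_finsetSum N fun n _ => ?_) e
  have := (hreg (MvPolynomial.lcoeff ℝ n)).ac.continuousOn
  rw [uIcc_of_le hT.le] at this
  exact this.smul continuousOn_const

/-- The projected errors form an error system. -/
theorem exists_errorSystem (hd : 1 ≤ d) (hΩ : IsConvexPolyhedralDomain Ω) (hα : 0 < α) (hT : 0 < T)
    (hu : IsExactSolution Ω α T f g u₀ u q) (hu1 : ContDiffOn ℝ 1 u (Icc 0 T))
    (hq1 : ContDiffOn ℝ 1 q (Icc 0 T)) {A B C σ : ℝ} (hA : c1Norm T u ≤ A) (hB : c1Norm T q ≤ B)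
    (hσ : 𝒯.ShapeRegular σ) (hτ : τ.Nonneg 𝒯) (hτC : τ.BoundedBy 𝒯 C)
    (hs : IsHDGSolution 𝒯 k τ α T f g u₀ (q 0) uh qh uhat) {L : ℝ}
    (hL : L = projConst d k C σ * 𝒯.meshSize ^ (k + 1) * (d + 1) * (A + B)) (hL0 : 0 ≤ L) :
    ∃ (E G η : ℝ → ScalarSpace 𝒯) (Q δ : ℝ → FluxSpace 𝒯) (Y : ℝ → JumpSpace 𝒯),
      ErrorSystem α T L (polySpace k 𝒯) E G η Q δ Y ∧
      scalarRes 𝒯 hd hΩ (u T).toL2 - scalarClass 𝒯 (uh T) = E T - η T ∧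
      fluxRes 𝒯 hd hΩ (q T) - fluxClass 𝒯 (qh T) = Q T - δ T ∧ ‖η T‖ ≤ L ∧ ‖δ T‖ ≤ L := by
  -- At time zero the projection is the one whose scalar part is the discrete initial value, so that
  -- `E` vanishes there without appealing to uniqueness.
  have hproj : ∀ t, ∃ p z, IsElementProjection hd hΩ 𝒯 k τ (q t) (u t) p z ∧
      (t = 0 → z = uh 0) := by
    intro t
    by_cases ht : t = 0
    · subst ht
      obtain ⟨p, hp⟩ := hs.initial
      exact ⟨p, uh 0, hu.initial ▸ hp.isElementProjection, fun _ => rfl⟩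
    · obtain ⟨p, z, h⟩ := exists_isElementProjection (hd := hd) (hΩ := hΩ) (k := k) hτ hτC (q t) (u t)
      exact ⟨p, z, h, fun h => absurd h ht⟩
  choose p z hp hz0 using hproj
  choose w hw hwu using fun t => exists_traceProjection 𝒯 hd hΩ k (u t)
  choose G hG using fun t =>
    exists_isBalance (k := k) 𝒯 hd τ (p t - qh t) (z t - uh t) (w t - uhat t)
  have htrip : ∀ t ∈ Ioc 0 T, _ := fun t ht =>
    isErrorTriple_of_solution (hd := hd) hu hs ht (hp t) (hw t) (hwu t)
  have hscale : ∀ a b : ℝ, a ≤ b →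
      projConst d k C σ * 𝒯.meshSize ^ (k + 1) * (d + 1) * a ≤
      projConst d k C σ * 𝒯.meshSize ^ (k + 1) * (d + 1) * b := by
    intro a b hab
    obtain ⟨K₀⟩ := exists_element (𝒯 := 𝒯) hΩ
    obtain ⟨v0, -, hpos, hC, -⟩ := exists_face_max hd hτC K₀
    have h1 := projConst_nonneg (d := d) (k := k) ((one_div_pos.2 hpos).le.trans hC)
      (hσ.sigma_nonneg K₀)
    have h2 := 𝒯.meshSize_nonneg
    exact mul_le_mul_of_nonneg_left hab (by positivity)
  have hle : ∀ t ∈ Icc 0 T, ‖scalarClass 𝒯 (z t) - scalarRes 𝒯 hd hΩ (u t).toL2‖ ≤ L ∧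
      ‖fluxClass 𝒯 (p t) - fluxRes 𝒯 hd hΩ (q t)‖ ≤ L := by
    intro t ht
    have h := (hp t).norm_le hτ hτC hσ
    have h3 := hscale _ _ (add_le_add ((norm_le_c1Norm hT hu1 ht).1.trans hA)
      ((norm_le_c1Norm hT hq1 ht).1.trans hB))
    rw [hL]
    exact ⟨h.1.trans h3, h.2.trans h3⟩
  -- The difference of two projections is the projection of the difference, so the approximation
  -- estimate applied to `u s - u t` and `q s - q t` yields the Lipschitz bound.
  have hlip : ∀ s ∈ Icc 0 T, ∀ t ∈ Icc 0 T,
      ‖(scalarClass 𝒯 (z s) - scalarRes 𝒯 hd hΩ (u s).toL2) -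
        (scalarClass 𝒯 (z t) - scalarRes 𝒯 hd hΩ (u t).toL2)‖ ≤ L * |s - t| ∧
      ‖(fluxClass 𝒯 (p s) - fluxRes 𝒯 hd hΩ (q s)) -
        (fluxClass 𝒯 (p t) - fluxRes 𝒯 hd hΩ (q t))‖ ≤ L * |s - t| := by
    intro s hs' t ht
    have h := ((hp s).sub (hp t)).norm_le hτ hτC hσ
    have h3 := hscale (‖u s - u t‖ + ‖q s - q t‖) ((A + B) * |s - t|) (by
      rw [add_mul]
      exact add_le_add
        ((norm_sub_le_c1Norm hT hu1 hs' ht).trans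
          (mul_le_mul_of_nonneg_right hA (abs_nonneg _)))
        ((norm_sub_le_c1Norm hT hq1 hs' ht).trans
          (mul_le_mul_of_nonneg_right hB (abs_nonneg _))))
    rw [← mul_assoc, ← hL] at h3
    have e1 : (scalarClass 𝒯 (z s) - scalarRes 𝒯 hd hΩ (u s).toL2) -
        (scalarClass 𝒯 (z t) - scalarRes 𝒯 hd hΩ (u t).toL2) =
        scalarClass 𝒯 (z s - z t) - scalarRes 𝒯 hd hΩ (u s - u t).toL2 := by
      have : (u s - u t).toL2 = (u s).toL2 - (u t).toL2 := rfl
      rw [this, map_sub, scalarClass_sub]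
      abel
    have e2 : (fluxClass 𝒯 (p s) - fluxRes 𝒯 hd hΩ (q s)) -
        (fluxClass 𝒯 (p t) - fluxRes 𝒯 hd hΩ (q t)) =
        fluxClass 𝒯 (p s - p t) - fluxRes 𝒯 hd hΩ (q s - q t) := by
      rw [map_sub, fluxClass_sub]
      abel
    rw [e1, e2]
    exact ⟨h.1.trans h3, h.2.trans h3⟩
  have hdiff : ∀ s, scalarClass 𝒯 (z s - uh s) -
      (scalarClass 𝒯 (z s) - scalarRes 𝒯 hd hΩ (u s).toL2) =
      scalarRes 𝒯 hd hΩ (u s).toL2 - scalarClass 𝒯 (uh s) := by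
    intro s
    rw [scalarClass_sub]
    abel
  -- `M` may depend on the mesh and on `τ`: it only enters the continuity in time of `Q` and `Y` and
  -- their behaviour near `0`, not the final bound.
  obtain ⟨M, hM, hMle⟩ := exists_norm_balance_le (k := k) 𝒯 hd hτ
  refine ⟨fun t => scalarClass 𝒯 (z t - uh t), fun t => scalarClass 𝒯 (G t),
    fun t => scalarClass 𝒯 (z t) - scalarRes 𝒯 hd hΩ (u t).toL2,
    fun t => fluxClass 𝒯 (p t - qh t), fun t => fluxClass 𝒯 (p t) - fluxRes 𝒯 hd hΩ (q t),
    fun t => jumpClass 𝒯 hd τ (z t - uh t) (w t - uhat t), ?_, (hdiff T).symm, ?_,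
    (hle T (right_mem_Icc.2 hT.le)).1, (hle T (right_mem_Icc.2 hT.le)).2⟩
  swap
  · simp only
    rw [fluxClass_sub]
    abel
  constructor
  · change scalarClass 𝒯 (z 0 - uh 0) = 0
    rw [hz0 0 rfl, scalarClass_sub, sub_self]
  · exact fun t ht => ⟨_, fun K hK => mem_Pl_succ.1 (Submodule.sub_mem _
      (mem_Pl_succ.2 ((hp t).2.1 K hK)) (hs.mem_Pl hK ht)), rfl⟩
  · exact fun t _ => ⟨_, fun K hK => mem_Pl_succ.1 (hG t K hK).1, rfl⟩
  · have h1 : ContinuousOn (fun s => scalarClass 𝒯 (z s) - scalarRes 𝒯 hd hΩ (u s).toL2)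
        (Icc 0 T) := by
      have : LipschitzOnWith ⟨L, hL0⟩
          (fun s => scalarClass 𝒯 (z s) - scalarRes 𝒯 hd hΩ (u s).toL2) (Icc 0 T) :=
        LipschitzOnWith.of_dist_le_mul fun x hx y hy => by
          rw [dist_eq_norm, Real.dist_eq]; exact (hlip x hx y hy).1
      exact this.continuousOn
    have h2 : ContinuousOn (fun s => scalarRes 𝒯 hd hΩ (u s).toL2) (Icc 0 T) := by
      refine (PiLp.continuous_toLp 2 _).comp_continuousOn (continuousOn_pi.2 fun K => ?_)
      exact ((res (𝒯.inside hd hΩ.convex K.2)).comp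
        (Dmap (MultiIndex.zero d (k + 1)))).continuous.comp_continuousOn hu1.continuousOn
    refine ((h1.add h2).sub (continuousOn_scalarClass hT hs)).congr fun s _ => ?_
    simp only [Pi.sub_apply, Pi.add_apply, scalarClass_sub]
    abel
  · rintro _ ⟨r, hr, rfl⟩
    simp only [hdiff, inner_error]
    exact CaputoRegular.sum _ fun K _ => caputoRegular_local hα hT hs hu1 K.2 _ _
  · rintro t ht _ ⟨r, hr, rfl⟩
    simp only [hdiff, inner_error]
    rw [CaputoRegular.caputo_sum _ (fun K _ => caputoRegular_local hα hT hs hu1 K.2 _ _) ht,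
      (hG t).inner hr]
    exact Finset.sum_congr rfl fun K _ => fluxForm_eq_caputo hα hu hu1 hs ht (hp t) (hwu t) K
      (mem_Pl_succ.2 (hr K.1 K.2))
  · exact fun s h t ht => (hlip s h t ht).1
  · exact fun s h t ht => (hlip s h t ht).2
  · exact fun s h => (hle s h).2
  · exact fun s h t ht => (htrip t ht).energy hd hτ (htrip s h) (hG t)
  · refine ⟨M, hM, fun t ht => hMle _ _ _ _ (htrip t ht).mem_q (hG t), fun s h t ht => ?_⟩
    have := hMle ((p t - qh t) - (p s - qh s)) ((z t - uh t) - (z s - uh s))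
      ((w t - uhat t) - (w s - uhat s)) (G t - G s) (fun i K hK => mem_Pl_succ.1 (Submodule.sub_mem _
      (mem_Pl_succ.2 ((htrip t ht).mem_q i K hK)) (mem_Pl_succ.2 ((htrip s h).mem_q i K hK))))
      ((hG t).sub (hG s))
    rw [fluxClass_sub, jumpClass_sub, scalarClass_sub] at this
    exact this

end Evolution

/-! ### Norms on the domain -/

section Norms

variable {d k m : ℕ} {Ω : Set (Space d)} {𝒯 : Triangulation Ω} (hd : 1 ≤ d)
  (hΩ : IsConvexPolyhedralDomain Ω)
include hd hΩ

omit hd in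
theorem memLp_toFun (r : Piecewise d) : MemLp (toFun 𝒯 r) 2 (volume.restrict Ω) := by
  have h : ∀ K ∈ 𝒯.elements,
      MemLp ((interior (hull K)).indicator (ev (r K))) 2 (volume.restrict Ω) := fun K _ =>
    (memLp_of_continuous hΩ.isBounded hΩ.isOpen.measurableSet (continuous_ev _)).indicator
      isOpen_interior.measurableSet
  exact memLp_finsetSum _ h

/-- The `L²(Ω)` distance to a piecewise polynomial, computed on the elements. -/
theorem eLpNorm_sub_toFun_le (F : L2 Ω) (r : Piecewise d) {N : ℝ} (hN : 0 ≤ N)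
    (h : ∑ K : 𝒯.elements, ‖res (𝒯.inside hd hΩ.convex K.2) F - pol K.1 (r K.1)‖ ^ 2 ≤ N ^ 2) :
    eLpNorm (fun x => F x - toFun 𝒯 r x) 2 (volume.restrict Ω) ≤ ENNReal.ofReal N := by
  have hF : MemLp (F : Space d → ℝ) 2 (volume.restrict Ω) := Lp.memLp F
  have hr := memLp_toFun (𝒯 := 𝒯) hΩ r
  have hsub : MemLp (fun x => F x - toFun 𝒯 r x) 2 (volume.restrict Ω) := hF.sub hr
  rw [eLpNorm_eq_norm_toL hsub]
  refine ENNReal.ofReal_le_ofReal ((abs_le_of_sq_le_sq' ?_ hN).2)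
  rw [𝒯.norm_sq_eq_sum hd hΩ.convex]
  refine le_of_eq_of_le (Finset.sum_congr rfl fun K _ => ?_) h
  congr 2
  have hin := 𝒯.inside hd hΩ.convex K.2
  have e : res hin (toL (volume.restrict Ω) (toFun 𝒯 r)) = pol K.1 (r K.1) := by
    rw [res_toL hin hr]
    exact toL_congr (hr.mono_measure hin) (𝒯.toFun_ae hd r K.2)
  rw [toL_sub hF hr, map_sub, e, toL_coe]

theorem eLpNorm_sub_vtoFun_le (Q : VSobolev Ω m) (r : VPiecewise d) {N : ℝ} (hN : 0 ≤ N)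
    (h : ∀ i, ∑ K : 𝒯.elements,
      ‖res (𝒯.inside hd hΩ.convex K.2) (Q i).toL2 - pol K.1 (r i K.1)‖ ^ 2 ≤ N ^ 2) :
    eLpNorm (fun x => vval Q x - vtoFun 𝒯 r x) 2 (volume.restrict Ω) ≤ ENNReal.ofReal (d * N) := by
  -- The Euclidean length is at most the sum of the components, which costs the factor `d`.
  have h1 : eLpNorm (fun x => vval Q x - vtoFun 𝒯 r x) 2 (volume.restrict Ω) ≤
      eLpNorm (∑ i, fun x => ‖(Q i).toL2 x - toFun 𝒯 (r i) x‖) 2 (volume.restrict Ω) := by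
    refine eLpNorm_mono fun x => ?_
    rw [Finset.sum_apply, Real.norm_of_nonneg (Finset.sum_nonneg fun i _ => norm_nonneg _)]
    have e : ‖vval Q x - vtoFun 𝒯 r x‖ ^ 2 = ∑ i, ‖(Q i).toL2 x - toFun 𝒯 (r i) x‖ ^ 2 :=
      PiLp.norm_sq_eq_of_L2 _ _
    refine (abs_le_of_sq_le_sq' ?_ (Finset.sum_nonneg fun i _ => norm_nonneg _)).2
    rw [e]
    exact Finset.sum_sq_le_sq_sum_of_nonneg fun _ _ => norm_nonneg _
  refine h1.trans ((eLpNorm_sum_le (fun i _ => ?_) one_le_two).trans ?_)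
  · exact ((Lp.memLp (Q i).toL2).sub (memLp_toFun hΩ (r i))).1.norm
  · calc ∑ i, eLpNorm (fun x => ‖(Q i).toL2 x - toFun 𝒯 (r i) x‖) 2 (volume.restrict Ω)
        ≤ ∑ _i : Fin d, ENNReal.ofReal N := Finset.sum_le_sum fun i _ => by
          rw [eLpNorm_norm]
          exact eLpNorm_sub_toFun_le hd hΩ (Q i).toL2 (r i) hN (h i)
      _ = ENNReal.ofReal (d * N) := by
          rw [Finset.sum_const, Finset.card_univ, Fintype.card_fin, nsmul_eq_mul,
            ENNReal.ofReal_mul (Nat.cast_nonneg d), ENNReal.ofReal_natCast]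

theorem eLpNorm_scalar_le (F : L2 Ω) (r : Piecewise d) {N : ℝ}
    (h : ‖scalarRes 𝒯 hd hΩ F - scalarClass 𝒯 r‖ ≤ N) :
    eLpNorm (fun x => F x - toFun 𝒯 r x) 2 (volume.restrict Ω) ≤ ENNReal.ofReal N := by
  refine eLpNorm_sub_toFun_le hd hΩ F r ((norm_nonneg _).trans h) ?_
  have := pow_le_pow_left₀ (norm_nonneg _) h 2
  rwa [PiLp.norm_sq_eq_of_L2] at this

theorem eLpNorm_flux_le (Q : VSobolev Ω m) (r : VPiecewise d) {N : ℝ}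
    (h : ‖fluxRes 𝒯 hd hΩ Q - fluxClass 𝒯 r‖ ≤ N) :
    eLpNorm (fun x => vval Q x - vtoFun 𝒯 r x) 2 (volume.restrict Ω) ≤
      ENNReal.ofReal (d * N) := by
  refine eLpNorm_sub_vtoFun_le hd hΩ Q r ((norm_nonneg _).trans h) fun i => ?_
  have := pow_le_pow_left₀ (norm_nonneg _) h 2
  rw [PiLp.norm_sq_eq_of_L2, Fintype.sum_prod_type, Finset.sum_comm] at this
  exact (Finset.single_le_sum (f := fun i => ∑ K : 𝒯.elements,
    ‖(fluxRes 𝒯 hd hΩ Q - fluxClass 𝒯 r) (K, i)‖ ^ 2)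
    (fun i _ => Finset.sum_nonneg fun _ _ => sq_nonneg _) (Finset.mem_univ i)).trans this

end Norms

end HDG

end

/-! ### The error estimate -/

theorem theorem3p3 (d k : ℕ) (hd1 : 1 ≤ d) (hd3 : d ≤ 3) (α σ C A B : ℝ) (hα0 : 0 < α)
    (hα1 : α < 1) :
    ∃ C₁ : ℝ, ∀ (Ω : Set (HDG.Space d)), HDG.IsConvexPolyhedralDomain Ω →
      ∀ (T : ℝ), 0 < T →
      ∀ (f : ℝ → HDG.L2 Ω) (g : HDG.Space d → ℝ) (u₀ : HDG.Sobolev Ω (k + 1))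
        (u : ℝ → HDG.Sobolev Ω (k + 1)) (q : ℝ → HDG.VSobolev Ω (k + 1)),
      HDG.IsExactSolution Ω α T f g u₀ u q →
      ContDiffOn ℝ 1 u (Set.Icc 0 T) → ContDiffOn ℝ 1 q (Set.Icc 0 T) →
      HDG.c1Norm T u ≤ A → HDG.c1Norm T q ≤ B →
      ∀ (𝒯 : HDG.Triangulation Ω), 𝒯.ShapeRegular σ →
      ∀ (τ : HDG.Stabilization d), τ.Nonneg 𝒯 → τ.BoundedBy 𝒯 C →
      ∀ (uh : ℝ → HDG.Piecewise d) (qh : ℝ → HDG.VPiecewise d) (uhat : ℝ → HDG.Piecewise d),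
      HDG.IsHDGSolution 𝒯 k τ α T f g u₀ (q 0) uh qh uhat →
      MeasureTheory.eLpNorm (fun x => (u T).toL2 x - HDG.toFun 𝒯 (uh T) x) 2
          (MeasureTheory.volume.restrict Ω)
        + MeasureTheory.eLpNorm (fun x => HDG.vval (q T) x - HDG.vtoFun 𝒯 (qh T) x) 2
          (MeasureTheory.volume.restrict Ω)
      ≤ ENNReal.ofReal (C₁ * (1 + T) * 𝒯.meshSize ^ (k + 1)) := by
  -- `c` is `L` without its power of the mesh size. `cE` and `cQ` are the constants of `norm_E_le`
  -- and `norm_Q_le`; the `+ 1` added to each in the final constant accounts for the projection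
  -- errors, and `d` for the components of the flux.
  set c := HDG.projConst d k C σ * (d + 1) * (A + B) with hc
  set cE := 1 / α + Real.Gamma α / 4 + 1 with hcE
  set cQ := (1 + 1 / α) + 1 / (4 * α ^ 2 * Real.Gamma α) + 1 with hcQ
  refine ⟨((cE + 1) + d * (cQ + 1)) * c, fun Ω hΩ T hT f g u₀ u q hu hu1 hq1 hA hB 𝒯 hσ τ hτ hτC
    uh qh uhat hs => ?_⟩
  have hΓ := Real.Gamma_pos_of_pos hα0
  have hcE0 : 0 ≤ cE := by positivity
  have hcQ0 : 0 ≤ cQ := by positivity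
  obtain ⟨K₀⟩ := HDG.exists_element (𝒯 := 𝒯) hΩ
  obtain ⟨v0, -, hpos, hC, -⟩ := HDG.exists_face_max hd1 hτC K₀
  have hP := HDG.projConst_nonneg (d := d) (k := k) ((one_div_pos.2 hpos).le.trans hC)
    (hσ.sigma_nonneg K₀)
  have h0 : (0 : ℝ) ∈ Set.Icc 0 T := Set.left_mem_Icc.2 hT.le
  have hA0 : 0 ≤ A := (norm_nonneg _).trans ((HDG.norm_le_c1Norm hT hu1 h0).1.trans hA)
  have hB0 : 0 ≤ B := (norm_nonneg _).trans ((HDG.norm_le_c1Norm hT hq1 h0).1.trans hB)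
  have hh := pow_nonneg 𝒯.meshSize_nonneg (k + 1)
  have hL0 : 0 ≤ HDG.projConst d k C σ * 𝒯.meshSize ^ (k + 1) * (d + 1) * (A + B) := by positivity
  obtain ⟨E, G, η, Q, δ, Y, hsys, hEu, hQq, hη, hδ⟩ := HDG.exists_errorSystem hd1 hΩ hα0 hT hu hu1 hq1
    hA hB hσ hτ hτC hs rfl hL0
  have hE := hsys.norm_E_le hα0 hα1 hT hL0
  have hQ := hsys.norm_Q_le hα0 hα1 hT hL0
  rw [← hcE] at hE
  rw [← hcQ] at hQ
  set L := HDG.projConst d k C σ * 𝒯.meshSize ^ (k + 1) * (d + 1) * (A + B) with hL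
  have hLT : L ≤ (1 + T) * L := by nlinarith
  have e1 := HDG.eLpNorm_scalar_le hd1 hΩ (u T).toL2 (uh T) (N := (cE + 1) * ((1 + T) * L)) (by
    rw [hEu]
    refine (norm_sub_le _ _).trans ?_
    linarith)
  have e2 := HDG.eLpNorm_flux_le hd1 hΩ (q T) (qh T) (N := (cQ + 1) * ((1 + T) * L)) (by
    rw [hQq]
    refine (norm_sub_le _ _).trans ?_
    linarith)
  refine (add_le_add e1 e2).trans ?_
  rw [← ENNReal.ofReal_add (by positivity) (by positivity)]
  refine ENNReal.ofReal_le_ofReal (le_of_eq ?_)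
  rw [hL, hc]
  ring
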